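/- Let $S$ be a quasi-separated scheme, and write $\mathcal O_S((t))$ for the Zariski sheaf of rings associated with $U\mapsto \Gamma(U,\mathcal O_S)((t))$ and $\mathcal O_S[[t]]\subset\mathcal O_S((t))$ for the subsheaf of power series. Let $\mathcal E$ be a locally free $\mathcal O_S((t))$-module of finite rank $N$. For a morphism $p:T\to S$ put $$p^*\mathcal E = p^{-1}\mathcal E\otimes_{p^{-1}\mathcal O_S((t))}\mathcal O_T((t)).$$ A lattice in $p^*\mathcal E$ is a subsheaf $\mathcal F\subset p^*\mathcal E$ of $\mathcal O_T[[t]]$-submodules such that, Zariski locally on $T$, the pair $(\mathcal F,p^*\mathcal E)$ is isomorphic to $(\mathcal O_T[[t]]^N,\mathcal O_T((t))^N)$. Let $\gamma$ be the contravariant functor on $S$-schemes that sends $p:T\to S$ to the set of lattices in $p^*\mathcal E$; a morphism $g:T'\to T$ over $S$ sends $\mathcal F$ to the $\mathcal O_{T'}[[t]]$-submodule $g^*\mathcal F$ of $(p\circ g)^*\mathcal E$ generated by $\mathcal F$. Then $\gamma$ is represented by an ind-proper, formally smooth ind-scheme $\mathrm{Gr}(S,\mathcal E)$ over $S$, the twisted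 affine Grassmannian. That is, there is an inductive system $(Y_i)_{i\in I}$ of proper $S$-schemes, indexed by a nonempty directed partially ordered set, whose transition maps are closed immersions over $S$, such that: 1. $\gamma$ is a Zariski sheaf, and there is a morphism of functors $\varinjlim_i \mathrm{Hom}_S(-,Y_i)\to\gamma$ which is bijective on every quasi-compact $S$-scheme $T$ (so that $\gamma$ is the Zariski sheaf associated with $\varinjlim_i \mathrm{Hom}_S(-,Y_i)$); 2. for every affine $S$-scheme $\mathrm{Spec}\,A$ and every nilpotent ideal $I\subset A$, the map from $\varinjlim_i \mathrm{Hom}_S(\mathrm{Spec}\,A,Y_i)$ to $\varinjlim_i \mathrm{Hom}_S(\mathrm{Spec}(A/I),Y_i)$ is surjective. -/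

import Mathlib

open CategoryTheory TopologicalSpace AlgebraicGeometry Opposite

universe u

noncomputable section

namespace TwistedGrassmannian

variable {S T T' T'' : Scheme.{u}}

/-- The ring homomorphism `R((t)) → R'((t))` applying `f` to every coefficient. -/
def laurentMap {R R' : Type*} [CommRing R] [CommRing R'] (f : R →+* R') :
    LaurentSeries R →+* LaurentSeries R' where
  toFun a := HahnSeries.map a f
  map_zero' := HahnSeries.map_zero (f : ZeroHom R R')
  map_one' := HahnSeries.map_one f.toMonoidWithZeroHom
  map_add' _ _ := HahnSeries.map_add (f : R →+ R')
  map_mul' _ _ := HahnSeries.map_mul (f : R →ₙ+* R')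

@[simp]
theorem laurentMap_coeff {R R' : Type*} [CommRing R] [CommRing R'] (f : R →+* R')
    (a : LaurentSeries R) (n : ℤ) : (laurentMap f a).coeff n = f (a.coeff n) := rfl

theorem laurentMap_comp {R R' R'' : Type*} [CommRing R] [CommRing R'] [CommRing R'']
    (g : R' →+* R'') (f : R →+* R') (a : LaurentSeries R) :
    laurentMap g (laurentMap f a) = laurentMap (g.comp f) a := rfl


/-- The Laurent series ring over the local ring of `S` at `x`. -/
abbrev StalkLaurent (S : Scheme.{u}) (x : S) : Type u := LaurentSeries (S.presheaf.stalk x)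

/-- The family of germs of a Laurent series over `Γ(S, U)`. -/
def germs (U : S.Opens) : LaurentSeries Γ(S, U) →+* (∀ x : U, StalkLaurent S x) :=
  RingHom.pi fun x => laurentMap (S.presheaf.germ U x.1 x.2).hom

theorem germs_res {U V : S.Opens} (h : V ≤ U) (s : LaurentSeries Γ(S, U)) (x : V) :
    germs V (laurentMap (S.presheaf.map (homOfLE h).op).hom s) x = germs U s ⟨x.1, h x.2⟩ := by
  ext n
  exact TopCat.Presheaf.germ_res_apply S.presheaf (homOfLE h) x.1 x.2 (s.coeff n)

/-- A family of stalkwise Laurent series over `U` is a section of `𝒪_S((t))` if it is locally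
given by a Laurent series with coefficients in the ring of functions. -/
def laurentSubring (U : S.Opens) : Subring (∀ x : U, StalkLaurent S x) where
  carrier := {f | ∀ x : U, ∃ (V : S.Opens) (_ : x.1 ∈ V) (h : V ≤ U),
    ∃ s : LaurentSeries Γ(S, V), ∀ y : V, f ⟨y.1, h y.2⟩ = germs V s y}
  zero_mem' x := ⟨U, x.2, le_rfl, 0, fun y => by simp⟩
  one_mem' x := ⟨U, x.2, le_rfl, 1, fun y => by simp⟩
  neg_mem' {f} hf x := by
    obtain ⟨V, hx, h, s, hs⟩ := hf x
    exact ⟨V, hx, h, -s, fun y => by rw [map_neg, Pi.neg_apply, Pi.neg_apply, hs]⟩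
  add_mem' {f g} hf hg x := by
    obtain ⟨V, hx, h, s, hs⟩ := hf x
    obtain ⟨V', hx', h', s', hs'⟩ := hg x
    refine ⟨V ⊓ V', ⟨hx, hx'⟩, inf_le_left.trans h,
      laurentMap (S.presheaf.map (homOfLE inf_le_left).op).hom s +
      laurentMap (S.presheaf.map (homOfLE inf_le_right).op).hom s', fun y => ?_⟩
    rw [map_add, Pi.add_apply, Pi.add_apply, germs_res, germs_res, ← hs, ← hs']
  mul_mem' {f g} hf hg x := by
    obtain ⟨V, hx, h, s, hs⟩ := hf x
    obtain ⟨V', hx', h', s', hs'⟩ := hg x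
    refine ⟨V ⊓ V', ⟨hx, hx'⟩, inf_le_left.trans h,
      laurentMap (S.presheaf.map (homOfLE inf_le_left).op).hom s *
      laurentMap (S.presheaf.map (homOfLE inf_le_right).op).hom s', fun y => ?_⟩
    rw [map_mul, Pi.mul_apply, Pi.mul_apply, germs_res, germs_res, ← hs, ← hs']

theorem laurentSubring_res {U V : S.Opens} (h : V ≤ U) {f : ∀ x : U, StalkLaurent S x}
    (hf : f ∈ laurentSubring U) : (fun x : V => f ⟨x.1, h x.2⟩) ∈ laurentSubring V := by
  intro x
  obtain ⟨W, hx, hW, s, hs⟩ := hf ⟨x.1, h x.2⟩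
  exact ⟨W ⊓ V, ⟨hx, x.2⟩, inf_le_right,
    laurentMap (S.presheaf.map (homOfLE inf_le_left).op).hom s, fun y => by
      rw [germs_res, ← hs]⟩

/-- The local predicate cutting out the sections of `𝒪_S((t))`. -/
def laurentPredicate (S : Scheme.{u}) :
    TopCat.LocalPredicate (X := S) (fun x => StalkLaurent S x) where
  pred {U} f := f ∈ laurentSubring (S := S) U
  res i _ hf := laurentSubring_res i.le hf
  locality {U} f hf x := by
    obtain ⟨V, hx, i, h⟩ := hf x
    obtain ⟨W, hx', hW, s, hs⟩ := h ⟨x.1, hx⟩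
    exact ⟨W, hx', hW.trans i.le, s, hs⟩

/-- The ring of sections of `𝒪_S((t))` over `U`. -/
def LaurentSec (U : S.Opens) : Type u := laurentSubring U

instance (U : S.Opens) : CommRing (LaurentSec U) := inferInstanceAs (CommRing (laurentSubring U))

/-- The presheaf of rings `U ↦ Γ(U, 𝒪_S((t)))`. -/
def laurentPresheaf (S : Scheme.{u}) : TopCat.Presheaf RingCat.{u} S where
  obj U := RingCat.of (LaurentSec (S := S) U.unop)
  map i := RingCat.ofHom
    { toFun := fun f => ⟨fun x => f.1 ⟨x.1, i.unop.le x.2⟩, laurentSubring_res i.unop.le f.2⟩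
      map_zero' := rfl
      map_one' := rfl
      map_add' := fun _ _ => rfl
      map_mul' := fun _ _ => rfl }

/-- The sheaf of rings `𝒪_S((t))`: the sheaf associated with `U ↦ Γ(S, U)((t))`, realised as the
sheaf of those families of stalkwise Laurent series that locally come from `Γ(S, V)((t))`. -/
def laurentSheaf (S : Scheme.{u}) : TopCat.Sheaf RingCat.{u} S :=
  ⟨laurentPresheaf S, (TopCat.Presheaf.isSheaf_iff_isSheaf_comp (forget RingCat) _).mpr
    (TopCat.Presheaf.isSheaf_of_iso
      (NatIso.ofComponents (fun _ => Iso.refl _) (by intros; rfl) :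
        (TopCat.subsheafToTypes (laurentPredicate S)).1 ≅ laurentPresheaf S ⋙ forget RingCat)
      (TopCat.subsheafToTypes (laurentPredicate S)).property)⟩

theorem stalk_germs (p : T ⟶ S) (U : S.Opens) (s : LaurentSeries Γ(S, U)) (y : T)
    (hy : p y ∈ U) : laurentMap (p.stalkMap y).hom (germs U s ⟨p y, hy⟩) =
      germs (p ⁻¹ᵁ U) (laurentMap (p.app U).hom s) ⟨y, hy⟩ := by
  ext n
  exact Scheme.Hom.germ_stalkMap_apply p U y hy (s.coeff n)

/-- The ring homomorphism `Γ(U, 𝒪_S((t))) → Γ(p⁻¹U, 𝒪_T((t)))`. -/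
def laurentApp (p : T ⟶ S) (U : S.Opens) : LaurentSec U →+* LaurentSec (p ⁻¹ᵁ U) where
  toFun f := ⟨fun y => laurentMap (p.stalkMap y.1).hom (f.1 ⟨p y.1, y.2⟩), fun y => by
    obtain ⟨V, hy, h, s, hs⟩ := f.2 ⟨p y.1, y.2⟩
    exact ⟨p ⁻¹ᵁ V, hy, fun z hz => h hz, laurentMap (p.app V).hom s, fun z => by
      rw [← stalk_germs p V s z.1 z.2, ← hs]⟩⟩
  map_zero' := Subtype.ext (funext fun y => map_zero _)
  map_one' := Subtype.ext (funext fun y => map_one _)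
  map_add' _ _ := Subtype.ext (funext fun y => map_add _ _ _)
  map_mul' _ _ := Subtype.ext (funext fun y => map_mul _ _ _)

/-- The morphism of sheaves of rings `𝒪_S((t)) ⟶ p_* 𝒪_T((t))`. -/
def laurentHom (p : T ⟶ S) : laurentSheaf S ⟶
    ((Opens.map p.base).sheafPushforwardContinuous RingCat.{u} _ _).obj (laurentSheaf T) :=
  ⟨{ app := fun U => RingCat.ofHom (laurentApp p U.unop)
     naturality := fun _ _ _ => rfl }⟩

/-- An `𝒪_S((t))`-module. -/
abbrev LaurentModule (S : Scheme.{u}) := SheafOfModules.{u} (laurentSheaf S)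


instance : Category.{u} (LaurentModule S) := SheafOfModules.instCategory

/-- The direct image `p_*` of `𝒪((t))`-modules. -/
def push (p : T ⟶ S) : LaurentModule T ⥤ LaurentModule S :=
  SheafOfModules.pushforward.{u} (laurentHom p)

theorem presheaf_push_isRightAdjoint {C D : Type u} [SmallCategory C] [SmallCategory D]
    {F : C ⥤ D} {R : Dᵒᵖ ⥤ RingCat.{u}} {R' : Cᵒᵖ ⥤ RingCat.{u}} (φ : R' ⟶ F.op ⋙ R) :
    (PresheafOfModules.pushforward.{u} φ).IsRightAdjoint := inferInstance

instance push_isRightAdjoint (p : T ⟶ S) :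
    (SheafOfModules.pushforward.{u} (laurentHom p)).IsRightAdjoint :=
  haveI := presheaf_push_isRightAdjoint (laurentHom p).hom
  (SheafOfModules.PullbackConstruction.adjunction.{u} (laurentHom p)).isRightAdjoint

/-- The inverse image `p^*` of `𝒪((t))`-modules. -/
def pull (p : T ⟶ S) : LaurentModule S ⥤ LaurentModule T :=
  SheafOfModules.pullback.{u} (laurentHom p)

/-- The adjunction between `p^*` and `p_*`. -/
def pullPushAdj (p : T ⟶ S) : pull p ⊣ push p :=
  SheafOfModules.pullbackPushforwardAdjunction.{u} (laurentHom p)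

section Sections

variable {M N : LaurentModule S}

/-- The sections of an `𝒪_S((t))`-module over an open set. -/
abbrev Sec (M : LaurentModule S) (U : S.Opens) : Type u := M.val.obj (op U)

instance (U : S.Opens) : Module (LaurentSec U) (Sec M U) :=
  inferInstanceAs (Module ((laurentSheaf S).obj.obj (op U)) (M.val.obj (op U)))

/-- Restriction of sections of `𝒪_S((t))`. -/
def resRing {U V : S.Opens} (h : V ≤ U) : LaurentSec U →+* LaurentSec V :=
  ((laurentSheaf S).obj.map (homOfLE h).op).hom

theorem resRing_apply {U V : S.Opens} (h : V ≤ U) (f : LaurentSec U) (x : V) :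
    (resRing h f).1 x = f.1 ⟨x.1, h x.2⟩ := rfl

/-- Restriction of sections of a module. -/
def res {U V : S.Opens} (h : V ≤ U) : Sec M U →+ Sec M V :=
  (M.val.presheaf.map (homOfLE h).op).hom

theorem res_smul {U V : S.Opens} (h : V ≤ U) (a : LaurentSec U) (s : Sec M U) :
    res h (a • s) = resRing h a • res h s :=
  M.val.map_smul (homOfLE h).op a s

theorem res_res {U V W : S.Opens} (h : V ≤ U) (h' : W ≤ V) (s : Sec M U) :
    res h' (res h s) = res (h'.trans h) s :=
  (ConcreteCategory.congr_hom (M.val.presheaf.map_comp (homOfLE h).op (homOfLE h').op) s).symm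

theorem res_self {U : S.Opens} (h : U ≤ U) (s : Sec M U) : res h s = s :=
  ConcreteCategory.congr_hom (M.val.presheaf.map_id (op U)) s

/-- Two sections that agree locally are equal. -/
theorem sec_ext {U : S.Opens} (s s' : Sec M U)
    (H : ∀ x ∈ U, ∃ (V : S.Opens) (_ : x ∈ V) (h : V ≤ U), res h s = res h s') : s = s' := by
  choose V hx h hV using H
  exact TopCat.Sheaf.eq_of_locally_eq' (⟨M.val.presheaf, M.isSheaf⟩ : TopCat.Sheaf Ab S)
    (fun x : U => V x.1 x.2) U (fun x => homOfLE (h x.1 x.2))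
    (fun x hxU => Opens.mem_iSup.2 ⟨⟨x, hxU⟩, hx x hxU⟩) s s' (fun x => hV x.1 x.2)

/-- The action of a morphism on sections. -/
def app (f : M ⟶ N) (U : S.Opens) : Sec M U →+ Sec N U :=
  ((f.val.app (op U)).hom).toAddMonoidHom

theorem app_smul (f : M ⟶ N) (U : S.Opens) (a : LaurentSec U) (s : Sec M U) :
    app f U (a • s) = a • app f U s :=
  (f.val.app (op U)).hom.map_smul a s

theorem app_res (f : M ⟶ N) {U V : S.Opens} (h : V ≤ U) (s : Sec M U) :
    app f V (res h s) = res h (app f U s) :=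
  PresheafOfModules.naturality_apply f.val (homOfLE h).op s

theorem app_ext {f g : M ⟶ N} (H : ∀ U s, app f U s = app g U s) : f = g := by
  apply SheafOfModules.hom_ext
  ext U s
  exact H U.unop s

/-- A morphism of modules from its action on sections. -/
def mkHom (f : ∀ U, Sec M U →+ Sec N U)
    (hs : ∀ U (a : LaurentSec U) s, f U (a • s) = a • f U s)
    (hr : ∀ {U V : S.Opens} (h : V ≤ U) s, f V (res h s) = res h (f U s)) : M ⟶ N :=
  ⟨PresheafOfModules.homMk
    { app := fun U => AddCommGrpCat.ofHom (f U.unop)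
      naturality := fun _ _ i => by
        ext s
        exact hr i.unop.le s }
    (fun U a s => hs U.unop a s)⟩

theorem app_mkHom (f : ∀ U, Sec M U →+ Sec N U) (hs hr) (U : S.Opens) (s : Sec M U) :
    app (mkHom (M := M) (N := N) f hs hr) U s = f U s := rfl

theorem push_smul (p : T ⟶ S) (M : LaurentModule T) (U : S.Opens) (a : LaurentSec U)
    (s : Sec ((push p).obj M) U) :
    a • s = (laurentApp p U a • (show Sec M (p ⁻¹ᵁ U) from s) : Sec M (p ⁻¹ᵁ U)) := rfl

theorem push_res (p : T ⟶ S) (M : LaurentModule T) {U V : S.Opens} (h : V ≤ U)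
    (s : Sec ((push p).obj M) U) :
    res h s = (res (M := M) (fun _ hx => h hx : p ⁻¹ᵁ V ≤ p ⁻¹ᵁ U) s : Sec M (p ⁻¹ᵁ V)) := rfl

theorem app_comp {K : LaurentModule S} (f : M ⟶ N) (g : N ⟶ K) (U : S.Opens) (s : Sec M U) :
    app (f ≫ g) U s = app g U (app f U s) := rfl

theorem app_push {p : T ⟶ S} {M N : LaurentModule T} (f : M ⟶ N) (U : S.Opens)
    (s : Sec ((push p).obj M) U) :
    app ((push p).map f) U s = app f (p ⁻¹ᵁ U) s := rfl

end Sections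

/-- The canonical map `Γ(U, E) → Γ(p⁻¹U, p^*E)`. -/
def pullSec (p : T ⟶ S) (E : LaurentModule S) (U : S.Opens) :
    Sec E U →+ Sec ((pull p).obj E) (p ⁻¹ᵁ U) :=
  app ((pullPushAdj p).unit.app E) U

theorem pullSec_smul (p : T ⟶ S) (E : LaurentModule S) (U : S.Opens) (a : LaurentSec U)
    (s : Sec E U) : pullSec p E U (a • s) = laurentApp p U a • pullSec p E U s :=
  app_smul ((pullPushAdj p).unit.app E) U a s

theorem pullSec_res (p : T ⟶ S) (E : LaurentModule S) {U V : S.Opens} (h : V ≤ U) (s : Sec E U) :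
    pullSec p E V (res h s) = res (fun _ hx => h hx : p ⁻¹ᵁ V ≤ p ⁻¹ᵁ U) (pullSec p E U s) :=
  app_res ((pullPushAdj p).unit.app E) h s

theorem pull_hom_ext (p : T ⟶ S) (E : LaurentModule S) {P : LaurentModule T}
    {f g : (pull p).obj E ⟶ P}
    (H : ∀ U s, app f (p ⁻¹ᵁ U) (pullSec p E U s) = app g (p ⁻¹ᵁ U) (pullSec p E U s)) :
    f = g := by
  apply ((pullPushAdj p).homEquiv E P).injective
  rw [Adjunction.homEquiv_unit, Adjunction.homEquiv_unit]
  exact app_ext H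

/-- The map `p^*E → P` corresponding to `f : E → p_*P`. -/
def pullDesc (p : T ⟶ S) {E : LaurentModule S} {P : LaurentModule T} (f : E ⟶ (push p).obj P) :
    (pull p).obj E ⟶ P :=
  ((pullPushAdj p).homEquiv E P).symm f

theorem pullDesc_pullSec (p : T ⟶ S) {E : LaurentModule S} {P : LaurentModule T}
    (f : E ⟶ (push p).obj P) (U : S.Opens) (s : Sec E U) :
    app (pullDesc p f) (p ⁻¹ᵁ U) (pullSec p E U s) = app f U s := by
  have := ((pullPushAdj p).homEquiv E P).apply_symm_apply f
  rw [Adjunction.homEquiv_unit] at this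
  exact congrArg (fun k => app k U s) this

theorem preimage_le {p : T ⟶ S} {g : T' ⟶ T} {p' : T' ⟶ S} (h : g ≫ p = p') (U : S.Opens) :
    g ⁻¹ᵁ (p ⁻¹ᵁ U) ≤ p' ⁻¹ᵁ U := by subst h; exact le_rfl

theorem preimage_ge {p : T ⟶ S} {g : T' ⟶ T} {p' : T' ⟶ S} (h : g ≫ p = p') (U : S.Opens) :
    p' ⁻¹ᵁ U ≤ g ⁻¹ᵁ (p ⁻¹ᵁ U) := by subst h; exact le_rfl

theorem laurentApp_comp {p : T ⟶ S} {g : T' ⟶ T} {p' : T' ⟶ S} (h : g ≫ p = p') (U : S.Opens)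
    (a : LaurentSec U) :
    resRing (preimage_le h U) (laurentApp p' U a) = laurentApp g _ (laurentApp p U a) := by
  subst h
  apply Subtype.ext
  funext y
  refine Eq.trans ?_ (laurentMap_comp (g.stalkMap y.1).hom (p.stalkMap (g y.1)).hom _).symm
  rw [← CommRingCat.hom_comp, ← Scheme.Hom.stalkMap_comp]
  rfl

theorem laurentApp_res (p : T ⟶ S) {U V : S.Opens} (h : V ≤ U) (a : LaurentSec U) :
    laurentApp p V (resRing h a) =
      resRing (fun _ hx => h hx : p ⁻¹ᵁ V ≤ p ⁻¹ᵁ U) (laurentApp p U a) := rfl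

theorem laurentApp_id (U : S.Opens) (a : LaurentSec U) : laurentApp (𝟙 S) U a = a := by
  apply Subtype.ext
  funext y
  refine HahnSeries.ext (funext fun n => ?_)
  change ((𝟙 S : S ⟶ S).stalkMap y.1).hom ((a.1 y).coeff n) = _
  rw [Scheme.Hom.stalkMap_id]
  rfl

/-- Transport of a map `E → p'_* P` to a map `E → p_* g_* P`, when `p' = p ∘ g`. -/
def toPushPush {p : T ⟶ S} {g : T' ⟶ T} {p' : T' ⟶ S} (h : g ≫ p = p')
    {E : LaurentModule S} {P : LaurentModule T'} (f : E ⟶ (push p').obj P) :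
    E ⟶ (push p).obj ((push g).obj P) :=
  mkHom (fun U => (res (M := P) (preimage_le h U)).comp (app f U))
    (fun U a s => by
      change res (M := P) (preimage_le h U) (app f U (a • s)) = _
      rw [app_smul, push_smul, res_smul, laurentApp_comp h]
      rfl)
    (fun {U V} i s => by
      change res (M := P) (preimage_le h V) (app f V (res i s)) = _
      rw [app_res]
      exact (res_res (M := P) _ _ _).trans (res_res (M := P) _ _ _).symm)

/-- Transport of a map `E → p_* g_* P` to a map `E → p'_* P`, when `p' = p ∘ g`. -/
def ofPushPush {p : T ⟶ S} {g : T' ⟶ T} {p' : T' ⟶ S} (h : g ≫ p = p')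
    {E : LaurentModule S} {P : LaurentModule T'} (f : E ⟶ (push p).obj ((push g).obj P)) :
    E ⟶ (push p').obj P :=
  mkHom (fun U => (res (M := P) (preimage_ge h U)).comp (app f U))
    (fun U a s => by
      change res (M := P) (preimage_ge h U) (app f U (a • s)) = _
      rw [app_smul, push_smul, push_smul, ← laurentApp_comp h]
      erw [res_smul]
      rfl)
    (fun {U V} i s => by
      change res (M := P) (preimage_ge h V) (app f V (res i s)) = _
      rw [app_res]
      exact (res_res (M := P) _ _ _).trans (res_res (M := P) _ _ _).symm)

/-- The canonical map `p^*E → g_* p'^*E` for `p' = p ∘ g`; it exhibits `p'^*E` as `g^* p^*E`. -/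
def compare {p : T ⟶ S} {g : T' ⟶ T} {p' : T' ⟶ S} (h : g ≫ p = p') (E : LaurentModule S) :
    (pull p).obj E ⟶ (push g).obj ((pull p').obj E) :=
  pullDesc p (toPushPush h ((pullPushAdj p').unit.app E))

/-- The canonical map `Γ(U, p^*E) → Γ(g⁻¹U, p'^*E)` for `p' = p ∘ g`. -/
def compareSec {p : T ⟶ S} {g : T' ⟶ T} {p' : T' ⟶ S} (h : g ≫ p = p') (E : LaurentModule S)
    (U : T.Opens) : Sec ((pull p).obj E) U →+ Sec ((pull p').obj E) (g ⁻¹ᵁ U) :=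
  app (compare h E) U

section
variable {p : T ⟶ S} {g : T' ⟶ T} {p' : T' ⟶ S} (h : g ≫ p = p') (E : LaurentModule S)

theorem compareSec_smul (U : T.Opens) (a : LaurentSec U) (s : Sec ((pull p).obj E) U) :
    compareSec h E U (a • s) = laurentApp g U a • compareSec h E U s :=
  app_smul (compare h E) U a s

theorem compareSec_res {U V : T.Opens} (i : V ≤ U) (s : Sec ((pull p).obj E) U) :
    compareSec h E V (res i s) =
      res (fun _ hx => i hx : g ⁻¹ᵁ V ≤ g ⁻¹ᵁ U) (compareSec h E U s) :=
  app_res (compare h E) i s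

theorem compareSec_pullSec (U : S.Opens) (s : Sec E U) :
    compareSec h E (p ⁻¹ᵁ U) (pullSec p E U s) = res (preimage_le h U) (pullSec p' E U s) :=
  pullDesc_pullSec p (toPushPush h ((pullPushAdj p').unit.app E)) U s

theorem compare_hom_ext {P : LaurentModule T'} {f k : (pull p').obj E ⟶ P}
    (H : ∀ U s, app f (g ⁻¹ᵁ U) (compareSec h E U s) = app k (g ⁻¹ᵁ U) (compareSec h E U s)) :
    f = k := by
  apply pull_hom_ext p'
  intro U s
  have := congrArg (res (preimage_ge h U)) (H (p ⁻¹ᵁ U) (pullSec p E U s))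
  rwa [compareSec_pullSec, app_res, app_res, res_res, res_res, res_self, res_self] at this

theorem compare_desc {P : LaurentModule T'} (f : (pull p).obj E ⟶ (push g).obj P) :
    ∃ k : (pull p').obj E ⟶ P, ∀ U s, app k (g ⁻¹ᵁ U) (compareSec h E U s) = app f U s := by
  refine ⟨pullDesc p' (ofPushPush h ((pullPushAdj p).unit.app E ≫ (push p).map f)), fun U s => ?_⟩
  refine congrArg (fun k => app k U s) (pull_hom_ext p E (P := (push g).obj P)
    (f := compare h E ≫ (push g).map (pullDesc p' (ofPushPush h _))) (g := f) fun U s => ?_)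
  rw [app_comp, app_push]
  change app _ _ (compareSec h E (p ⁻¹ᵁ U) (pullSec p E U s)) = _
  rw [compareSec_pullSec, app_res, pullDesc_pullSec]
  change res (M := P) _ (res (M := P) _ _) = _
  rw [res_res, res_self]
  rfl

end

theorem compareSec_id {p : T ⟶ S} (h : 𝟙 T ≫ p = p) (E : LaurentModule S) (U : T.Opens)
    (s : Sec ((pull p).obj E) U) : compareSec h E U s = s := by
  let f : (pull p).obj E ⟶ (push (𝟙 T)).obj ((pull p).obj E) :=
    mkHom (fun U => AddMonoidHom.id (Sec ((pull p).obj E) U))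
      (fun U a s => by
        rw [push_smul, laurentApp_id]; rfl)
      (fun _ _ => rfl)
  refine congrArg (fun k => app k U s) (pull_hom_ext p E (f := compare h E) (g := f) fun U s => ?_)
  exact (compareSec_pullSec h E U s).trans (res_self _ _)

theorem compareSec_comp {p : T ⟶ S} {p' : T' ⟶ S} {p'' : T'' ⟶ S} {g : T' ⟶ T} {g' : T'' ⟶ T'}
    (h : g ≫ p = p') (h' : g' ≫ p' = p'') (h'' : (g' ≫ g) ≫ p = p'') (E : LaurentModule S)
    (U : T.Opens) (s : Sec ((pull p).obj E) U) :
    compareSec h' E (g ⁻¹ᵁ U) (compareSec h E U s) = compareSec h'' E U s := by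
  refine (congrArg (fun k => app k U s) (pull_hom_ext p E
    (f := compare h E ≫ (push g).map (compare h' E))
    (g := toPushPush (p := g) (g := g') rfl (compare h'' E)) fun U s => ?_)).trans (res_self _ _)
  rw [app_comp, app_push]
  change compareSec h' E _ (compareSec h E (p ⁻¹ᵁ U) (pullSec p E U s)) = _
  rw [compareSec_pullSec, compareSec_res, compareSec_pullSec]
  change _ = res _ (compareSec h'' E (p ⁻¹ᵁ U) (pullSec p E U s))
  rw [compareSec_pullSec]
  exact (res_res (M := (pull p'').obj E) _ _ _).trans (res_res (M := (pull p'').obj E) _ _ _).symm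

section Free

/-- Sections `e₁, …, e_N` of `M` over `U` form a basis over `𝒪_U((t))`: they define an isomorphism
`𝒪_U((t))^N ≅ M|_U`. -/
def IsBasisOver {M : LaurentModule S} {N : ℕ} {U : S.Opens} (e : Fin N → Sec M U) : Prop :=
  ∀ (V : S.Opens) (h : V ≤ U),
    Function.Bijective fun a : Fin N → LaurentSec V => ∑ i, a i • res h (e i)

/-- `M` is locally free of rank `N` over `𝒪_S((t))`. -/
def IsLocallyFree (M : LaurentModule S) (N : ℕ) : Prop :=
  ∀ x : S, ∃ (U : S.Opens) (_ : x ∈ U) (e : Fin N → Sec M U), IsBasisOver e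

/-- The open set `W ∩ V`, as a functor of `W`. -/
def interFunctor (V : S.Opens) : S.Opens ⥤ S.Opens := Opens.map V.ι.base ⋙ V.ι.opensFunctor

theorem mem_inter {V W : S.Opens} {x : S} : x ∈ (interFunctor V).obj W ↔ x ∈ W ∧ x ∈ V := by
  constructor
  · rintro ⟨y, hy, rfl⟩
    exact ⟨hy, y.2⟩
  · rintro ⟨h, h'⟩
    exact ⟨⟨x, h'⟩, h, rfl⟩

theorem inter_le_left (V W : S.Opens) : (interFunctor V).obj W ≤ W := fun _ h => (mem_inter.1 h).1
theorem inter_le_right (V W : S.Opens) : (interFunctor V).obj W ≤ V := fun _ h => (mem_inter.1 h).2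
theorem le_inter {V W : S.Opens} (h : W ≤ V) : W ≤ (interFunctor V).obj W :=
  fun _ hx => mem_inter.2 ⟨hx, h hx⟩

instance (V : S.Opens) : (interFunctor V).IsContinuous (Opens.grothendieckTopology S)
    (Opens.grothendieckTopology S) :=
  Functor.isContinuous_comp.{u} (Opens.map V.ι.base) V.ι.opensFunctor
    (Opens.grothendieckTopology S) (Opens.grothendieckTopology V) (Opens.grothendieckTopology S)

/-- Restriction to `W ∩ V`, as a morphism of sheaves of rings. -/
def interHom (V : S.Opens) : laurentSheaf S ⟶
    ((interFunctor V).sheafPushforwardContinuous RingCat.{u} _ _).obj (laurentSheaf S) :=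
  ⟨{ app := fun W => (laurentSheaf S).obj.map (homOfLE (inter_le_left V W.unop)).op
     naturality := fun _ _ _ => rfl }⟩

/-- The module `W ↦ M(W ∩ V)`. -/
def cut (V : S.Opens) (M : LaurentModule S) : LaurentModule S :=
  (SheafOfModules.pushforward.{u} (interHom V)).obj M

theorem cut_smul (V : S.Opens) (M : LaurentModule S) (U : S.Opens) (a : LaurentSec U)
    (s : Sec (cut V M) U) :
    a • s = (resRing (inter_le_left V U) a • (show Sec M ((interFunctor V).obj U) from s) :
      Sec M ((interFunctor V).obj U)) := rfl

theorem cut_res (V : S.Opens) (M : LaurentModule S) {U W : S.Opens} (h : W ≤ U)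
    (s : Sec (cut V M) U) :
    res h s = (res (M := M) ((interFunctor V).map (homOfLE h)).le s :
      Sec M ((interFunctor V).obj W)) := rfl

/-- `𝒪_S((t))` as a module over itself. -/
def unitModule (S : Scheme.{u}) : LaurentModule S := SheafOfModules.unit _

theorem unit_smul (U : S.Opens) (a : LaurentSec U) (s : Sec (unitModule S) U) :
   a • s = (a * (show LaurentSec U from s) : LaurentSec U) := rfl
theorem unit_res {U V: S.Opens} (h : V ≤ U)  (s : Sec (unitModule S) U) :
   res h s = (resRing h s : LaurentSec V) := rfl

theorem res_sum {M : LaurentModule S} {N : ℕ} {U V : S.Opens} (h : V ≤ U)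
    (a : Fin N → LaurentSec U) (s : Fin N → Sec M U) :
    res h (∑ i, a i • s i) = ∑ i, resRing h (a i) • res h (s i) := by
  rw [map_sum]
  exact Finset.sum_congr rfl fun i _ => res_smul h _ _

theorem resRing_resRing {U V W : S.Opens} (h : V ≤ U) (h' : W ≤ V) (a : LaurentSec U) :
    resRing h' (resRing h a) = resRing (h'.trans h) a := rfl

theorem resRing_self {U : S.Opens} (h : U ≤ U) (a : LaurentSec U) : resRing h a = a := rfl

section Coeff

variable {M : LaurentModule S} {N : ℕ} {V : S.Opens} {e : Fin N → Sec M V} (he : IsBasisOver e)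

/-- The coordinates of a section in a basis. -/
def coord {W : S.Opens} (h : W ≤ V) (s : Sec M W) : Fin N → LaurentSec W :=
  (Equiv.ofBijective _ (he W h)).symm s

theorem sum_coord {W : S.Opens} (h : W ≤ V) (s : Sec M W) :
    ∑ i, coord he h s i • res h (e i) = s :=
  (Equiv.ofBijective _ (he W h)).apply_symm_apply s

theorem coord_unique {W : S.Opens} (h : W ≤ V) (s : Sec M W) (a : Fin N → LaurentSec W)
    (ha : ∑ i, a i • res h (e i) = s) : coord he h s = a :=
  (he W h).injective ((sum_coord he h s).trans ha.symm)

theorem coord_add {W : S.Opens} (h : W ≤ V) (s s' : Sec M W) :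
    coord he h (s + s') = coord he h s + coord he h s' :=
  coord_unique he h _ _ (by
    simp only [Pi.add_apply, add_smul, Finset.sum_add_distrib, sum_coord])

theorem coord_smul {W : S.Opens} (h : W ≤ V) (a : LaurentSec W) (s : Sec M W) :
    coord he h (a • s) = fun i => a * coord he h s i :=
  coord_unique he h _ _ (by
    simp only [mul_smul, ← Finset.smul_sum, sum_coord])

theorem coord_res {W W' : S.Opens} (h : W ≤ V) (h' : W' ≤ W) (s : Sec M W) :
    coord he (h'.trans h) (res h' s) = fun i => resRing h' (coord he h s i) :=
  coord_unique he _ _ _ (by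
    conv_rhs => rw [← sum_coord he h s, res_sum]
    simp only [res_res])

theorem coord_basis (i : Fin N) : coord he le_rfl (e i) = Pi.single i 1 :=
  coord_unique he _ _ _ (by
    rw [Finset.sum_eq_single i]
    · rw [Pi.single_eq_same, one_smul, res_self]
    · intro j _ hj
      rw [Pi.single_eq_of_ne hj, zero_smul]
    · intro hi
      exact absurd (Finset.mem_univ i) hi)

end Coeff

theorem inter_preimage (g : T' ⟶ T) (V U : T.Opens) :
    (interFunctor (g ⁻¹ᵁ V)).obj (g ⁻¹ᵁ U) ≤ g ⁻¹ᵁ ((interFunctor V).obj U) :=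
  fun _ hx => mem_inter.2 ((mem_inter (S := T')).1 hx)

/-- A morphism to `W ↦ Γ(W ∩ V, 𝒪((t)))` on sections. -/
def fnApp {M : LaurentModule S} {V : S.Opens} (f : M ⟶ cut V (unitModule S)) (U : S.Opens) :
    Sec M U →+ LaurentSec ((interFunctor V).obj U) :=
  app f U

theorem fnApp_smul {M : LaurentModule S} {V : S.Opens} (f : M ⟶ cut V (unitModule S))
    (U : S.Opens) (a : LaurentSec U) (s : Sec M U) :
    fnApp f U (a • s) = resRing (inter_le_left V U) a * fnApp f U s :=
  app_smul f U a s

theorem fnApp_res {M : LaurentModule S} {V : S.Opens} (f : M ⟶ cut V (unitModule S))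
    {U W : S.Opens} (h : W ≤ U) (s : Sec M U) :
    fnApp f W (res h s) = resRing ((interFunctor V).map (homOfLE h)).le (fnApp f U s) :=
  app_res f h s

/-- The `i`-th coordinate in a basis over `V`, as a function on `g⁻¹V`. -/
def coordFn {M : LaurentModule T} (g : T' ⟶ T) {N : ℕ} {V : T.Opens} {e : Fin N → Sec M V}
    (he : IsBasisOver e) (i : Fin N) (U : T.Opens) (s : Sec M U) :
    LaurentSec ((interFunctor (g ⁻¹ᵁ V)).obj (g ⁻¹ᵁ U)) :=
  resRing (inter_preimage g V U)
    (laurentApp g _ (coord he (inter_le_right V U) (res (inter_le_left V U) s) i))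

/-- The morphism given by `coordFn`. -/
def coordHom {M : LaurentModule T} (g : T' ⟶ T) {N : ℕ} {V : T.Opens} {e : Fin N → Sec M V}
    (he : IsBasisOver e) (i : Fin N) :
    M ⟶ (push g).obj (cut (g ⁻¹ᵁ V) (unitModule T')) :=
  mkHom (fun U => (AddMonoidHom.mk' (coordFn g he i U) (fun s s' => by
      rw [coordFn, map_add, coord_add, Pi.add_apply, map_add, map_add]; rfl) :
        Sec M U →+ LaurentSec ((interFunctor (g ⁻¹ᵁ V)).obj (g ⁻¹ᵁ U))))
    (fun U a s => by
      change coordFn g he i U (a • s) = resRing (inter_le_left (g ⁻¹ᵁ V) (g ⁻¹ᵁ U))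
        (laurentApp g U a) * coordFn g he i U s
      rw [coordFn, res_smul, coord_smul, map_mul, map_mul]
      rfl)
    (fun {U W} h s => by
      change coordFn g he i W (res h s) = resRing
        ((interFunctor (g ⁻¹ᵁ V)).map (homOfLE (fun _ hx => h hx : g ⁻¹ᵁ W ≤ g ⁻¹ᵁ U))).le
        (coordFn g he i U s)
      have h1 : res (inter_le_left V W) (res h s) =
          res ((interFunctor V).map (homOfLE h)).le (res (inter_le_left V U) s) := by
        rw [res_res, res_res]
      rw [coordFn, h1, coord_res he (inter_le_right V U)]
      rfl)

/-- Restriction, as a morphism from `M` to `W ↦ M(W ∩ V)`. -/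
def toCut (V : S.Opens) (M : LaurentModule S) : M ⟶ cut V M :=
  mkHom (fun U => res (inter_le_left V U)) (fun U a s => res_smul _ a s)
    (fun {U W} h s => by
      rw [cut_res]
      exact (res_res (M := M) _ _ _).trans (res_res (M := M) _ _ _).symm)

/-- The linear combination with coefficients `k i`. -/
def combSec {M : LaurentModule S} {N : ℕ} {V : S.Opens} (e : Fin N → Sec M V)
    (k : Fin N → (M ⟶ cut V (unitModule S))) (U : S.Opens) (s : Sec M U) :
    Sec M ((interFunctor V).obj U) :=
  ∑ i, fnApp (k i) U s • res (inter_le_right V U) (e i)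

/-- The morphism given by `combSec`. -/
def combHom {M : LaurentModule S} {N : ℕ} {V : S.Opens} (e : Fin N → Sec M V)
    (k : Fin N → (M ⟶ cut V (unitModule S))) : M ⟶ cut V M :=
  mkHom (fun U => (AddMonoidHom.mk' (combSec e k U) (fun s s' => by
      simp only [combSec, map_add, add_smul, Finset.sum_add_distrib]) :
        Sec M U →+ Sec M ((interFunctor V).obj U)))
    (fun U a s => by
      change combSec e k U (a • s) = resRing (inter_le_left V U) a • combSec e k U s
      simp only [combSec, fnApp_smul, mul_smul, Finset.smul_sum])
    (fun {U W} h s => by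
      change combSec e k W (res h s) = res ((interFunctor V).map (homOfLE h)).le (combSec e k U s)
      simp only [combSec, fnApp_res, res_sum, res_res])

section Pullback

variable {p : T ⟶ S} {g : T' ⟶ T} {p' : T' ⟶ S} (h : g ≫ p = p') {E : LaurentModule S}

/-- The pullback of a local basis is a local basis. -/
theorem isBasisOver_compare {N : ℕ} {V : T.Opens} {e : Fin N → Sec ((pull p).obj E) V}
    (he : IsBasisOver e) : IsBasisOver fun i => compareSec h E V (e i) := by
  choose k hk' using fun i => compare_desc h E (coordHom g he i)
  have hk (i : Fin N) (U : T.Opens) (s : Sec ((pull p).obj E) U) :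
      fnApp (k i) (g ⁻¹ᵁ U) (compareSec h E U s) = coordFn g he i U s := hk' i U s
  have key : combHom (fun i => compareSec h E V (e i)) k = toCut (g ⁻¹ᵁ V) _ := by
    apply compare_hom_ext h
    intro U s
    change combSec (fun i => compareSec h E V (e i)) k (g ⁻¹ᵁ U) (compareSec h E U s) =
      res (M := (pull p').obj E) (inter_le_left (g ⁻¹ᵁ V) (g ⁻¹ᵁ U)) (compareSec h E U s)
    have h1 : res (M := (pull p').obj E) (inter_le_left (g ⁻¹ᵁ V) (g ⁻¹ᵁ U))
        (compareSec h E U s) = res (inter_preimage g V U)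
          (compareSec h E _ (res (inter_le_left V U) s)) := by
      rw [compareSec_res]
      exact (res_res (M := (pull p').obj E) _ _ _).symm
    rw [h1]
    conv_rhs => rw [← sum_coord he (inter_le_right V U) (res (inter_le_left V U) s)]
    rw [map_sum, map_sum, combSec]
    refine Finset.sum_congr rfl fun i _ => ?_
    rw [hk, compareSec_smul, res_smul, compareSec_res]
    exact congrArg _ (res_res (M := (pull p').obj E) _ _ _).symm
  intro W hW
  have hsum (s : Sec ((pull p').obj E) W) :
      ∑ i, resRing (le_inter hW) (fnApp (k i) W s) •
        res hW (compareSec h E V (e i)) = s := by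
    have h1 : combSec (fun i => compareSec h E V (e i)) k W s =
        res (inter_le_left (g ⁻¹ᵁ V) W) s := congrArg (fun f => app f W s) key
    have h2 := congrArg (res (le_inter hW)) h1
    rw [combSec, res_sum, res_res, res_self] at h2
    simpa only [res_res] using h2
  have hdelta (i j : Fin N) : resRing (le_inter hW)
      (fnApp (k j) W (res hW (compareSec h E V (e i)))) = if j = i then 1 else 0 := by
    have h2 : coord he (inter_le_right V V) (res (inter_le_left V V) (e i)) j =
      resRing (inter_le_left V V) (coord he le_rfl (e i) j) :=
        congrFun (coord_res he le_rfl (inter_le_left V V) (e i)) j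
    rw [fnApp_res, hk, coordFn, h2, coord_basis, Pi.single_apply]
    split_ifs
    · simp only [map_one]
    · simp only [map_zero]
  have hrec (a : Fin N → LaurentSec W) (j : Fin N) :
      resRing (le_inter hW) (fnApp (k j) W
        (∑ i, a i • res hW (compareSec h E V (e i)))) = a j := by
    rw [map_sum, map_sum]
    have h1 (i : Fin N) : resRing (le_inter hW)
        (fnApp (k j) W (a i • res hW (compareSec h E V (e i)))) = if j = i then a i else 0 := by
      rw [fnApp_smul, map_mul, hdelta, mul_ite, mul_one, mul_zero]
      rfl
    rw [Finset.sum_congr rfl fun i _ => h1 i, Finset.sum_ite_eq, if_pos (Finset.mem_univ j)]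
  refine ⟨fun a b hab => ?_, fun s => ⟨_, hsum s⟩⟩
  funext j
  rw [← hrec a j, ← hrec b j]
  exact congrArg (fun s => resRing (le_inter hW) (fnApp (k j) W s)) hab

end Pullback
end Free

section Lattices

theorem ofPowerSeries_coeff_negSucc {R : Type*} [CommRing R] (c : PowerSeries R) (n : ℕ) :
    (HahnSeries.ofPowerSeries ℤ R c).coeff (Int.negSucc n) = 0 := by
  rw [HahnSeries.ofPowerSeries_apply]
  refine HahnSeries.embDomain_of_notMem_range ?_
  rintro ⟨m, hm⟩
  exact absurd hm (by simp)

/-- Power series are mapped to power series by `laurentMap`. -/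
theorem laurentMap_mem_range {R R' : Type*} [CommRing R] [CommRing R'] (f : R →+* R')
    {a : LaurentSeries R} (ha : a ∈ (HahnSeries.ofPowerSeries ℤ R).range) :
    laurentMap f a ∈ (HahnSeries.ofPowerSeries ℤ R').range := by
  obtain ⟨b, rfl⟩ := ha
  refine ⟨PowerSeries.map f b, HahnSeries.ext (funext fun n => ?_)⟩
  rw [laurentMap_coeff]
  rcases n with n | n
  · have h1 := LaurentSeries.coeff_coe_powerSeries (PowerSeries.map f b) n
    have h2 := LaurentSeries.coeff_coe_powerSeries b n
    exact h1.trans (by rw [PowerSeries.coeff_map, ← h2]; rfl)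
  · rw [ofPowerSeries_coeff_negSucc, ofPowerSeries_coeff_negSucc, map_zero]

/-- The sections over `U` of the subsheaf of rings `𝒪_S[[t]] ⊆ 𝒪_S((t))`. -/
def powerSubring (U : S.Opens) : Subring (LaurentSec U) where
  carrier := {f | ∀ x : U, f.1 x ∈ (HahnSeries.ofPowerSeries ℤ (S.presheaf.stalk x.1)).range}
  zero_mem' _ := zero_mem _
  one_mem' _ := one_mem _
  neg_mem' h x := neg_mem (h x)
  add_mem' h h' x := add_mem (h x) (h' x)
  mul_mem' h h' x := mul_mem (h x) (h' x)

theorem resRing_mem_power {U V : S.Opens} (h : V ≤ U) {a : LaurentSec U}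
    (ha : a ∈ powerSubring U) : resRing h a ∈ powerSubring V := fun x => ha ⟨x.1, h x.2⟩

theorem laurentApp_mem_power (p : T ⟶ S) {U : S.Opens} {a : LaurentSec U}
    (ha : a ∈ powerSubring U) : laurentApp p U a ∈ powerSubring (p ⁻¹ᵁ U) :=
  fun y => laurentMap_mem_range _ (ha ⟨p y.1, y.2⟩)

/-- A subsheaf of `𝒪_S[[t]]`-submodules of an `𝒪_S((t))`-module `M`. -/
@[ext]
structure PowerSubmodule (M : LaurentModule S) where
  /-- The group of sections over an open set. -/
  sec (U : S.Opens) : AddSubgroup (Sec M U)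
  smul_mem {U : S.Opens} {a : LaurentSec U} (ha : a ∈ powerSubring U) {s : Sec M U} :
    s ∈ sec U → a • s ∈ sec U
  res_mem {U V : S.Opens} (h : V ≤ U) {s : Sec M U} : s ∈ sec U → res h s ∈ sec V
  mem_of_local {U : S.Opens} {s : Sec M U} :
    (∀ x ∈ U, ∃ (V : S.Opens) (_ : x ∈ V) (h : V ≤ U), res h s ∈ sec V) → s ∈ sec U

namespace PowerSubmodule

variable {M : LaurentModule S}

instance : PartialOrder (PowerSubmodule M) where
  le F G := ∀ U, F.sec U ≤ G.sec U
  le_refl _ _ := le_rfl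
  le_trans _ _ _ h h' U := (h U).trans (h' U)
  le_antisymm _ _ h h' := PowerSubmodule.ext (funext fun U => le_antisymm (h U) (h' U))

/-- `F ⊆ M` is a lattice of rank `N` if the pair `(F, M)` is locally isomorphic to
`(𝒪_S[[t]]^N, 𝒪_S((t))^N)`. -/
def IsLattice (N : ℕ) (F : PowerSubmodule M) : Prop :=
  ∀ x : S, ∃ (U : S.Opens) (_ : x ∈ U) (e : Fin N → Sec M U), IsBasisOver e ∧
    ∀ (V : S.Opens) (h : V ≤ U) (a : Fin N → LaurentSec V),
      ∑ i, a i • res h (e i) ∈ F.sec V ↔ ∀ i, a i ∈ powerSubring V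

section Pullback

variable {p : T ⟶ S} {g : T' ⟶ T} {p' : T' ⟶ S} (h : g ≫ p = p') {E : LaurentModule S}

/-- The inverse image of `G ⊆ p'^*E` under `p^*E → g_* p'^*E`. -/
def comap (G : PowerSubmodule ((pull p').obj E)) : PowerSubmodule ((pull p).obj E) where
  sec U :=
    { carrier := {s | compareSec h E U s ∈ G.sec (g ⁻¹ᵁ U)}
      zero_mem' := by
        change compareSec h E U 0 ∈ G.sec (g ⁻¹ᵁ U)
        rw [map_zero]
        exact zero_mem _
      add_mem' := fun {s s'} hs hs' => by
        change compareSec h E U (s + s') ∈ G.sec (g ⁻¹ᵁ U)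
        rw [map_add]
        exact add_mem hs hs'
      neg_mem' := fun {s} hs => by
        change compareSec h E U (-s) ∈ G.sec (g ⁻¹ᵁ U)
        rw [map_neg]
        exact neg_mem hs }
  smul_mem {U a} ha s hs := by
    change compareSec h E U (a • s) ∈ G.sec (g ⁻¹ᵁ U)
    rw [compareSec_smul]
    exact G.smul_mem (laurentApp_mem_power g ha) hs
  res_mem {U V} i s hs := by
    change compareSec h E V (res i s) ∈ G.sec (g ⁻¹ᵁ V)
    rw [compareSec_res]
    exact G.res_mem _ hs
  mem_of_local {U s} H := by
    refine G.mem_of_local fun y hy => ?_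
    obtain ⟨V, hx, i, hV⟩ := H (g y) hy
    refine ⟨g ⁻¹ᵁ V, hx, fun _ hz => i hz, ?_⟩
    change compareSec h E V (res i s) ∈ G.sec (g ⁻¹ᵁ V) at hV
    rwa [compareSec_res] at hV

theorem mem_comap {G : PowerSubmodule ((pull p').obj E)} {U : T.Opens}
    {s : Sec ((pull p).obj E) U} :
    s ∈ (comap h G).sec U ↔ compareSec h E U s ∈ G.sec (g ⁻¹ᵁ U) := Iff.rfl

/-- The pullback `g^*F ⊆ p'^*E` of `F ⊆ p^*E`: the subsheaf of `𝒪[[t]]`-submodules generated by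
the image of `F`. -/
def pullback (F : PowerSubmodule ((pull p).obj E)) : PowerSubmodule ((pull p').obj E) where
  sec U := ⨅ G : {G : PowerSubmodule ((pull p').obj E) // F ≤ comap h G}, G.1.sec U
  smul_mem ha s hs := by
    rw [AddSubgroup.mem_iInf] at hs ⊢
    exact fun G => G.1.smul_mem ha (hs G)
  res_mem i s hs := by
    rw [AddSubgroup.mem_iInf] at hs ⊢
    exact fun G => G.1.res_mem i (hs G)
  mem_of_local {U s} H := by
    rw [AddSubgroup.mem_iInf]
    intro G
    refine G.1.mem_of_local fun x hx => ?_
    obtain ⟨V, hxV, i, hV⟩ := H x hx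
    exact ⟨V, hxV, i, AddSubgroup.mem_iInf.1 hV G⟩

theorem pullback_le_iff {F : PowerSubmodule ((pull p).obj E)}
    {G : PowerSubmodule ((pull p').obj E)} : pullback h F ≤ G ↔ F ≤ comap h G := by
  constructor
  · intro H U s hs
    refine H (g ⁻¹ᵁ U) (AddSubgroup.mem_iInf.2 fun G' => ?_)
    exact G'.2 U hs
  · intro H U s hs
    exact AddSubgroup.mem_iInf.1 hs ⟨G, H⟩

theorem compareSec_mem_pullback {F : PowerSubmodule ((pull p).obj E)} {U : T.Opens}
    {s : Sec ((pull p).obj E) U} (hs : s ∈ F.sec U) :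
    compareSec h E U s ∈ (pullback h F).sec (g ⁻¹ᵁ U) :=
  (pullback_le_iff h).1 le_rfl U hs

/-- Sections whose coordinates over `V` are power series. -/
def ofBasis {M : LaurentModule S} {N : ℕ} {V : S.Opens} {e : Fin N → Sec M V}
    (he : IsBasisOver e) : PowerSubmodule M where
  sec U :=
    { carrier := {s | ∀ i, coord he (inter_le_right V U) (res (inter_le_left V U) s) i ∈
        powerSubring _}
      zero_mem' := fun i => by
        have : coord he (inter_le_right V U) 0 = 0 := coord_unique he _ _ _ (by simp)
        rw [map_zero, this]
        exact zero_mem _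
      add_mem' := fun {s s'} hs hs' i => by
        rw [map_add, coord_add]
        exact add_mem (hs i) (hs' i)
      neg_mem' := fun {s} hs i => by
        have : coord he (inter_le_right V U) (-res (inter_le_left V U) s) =
            -coord he (inter_le_right V U) (res (inter_le_left V U) s) :=
          coord_unique he _ _ _ (by
            simp only [Pi.neg_apply, neg_smul, Finset.sum_neg_distrib, sum_coord])
        rw [map_neg, this]
        exact neg_mem (hs i) }
  smul_mem ha s hs i := by
    rw [res_smul, coord_smul]
    exact mul_mem (resRing_mem_power _ ha) (hs i)
  res_mem {U W} h s hs i := by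
    have h1 : res (inter_le_left V W) (res h s) =
        res ((interFunctor V).map (homOfLE h)).le (res (inter_le_left V U) s) := by
      rw [res_res, res_res]
    rw [h1, coord_res he (inter_le_right V U)]
    exact resRing_mem_power _ (hs i)
  mem_of_local {U s} H i x := by
    obtain ⟨W, hx, h, hW⟩ := H x.1 (inter_le_left V U x.2)
    have h1 : res (inter_le_left V W) (res h s) =
        res ((interFunctor V).map (homOfLE h)).le (res (inter_le_left V U) s) := by
      rw [res_res, res_res]
    have h2 := hW i
    rw [h1, coord_res he (inter_le_right V U)] at h2
    exact h2 ⟨x.1, mem_inter.2 ⟨hx, inter_le_right V U x.2⟩⟩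

theorem IsLattice.pullback {N : ℕ} {F : PowerSubmodule ((pull p).obj E)} (hF : F.IsLattice N) :
    (F.pullback h).IsLattice N := by
  intro y
  obtain ⟨V, hy, e, he, hFe⟩ := hF (g y)
  have he' := isBasisOver_compare h he
  refine ⟨g ⁻¹ᵁ V, hy, fun i => compareSec h E V (e i), he', fun W hW a => ⟨fun ha i => ?_,
    fun ha => sum_mem fun i _ => ?_⟩⟩
  · have hle : F.pullback h ≤ ofBasis he' := by
      rw [pullback_le_iff]
      intro U s hs
      rw [mem_comap]
      intro j
      have hc := (hFe _ (inter_le_right V U) (coord he (inter_le_right V U)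
        (res (inter_le_left V U) s))).1 (by rw [sum_coord]; exact F.res_mem _ hs)
      have h1 : coord he' (inter_le_right (g ⁻¹ᵁ V) (g ⁻¹ᵁ U))
          (res (inter_le_left (g ⁻¹ᵁ V) (g ⁻¹ᵁ U)) (compareSec h E U s)) =
          fun i => coordFn g he i U s := by
        refine coord_unique he' _ _ _ ?_
        have h2 : res (M := (pull p').obj E) (inter_le_left (g ⁻¹ᵁ V) (g ⁻¹ᵁ U))
            (compareSec h E U s) = res (inter_preimage g V U)
              (compareSec h E _ (res (inter_le_left V U) s)) := by
          rw [compareSec_res]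
          exact (res_res (M := (pull p').obj E) _ _ _).symm
        rw [h2]
        conv_rhs => rw [← sum_coord he (inter_le_right V U) (res (inter_le_left V U) s)]
        rw [map_sum, map_sum]
        refine Finset.sum_congr rfl fun i _ => ?_
        rw [compareSec_smul, res_smul, compareSec_res]
        exact congrArg _ (res_res (M := (pull p').obj E) _ _ _).symm
      rw [h1]
      exact resRing_mem_power _ (laurentApp_mem_power g (hc j))
    have h3 := hle W ha i
    rw [coord_res he' hW (inter_le_left _ W), coord_unique he' hW _ a rfl] at h3
    exact fun x => h3 ⟨x.1, le_inter hW x.2⟩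
  · refine PowerSubmodule.smul_mem _ (ha i) (PowerSubmodule.res_mem _ _ ?_)
    refine compareSec_mem_pullback h ?_
    have := (hFe V le_rfl (Pi.single i 1)).2 (fun j => by
      rw [Pi.single_apply]
      split_ifs
      · exact one_mem _
      · exact zero_mem _)
    rwa [← coord_basis he i, sum_coord] at this

end Pullback

theorem pullback_id {p : T ⟶ S} (h : 𝟙 T ≫ p = p) {E : LaurentModule S}
    (F : PowerSubmodule ((pull p).obj E)) : F.pullback h = F := by
  apply le_antisymm
  · rw [pullback_le_iff]
    intro U s hs
    rw [mem_comap, compareSec_id]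
    exact hs
  · intro U s hs
    have := compareSec_mem_pullback h hs
    rwa [compareSec_id] at this

theorem pullback_comp {p : T ⟶ S} {p' : T' ⟶ S} {p'' : T'' ⟶ S} {g : T' ⟶ T} {g' : T'' ⟶ T'}
    (h : g ≫ p = p') (h' : g' ≫ p' = p'') (h'' : (g' ≫ g) ≫ p = p'') {E : LaurentModule S}
    (F : PowerSubmodule ((pull p).obj E)) :
    F.pullback h'' = (F.pullback h).pullback h' := by
  apply le_antisymm
  · rw [pullback_le_iff]
    intro U s hs
    rw [mem_comap, ← compareSec_comp h h' h'']
    exact compareSec_mem_pullback h' (compareSec_mem_pullback h hs)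
  · rw [pullback_le_iff, pullback_le_iff]
    intro U s hs
    rw [mem_comap, mem_comap, compareSec_comp h h' h'']
    have hm := compareSec_mem_pullback h'' hs
    exact hm

end PowerSubmodule

/-- The contravariant functor on `S`-schemes sending `p : T ⟶ S` to the set of
`𝒪_T[[t]]`-lattices in `p^*E`. -/
def latticeFunctor (E : LaurentModule S) (N : ℕ) : (Over S)ᵒᵖ ⥤ Type u where
  obj T := {F : PowerSubmodule ((pull T.unop.hom).obj E) // F.IsLattice N}
  map f := TypeCat.ofHom fun F => ⟨F.1.pullback (Over.w f.unop), F.2.pullback (Over.w f.unop)⟩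
  map_id T := by
    refine ConcreteCategory.hom_ext _ _ fun F => ?_
    exact Subtype.ext (PowerSubmodule.pullback_id (Over.w (𝟙 T.unop)) F.1)
  map_comp f f' := by
    refine ConcreteCategory.hom_ext _ _ fun F => ?_
    exact Subtype.ext (PowerSubmodule.pullback_comp (Over.w f.unop) (Over.w f'.unop)
      (Over.w (f'.unop ≫ f.unop)) F.1)

end Lattices

section IndSchemes

open Limits

/-- An ind-scheme over `S`: a system of quasi-compact `S`-schemes and closed immersions over `S`
indexed by a (nonempty) filtered partially ordered set. When `S` is quasi-compact, this says that
the schemes themselves are quasi-compact. -/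
structure IndScheme (S : Scheme.{u}) where
  /-- The index set. -/
  index : Type u
  [partialOrder : PartialOrder index]
  [nonempty : Nonempty index]
  [directed : IsDirectedOrder index]
  /-- The system of schemes. -/
  diagram : index ⥤ Over S
  isClosedImmersion {i j : index} (f : i ⟶ j) : IsClosedImmersion (diagram.map f).left
  quasiCompact (i : index) : QuasiCompact (diagram.obj i).hom

attribute [instance] IndScheme.partialOrder IndScheme.nonempty IndScheme.directed

/-- The functor `T ↦ colim_i Hom_S(T, Y_i)` defined by an ind-scheme. -/
def IndScheme.points (Y : IndScheme S) : (Over S)ᵒᵖ ⥤ Type u :=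
  colimit (Y.diagram ⋙ yoneda)

/-- An ind-scheme over `S` is ind-proper if it is an inductive system of proper `S`-schemes. -/
def IndScheme.IsIndProper (Y : IndScheme S) : Prop :=
  ∀ i, IsProper (Y.diagram.obj i).hom

/-- A functor on `S`-schemes is formally smooth over `S` if, for every affine `S`-scheme `Spec A`
and every nilpotent ideal `I`, points over `Spec (A ⧸ I)` lift to points over `Spec A`. -/
def IsFormallySmooth (P : (Over S)ᵒᵖ ⥤ Type u) : Prop :=
  ∀ (A : CommRingCat.{u}) (I : Ideal A), IsNilpotent I → ∀ p : Spec A ⟶ S,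
    Function.Surjective (P.map
      (Over.homMk (Spec.map (CommRingCat.ofHom (Ideal.Quotient.mk I))) :
        Over.mk (Spec.map (CommRingCat.ofHom (Ideal.Quotient.mk I)) ≫ p) ⟶ Over.mk p).op)

/-- `P` is represented by the ind-scheme `Y`: `P` is a Zariski sheaf, and there is a morphism
`colim_i Hom_S(-, Y_i) ⟶ P` which is bijective on quasi-compact `S`-schemes. In other words, `P`
agrees with the functor of points of `Y` on quasi-compact (in particular, on affine) schemes, and
it is the Zariski sheaf associated with this functor on all schemes. -/
def IndScheme.Represents (Y : IndScheme S) (P : (Over S)ᵒᵖ ⥤ Type u) : Prop :=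
  Presheaf.IsSheaf (Scheme.zariskiTopology.over S) P ∧
    ∃ α : Y.points ⟶ P, ∀ T : Over S, CompactSpace T.left → Function.Bijective (α.app (op T))

end IndSchemes

end TwistedGrassmannian

end

/-!
Over an open subset of `S` on which `𝓔` has a basis, a lattice in `p^*𝓔` is a family of cosets in
`GL_N(𝒪_{T,x}((t))) / GL_N(𝒪_{T,x}[[t]])` that is locally given by an invertible matrix of Laurent
series (`FiberLattice`, `exists_hasFamily`, `ofFamily`). On a quasi-compact `T` such a family is
bounded, that is, it lies between `t^m 𝒪[[t]]^N` and `t^(-m) 𝒪[[t]]^N` for some `m`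
(`FiberLattice.IsLocal.exists_bounded`). After a shift, the quotient of `𝒪[[t]]^N` by a bounded
lattice is locally free of finite rank with a nilpotent endomorphism `t`, and over a local ring it
has a basis consisting of monomials `t^k e_i`, `k < d i`, for some `d : Fin N → ℕ`
(`BoundedMatrix.exists_isChart`). A lattice with this monomial basis is determined by the
coefficients of the `t^(d i) e_i`, which are subject to polynomial equations only (`ChartValid`).
Hence the functor of `m`-bounded lattices is covered by finitely many affine open subfunctors, so it
is represented by a scheme `BoundedGr N m` of finite type over `ℤ`. The valuative criterion shows
that this scheme is proper (`isProper_boundedGrHom`): over a valuation ring `A` with field of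
fractions `K`, the `A`-span of the `t^k e_i` in the quotient over `K` is finitely generated and
torsion-free, hence free, so a monomial basis and the coefficients can be chosen over `A`.

As `𝓔` need not have a global basis, the bounds `m` have no global meaning, and the schemes of
bounded lattices over the open subsets of `S` do not glue. They are replaced by closures. Both
`exists_closure` and `HasExhaustedBasis.exists_indScheme` are about an arbitrary functor that
satisfies gluing and is exhausted by proper subfunctors over each member of a basis of affine open
subsets of `S`. For a point `w : W ⟶ P` with `W` quasi-compact over `S`, the scheme-theoretic image
of `w` over each of these open subsets does not depend on the bound used to form it, and is
compatible with restriction to smaller ones; so the images glue to a proper `S`-scheme, the smallest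
proper subfunctor through which `w` factors. Applied to the finite disjoint unions of the schemes of
bounded lattices over the various affine open subsets, whose structure morphisms to `S` are
quasi-compact because `S` is quasi-separated, this yields the directed system. A point with values
in a quasi-compact scheme factors through a finite stage, as it does so locally. Gluing for the
functor of lattices is `gluesOver_latticeFunctor`.

For formal smoothness one lifts lattices along `Spec B ⟶ Spec A` with nilpotent kernel, and may
assume that the kernel has square zero. Bases of the lattice lift locally (`exists_local_lift`).
The transition matrices of the lifts are matrices of power series up to matrices `n_{ik}` with
finitely many polar coefficients, which lie in the kernel. These form a cocycle with values in a
quasi-coherent sheaf on an affine scheme, so they are a coboundary by the usual argument with a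
partition of unity (`IsCocycle.exists_split`, `IsCocycle.exists_correction`). The bases corrected
accordingly span a lattice (`exists_lift_of_squareZero`).
-/

noncomputable section

namespace TwistedGrassmannian

/-! ### Power series among Laurent series -/

section Laurent

variable {R R' R'' : Type*} [CommRing R] [CommRing R'] [CommRing R'']

theorem mem_power_iff {a : LaurentSeries R} :
    a ∈ (HahnSeries.ofPowerSeries ℤ R).range ↔ ∀ n : ℕ, a.coeff (Int.negSucc n) = 0 := by
  constructor
  · rintro ⟨b, rfl⟩ n
    exact ofPowerSeries_coeff_negSucc b n
  · intro h
    refine ⟨PowerSeries.mk fun n => a.coeff n, HahnSeries.ext (funext fun n => ?_)⟩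
    rcases n with n | n
    · exact (LaurentSeries.coeff_coe_powerSeries _ n).trans (PowerSeries.coeff_mk _ _)
    · rw [ofPowerSeries_coeff_negSucc, h]

theorem laurentMap_ofPowerSeries (f : R →+* R') (a : PowerSeries R) :
    laurentMap f (HahnSeries.ofPowerSeries ℤ R a) =
      HahnSeries.ofPowerSeries ℤ R' (PowerSeries.map f a) := by
  refine HahnSeries.ext (funext fun n => ?_)
  rw [laurentMap_coeff]
  rcases n with n | n
  · have h1 := LaurentSeries.coeff_coe_powerSeries (PowerSeries.map f a) n
    have h2 := LaurentSeries.coeff_coe_powerSeries a n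
    exact (congrArg f h2).trans ((PowerSeries.coeff_map f n a).symm.trans h1.symm)
  · rw [ofPowerSeries_coeff_negSucc, ofPowerSeries_coeff_negSucc, map_zero]

theorem laurentMap_single (f : R →+* R') (n : ℤ) (r : R) :
    laurentMap f (HahnSeries.single n r) = HahnSeries.single n (f r) := by
  refine HahnSeries.ext (funext fun k => ?_)
  rw [laurentMap_coeff, HahnSeries.coeff_single, HahnSeries.coeff_single]
  split_ifs <;> simp

theorem mem_power_of_injective {f : R →+* R'} (hf : Function.Injective f) {a : LaurentSeries R}
    (h : laurentMap f a ∈ (HahnSeries.ofPowerSeries ℤ R').range) :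
    a ∈ (HahnSeries.ofPowerSeries ℤ R).range := by
  rw [mem_power_iff] at h ⊢
  intro n
  have := h n
  rw [laurentMap_coeff] at this
  exact hf (this.trans (map_zero f).symm)

end Laurent

/-! ### Free lattices as cosets, and bounded lattices -/

section Cosets

variable {R R' R'' : Type*} [CommRing R] [CommRing R'] [CommRing R'']

variable (N : ℕ)

/-- The subgroup `GL_N(R[[t]])` of `GL_N(R((t)))`. -/
def powerGL (R : Type*) [CommRing R] : Subgroup (GL (Fin N) (LaurentSeries R)) :=
  (Matrix.GeneralLinearGroup.map (HahnSeries.ofPowerSeries ℤ R)).range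

/-- The set of free lattices in `R((t))^N`, as the coset space `GL_N(R((t))) / GL_N(R[[t]])`. -/
def Gr (R : Type*) [CommRing R] : Type _ := GL (Fin N) (LaurentSeries R) ⧸ powerGL N R

variable {N}

/-- A matrix belongs to `GL_N(R[[t]])` if it and its inverse have entries in `R[[t]]`. -/
theorem mem_powerGL {g : GL (Fin N) (LaurentSeries R)} :
    g ∈ powerGL N R ↔ (∀ i j, g.1 i j ∈ (HahnSeries.ofPowerSeries ℤ R).range) ∧
      ∀ i j, g⁻¹.1 i j ∈ (HahnSeries.ofPowerSeries ℤ R).range := by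
  constructor
  · rintro ⟨h, rfl⟩
    exact ⟨fun i j => ⟨h.1 i j, rfl⟩, fun i j => ⟨h⁻¹.1 i j, by rw [← map_inv]; rfl⟩⟩
  · rintro ⟨h1, h2⟩
    choose A hA using h1
    choose B hB using h2
    have hinj : Function.Injective fun M : Matrix (Fin N) (Fin N) (PowerSeries R) =>
        M.map (HahnSeries.ofPowerSeries ℤ R) :=
      Matrix.map_injective HahnSeries.ofPowerSeries_injective
    have hA' : (Matrix.of A).map (HahnSeries.ofPowerSeries ℤ R) = g.1 := by ext i j; simp [← hA]
    have hB' : (Matrix.of B).map (HahnSeries.ofPowerSeries ℤ R) = g⁻¹.1 := by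
      ext i j; simp [← hB]
    refine ⟨⟨Matrix.of A, Matrix.of B, hinj ?_, hinj ?_⟩, Units.ext hA'⟩
    · change ((Matrix.of A) * (Matrix.of B)).map (HahnSeries.ofPowerSeries ℤ R) =
        (1 : Matrix _ _ _).map (HahnSeries.ofPowerSeries ℤ R)
      rw [Matrix.map_mul, hA', hB', Matrix.map_one _ (map_zero _) (map_one _)]
      exact g.mul_inv
    · change ((Matrix.of B) * (Matrix.of A)).map (HahnSeries.ofPowerSeries ℤ R) =
        (1 : Matrix _ _ _).map (HahnSeries.ofPowerSeries ℤ R)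
      rw [Matrix.map_mul, hA', hB', Matrix.map_one _ (map_zero _) (map_one _)]
      exact g.inv_mul

/-- The map `GL_N(R((t))) → GL_N(R'((t)))` induced by `R → R'`. -/
def glMap (f : R →+* R') : GL (Fin N) (LaurentSeries R) →* GL (Fin N) (LaurentSeries R') :=
  Matrix.GeneralLinearGroup.map (laurentMap f)

theorem glMap_apply (f : R →+* R') (g : GL (Fin N) (LaurentSeries R)) (i j : Fin N) :
    (glMap f g).1 i j = laurentMap f (g.1 i j) := rfl

theorem glMap_glMap (g : R' →+* R'') (f : R →+* R') (a : GL (Fin N) (LaurentSeries R)) :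
    glMap g (glMap f a) = glMap (g.comp f) a := Units.ext (by ext; rfl)

theorem glMap_mem {f : R →+* R'} {g : GL (Fin N) (LaurentSeries R)} (h : g ∈ powerGL N R) :
    glMap f g ∈ powerGL N R' := by
  rw [mem_powerGL] at h ⊢
  refine ⟨fun i j => laurentMap_mem_range f (h.1 i j), fun i j => ?_⟩
  rw [← map_inv]
  exact laurentMap_mem_range f (h.2 i j)

theorem mem_of_glMap_mem {f : R →+* R'} (hf : Function.Injective f)
    {g : GL (Fin N) (LaurentSeries R)} (h : glMap f g ∈ powerGL N R') : g ∈ powerGL N R := by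
  rw [mem_powerGL] at h ⊢
  refine ⟨fun i j => mem_power_of_injective hf (h.1 i j),
    fun i j => mem_power_of_injective hf (?_ : laurentMap f (g⁻¹.1 i j) ∈ _)⟩
  have := h.2 i j
  rwa [← map_inv] at this

namespace Gr

/-- The lattice spanned by the columns of `g`. -/
def mk (g : GL (Fin N) (LaurentSeries R)) : Gr N R := QuotientGroup.mk g

theorem mk_surjective (q : Gr N R) : ∃ g, mk g = q := QuotientGroup.mk_surjective q

theorem mk_eq_iff {g h : GL (Fin N) (LaurentSeries R)} :
    mk g = mk h ↔ g⁻¹ * h ∈ powerGL N R := QuotientGroup.eq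

/-- Extension of scalars of free lattices. -/
def map (f : R →+* R') : Gr N R → Gr N R' :=
  Quotient.map' (glMap f) fun _ _ h => by
    rw [QuotientGroup.leftRel_apply] at h ⊢
    rw [← map_inv, ← map_mul]
    exact glMap_mem h

@[simp]
theorem map_mk (f : R →+* R') (g : GL (Fin N) (LaurentSeries R)) :
    map f (mk g) = mk (glMap f g) := rfl

theorem map_map (g : R' →+* R'') (f : R →+* R') (q : Gr N R) :
    map g (map f q) = map (g.comp f) q := by
  obtain ⟨a, rfl⟩ := mk_surjective q
  simp only [map_mk, glMap_glMap]

theorem map_id (q : Gr N R) : map (RingHom.id R) q = q := by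
  obtain ⟨a, rfl⟩ := mk_surjective q
  exact congrArg mk (Units.ext (by ext; rfl))

theorem map_injective {f : R →+* R'} (hf : Function.Injective f) :
    Function.Injective (map (N := N) f) := by
  intro p q h
  obtain ⟨a, rfl⟩ := mk_surjective p
  obtain ⟨b, rfl⟩ := mk_surjective q
  rw [map_mk, map_mk, mk_eq_iff, ← map_inv, ← map_mul] at h
  exact mk_eq_iff.2 (mem_of_glMap_mem hf h)

end Gr

/-- An `N × N` matrix over `R[[t]]` that divides `t^(2m)`: up to the shift by `t^(-m)`, these are
the bases of the free lattices between `t^m R[[t]]^N` and `t^(-m) R[[t]]^N`. -/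
structure BoundedMatrix (N m : ℕ) (R : Type*) [CommRing R] where
  /-- The matrix. -/
  mat : Matrix (Fin N) (Fin N) (PowerSeries R)
  /-- Its inverse up to `t^(2m)`. -/
  inv : Matrix (Fin N) (Fin N) (PowerSeries R)
  mul_inv : mat * inv = (PowerSeries.X ^ (2 * m) : PowerSeries R) • 1
  inv_mul : inv * mat = (PowerSeries.X ^ (2 * m) : PowerSeries R) • 1

theorem single_mul_X_pow (m : ℕ) : (HahnSeries.single (-(m : ℤ)) (1 : R)) *
    HahnSeries.single (-(m : ℤ)) (1 : R) *
      HahnSeries.ofPowerSeries ℤ R (PowerSeries.X ^ (2 * m)) = 1 := by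
  rw [HahnSeries.ofPowerSeries_X_pow, HahnSeries.single_mul_single, HahnSeries.single_mul_single,
    mul_one, mul_one]
  have : (-(m : ℤ) + -(m : ℤ) + ((2 * m : ℕ) : ℤ)) = 0 := by push_cast; ring
  rw [this]
  rfl

namespace BoundedMatrix

variable {m : ℕ}

theorem shift_mul_shift {A B : Matrix (Fin N) (Fin N) (PowerSeries R)}
    (h : A * B = (PowerSeries.X ^ (2 * m) : PowerSeries R) • 1) :
    (HahnSeries.single (-(m : ℤ)) (1 : R) • A.map (HahnSeries.ofPowerSeries ℤ R)) *
      (HahnSeries.single (-(m : ℤ)) (1 : R) • B.map (HahnSeries.ofPowerSeries ℤ R)) = 1 := by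
  rw [Matrix.smul_mul, Matrix.mul_smul, ← Matrix.map_mul, h, smul_smul]
  refine Matrix.ext fun i j => ?_
  by_cases hij : i = j
  · subst hij
    simpa using single_mul_X_pow (R := R) m
  · simp [hij]

/-- The element `t^(-m) B` of `GL_N(R((t)))`. -/
def toGL (B : BoundedMatrix N m R) : GL (Fin N) (LaurentSeries R) where
  val := HahnSeries.single (-(m : ℤ)) (1 : R) • B.mat.map (HahnSeries.ofPowerSeries ℤ R)
  inv := HahnSeries.single (-(m : ℤ)) (1 : R) • B.inv.map (HahnSeries.ofPowerSeries ℤ R)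
  val_inv := shift_mul_shift B.mul_inv
  inv_val := shift_mul_shift B.inv_mul

/-- Extension of scalars. -/
def map (f : R →+* R') (B : BoundedMatrix N m R) : BoundedMatrix N m R' where
  mat := B.mat.map (PowerSeries.map f)
  inv := B.inv.map (PowerSeries.map f)
  mul_inv := by
    rw [← Matrix.map_mul, B.mul_inv]
    refine Matrix.ext fun i j => ?_
    by_cases hij : i = j
    · subst hij; simp
    · simp [hij]
  inv_mul := by
    rw [← Matrix.map_mul, B.inv_mul]
    refine Matrix.ext fun i j => ?_
    by_cases hij : i = j
    · subst hij; simp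
    · simp [hij]

theorem toGL_map (f : R →+* R') (B : BoundedMatrix N m R) :
    (B.map f).toGL = glMap f B.toGL := by
  refine Units.ext (Matrix.ext fun i j => ?_)
  rw [glMap_apply]
  change HahnSeries.single (-(m : ℤ)) (1 : R') * HahnSeries.ofPowerSeries ℤ R' _ =
    laurentMap f (HahnSeries.single (-(m : ℤ)) (1 : R) * HahnSeries.ofPowerSeries ℤ R _)
  rw [map_mul, laurentMap_single, laurentMap_ofPowerSeries, f.map_one]
  rfl

/-- The lattice spanned by the columns, before the shift by `t^(-m)`. -/
def lattice (B : BoundedMatrix N m R) : Submodule (PowerSeries R) (Fin N → PowerSeries R) :=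
  LinearMap.range B.mat.mulVecLin

theorem X_pow_smul_mem (B : BoundedMatrix N m R) (v : Fin N → PowerSeries R) :
    (PowerSeries.X ^ (2 * m) : PowerSeries R) • v ∈ B.lattice :=
  ⟨B.inv.mulVec v, by
    rw [Matrix.mulVecLin_apply, Matrix.mulVec_mulVec, B.mul_inv, Matrix.smul_mulVec,
      Matrix.one_mulVec]⟩

/-- If one lattice is contained in the other, the change of basis has entries in `R[[t]]`. -/
theorem entries_of_le {A B : BoundedMatrix N m R} (h : B.lattice ≤ A.lattice) (i j : Fin N) :
    (A.toGL⁻¹ * B.toGL).1 i j ∈ (HahnSeries.ofPowerSeries ℤ R).range := by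
  have h1 (j : Fin N) : ∃ w, A.mat.mulVec w = B.mat.col j :=
    h ⟨Pi.single j 1, by simp⟩
  choose w hw using h1
  have h2 : A.mat * (Matrix.of fun i j => w j i) = B.mat := by
    exact Matrix.ext fun i j => congrFun (hw j) i
  have h3 : B.toGL.1 =
      A.toGL.1 * (Matrix.of fun i j => w j i).map (HahnSeries.ofPowerSeries ℤ R) := by
    change _ • B.mat.map (HahnSeries.ofPowerSeries ℤ R) =
      _ • A.mat.map (HahnSeries.ofPowerSeries ℤ R) * _
    rw [Matrix.smul_mul, ← Matrix.map_mul, h2]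
  rw [Units.val_mul, h3, ← mul_assoc, Units.inv_mul, one_mul]
  exact ⟨_, rfl⟩

theorem mk_toGL_eq {A B : BoundedMatrix N m R} (h : A.lattice = B.lattice) :
    Gr.mk A.toGL = Gr.mk B.toGL := by
  rw [Gr.mk_eq_iff, mem_powerGL]
  refine ⟨entries_of_le h.ge, ?_⟩
  rw [mul_inv_rev, inv_inv]
  exact entries_of_le h.le

/-- The lattice of columns only depends on the coset of the matrix. -/
theorem lattice_le_of_mk_toGL_eq {A B : BoundedMatrix N m R}
    (h : Gr.mk A.toGL = Gr.mk B.toGL) : B.lattice ≤ A.lattice := by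
  rw [Gr.mk_eq_iff] at h
  obtain ⟨k, hk⟩ := h
  have h1 : B.toGL = A.toGL * Matrix.GeneralLinearGroup.map (HahnSeries.ofPowerSeries ℤ R) k := by
    rw [hk, mul_inv_cancel_left]
  have h2 : B.mat = A.mat * k.1 := by
    apply Matrix.map_injective (HahnSeries.ofPowerSeries_injective (Γ := ℤ) (R := R))
    have h3 := congrArg (fun g => HahnSeries.single (m : ℤ) (1 : R) • g.1) h1
    change HahnSeries.single (m : ℤ) (1 : R) • (HahnSeries.single (-(m : ℤ)) (1 : R) •
      B.mat.map (HahnSeries.ofPowerSeries ℤ R)) = HahnSeries.single (m : ℤ) (1 : R) •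
      ((HahnSeries.single (-(m : ℤ)) (1 : R) •
      A.mat.map (HahnSeries.ofPowerSeries ℤ R)) * k.1.map (HahnSeries.ofPowerSeries ℤ R)) at h3
    rw [Matrix.smul_mul, smul_smul, smul_smul, HahnSeries.single_mul_single, add_neg_cancel,
      mul_one, ← Matrix.map_mul] at h3
    have h4 : (HahnSeries.single (0 : ℤ) (1 : R)) = 1 := rfl
    rwa [h4, one_smul, one_smul] at h3
  rintro _ ⟨w, rfl⟩
  exact ⟨k.1.mulVec w, by simp [h2]⟩

theorem lattice_eq_of_mk_toGL_eq {A B : BoundedMatrix N m R}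
    (h : Gr.mk A.toGL = Gr.mk B.toGL) : A.lattice = B.lattice :=
  le_antisymm (lattice_le_of_mk_toGL_eq h.symm) (lattice_le_of_mk_toGL_eq h)

end BoundedMatrix

/-- A free lattice is `m`-bounded if it lies between `t^m R[[t]]^N` and `t^(-m) R[[t]]^N`. -/
def Gr.Bounded (m : ℕ) (q : Gr N R) : Prop := ∃ B : BoundedMatrix N m R, mk B.toGL = q

theorem Gr.Bounded.map {m : ℕ} (f : R →+* R') {q : Gr N R} (h : q.Bounded m) :
    (Gr.map f q).Bounded m := by
  obtain ⟨B, rfl⟩ := h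
  exact ⟨B.map f, by rw [Gr.map_mk, BoundedMatrix.toGL_map]⟩

end Cosets

/-! ### Charts: lattices with a prescribed monomial basis -/

section Charts

variable {R R' : Type*} [CommRing R] [CommRing R'] {N : ℕ}

/-- The monomials `t^k e_i` with `k < d i`. -/
abbrev MonoIdx (d : Fin N → ℕ) : Type := Σ i, Fin (d i)

/-- The combination of the monomials `t^k e_i`, `k < d i`, with coefficients `x`. -/
def monoVec (d : Fin N → ℕ) : (MonoIdx d → R) →ₗ[R] (Fin N → PowerSeries R) where
  toFun x i := PowerSeries.mk fun k => if h : k < d i then x ⟨i, k, h⟩ else 0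
  map_add' x y := by
    ext i k
    simp only [PowerSeries.coeff_mk, Pi.add_apply, map_add]
    split_ifs <;> simp
  map_smul' r x := by
    ext i k
    simp only [PowerSeries.coeff_mk, Pi.smul_apply, RingHom.id_apply, map_smul]
    split_ifs <;> simp

theorem coeff_monoVec (d : Fin N → ℕ) (x : MonoIdx d → R) (i : Fin N) (k : ℕ) :
    PowerSeries.coeff k (monoVec d x i) = if h : k < d i then x ⟨i, k, h⟩ else 0 :=
  PowerSeries.coeff_mk k fun k => if h : k < d i then x ⟨i, k, h⟩ else 0

theorem monoVec_single (d : Fin N → ℕ) (j : MonoIdx d) :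
    monoVec d (Pi.single j (1 : R)) = Pi.single j.1 (PowerSeries.X ^ (j.2 : ℕ)) := by
  obtain ⟨j, l, hl⟩ := j
  ext i k
  rw [coeff_monoVec]
  by_cases hij : i = j
  · subst hij
    rw [Pi.single_eq_same, PowerSeries.coeff_X_pow]
    by_cases hk : k = l
    · subst hk
      rw [dif_pos hl, if_pos rfl, Pi.single_eq_same]
    · rw [if_neg hk]
      split_ifs with h
      · rw [Pi.single_eq_of_ne]
        intro h'
        exact hk (congrArg Fin.val (eq_of_heq (Sigma.mk.inj_iff.1 h').2))
      · rfl
  · rw [Pi.single_eq_of_ne hij]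
    split_ifs with h
    · rw [Pi.single_eq_of_ne]
      · simp
      · intro h'
        exact hij (congrArg Sigma.fst h')
    · simp

/-- `L ⊕ span {t^k e_i | k < d i} = R[[t]]^N`: every vector is congruent modulo `L` to a unique
combination of the monomials. -/
def IsChart (L : Submodule (PowerSeries R) (Fin N → PowerSeries R)) (d : Fin N → ℕ) : Prop :=
  ∀ v, ∃! x : MonoIdx d → R, v - monoVec d x ∈ L

variable (d : Fin N → ℕ) (c : Fin N → MonoIdx d → R)

/-- The vector `t^k e_i`, `k ≤ d i`, as a combination of the monomials `t^l e_j`, `l < d j`, under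
the relations `t^(d i) e_i = c i`. -/
def chartBasis (i : Fin N) (k : ℕ) : MonoIdx d → R :=
  if h : k < d i then Pi.single ⟨i, k, h⟩ 1 else c i

/-- Multiplication by `t` on the combinations of the monomials `t^k e_i`, `k < d i`, if the
relations `t^(d i) e_i = c i` hold. -/
def chartShift : Module.End R (MonoIdx d → R) :=
  (Pi.basisFun R (MonoIdx d)).constr R fun j => chartBasis d c j.1 (j.2 + 1)

theorem chartShift_single (j : MonoIdx d) :
    chartShift d c (Pi.single j 1) = chartBasis d c j.1 (j.2 + 1) := by
  have := (Pi.basisFun R (MonoIdx d)).constr_basis R (fun j => chartBasis d c j.1 (j.2 + 1)) j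
  rwa [Pi.basisFun_apply] at this

theorem chartShift_pow (i : Fin N) {k : ℕ} (hk : k ≤ d i) :
    (chartShift d c ^ k) (chartBasis d c i 0) = chartBasis d c i k := by
  induction k with
  | zero => rfl
  | succ k ih =>
    rw [pow_succ', Module.End.mul_apply, ih (Nat.le_of_succ_le hk)]
    have h1 : chartBasis d c i k = Pi.single ⟨i, k, hk⟩ 1 := dif_pos hk
    rw [h1, chartShift_single]

theorem chartShift_pow_lt (j : MonoIdx d) :
    (chartShift d c ^ (j.2 : ℕ)) (chartBasis d c j.1 0) = Pi.single j 1 := by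
  rw [chartShift_pow d c j.1 j.2.2.le, chartBasis, dif_pos j.2.2]

theorem chartShift_pow_self (i : Fin N) :
    (chartShift d c ^ (d i)) (chartBasis d c i 0) = c i := by
  rw [chartShift_pow d c i le_rfl, chartBasis, dif_neg (lt_irrefl _)]

/-- The relations `t^(d i) e_i = c i` imply that `t^e = 0`. -/
def ChartValid (e : ℕ) : Prop := ∀ i, (chartShift d c ^ e) (chartBasis d c i 0) = 0

/-- The vector `t^(d i) e_i - c i`. -/
def chartVec (i : Fin N) : Fin N → PowerSeries R :=
  Pi.single i (PowerSeries.X ^ d i) - monoVec d (c i)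

/-- The submodule generated by the vectors `t^(d i) e_i - c i`. -/
def chartLattice : Submodule (PowerSeries R) (Fin N → PowerSeries R) :=
  Submodule.span _ (Set.range (chartVec d c))

/-- The linear map sending `t^k e_i` to its combination of monomials modulo the relations.
Coefficients of order at least `e` are ignored, as `t^e = 0` for valid `c`. -/
def chartProj (e : ℕ) : (Fin N → PowerSeries R) →ₗ[R] (MonoIdx d → R) :=
  ∑ i, ∑ k ∈ Finset.range e, ((PowerSeries.coeff k).comp (LinearMap.proj i)).smulRight
    ((chartShift d c ^ k) (chartBasis d c i 0))

theorem chartProj_apply (e : ℕ) (v : Fin N → PowerSeries R) :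
    chartProj d c e v = ∑ i, ∑ k ∈ Finset.range e,
      PowerSeries.coeff k (v i) • (chartShift d c ^ k) (chartBasis d c i 0) := by
  simp [chartProj, LinearMap.sum_apply]

theorem chartProj_X_pow_smul (e : ℕ) (v : Fin N → PowerSeries R) :
    chartProj d c e ((PowerSeries.X ^ e : PowerSeries R) • v) = 0 := by
  rw [chartProj_apply]
  refine Finset.sum_eq_zero fun i _ => Finset.sum_eq_zero fun k hk => ?_
  rw [Pi.smul_apply, smul_eq_mul, PowerSeries.coeff_X_pow_mul',
    if_neg (not_le.2 (Finset.mem_range.1 hk)), zero_smul]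

variable {d c} {e : ℕ}

theorem chartProj_X_smul (hc : ChartValid d c e) (v : Fin N → PowerSeries R) :
    chartProj d c e ((PowerSeries.X : PowerSeries R) • v) =
      chartShift d c (chartProj d c e v) := by
  rw [chartProj_apply, chartProj_apply, map_sum]
  refine Finset.sum_congr rfl fun i _ => ?_
  have h1 := Finset.sum_range_succ (fun k => PowerSeries.coeff k
    (((PowerSeries.X : PowerSeries R) • v) i) • (chartShift d c ^ k) (chartBasis d c i 0)) e
  -- The term of order `e` vanishes, so one may sum over `k ≤ e` and shift the index.
  rw [hc i, smul_zero, add_zero] at h1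
  rw [← h1, Finset.sum_range_succ', map_sum]
  rw [Pi.smul_apply, smul_eq_mul, PowerSeries.coeff_zero_X_mul, zero_smul, add_zero]
  refine Finset.sum_congr rfl fun k _ => ?_
  rw [PowerSeries.coeff_succ_X_mul, map_smul, pow_succ', Module.End.mul_apply]

theorem chartProj_X_pow_smul' (hc : ChartValid d c e) (k : ℕ) (v : Fin N → PowerSeries R) :
    chartProj d c e ((PowerSeries.X ^ k : PowerSeries R) • v) =
      (chartShift d c ^ k) (chartProj d c e v) := by
  induction k with
  | zero => simp
  | succ k ih =>
    rw [pow_succ', mul_smul, chartProj_X_smul hc, ih, pow_succ', Module.End.mul_apply]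

theorem powerSeries_eq_sum (a : PowerSeries R) (e : ℕ) : ∃ b : PowerSeries R,
    a = ∑ k ∈ Finset.range e, PowerSeries.coeff k a • PowerSeries.X ^ k +
      PowerSeries.X ^ e * b := by
  refine ⟨PowerSeries.mk fun k => PowerSeries.coeff (k + e) a, ?_⟩
  ext n
  rw [map_add, map_sum, PowerSeries.coeff_X_pow_mul', PowerSeries.coeff_mk]
  simp only [map_smul, PowerSeries.coeff_X_pow, smul_eq_mul, mul_ite, mul_one, mul_zero]
  rw [Finset.sum_ite_eq]
  by_cases h : e ≤ n
  · simp [h]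
  · simp [h, not_le.1 h]

/-- The kernel of `chartProj` is stable under `R[[t]]`, not only under polynomials, since
`chartProj` vanishes on the multiples of `t^e`. -/
theorem chartProj_smul (hc : ChartValid d c e) (a : PowerSeries R) {v : Fin N → PowerSeries R}
    (hv : chartProj d c e v = 0) : chartProj d c e (a • v) = 0 := by
  obtain ⟨b, hb⟩ := powerSeries_eq_sum a e
  rw [hb, add_smul, mul_smul, map_add, chartProj_X_pow_smul, add_zero, Finset.sum_smul, map_sum]
  refine Finset.sum_eq_zero fun k _ => ?_
  rw [smul_assoc, map_smul, chartProj_X_pow_smul' hc, hv, map_zero, smul_zero]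

theorem chartProj_single_one (hc : ChartValid d c e) (i : Fin N) :
    chartProj d c e (Pi.single i 1) = chartBasis d c i 0 := by
  rw [chartProj_apply, Finset.sum_eq_single i]
  -- For `e = 0` the sum is empty, but then validity says that `e_i = 0`.
  · rcases e with _ | e
    · rw [Finset.range_zero, Finset.sum_empty]
      exact (hc i).symm
    · rw [Finset.sum_range_succ', Pi.single_eq_same]
      simp [PowerSeries.coeff_one]
  · intro j _ hj
    simp [Pi.single_eq_of_ne hj]
  · simp

theorem chartProj_single (hc : ChartValid d c e) (i : Fin N) (k : ℕ) :
    chartProj d c e (Pi.single i (PowerSeries.X ^ k)) =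
      (chartShift d c ^ k) (chartBasis d c i 0) := by
  rw [← chartProj_single_one hc, ← chartProj_X_pow_smul' hc, ← Pi.single_smul, smul_eq_mul,
    mul_one]

theorem chartProj_monoVec (hc : ChartValid d c e) (x : MonoIdx d → R) :
    chartProj d c e (monoVec d x) = x := by
  have : (chartProj d c e).comp (monoVec d) = LinearMap.id := by
    refine (Pi.basisFun R (MonoIdx d)).ext fun j => ?_
    rw [Pi.basisFun_apply, LinearMap.comp_apply, monoVec_single, chartProj_single hc,
      chartShift_pow_lt]
    rfl
  exact congrArg (fun f => f x) this

theorem chartProj_chartVec (hc : ChartValid d c e) (i : Fin N) :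
    chartProj d c e (chartVec d c i) = 0 := by
  rw [chartVec, map_sub, chartProj_single hc, chartProj_monoVec hc, chartShift_pow_self, sub_self]

theorem chartProj_eq_zero_of_mem (hc : ChartValid d c e) {v : Fin N → PowerSeries R}
    (hv : v ∈ chartLattice d c) : chartProj d c e v = 0 := by
  induction hv using Submodule.span_induction with
  | mem v hv =>
    obtain ⟨i, rfl⟩ := hv
    exact chartProj_chartVec hc i
  | zero => exact map_zero _
  | add v w _ _ hv hw => rw [map_add, hv, hw, add_zero]
  | smul a v _ hv => exact chartProj_smul hc a hv

theorem chartVec_mem (i : Fin N) : chartVec d c i ∈ chartLattice d c :=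
  Submodule.subset_span ⟨i, rfl⟩

/-- The endomorphism `chartShift` is multiplication by `t` modulo the relations. -/
theorem X_smul_monoVec_sub_mem (x : MonoIdx d → R) :
    (PowerSeries.X : PowerSeries R) • monoVec d x - monoVec d (chartShift d c x) ∈
      chartLattice d c := by
  let L : Submodule R (MonoIdx d → R) :=
    ((chartLattice d c).restrictScalars R).comap
      ((LinearMap.lsmul (PowerSeries R) (Fin N → PowerSeries R) PowerSeries.X).restrictScalars R ∘ₗ
        monoVec d - monoVec d ∘ₗ chartShift d c)
  suffices h : L = ⊤ from (h ▸ Submodule.mem_top : x ∈ L)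
  rw [eq_top_iff, ← (Pi.basisFun R (MonoIdx d)).span_eq, Submodule.span_le]
  rintro _ ⟨j, rfl⟩
  change (PowerSeries.X : PowerSeries R) • monoVec d (Pi.basisFun R (MonoIdx d) j) -
    monoVec d (chartShift d c (Pi.basisFun R (MonoIdx d) j)) ∈ chartLattice d c
  rw [Pi.basisFun_apply, chartShift_single, monoVec_single, ← Pi.single_smul, smul_eq_mul,
    ← pow_succ', chartBasis]
  split_ifs with h
  · rw [monoVec_single, sub_self]
    exact zero_mem _
  -- Multiplication by `t` leaves the range of the monomials: this is one of the relations.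
  · have h1 : (j.2 : ℕ) + 1 = d j.1 := le_antisymm j.2.2 (not_lt.1 h)
    rw [h1]
    exact chartVec_mem j.1

theorem single_sub_mem (i : Fin N) :
    Pi.single i 1 - monoVec d (chartBasis d c i 0) ∈ chartLattice d c := by
  rw [chartBasis]
  split_ifs with h
  · rw [monoVec_single, pow_zero, sub_self]
    exact zero_mem _
  · have h1 := chartVec_mem (d := d) (c := c) i
    rwa [chartVec, Nat.eq_zero_of_not_pos h, pow_zero] at h1

theorem single_X_pow_sub_mem (i : Fin N) (k : ℕ) :
    Pi.single i (PowerSeries.X ^ k) - monoVec d ((chartShift d c ^ k) (chartBasis d c i 0)) ∈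
      chartLattice d c := by
  induction k with
  | zero => exact single_sub_mem i
  | succ k ih =>
    have h1 := (chartLattice d c).smul_mem PowerSeries.X ih
    rw [smul_sub, ← Pi.single_smul, smul_eq_mul, ← pow_succ'] at h1
    have h2 := add_mem h1 (X_smul_monoVec_sub_mem (c := c)
      ((chartShift d c ^ k) (chartBasis d c i 0)))
    rwa [sub_add_sub_cancel, ← Module.End.mul_apply, ← pow_succ'] at h2

theorem X_pow_smul_mem_chartLattice (hc : ChartValid d c e) (v : Fin N → PowerSeries R) :
    (PowerSeries.X ^ e : PowerSeries R) • v ∈ chartLattice d c := by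
  rw [pi_eq_sum_univ v, Finset.smul_sum]
  refine sum_mem fun i _ => ?_
  have h1 := single_X_pow_sub_mem (c := c) i e
  rw [hc i, map_zero, sub_zero] at h1
  convert (chartLattice d c).smul_mem (v i) h1 using 1
  ext j : 1
  by_cases hij : i = j
  · subst hij
    simp [mul_comm]
  · simp [hij]

/-- Every vector is congruent to the combination of monomials given by `chartProj`. -/
theorem sub_monoVec_chartProj_mem (hc : ChartValid d c e) (v : Fin N → PowerSeries R) :
    v - monoVec d (chartProj d c e v) ∈ chartLattice d c := by
  choose b hb using fun i => powerSeries_eq_sum (v i) e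
  have h1 : v = ∑ i, ∑ k ∈ Finset.range e, PowerSeries.coeff k (v i) •
      (Pi.single i (PowerSeries.X ^ k) : Fin N → PowerSeries R) +
        (PowerSeries.X ^ e : PowerSeries R) • b := by
    ext j : 1
    rw [Pi.add_apply, Finset.sum_apply, Finset.sum_eq_single j]
    · rw [Finset.sum_apply]
      simp only [Pi.smul_apply, Pi.single_eq_same, smul_eq_mul]
      exact hb j
    · intro i _ hij
      rw [Finset.sum_apply]
      exact Finset.sum_eq_zero fun k _ => by
        rw [Pi.smul_apply, Pi.single_eq_of_ne (Ne.symm hij), smul_zero]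
    · simp
  rw [chartProj_apply]
  have h2 (w : Fin N → PowerSeries R) (h : w ∈ chartLattice d c) (hw : v - monoVec d (∑ i,
      ∑ k ∈ Finset.range e, PowerSeries.coeff k (v i) • (chartShift d c ^ k) (chartBasis d c i 0)) =
        w) : v - monoVec d (∑ i, ∑ k ∈ Finset.range e,
          PowerSeries.coeff k (v i) • (chartShift d c ^ k) (chartBasis d c i 0)) ∈
            chartLattice d c := hw ▸ h
  refine h2 _ ?_ (congrArg (fun w => w - _) h1)
  rw [add_sub_right_comm, map_sum, ← Finset.sum_sub_distrib]
  refine add_mem (sum_mem fun i _ => ?_) (X_pow_smul_mem_chartLattice hc b)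
  rw [map_sum, ← Finset.sum_sub_distrib]
  refine sum_mem fun k _ => ?_
  rw [map_smul, ← smul_sub]
  exact ((chartLattice d c).restrictScalars R).smul_mem _ (single_X_pow_sub_mem i k)

theorem mem_chartLattice_iff (hc : ChartValid d c e) {v : Fin N → PowerSeries R} :
    v ∈ chartLattice d c ↔ chartProj d c e v = 0 := by
  refine ⟨chartProj_eq_zero_of_mem hc, fun h => ?_⟩
  have := sub_monoVec_chartProj_mem hc v
  rwa [h, map_zero, sub_zero] at this

theorem isChart_chartLattice (hc : ChartValid d c e) : IsChart (chartLattice d c) d := fun v => by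
  refine ⟨chartProj d c e v, sub_monoVec_chartProj_mem hc v, fun x hx => ?_⟩
  have := chartProj_eq_zero_of_mem hc hx
  rw [map_sub, chartProj_monoVec hc, sub_eq_zero] at this
  exact this.symm

/-- A lattice in the chart `d` is given by its relations `t^(d i) e_i = c i`. Validity of `c`
holds because the monomials are independent modulo `L` and `t^e` vanishes there. -/
theorem IsChart.exists_eq {L : Submodule (PowerSeries R) (Fin N → PowerSeries R)}
    (hL : IsChart L d) (he : ∀ v, (PowerSeries.X ^ e : PowerSeries R) • v ∈ L)
    (hc : ∀ i, chartVec d c i ∈ L) : ChartValid d c e ∧ chartLattice d c = L := by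
  have h0 : chartLattice d c ≤ L := Submodule.span_le.2 (by rintro _ ⟨i, rfl⟩; exact hc i)
  have h1 {x : MonoIdx d → R} (hx : monoVec d x ∈ L) : x = 0 :=
    (hL 0).unique (by rw [zero_sub]; exact neg_mem hx) (by simp)
  have h2 : ChartValid d c e := fun i => h1 <| by
    have := sub_mem (he (Pi.single i 1)) (h0 (single_X_pow_sub_mem (c := c) i e))
    rwa [← Pi.single_smul, smul_eq_mul, mul_one, sub_sub_cancel] at this
  refine ⟨h2, le_antisymm h0 fun v hv => ?_⟩
  have h3 := sub_monoVec_chartProj_mem h2 v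
  have h4 := h1 (by simpa using sub_mem hv (h0 h3))
  rwa [h4, map_zero, sub_zero] at h3

theorem IsChart.exists_chart {L : Submodule (PowerSeries R) (Fin N → PowerSeries R)}
    (hL : IsChart L d) (he : ∀ v, (PowerSeries.X ^ e : PowerSeries R) • v ∈ L) :
    ∃ c, ChartValid d c e ∧ chartLattice d c = L := by
  choose c hc _ using fun i : Fin N => hL (Pi.single i (PowerSeries.X ^ d i))
  exact ⟨c, hL.exists_eq he hc⟩

theorem chart_unique {c' : Fin N → MonoIdx d → R} (hc : ChartValid d c e)
    (h : chartLattice d c = chartLattice d c') : c = c' := by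
  funext i
  exact (isChart_chartLattice hc _).unique (chartVec_mem (c := c) i)
    (h ▸ chartVec_mem (c := c') i)

/-- The matrix with columns `t^(d i) e_i - c i`. -/
def chartMat (d : Fin N → ℕ) (c : Fin N → MonoIdx d → R) :
    Matrix (Fin N) (Fin N) (PowerSeries R) := Matrix.of fun j i => chartVec d c i j

theorem range_chartMat : LinearMap.range (chartMat d c).mulVecLin = chartLattice d c := by
  rw [Matrix.range_mulVecLin]
  rfl

/-- The columns of `chartMat d c` span a lattice containing `t^(2m) R[[t]]^N`, so the matrix
divides `t^(2m)`. -/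
theorem chartMat_exists_inv {m : ℕ} (hc : ChartValid d c (2 * m)) :
    ∃ B, chartMat d c * B = (PowerSeries.X ^ (2 * m) : PowerSeries R) • 1 ∧
      B * chartMat d c = (PowerSeries.X ^ (2 * m) : PowerSeries R) • 1 := by
  have h1 (i : Fin N) : ∃ w, (chartMat d c).mulVec w =
      (PowerSeries.X ^ (2 * m) : PowerSeries R) • Pi.single i 1 := by
    have := X_pow_smul_mem_chartLattice hc (Pi.single i 1)
    rwa [← range_chartMat] at this
  choose w hw using h1
  have h2 : chartMat d c * (Matrix.of fun i j => w j i) =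
      (PowerSeries.X ^ (2 * m) : PowerSeries R) • 1 := by
    refine Matrix.ext fun i j => (congrFun (hw j) i).trans ?_
    rw [Matrix.smul_apply, Matrix.one_apply, Pi.smul_apply, Pi.single_apply]
  refine ⟨_, h2, ?_⟩
  -- Over `R((t))` the matrix is invertible, and a right inverse is a left inverse.
  apply Matrix.map_injective (HahnSeries.ofPowerSeries_injective (Γ := ℤ) (R := R))
  have h3 := mul_eq_one_comm.1 (BoundedMatrix.shift_mul_shift h2)
  have h4 := congrArg (fun M => HahnSeries.single ((2 * m : ℕ) : ℤ) (1 : R) • M) h3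
  simp only [Matrix.smul_mul, Matrix.mul_smul, smul_smul, HahnSeries.single_mul_single,
    ← Matrix.map_mul] at h4
  have h5 : (((2 * m : ℕ) : ℤ) + (-(m : ℤ) + -(m : ℤ))) = 0 := by push_cast; ring
  have h6 : (HahnSeries.single (0 : ℤ) (1 : R)) = 1 := rfl
  rw [mul_one, mul_one, h5, h6, one_smul] at h4
  refine h4.trans (Matrix.ext fun i j => ?_)
  by_cases hij : i = j
  · subst hij; simp
  · simp [hij]

/-- The lattice of a point of the chart, as a bounded matrix. -/
def chartMatrix {m : ℕ} (hc : ChartValid d c (2 * m)) : BoundedMatrix N m R where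
  mat := chartMat d c
  inv := (chartMat_exists_inv hc).choose
  mul_inv := (chartMat_exists_inv hc).choose_spec.1
  inv_mul := (chartMat_exists_inv hc).choose_spec.2

theorem lattice_chartMatrix {m : ℕ} (hc : ChartValid d c (2 * m)) :
    (chartMatrix hc).lattice = chartLattice d c := range_chartMat

theorem chartBasis_map (f : R →+* R') (i : Fin N) (k : ℕ) :
    chartBasis d (fun i j => f (c i j)) i k = fun j => f (chartBasis d c i k j) := by
  funext j
  rw [chartBasis, chartBasis]
  split_ifs with h
  · rw [Pi.single_apply, Pi.single_apply]
    split_ifs <;> simp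
  · rfl

theorem chartShift_map (f : R →+* R') (x : MonoIdx d → R) :
    chartShift d (fun i j => f (c i j)) (fun j => f (x j)) =
      fun j => f (chartShift d c x j) := by
  conv_rhs => rw [pi_eq_sum_univ' x]
  conv_lhs => rw [pi_eq_sum_univ' (fun j => f (x j))]
  rw [map_sum, map_sum]
  funext j
  rw [Finset.sum_apply, Finset.sum_apply, map_sum]
  refine Finset.sum_congr rfl fun l _ => ?_
  rw [map_smul, map_smul, chartShift_single, chartShift_single, chartBasis_map,
    Pi.smul_apply, Pi.smul_apply, smul_eq_mul, smul_eq_mul, map_mul]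

theorem chartShift_pow_map (f : R →+* R') (k : ℕ) (x : MonoIdx d → R) :
    (chartShift d (fun i j => f (c i j)) ^ k) (fun j => f (x j)) =
      fun j => f ((chartShift d c ^ k) x j) := by
  induction k with
  | zero => rfl
  | succ k ih => rw [pow_succ', Module.End.mul_apply, ih, chartShift_map, pow_succ']; rfl

/-- Validity is given by polynomial equations in `c`. -/
theorem chartValid_iff_map (f : R →+* R') : ChartValid d (fun i j => f (c i j)) e ↔
    ∀ i j, f ((chartShift d c ^ e) (chartBasis d c i 0) j) = 0 := by
  simp only [ChartValid, chartBasis_map, chartShift_pow_map, funext_iff, Pi.zero_apply]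

theorem ChartValid.map (f : R →+* R') (hc : ChartValid d c e) :
    ChartValid d (fun i j => f (c i j)) e :=
  (chartValid_iff_map f).2 fun i j => by rw [hc i, Pi.zero_apply, map_zero]

theorem chartMat_map (f : R →+* R') :
    chartMat d (fun i j => f (c i j)) = (chartMat d c).map (PowerSeries.map f) := by
  refine Matrix.ext fun j i => PowerSeries.ext fun k => ?_
  change PowerSeries.coeff k ((Pi.single i (PowerSeries.X ^ d i) :
    Fin N → PowerSeries R') j - monoVec d _ j) = PowerSeries.coeff k (PowerSeries.map f
      ((Pi.single i (PowerSeries.X ^ d i) : Fin N → PowerSeries R) j - monoVec d _ j))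
  rw [map_sub, map_sub, map_sub, coeff_monoVec, PowerSeries.coeff_map, PowerSeries.coeff_map,
    coeff_monoVec]
  congr 1
  · by_cases hij : j = i
    · subst hij
      rw [Pi.single_eq_same, Pi.single_eq_same, PowerSeries.coeff_X_pow, PowerSeries.coeff_X_pow]
      split_ifs <;> simp
    · simp [Pi.single_eq_of_ne hij]
  · split_ifs <;> simp

theorem toGL_chartMatrix_map {m : ℕ} (f : R →+* R') (hc : ChartValid d c (2 * m)) :
    glMap f (chartMatrix hc).toGL = (chartMatrix (hc.map f)).toGL := by
  rw [← BoundedMatrix.toGL_map]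
  refine Units.ext ?_
  change _ • Matrix.map ((chartMat d c).map (PowerSeries.map f)) _ = _ • Matrix.map (chartMat d _) _
  rw [chartMat_map]

theorem chart_toGL_injective {m : ℕ} {c' : Fin N → MonoIdx d → R} (hc : ChartValid d c (2 * m))
    (hc' : ChartValid d c' (2 * m))
    (h : Gr.mk (chartMatrix hc).toGL = Gr.mk (chartMatrix hc').toGL) : c = c' := by
  have := BoundedMatrix.lattice_eq_of_mk_toGL_eq h
  rw [lattice_chartMatrix, lattice_chartMatrix] at this
  exact chart_unique hc this

end Charts

/-! ### Bounded lattices over local rings and valuation rings -/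

section Local

variable {N : ℕ}

/-- If the vectors `τ^k v_i` span `V` and `τ^e v_i = 0`, then a suitable part
`{τ^k v_i | k < d i}` of them is a basis. One takes a spanning family with `∑ d i` minimal; a
relation would allow one to lower one of the `d i`. -/
theorem exists_basis_of_field {K V : Type*} [Field K] [AddCommGroup V] [Module K V]
    (τ : Module.End K V) (v : Fin N → V) {e : ℕ} (he : ∀ i, (τ ^ e) (v i) = 0)
    (hs : Submodule.span K (Set.range fun p : Fin N × ℕ => (τ ^ p.2) (v p.1)) = ⊤) :
    ∃ d : Fin N → ℕ, (∀ i, d i ≤ e) ∧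
      LinearIndependent K (fun j : MonoIdx d => (τ ^ (j.2 : ℕ)) (v j.1)) ∧
      Submodule.span K (Set.range fun j : MonoIdx d => (τ ^ (j.2 : ℕ)) (v j.1)) = ⊤ := by
  classical
  let F (d : Fin N → ℕ) (j : MonoIdx d) : V := (τ ^ (j.2 : ℕ)) (v j.1)
  have hex : ∃ n, ∃ d : Fin N → ℕ, ((∀ i, d i ≤ e) ∧
      Submodule.span K (Set.range (F d)) = ⊤) ∧ ∑ i, d i = n := by
    refine ⟨_, fun _ => e, ⟨fun _ => le_rfl, ?_⟩, rfl⟩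
    rw [eq_top_iff, ← hs, Submodule.span_le]
    rintro _ ⟨⟨i, k⟩, rfl⟩
    by_cases hk : k < e
    · exact Submodule.subset_span ⟨⟨i, k, hk⟩, rfl⟩
    · obtain ⟨l, rfl⟩ := Nat.exists_eq_add_of_le' (not_lt.1 hk)
      change (τ ^ (l + e)) (v i) ∈ _
      rw [pow_add, Module.End.mul_apply, he, map_zero]
      exact zero_mem _
  obtain ⟨d, ⟨hd, hspan⟩, hn⟩ := Nat.find_spec hex
  refine ⟨d, hd, ?_, hspan⟩
  rw [Fintype.linearIndependent_iff]
  intro g hg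
  by_contra! hne
  obtain ⟨j0, hj0⟩ := hne
  -- Among the vectors `τ^k v_i` occurring in the relation, choose one with `d i - 1 - k` minimal.
  obtain ⟨j1, hj1, hmin⟩ := Finset.exists_min_image
    (Finset.univ.filter fun j : MonoIdx d => g j ≠ 0) (fun j => d j.1 - 1 - j.2)
    ⟨j0, by simpa using hj0⟩
  have hg1 : g j1 ≠ 0 := by simpa using hj1
  set l := d j1.1 - 1 - j1.2 with hl
  have hj1l : (j1.2 : ℕ) + l + 1 = d j1.1 := by have := j1.2.2; omega
  -- After multiplication by `τ^l` the relation involves a vector `τ^(d i - 1) v_i`.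
  let d' : Fin N → ℕ := Function.update d j1.1 (d j1.1 - 1)
  have hlt : ∑ i, d' i < ∑ i, d i := by
    refine Finset.sum_lt_sum (fun i _ => ?_) ⟨j1.1, Finset.mem_univ _, ?_⟩
    · simp only [d', Function.update_apply]
      split_ifs with h
      · subst h; omega
      · exact le_rfl
    · simp only [d', Function.update_self]; omega
  refine Nat.find_min hex (hn ▸ hlt) ⟨d', ⟨fun i => ?_, ?_⟩, rfl⟩
  · refine le_trans ?_ (hd i)
    simp only [d', Function.update_apply]
    split_ifs with h
    · subst h; omega
    · exact le_rfl
  have hmem (i : Fin N) (k : ℕ) (hk : k < d i) (hne : ¬ (i = j1.1 ∧ k = d j1.1 - 1)) :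
      (τ ^ k) (v i) ∈ Submodule.span K (Set.range (F d')) := by
    have hk' : k < d' i := by
      simp only [d', Function.update_apply]
      split_ifs with h
      · subst h; have := fun h => hne ⟨rfl, h⟩; omega
      · exact hk
    exact Submodule.subset_span ⟨⟨i, k, hk'⟩, rfl⟩
  -- The remaining terms of this multiple of the relation are in the span of the family `d'`, in
  -- which `τ^(d i - 1) v_i` is left out for the chosen `i`.
  have hrel : ∑ j, g j • (τ ^ ((j.2 : ℕ) + l)) (v j.1) = 0 := by
    have := congrArg (τ ^ l) hg
    rw [map_sum, map_zero] at this
    rw [← this]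
    refine Finset.sum_congr rfl fun j _ => ?_
    rw [map_smul, add_comm, pow_add, Module.End.mul_apply]
  rw [Fintype.sum_eq_add_sum_compl j1, add_eq_zero_iff_eq_neg] at hrel
  have htop : (τ ^ ((j1.2 : ℕ) + l)) (v j1.1) ∈ Submodule.span K (Set.range (F d')) := by
    rw [← Submodule.smul_mem_iff _ hg1, hrel]
    refine neg_mem (sum_mem fun j hj => ?_)
    by_cases hgj : g j = 0
    · rw [hgj, zero_smul]; exact zero_mem _
    refine Submodule.smul_mem _ _ (hmem _ _ ?_ ?_)
    · have h1 := hmin j (by simpa using hgj)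
      have h2 := j.2.2
      omega
    · rintro ⟨h1, h2⟩
      refine (Finset.mem_compl.1 hj) (Finset.mem_singleton.2 ?_)
      obtain ⟨i, k, hk⟩ := j
      obtain ⟨i1, k1, hk1⟩ := j1
      dsimp only at *
      subst h1
      have : k = k1 := by omega
      subst this
      rfl
  rw [eq_top_iff, ← hspan, Submodule.span_le]
  rintro _ ⟨j, rfl⟩
  by_cases h : j.1 = j1.1 ∧ (j.2 : ℕ) = d j1.1 - 1
  · have h2 : (j.2 : ℕ) = (j1.2 : ℕ) + l := by omega
    change (τ ^ (j.2 : ℕ)) (v j.1) ∈ _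
    rw [h2, h.1]
    exact htop
  · exact hmem _ _ j.2.2 h

/-- The version of `exists_basis_of_field` over a local ring, by reduction to the residue field
and Nakayama's lemma. -/
theorem exists_basis_of_isLocalRing {R Q : Type*} [CommRing R] [IsLocalRing R] [AddCommGroup Q]
    [Module R Q] [Module.Finite R Q] [Module.Flat R Q]
    (τ : Module.End R Q) (v : Fin N → Q) {e : ℕ} (he : ∀ i, (τ ^ e) (v i) = 0)
    (hs : Submodule.span R (Set.range fun p : Fin N × ℕ => (τ ^ p.2) (v p.1)) = ⊤) :
    ∃ d : Fin N → ℕ, (∀ i, d i ≤ e) ∧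
      ∃ b : Module.Basis (MonoIdx d) R Q, ∀ j, b j = (τ ^ (j.2 : ℕ)) (v j.1) := by
  let k := IsLocalRing.ResidueField R
  let τ' : Module.End k (TensorProduct R k Q) := τ.baseChange k
  have hpow (n : ℕ) (x : Q) : (τ' ^ n) (TensorProduct.mk R k Q 1 x) =
      TensorProduct.mk R k Q 1 ((τ ^ n) x) := by
    induction n with
    | zero => rfl
    | succ n ih =>
      rw [pow_succ', Module.End.mul_apply, ih, pow_succ', Module.End.mul_apply]
      exact LinearMap.baseChange_tmul _ _ _
  have hspan := (IsLocalRing.map_tensorProduct_mk_eq_top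
    (N := Submodule.span R (Set.range fun p : Fin N × ℕ => (τ ^ p.2) (v p.1)))).2 hs
  obtain ⟨d, hd, hli, hsp⟩ := exists_basis_of_field (e := e) τ'
    (fun i => TensorProduct.mk R k Q 1 (v i))
    (fun i => by rw [hpow, he, map_zero]) (by
      simp only [hpow]
      rw [← Submodule.span_image, ← Set.range_comp, eq_top_iff, ← SetLike.coe_subset_coe,
        Submodule.top_coe] at hspan
      rw [eq_top_iff]
      exact hspan.trans (Submodule.span_subset_span _ _ _))
  simp only [hpow] at hli hsp
  -- As `Q` is free, a lift of a basis of the fibre is a basis.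
  have : Module.Free R Q := Module.free_of_flat_of_isLocalRing
  have : Module.FinitePresentation R Q := Module.finitePresentation_of_projective R Q
  obtain ⟨b, hb⟩ := Module.exists_basis_of_basis_baseChange
    (fun j : MonoIdx d => (τ ^ (j.2 : ℕ)) (v j.1)) hli hsp
    (Module.Flat.rTensor_preserves_injective_linearMap _ Subtype.val_injective)
  exact ⟨d, hd, b, hb⟩

section Lattice

variable {R R' : Type*} [CommRing R] [CommRing R'] {m : ℕ}

/-- Dropping the first `e` coefficients. -/
def dropCoeff (N e : ℕ) (R : Type*) [CommRing R] :
    (Fin N → PowerSeries R) →ₗ[R] (Fin N → PowerSeries R) where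
  toFun v i := PowerSeries.mk fun k => PowerSeries.coeff (k + e) (v i)
  map_add' v w := by ext; simp
  map_smul' r v := by ext; simp

/-- The first `e` coefficients. -/
def firstCoeff (N e : ℕ) (R : Type*) [CommRing R] :
    (Fin N → PowerSeries R) →ₗ[R] (MonoIdx (fun _ : Fin N => e) → R) where
  toFun v j := PowerSeries.coeff j.2 (v j.1)
  map_add' v w := by ext; simp
  map_smul' r v := by ext; simp

theorem coeff_dropCoeff (e : ℕ) (v : Fin N → PowerSeries R) (i : Fin N) (k : ℕ) :
    PowerSeries.coeff k (dropCoeff N e R v i) = PowerSeries.coeff (k + e) (v i) :=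
  PowerSeries.coeff_mk k fun k => PowerSeries.coeff (k + e) (v i)

theorem monoVec_firstCoeff_add (e : ℕ) (v : Fin N → PowerSeries R) :
    monoVec _ (firstCoeff N e R v) + (PowerSeries.X ^ e : PowerSeries R) • dropCoeff N e R v =
      v := by
  ext i k
  rw [Pi.add_apply, map_add, coeff_monoVec, Pi.smul_apply, smul_eq_mul,
    PowerSeries.coeff_X_pow_mul']
  by_cases h : k < e
  · rw [dif_pos h, if_neg (not_le.2 h), add_zero]
    rfl
  · rw [dif_neg h, if_pos (not_lt.1 h), zero_add, coeff_dropCoeff,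
      Nat.sub_add_cancel (not_lt.1 h)]

theorem dropCoeff_X_pow_smul (e : ℕ) (v : Fin N → PowerSeries R) :
    dropCoeff N e R ((PowerSeries.X ^ e : PowerSeries R) • v) = v := by
  ext i k
  rw [coeff_dropCoeff, Pi.smul_apply, smul_eq_mul, PowerSeries.coeff_X_pow_mul]

theorem firstCoeff_X_pow_smul (e : ℕ) (v : Fin N → PowerSeries R) :
    firstCoeff N e R ((PowerSeries.X ^ e : PowerSeries R) • v) = 0 := by
  ext j
  change PowerSeries.coeff j.2 (((PowerSeries.X ^ e : PowerSeries R) • v) j.1) = 0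
  rw [Pi.smul_apply, smul_eq_mul, PowerSeries.coeff_X_pow_mul', if_neg (not_le.2 j.2.2)]

/-- The quotient of `R[[t]]^N` by the lattice, as an `R`-module. -/
abbrev BoundedMatrix.Quot (B : BoundedMatrix N m R) : Type _ :=
  (Fin N → PowerSeries R) ⧸ B.lattice.restrictScalars R

namespace BoundedMatrix

variable (B : BoundedMatrix N m R)

/-- The map from the quotient to `R[t]/t^(2m)` given by the inverse matrix. -/
def quotTo : B.Quot →ₗ[R] (MonoIdx (fun _ : Fin N => 2 * m) → R) :=
  Submodule.liftQ _ (firstCoeff N (2 * m) R ∘ₗ B.inv.mulVecLin.restrictScalars R) (by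
    rintro _ ⟨w, rfl⟩
    change firstCoeff N (2 * m) R (B.inv.mulVec (B.mat.mulVec w)) = 0
    rw [Matrix.mulVec_mulVec, B.inv_mul, Matrix.smul_mulVec, Matrix.one_mulVec,
      firstCoeff_X_pow_smul])

/-- A left inverse of `quotTo`, so that the quotient is a direct summand of a finite free module.
-/
def toQuot : (MonoIdx (fun _ : Fin N => 2 * m) → R) →ₗ[R] B.Quot :=
  Submodule.mkQ _ ∘ₗ dropCoeff N (2 * m) R ∘ₗ B.mat.mulVecLin.restrictScalars R ∘ₗ monoVec _

theorem toQuot_comp_quotTo : B.toQuot ∘ₗ B.quotTo = LinearMap.id := by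
  refine Submodule.linearMap_qext _ (LinearMap.ext fun v => ?_)
  change (Submodule.Quotient.mk (dropCoeff N (2 * m) R (B.mat.mulVec (monoVec _
    (firstCoeff N (2 * m) R (B.inv.mulVec v))))) : B.Quot) = Submodule.Quotient.mk v
  have h1 := congrArg (fun w => B.mat.mulVec w) (monoVec_firstCoeff_add (2 * m) (B.inv.mulVec v))
  simp only [Matrix.mulVec_mulVec, B.mul_inv, Matrix.smul_mulVec, Matrix.one_mulVec,
    Matrix.mulVec_add, Matrix.mulVec_smul] at h1
  rw [eq_sub_of_add_eq h1, ← smul_sub, dropCoeff_X_pow_smul, Submodule.Quotient.eq,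
    sub_sub_cancel_left]
  exact neg_mem ⟨_, rfl⟩

instance : Module.Projective R B.Quot :=
  Module.Projective.of_split B.quotTo B.toQuot B.toQuot_comp_quotTo

instance : Module.Finite R B.Quot :=
  Module.Finite.of_surjective B.toQuot fun q =>
    ⟨B.quotTo q, congrArg (fun f => f q) B.toQuot_comp_quotTo⟩

/-- Multiplication by `t` on the quotient. -/
def shift : Module.End R B.Quot :=
  Submodule.mapQ _ _ ((LinearMap.lsmul (PowerSeries R) (Fin N → PowerSeries R)
    PowerSeries.X).restrictScalars R) fun _ hv => B.lattice.smul_mem _ hv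

theorem shift_pow_mk (k : ℕ) (v : Fin N → PowerSeries R) :
    (B.shift ^ k) (Submodule.Quotient.mk v : B.Quot) =
      Submodule.Quotient.mk ((PowerSeries.X ^ k : PowerSeries R) • v) := by
  induction k with
  | zero => simp
  | succ k ih =>
    rw [pow_succ', Module.End.mul_apply, ih, pow_succ', mul_smul]
    rfl

theorem span_shift : Submodule.span R (Set.range fun p : Fin N × ℕ => (B.shift ^ p.2)
    (Submodule.Quotient.mk (Pi.single p.1 1) : B.Quot)) = ⊤ := by
  rw [eq_top_iff]
  rintro q -
  obtain ⟨v, rfl⟩ := Submodule.Quotient.mk_surjective _ q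
  have h1 : (Submodule.Quotient.mk v : B.Quot) = Submodule.mkQ _
      (monoVec (fun _ : Fin N => 2 * m) (firstCoeff N (2 * m) R v)) := by
    rw [Submodule.mkQ_apply, Submodule.Quotient.eq, sub_eq_of_eq_add'
      (monoVec_firstCoeff_add (2 * m) v).symm]
    exact B.X_pow_smul_mem _
  rw [h1, pi_eq_sum_univ' (firstCoeff N (2 * m) R v), map_sum, map_sum]
  refine sum_mem fun j _ => ?_
  rw [map_smul, map_smul, monoVec_single]
  refine Submodule.smul_mem _ _ (Submodule.subset_span ⟨(j.1, j.2), ?_⟩)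
  refine (B.shift_pow_mk _ _).trans ?_
  rw [← Pi.single_smul, smul_eq_mul, mul_one]
  rfl

theorem shift_pow_eq_zero (i : Fin N) :
    (B.shift ^ (2 * m)) (Submodule.Quotient.mk (Pi.single i 1) : B.Quot) = 0 := by
  rw [shift_pow_mk, Submodule.Quotient.mk_eq_zero]
  exact B.X_pow_smul_mem _

theorem mk_monoVec (d : Fin N → ℕ) (x : MonoIdx d → R) :
    (Submodule.Quotient.mk (monoVec d x) : B.Quot) =
      ∑ j, x j • (B.shift ^ (j.2 : ℕ)) (Submodule.Quotient.mk (Pi.single j.1 1)) := by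
  change Submodule.mkQ _ (monoVec d x) = _
  conv_lhs => rw [pi_eq_sum_univ' x]
  rw [map_sum, map_sum]
  refine Finset.sum_congr rfl fun j _ => ?_
  rw [map_smul, map_smul, monoVec_single, shift_pow_mk, ← Pi.single_smul, smul_eq_mul, mul_one]
  rfl

theorem isChart_of_basis {d : Fin N → ℕ} (b : Module.Basis (MonoIdx d) R B.Quot)
    (hb : ∀ j, b j = (B.shift ^ (j.2 : ℕ)) (Submodule.Quotient.mk (Pi.single j.1 1))) :
    IsChart B.lattice d := fun v => by
  have h (x : MonoIdx d → R) : v - monoVec d x ∈ B.lattice ↔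
      b.equivFun.symm x = Submodule.Quotient.mk v := by
    rw [Module.Basis.equivFun_symm_apply]
    simp only [hb]
    rw [← mk_monoVec, eq_comm, Submodule.Quotient.eq]
    rfl
  simp only [h]
  exact b.equivFun.symm.bijective.existsUnique _

/-- Over a local ring every bounded lattice lies in one of the charts. -/
theorem exists_isChart [IsLocalRing R] : ∃ d : Fin N → ℕ, (∀ i, d i ≤ 2 * m) ∧
    IsChart B.lattice d := by
  obtain ⟨d, hd, b, hb⟩ := exists_basis_of_isLocalRing B.shift
    (fun i => Submodule.Quotient.mk (Pi.single i 1)) B.shift_pow_eq_zero B.span_shift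
  exact ⟨d, hd, B.isChart_of_basis b hb⟩

/-- A bounded lattice over the field of fractions of a valuation ring extends to a point of one of
the charts over the valuation ring: the extension is its intersection with `A[[t]]^N`, and the
quotient by it is the `A`-span of the monomials in the quotient over `K`. -/
theorem exists_chart_of_valuationRing {A K : Type*} [CommRing A] [IsDomain A] [ValuationRing A]
    [Field K] [Algebra A K] [IsFractionRing A K] (B : BoundedMatrix N m K) :
    ∃ d : Fin N → ℕ, (∀ i, d i ≤ 2 * m) ∧ ∃ c : Fin N → MonoIdx d → A, ChartValid d c (2 * m) ∧
      chartLattice d (fun i j => algebraMap A K (c i j)) = B.lattice := by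
  let w (p : Fin N × ℕ) : B.Quot := (B.shift ^ p.2) (Submodule.Quotient.mk (Pi.single p.1 1))
  have hw (p : Fin N × ℕ) (hp : 2 * m ≤ p.2) : w p = 0 := by
    obtain ⟨l, hl⟩ := Nat.exists_eq_add_of_le' hp
    simp only [w]
    rw [hl, pow_add, Module.End.mul_apply, B.shift_pow_eq_zero, map_zero]
  -- The `A`-module spanned by the classes of the `t^k e_i`.
  let Q : Submodule A B.Quot := Submodule.span A (Set.range w)
  let τ : Module.End A B.Quot := B.shift.restrictScalars A
  have hτ (n : ℕ) (x : B.Quot) : (τ ^ n) x = (B.shift ^ n) x := by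
    induction n with
    | zero => rfl
    | succ n ih => rw [pow_succ', Module.End.mul_apply, ih, pow_succ']; rfl
  have hQ : ∀ x ∈ Q, τ x ∈ Q := fun x hx => by
    induction hx using Submodule.span_induction with
    | mem x hx =>
      obtain ⟨p, rfl⟩ := hx
      refine Submodule.subset_span ⟨(p.1, p.2 + 1), ?_⟩
      simp only [w, pow_succ', Module.End.mul_apply]
      rfl
    | zero => rw [map_zero]; exact zero_mem _
    | add x y _ _ hx hy => rw [map_add]; exact add_mem hx hy
    | smul a x _ hx => rw [map_smul]; exact Submodule.smul_mem _ _ hx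
  have hfg : Q.FG := by
    have h1 : Q = Submodule.span A (Set.range fun p : Fin N × Fin (2 * m) => w (p.1, p.2)) := by
      refine le_antisymm (Submodule.span_le.2 ?_) (Submodule.span_mono ?_)
      · rintro _ ⟨p, rfl⟩
        by_cases hp : p.2 < 2 * m
        · exact Submodule.subset_span ⟨(p.1, ⟨p.2, hp⟩), rfl⟩
        · rw [hw p (not_lt.1 hp)]
          exact zero_mem _
      · rintro _ ⟨p, rfl⟩
        exact ⟨(p.1, p.2), rfl⟩
    rw [h1]
    exact Submodule.fg_span (Set.finite_range _)
  have : Module.Finite A Q := Module.Finite.iff_fg.2 hfg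
  -- Torsion-free modules over a valuation ring are flat.
  have : Module.IsTorsionFree A K := inferInstance
  have : Module.IsTorsionFree A B.Quot := Module.IsTorsionFree.trans_faithfulSMul A K B.Quot
  have : Module.Flat A Q := by
    rw [Module.Flat.flat_iff_torsion_eq_bot_of_isBezout,
      ← Submodule.isTorsionFree_iff_torsion_eq_bot]
    infer_instance
  let τQ : Module.End A Q := τ.restrict hQ
  let vQ (i : Fin N) : Q := ⟨w (i, 0), Submodule.subset_span ⟨_, rfl⟩⟩
  have hτQ (n : ℕ) (i : Fin N) : ((τQ ^ n) (vQ i)).1 = w (i, n) := by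
    induction n with
    | zero => rfl
    | succ n ih =>
      rw [pow_succ', Module.End.mul_apply]
      change τ ((τQ ^ n) (vQ i)).1 = _
      rw [ih]
      simp only [w, pow_succ', Module.End.mul_apply]
      rfl
  obtain ⟨d, hd, b, hb⟩ := exists_basis_of_isLocalRing (e := 2 * m) τQ vQ
    (fun i => Subtype.ext ((hτQ _ i).trans (hw _ le_rfl))) (by
      rw [eq_top_iff]
      rintro ⟨x, hx⟩ -
      have h1 : Q.subtype ∘ (fun p : Fin N × ℕ => (τQ ^ p.2) (vQ p.1)) = w :=
        funext fun p => hτQ p.2 p.1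
      have h2 : x ∈ (Submodule.span A (Set.range fun p : Fin N × ℕ =>
          (τQ ^ p.2) (vQ p.1))).map Q.subtype := by
        rw [Submodule.map_span, ← Set.range_comp, h1]
        exact hx
      obtain ⟨y, hy, hyx⟩ := h2
      rwa [← show y = ⟨x, hx⟩ from Subtype.ext hyx])
  have hbw (j : MonoIdx d) : (b j).1 = w (j.1, j.2) := by rw [hb, hτQ]
  have hli : LinearIndependent K fun j : MonoIdx d => w (j.1, j.2) := by
    rw [← LinearIndependent.iff_fractionRing A K]
    have := b.linearIndependent.map' Q.subtype (Submodule.ker_subtype _)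
    rwa [show Q.subtype ∘ b = fun j : MonoIdx d => w (j.1, j.2) from funext hbw] at this
  have hsp : ⊤ ≤ Submodule.span K (Set.range fun j : MonoIdx d => w (j.1, j.2)) := by
    rw [← B.span_shift, Submodule.span_le]
    rintro _ ⟨p, rfl⟩
    have h1 : w p ∈ Q := Submodule.subset_span ⟨p, rfl⟩
    have h2 := congrArg Subtype.val (b.sum_repr ⟨w p, h1⟩)
    change w p ∈ _
    rw [← show _ = w p from h2, AddSubmonoidClass.coe_finsetSum]
    refine sum_mem fun j _ => ?_
    rw [SetLike.val_smul, ← algebraMap_smul K, hbw]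
    exact Submodule.smul_mem _ _ (Submodule.subset_span ⟨j, rfl⟩)
  -- A monomial `A`-basis of `Q` is a `K`-basis of the quotient over `K`.
  let bK := Module.Basis.mk hli hsp
  have hchart : IsChart B.lattice d := B.isChart_of_basis bK fun j => by
    rw [Module.Basis.mk_apply]
  -- The vectors `t^(d i) e_i` have coordinates in `A`, as they lie in `Q`.
  let c (i : Fin N) (j : MonoIdx d) : A := b.repr ⟨w (i, d i), Submodule.subset_span ⟨_, rfl⟩⟩ j
  have hc (i : Fin N) : chartVec d (fun i j => algebraMap A K (c i j)) i ∈ B.lattice := by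
    change _ ∈ B.lattice.restrictScalars K
    rw [chartVec, ← Submodule.Quotient.eq, mk_monoVec]
    have h1 : (Submodule.Quotient.mk (Pi.single i (PowerSeries.X ^ d i)) : B.Quot) =
        w (i, d i) := by
      simp only [w]
      rw [shift_pow_mk, ← Pi.single_smul, smul_eq_mul, mul_one]
    have h2 := congrArg Subtype.val (b.sum_repr
      (⟨w (i, d i), Submodule.subset_span ⟨_, rfl⟩⟩ : Q))
    rw [h1, ← show _ = w (i, d i) from h2, AddSubmonoidClass.coe_finsetSum]
    refine Finset.sum_congr rfl fun j _ => ?_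
    rw [SetLike.val_smul, ← algebraMap_smul K, hbw]
  obtain ⟨h1, h2⟩ := hchart.exists_eq B.X_pow_smul_mem hc
  -- Validity of `c` over `K` implies validity over `A`.
  refine ⟨d, hd, c, fun i => ?_, h2⟩
  funext j
  exact IsFractionRing.injective A K (((chartValid_iff_map _).1 h1 i j).trans (map_zero _).symm)

end BoundedMatrix

theorem monoVec_map (f : R →+* R') (d : Fin N → ℕ) (x : MonoIdx d → R) (i : Fin N) :
    monoVec d (fun j => f (x j)) i = PowerSeries.map f (monoVec d x i) := by
  ext k
  rw [PowerSeries.coeff_map, coeff_monoVec, coeff_monoVec]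
  split_ifs <;> simp

theorem chartProj_map (f : R →+* R') (d : Fin N → ℕ) (c : Fin N → MonoIdx d → R) (e : ℕ)
    (v : Fin N → PowerSeries R) :
    chartProj d (fun i j => f (c i j)) e (fun i => PowerSeries.map f (v i)) =
      fun j => f (chartProj d c e v j) := by
  rw [chartProj_apply, chartProj_apply]
  funext j
  simp only [Finset.sum_apply, map_sum, Pi.smul_apply, smul_eq_mul, map_mul,
    PowerSeries.coeff_map, chartBasis_map, chartShift_pow_map]

/-- A lattice given in the chart `d₀` belongs to the chart `d` if and only if the matrix of change
of monomial bases is invertible. -/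
theorem isChart_chartLattice_iff {d₀ d : Fin N → ℕ} {c : Fin N → MonoIdx d₀ → R} {e : ℕ}
    (hc : ChartValid d₀ c e) : IsChart (chartLattice d₀ c) d ↔
      Function.Bijective (chartProj d₀ c e ∘ₗ monoVec d) := by
  have h (v : Fin N → PowerSeries R) (x : MonoIdx d → R) :
      v - monoVec d x ∈ chartLattice d₀ c ↔
        (chartProj d₀ c e ∘ₗ monoVec d) x = chartProj d₀ c e v := by
    rw [mem_chartLattice_iff hc, map_sub, sub_eq_zero, eq_comm]
    rfl
  simp only [IsChart, h, Function.bijective_iff_existsUnique]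
  refine ⟨fun H y => ?_, fun H v => H _⟩
  have := H (monoVec d₀ y)
  rwa [chartProj_monoVec hc] at this

theorem lattice_map_eq {d : Fin N → ℕ} {c : Fin N → MonoIdx d → R} (hc : ChartValid d c (2 * m))
    {B : BoundedMatrix N m R} (h : chartLattice d c = B.lattice) (f : R →+* R') :
    chartLattice d (fun i j => f (c i j)) = (B.map f).lattice := by
  rw [← lattice_chartMatrix (hc.map f)]
  apply BoundedMatrix.lattice_eq_of_mk_toGL_eq
  rw [← toGL_chartMatrix_map, BoundedMatrix.toGL_map, ← Gr.map_mk, ← Gr.map_mk,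
    BoundedMatrix.mk_toGL_eq (A := chartMatrix hc) ((lattice_chartMatrix hc).trans h)]
  exact hc

theorem bijective_iff_isUnit_det {S ι κ : Type*} [CommRing S] [Fintype ι] [DecidableEq ι]
    [Fintype κ] (ε : ι ≃ κ) (g : (ι → S) →ₗ[S] (κ → S)) :
    Function.Bijective g ↔ IsUnit ((LinearMap.toMatrix' g).submatrix ε id).det := by
  have h1 : (Matrix.toLinAlgEquiv' ((LinearMap.toMatrix' g).submatrix ε id) :
      (ι → S) → (ι → S)) = (ε.arrowCongr (Equiv.refl S)).symm ∘ g := by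
    funext x i
    exact congrFun (LinearMap.toMatrix'_mulVec g x) (ε i)
  rw [← Matrix.isUnit_iff_isUnit_det, ← isUnit_map_iff (Matrix.toLinAlgEquiv' (R := S)),
    Module.End.isUnit_iff, h1]
  exact (Equiv.comp_bijective g (ε.arrowCongr (Equiv.refl S)).symm).symm

/-- Whether a lattice over a local ring lies in a chart can be checked after a local
homomorphism: the change of chart is a matrix whose determinant has to be invertible. -/
theorem isChart_of_isChart_map [IsLocalRing R] [IsLocalRing R'] (f : R →+* R') [IsLocalHom f]
    (B : BoundedMatrix N m R) {d : Fin N → ℕ} (h : IsChart (B.map f).lattice d) :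
    IsChart B.lattice d := by
  obtain ⟨d₀, -, h₀⟩ := B.exists_isChart
  obtain ⟨c, hc, hL⟩ := h₀.exists_chart B.X_pow_smul_mem
  rw [← hL, isChart_chartLattice_iff hc]
  rw [← lattice_map_eq hc hL f, isChart_chartLattice_iff (hc.map f)] at h
  -- The two monomial bases have the same number of elements, so that the change of bases is a
  -- square matrix.
  have hcard : Fintype.card (MonoIdx d) = Fintype.card (MonoIdx d₀) := by
    have h1 := LinearEquiv.finrank_eq (LinearEquiv.ofBijective _ h)
    rwa [Module.finrank_fintype_fun_eq_card, Module.finrank_fintype_fun_eq_card] at h1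
  let ε := Fintype.equivOfCardEq hcard
  let D : Matrix (MonoIdx d) (MonoIdx d) R :=
    (LinearMap.toMatrix' (chartProj d₀ c (2 * m) ∘ₗ monoVec d)).submatrix ε id
  rw [bijective_iff_isUnit_det ε] at h ⊢
  have h2 : (LinearMap.toMatrix' (chartProj d₀ (fun i j => f (c i j)) (2 * m) ∘ₗ
      monoVec d)).submatrix ε id = f.mapMatrix D := by
    refine Matrix.ext fun i j => ?_
    change (chartProj d₀ (fun i j => f (c i j)) (2 * m)) (monoVec d (Pi.single j 1)) (ε i) =
      f (chartProj d₀ c (2 * m) (monoVec d (Pi.single j 1)) (ε i))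
    have h3 := congrFun (chartProj_map f d₀ c (2 * m) (monoVec d (Pi.single j 1))) (ε i)
    rw [← h3]
    have h4 : (fun k => f ((Pi.single j 1 : MonoIdx d → R) k)) = Pi.single j 1 := by
      funext k
      rw [Pi.single_apply, Pi.single_apply]
      split_ifs <;> simp
    have h5 : (fun i => PowerSeries.map f (monoVec d (Pi.single j 1) i)) =
        monoVec d (Pi.single j 1) := by
      funext l
      rw [← monoVec_map, h4]
    rw [h5]
  rw [h2, ← RingHom.map_det] at h
  exact IsLocalHom.map_nonunit _ h

end Lattice

end Local

/-! ### Families of lattices in a free module -/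

section Families

variable {S T T' T'' : Scheme.{u}} {N : ℕ}

/-- A free lattice in `𝒪_{T,x}((t))^N` for every point `x` of `T`. -/
abbrev FiberLattice (N : ℕ) (T : Scheme.{u}) : Type u := ∀ x : T, Gr N (T.presheaf.stalk x)

/-- A family of stalkwise lattices is a family of lattices on `T` if it is locally given by an
invertible matrix of Laurent series. -/
def FiberLattice.IsLocal (ξ : FiberLattice N T) : Prop :=
  ∀ x : T, ∃ (V : T.Opens) (_ : x ∈ V) (g : GL (Fin N) (LaurentSeries Γ(T, V))),
    ∀ (y : T) (hy : y ∈ V), ξ y = Gr.mk (glMap (T.presheaf.germ V y hy).hom g)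

/-- Pullback of families of lattices. -/
def FiberLattice.pull (f : T' ⟶ T) (ξ : FiberLattice N T) : FiberLattice N T' :=
  fun y => Gr.map (f.stalkMap y).hom (ξ (f y))

namespace FiberLattice

theorem pull_id (ξ : FiberLattice N T) : ξ.pull (𝟙 T) = ξ := by
  funext y
  rw [pull, Scheme.Hom.stalkMap_id]
  exact Gr.map_id _

theorem pull_pull (f : T' ⟶ T) (g : T'' ⟶ T') (ξ : FiberLattice N T) :
    (ξ.pull f).pull g = ξ.pull (g ≫ f) := by
  funext y
  rw [pull, pull, Gr.map_map, pull, Scheme.Hom.stalkMap_comp]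
  rfl

theorem map_germ_stalkMap (f : T' ⟶ T) {V : T.Opens} (g : GL (Fin N) (LaurentSeries Γ(T, V)))
    (y : T') (hy : f y ∈ V) :
    Gr.map (f.stalkMap y).hom (Gr.mk (glMap (T.presheaf.germ V (f y) hy).hom g)) =
      Gr.mk (glMap (T'.presheaf.germ (f ⁻¹ᵁ V) y hy).hom (glMap (f.app V).hom g)) := by
  rw [Gr.map_mk, glMap_glMap, glMap_glMap, ← CommRingCat.hom_comp, ← CommRingCat.hom_comp,
    Scheme.Hom.germ_stalkMap]

theorem IsLocal.pull {ξ : FiberLattice N T} (hξ : ξ.IsLocal) (f : T' ⟶ T) :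
    (ξ.pull f).IsLocal := by
  intro y
  obtain ⟨V, hV, g, hg⟩ := hξ (f y)
  refine ⟨f ⁻¹ᵁ V, hV, glMap (f.app V).hom g, fun z hz => ?_⟩
  rw [FiberLattice.pull, hg _ hz]
  exact map_germ_stalkMap f g z hz

theorem map_stalkMap_injective (f : T' ⟶ T) [IsOpenImmersion f] (y : T') :
    Function.Injective (Gr.map (N := N) (f.stalkMap y).hom) :=
  Gr.map_injective (ConcreteCategory.bijective_of_isIso (f.stalkMap y)).1

theorem glMap_germ_res {U V : T.Opens} (h : V ≤ U) (g : GL (Fin N) (LaurentSeries Γ(T, U)))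
    (y : T) (hy : y ∈ V) :
    glMap (T.presheaf.germ V y hy).hom (glMap (T.presheaf.map (homOfLE h).op).hom g) =
      glMap (T.presheaf.germ U y (h hy)).hom g := by
  rw [glMap_glMap, ← CommRingCat.hom_comp]
  congr 2
  exact congrArg _ (TopCat.Presheaf.germ_res T.presheaf (homOfLE h) y hy)

/-- An invertible matrix of Laurent series on an open subscheme, viewed on the ambient scheme. -/
theorem exists_image_gl (f : T' ⟶ T) [IsOpenImmersion f] {V : T'.Opens}
    (g : GL (Fin N) (LaurentSeries Γ(T', V))) :
    ∃ g' : GL (Fin N) (LaurentSeries Γ(T, f ''ᵁ V)), ∀ y (hy : y ∈ V) (hy' : f y ∈ f ''ᵁ V),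
      Gr.map (f.stalkMap y).hom (Gr.mk (glMap (T.presheaf.germ (f ''ᵁ V) (f y) hy').hom g')) =
        Gr.mk (glMap (T'.presheaf.germ V y hy).hom g) := by
  refine ⟨glMap (f.appIso V).inv.hom g, fun y hy hy' => (map_germ_stalkMap f _ y hy').trans ?_⟩
  rw [glMap_glMap, glMap_glMap]
  congr 2
  rw [← CommRingCat.hom_comp, ← CommRingCat.hom_comp, ← Category.assoc,
    Scheme.Hom.appIso_inv_app]
  exact congrArg (fun k => glMap (CommRingCat.Hom.hom k)) (TopCat.Presheaf.germ_res T'.presheaf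
    (eqToHom _) y (show y ∈ f ⁻¹ᵁ f ''ᵁ V from hy'))

theorem isLocal_of_cover {ξ : FiberLattice N T}
    (h : ∀ x : T, ∃ U : T.Opens, x ∈ U ∧ (ξ.pull U.ι).IsLocal) : ξ.IsLocal := by
  intro x
  obtain ⟨U, hx, hU⟩ := h x
  obtain ⟨V, hV, g, hg⟩ := hU ⟨x, hx⟩
  obtain ⟨g', hg'⟩ := exists_image_gl U.ι g
  refine ⟨U.ι ''ᵁ V, ⟨⟨x, hx⟩, hV, rfl⟩, g', ?_⟩
  rintro _ ⟨y, hy, rfl⟩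
  exact map_stalkMap_injective U.ι y ((hg y hy).trans (hg' y hy ⟨y, hy, rfl⟩).symm)

/-- The inverse of the isomorphism between the stalks of `T` and of an open subscheme. -/
def stalkInv (U : T.Opens) (z : U.toScheme) :
    U.toScheme.presheaf.stalk z ⟶ T.presheaf.stalk (U.ι z) :=
  inv (U.ι.stalkMap z)

theorem stalkInv_comp (U : T.Opens) (z : U.toScheme) : stalkInv U z ≫ U.ι.stalkMap z = 𝟙 _ :=
  IsIso.inv_hom_id _

theorem comp_stalkInv (U : T.Opens) (z : U.toScheme) : U.ι.stalkMap z ≫ stalkInv U z = 𝟙 _ :=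
  IsIso.hom_inv_id _

/-- The value at `y` of a pullback depends only on the value at the image of `y`. -/
theorem map_stalkMap_congr {f g : T' ⟶ T} (h : f = g) (y : T') {x : T} (hf : f y = x)
    (hg : g y = x) (q : Gr N (T.presheaf.stalk x)) :
    Gr.map (f.stalkMap y).hom (hf.symm ▸ q) = Gr.map (g.stalkMap y).hom (hg.symm ▸ q) := by
  subst h
  rfl

/-- If families on `T₁` and `T₂` have the same pullback to `W`, then at a point of `W` the value
of one is obtained from that of the other by passing through the stalk of `T`; here `k` is an
inverse of the map of stalks along `g`. -/
theorem map_stalkMap_eq_of_pull_eq {T₁ T₂ W : Scheme.{u}} {a : W ⟶ T₁} {b : W ⟶ T₂} {f : T₁ ⟶ T}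
    {g : T₂ ⟶ T} [IsOpenImmersion a] (h : a ≫ f = b ≫ g) {ξ : FiberLattice N T₁}
    {η : FiberLattice N T₂} (H : ξ.pull a = η.pull b) {w : W} {y : T₁} {z : T₂} (hy : a w = y)
    (hz : b w = z) (hyz : f y = g z) {k : T₂.presheaf.stalk z ⟶ T.presheaf.stalk (g z)}
    (hk : k ≫ g.stalkMap z = 𝟙 _) :
    Gr.map (f.stalkMap y).hom (hyz.symm ▸ Gr.map k.hom (η z)) = ξ y := by
  subst hy hz
  apply map_stalkMap_injective a w
  have h3 : Gr.map (b.stalkMap w).hom (Gr.map (g.stalkMap (b w)).hom (Gr.map k.hom (η (b w)))) =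
      Gr.map (b.stalkMap w).hom (η (b w)) := by
    rw [Gr.map_map (f := k.hom), ← CommRingCat.hom_comp, hk]
    exact congrArg _ (Gr.map_id _)
  refine Eq.trans ?_ (h3.trans (congrFun H w).symm)
  refine (Gr.map_map _ _ _).trans (Eq.trans ?_ (Gr.map_map _ _ _).symm)
  have h5 := map_stalkMap_congr h w (x := g (b w)) hyz rfl (Gr.map k.hom (η (b w)))
  rw [Scheme.Hom.stalkMap_comp, Scheme.Hom.stalkMap_comp] at h5
  exact h5

/-- Stalkwise families glue: at each point, use one of the open sets containing it. -/
theorem exists_glue {ι : Type*} (U : ι → T.Opens) (hU : iSup U = ⊤)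
    (s : ∀ i, FiberLattice N (U i).toScheme)
    (hs : ∀ i j, (s i).pull (T.homOfLE (inf_le_left : U i ⊓ U j ≤ U i)) =
      (s j).pull (T.homOfLE (inf_le_right : U i ⊓ U j ≤ U j))) :
    ∃ ξ : FiberLattice N T, ∀ i, ξ.pull (U i).ι = s i := by
  have hx (x : T) : ∃ i, x ∈ U i := by
    have : x ∈ iSup U := hU ▸ Opens.mem_top x
    exact Opens.mem_iSup.1 this
  choose c hc using hx
  refine ⟨fun x => Gr.map (stalkInv (U (c x)) ⟨x, hc x⟩).hom (s (c x) ⟨x, hc x⟩),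
    fun i => funext fun y => ?_⟩
  exact map_stalkMap_eq_of_pull_eq (f := (U i).ι) (g := (U (c y.1)).ι) (by simp) (hs i (c y.1))
    (w := (⟨y.1, y.2, hc y.1⟩ : (U i ⊓ U (c y.1) : T.Opens).toScheme)) (y := y)
    (z := ⟨y.1, hc y.1⟩)
    (Subtype.ext (Scheme.homOfLE_apply ..)) (Subtype.ext (Scheme.homOfLE_apply ..)) rfl
    (stalkInv_comp (U (c y.1)) ⟨y.1, hc y.1⟩)

theorem eq_of_pull_eq {ι : Type*} {U : ι → T.Opens} (hU : iSup U = ⊤)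
    {ξ ξ' : FiberLattice N T} (h : ∀ i, ξ.pull (U i).ι = ξ'.pull (U i).ι) : ξ = ξ' := by
  funext x
  have : x ∈ iSup U := hU ▸ Opens.mem_top x
  obtain ⟨i, hi⟩ := Opens.mem_iSup.1 this
  exact map_stalkMap_injective (U i).ι ⟨x, hi⟩ (congrFun (h i) ⟨x, hi⟩)

end FiberLattice

/-- The functor sending `T` to the set of lattices in `𝒪_T((t))^N` that lie between
`t^m 𝒪_T[[t]]^N` and `t^(-m) 𝒪_T[[t]]^N`. -/
def boundedFunctor (N m : ℕ) : Scheme.{u}ᵒᵖ ⥤ Type u where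
  obj X := {ξ : FiberLattice N X.unop // ξ.IsLocal ∧ ∀ x, (ξ x).Bounded m}
  map f := TypeCat.ofHom fun ξ => ⟨ξ.1.pull f.unop, ξ.2.1.pull f.unop, fun _ => (ξ.2.2 _).map _⟩
  map_id _ := ConcreteCategory.hom_ext _ _ fun ξ => Subtype.ext (FiberLattice.pull_id ξ.1)
  map_comp f g := ConcreteCategory.hom_ext _ _ fun ξ =>
    Subtype.ext (FiberLattice.pull_pull f.unop g.unop ξ.1).symm

/-- Boundedness descends along a ring homomorphism with a left inverse. -/
theorem Gr.Bounded.of_isIso {R R' : Type*} [CommRing R] [CommRing R'] {m : ℕ} {f : R →+* R'}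
    {g : R' →+* R} (h : g.comp f = RingHom.id R) {q : Gr N R} (hq : (Gr.map f q).Bounded m) :
    q.Bounded m := by
  have := hq.map g
  rwa [Gr.map_map, h, Gr.map_id] at this

/-- A functor on schemes in which sections can be glued along open coverings. Index types in a
larger universe occur because the coverings generating the Zariski topology have such index types.
-/
def GluesOpens (P : Scheme.{u}ᵒᵖ ⥤ Type u) : Prop :=
  ∀ (T : Scheme.{u}) (ι : Type (u + 1)) (U : ι → T.Opens), iSup U = ⊤ →
    ∀ s : ∀ i, P.obj (op (U i).toScheme),
      (∀ i j, P.map (T.homOfLE (inf_le_left : U i ⊓ U j ≤ U i)).op (s i) =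
        P.map (T.homOfLE (inf_le_right : U i ⊓ U j ≤ U j)).op (s j)) →
      ∃! t : P.obj (op T), ∀ i, P.map (U i).ι.op t = s i

/-- Gluing along open subsets implies the sheaf condition for coverings by open immersions. -/
theorem GluesOpens.isSheaf {P : Scheme.{u}ᵒᵖ ⥤ Type u} (hP : GluesOpens P) :
    Presheaf.IsSheaf Scheme.zariskiTopology P := by
  rw [isSheaf_iff_isSheaf_of_type,
    Precoverage.isSheaf_toGrothendieck_iff_of_isStableUnderBaseChange]
  rintro Y S hS x hx
  obtain ⟨(𝓤 : Scheme.OpenCover Y), rfl⟩ := Scheme.exists_cover_of_mem_pretopology hS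
  have hsup : (⨆ i, (𝓤.f i).opensRange) = ⊤ := 𝓤.iSup_opensRange
  obtain ⟨t, ht, ht'⟩ := hP Y 𝓤.I₀ (fun i => (𝓤.f i).opensRange) hsup
    (fun i => P.map (𝓤.f i).isoOpensRange.inv.op (x (𝓤.f i) (.mk _))) (fun i j => by
      dsimp only
      rw [← Functor.map_comp_apply, ← Functor.map_comp_apply, ← op_comp, ← op_comp]
      exact hx _ _ _ _ (by simp))
  refine ⟨t, ?_, ?_⟩
  · rintro Z e ⟨j⟩
    have h1 := congrArg (P.map (𝓤.f j).isoOpensRange.hom.op) (ht j)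
    rw [← Functor.map_comp_apply, ← Functor.map_comp_apply, ← op_comp, ← op_comp] at h1
    simpa using h1
  · intro t'' h
    refine ht' t'' fun j => ?_
    dsimp only
    rw [← h (𝓤.f j) (.mk j), ← Functor.map_comp_apply, ← op_comp]
    simp

theorem gluesOpens_boundedFunctor (N m : ℕ) : GluesOpens (boundedFunctor.{u} N m) := by
  intro T ι U hU s hs
  obtain ⟨ξ, hξ⟩ := FiberLattice.exists_glue U hU (fun i => (s i).1)
    (fun i j => congrArg Subtype.val (hs i j))
  have hx (x : T) : ∃ i, x ∈ U i := by
    have : x ∈ iSup U := hU ▸ Opens.mem_top x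
    exact Opens.mem_iSup.1 this
  refine ⟨⟨ξ, FiberLattice.isLocal_of_cover fun x => ?_, fun x => ?_⟩,
    fun i => Subtype.ext (hξ i), ?_⟩
  · obtain ⟨i, hi⟩ := hx x
    exact ⟨U i, hi, hξ i ▸ (s i).2.1⟩
  · obtain ⟨i, hi⟩ := hx x
    have h1 := (s i).2.2 ⟨x, hi⟩
    rw [← hξ i] at h1
    refine Gr.Bounded.of_isIso (g := (FiberLattice.stalkInv (U i) ⟨x, hi⟩).hom) ?_ h1
    exact congrArg CommRingCat.Hom.hom (FiberLattice.comp_stalkInv (U i) ⟨x, hi⟩)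
  · intro ξ' h'
    exact Subtype.ext (FiberLattice.eq_of_pull_eq hU fun i =>
      (congrArg Subtype.val (h' i)).trans (hξ i).symm)

end Families

/-! ### Local charts for families of lattices -/

section SpreadingOut

variable {T T' : Scheme.{u}} {N : ℕ}

/-- Finitely many properties that hold near `x` hold simultaneously near `x`. -/
theorem exists_open_forall {ι : Type*} [Finite ι] {x : T} (P : ι → T.Opens → Prop)
    (mono : ∀ i {W W' : T.Opens}, W' ≤ W → P i W → P i W') (h : ∀ i, ∃ W, x ∈ W ∧ P i W) :
    ∃ W, x ∈ W ∧ ∀ i, P i W := by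
  choose W hx hW using h
  refine ⟨⟨⋂ i, (W i : Set T), isOpen_iInter_of_finite fun i => (W i).2⟩,
    Set.mem_iInter.2 hx, fun i => mono i ?_ (hW i)⟩
  exact fun y hy => Set.mem_iInter.1 hy i

/-- Compatible germs that locally come from sections come from a section. -/
theorem exists_section (U : T.Opens) (a : ∀ x ∈ U, T.presheaf.stalk x)
    (h : ∀ x ∈ U, ∃ (V : T.Opens) (_ : x ∈ V) (_ : V ≤ U) (s : Γ(T, V)), ∀ y (hy : y ∈ V)
      (hy' : y ∈ U), T.presheaf.germ V y hy s = a y hy') :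
    ∃ s : Γ(T, U), ∀ x (hx : x ∈ U), T.presheaf.germ U x hx s = a x hx := by
  choose V hx hV s hs using h
  obtain ⟨t, ht, -⟩ := TopCat.Sheaf.existsUnique_gluing' T.sheaf (fun x : U => V x.1 x.2) U
    (fun x => homOfLE (hV x.1 x.2)) (fun x h => Opens.mem_iSup.2 ⟨⟨x, h⟩, hx x h⟩)
    (fun x => s x.1 x.2) (fun x x' => by
      refine TopCat.Presheaf.section_ext T.sheaf _ _ _ fun y hy => ?_
      refine (TopCat.Presheaf.germ_res_apply T.presheaf _ y hy _).trans (Eq.trans ?_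
        (TopCat.Presheaf.germ_res_apply T.presheaf _ y hy _).symm)
      rw [hs x.1 x.2 y hy.1 (hV x.1 x.2 hy.1), hs x'.1 x'.2 y hy.2 (hV x.1 x.2 hy.1)])
  refine ⟨t, fun x h => ?_⟩
  rw [← hs x h x (hx x h) h]
  have h1 := ht ⟨x, h⟩
  refine (TopCat.Presheaf.germ_res_apply T.presheaf (homOfLE (hV x h)) x (hx x h) t).symm.trans ?_
  exact congrArg (T.presheaf.germ (V x h) x (hx x h)) h1

theorem exists_germ_eq_zero {U : T.Opens} (s : Γ(T, U)) {x : T} (hx : x ∈ U)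
    (h : T.presheaf.germ U x hx s = 0) :
    ∃ W : T.Opens, x ∈ W ∧ ∀ y ∈ W, ∀ hy : y ∈ U, T.presheaf.germ U y hy s = 0 := by
  obtain ⟨W, hxW, iU, iV, hW⟩ := TopCat.Presheaf.germ_eq T.presheaf x hx hx s 0
    (by rw [h, map_zero])
  refine ⟨W, hxW, fun y hy hyU => ?_⟩
  rw [← TopCat.Presheaf.germ_res_apply T.presheaf iU y hy s]
  refine (congrArg _ hW).trans ?_
  rw [map_zero, map_zero]

theorem section_eq_zero {U : T.Opens} {s : Γ(T, U)}
    (h : ∀ y (hy : y ∈ U), T.presheaf.germ U y hy s = 0) : s = 0 :=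
  TopCat.Presheaf.section_ext T.sheaf U s 0 fun y hy => (h y hy).trans (map_zero _).symm

theorem exists_coeff_eq_zero {R : Type*} [CommRing R] (a : LaurentSeries R) :
    ∃ k : ℕ, ∀ n : ℤ, n < -k → a.coeff n = 0 := by
  refine ⟨(HahnSeries.order a).natAbs, fun n hn => HahnSeries.coeff_eq_zero_of_lt_order ?_⟩
  omega

/-- A Laurent series whose germ at `x` is a power series is a power series near `x`. -/
theorem exists_germ_mem_power {U : T.Opens} (a : LaurentSeries Γ(T, U)) {x : T} (hx : x ∈ U)
    (h : laurentMap (T.presheaf.germ U x hx).hom a ∈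
      (HahnSeries.ofPowerSeries ℤ (T.presheaf.stalk x)).range) :
    ∃ W : T.Opens, x ∈ W ∧ ∀ y ∈ W, ∀ hy : y ∈ U, laurentMap (T.presheaf.germ U y hy).hom a ∈
      (HahnSeries.ofPowerSeries ℤ (T.presheaf.stalk y)).range := by
  obtain ⟨k, hk⟩ := exists_coeff_eq_zero a
  rw [mem_power_iff] at h
  obtain ⟨W, hW, H⟩ := exists_open_forall (x := x) (fun (n : Fin k) W => ∀ y ∈ W, ∀ hy : y ∈ U,
      T.presheaf.germ U y hy (a.coeff (Int.negSucc n)) = 0)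
    (fun n W W' hW H y hy => H y (hW hy)) (fun n => exists_germ_eq_zero _ hx (h n))
  refine ⟨W, hW, fun y hy hyU => mem_power_iff.2 fun n => ?_⟩
  rw [laurentMap_coeff]
  by_cases hn : n < k
  · exact H ⟨n, hn⟩ y hy hyU
  · rw [hk _ (by omega), map_zero]

theorem exists_germ_mem_powerGL {U : T.Opens} (g : GL (Fin N) (LaurentSeries Γ(T, U))) {x : T}
    (hx : x ∈ U) (h : glMap (T.presheaf.germ U x hx).hom g ∈ powerGL N _) :
    ∃ W : T.Opens, x ∈ W ∧ ∀ y ∈ W, ∀ hy : y ∈ U,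
      glMap (T.presheaf.germ U y hy).hom g ∈ powerGL N _ := by
  rw [mem_powerGL] at h
  have hmono (a : LaurentSeries Γ(T, U)) {W W' : T.Opens} (hW : W' ≤ W)
      (H : ∀ y ∈ W, ∀ hy : y ∈ U, laurentMap (T.presheaf.germ U y hy).hom a ∈
        (HahnSeries.ofPowerSeries ℤ (T.presheaf.stalk y)).range) : ∀ y ∈ W', ∀ hy : y ∈ U,
      laurentMap (T.presheaf.germ U y hy).hom a ∈
        (HahnSeries.ofPowerSeries ℤ (T.presheaf.stalk y)).range := fun y hy => H y (hW hy)
  obtain ⟨W, hW, H⟩ := exists_open_forall (x := x) _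
    (fun (p : Fin N × Fin N) => hmono (g.1 p.1 p.2))
    (fun p => exists_germ_mem_power _ hx (h.1 p.1 p.2))
  obtain ⟨W', hW', H'⟩ := exists_open_forall (x := x) _
    (fun (p : Fin N × Fin N) => hmono (g⁻¹.1 p.1 p.2))
    (fun p => exists_germ_mem_power _ hx (by
      have := h.2 p.1 p.2
      rwa [← map_inv] at this))
  refine ⟨W ⊓ W', ⟨hW, hW'⟩, fun y hy hyU => mem_powerGL.2 ⟨fun i j => ?_, fun i j => ?_⟩⟩
  · exact H (i, j) y hy.1 hyU
  · rw [← map_inv]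
    exact H' (i, j) y hy.2 hyU

/-- Lattices that agree at a point agree in a neighbourhood. -/
theorem exists_mk_germ_eq {U : T.Opens} (g h : GL (Fin N) (LaurentSeries Γ(T, U))) {x : T}
    (hx : x ∈ U) (H : Gr.mk (glMap (T.presheaf.germ U x hx).hom g) =
      Gr.mk (glMap (T.presheaf.germ U x hx).hom h)) :
    ∃ W : T.Opens, x ∈ W ∧ ∀ y ∈ W, ∀ hy : y ∈ U, Gr.mk (glMap (T.presheaf.germ U y hy).hom g) =
      Gr.mk (glMap (T.presheaf.germ U y hy).hom h) := by
  rw [Gr.mk_eq_iff, ← map_inv, ← map_mul] at H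
  obtain ⟨W, hW, H'⟩ := exists_germ_mem_powerGL _ hx H
  refine ⟨W, hW, fun y hy hyU => ?_⟩
  rw [Gr.mk_eq_iff, ← map_inv, ← map_mul]
  exact H' y hy hyU

/-- Validity of chart coordinates can be checked on germs. -/
theorem chartValid_of_germ {d : Fin N → ℕ} {e : ℕ} {U : T.Opens} {c : Fin N → MonoIdx d → Γ(T, U)}
    (h : ∀ y (hy : y ∈ U), ChartValid d (fun i j => T.presheaf.germ U y hy (c i j)) e) :
    ChartValid d c e := fun i => funext fun j => section_eq_zero fun y hy =>
  (chartValid_iff_map (T.presheaf.germ U y hy).hom).1 (h y hy) i j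

/-- The lattice `q` lies in the chart with monomial basis `d`. -/
def Gr.InChart {R : Type*} [CommRing R] (m : ℕ) (d : Fin N → ℕ) (q : Gr N R) : Prop :=
  ∃ (c : Fin N → MonoIdx d → R) (hc : ChartValid d c (2 * m)), q = Gr.mk (chartMatrix hc).toGL

theorem Gr.InChart.map {R R' : Type*} [CommRing R] [CommRing R'] {m : ℕ} {d : Fin N → ℕ}
    {q : Gr N R} (h : q.InChart m d) (f : R →+* R') : (Gr.map f q).InChart m d := by
  obtain ⟨c, hc, rfl⟩ := h
  exact ⟨_, hc.map f, congrArg Gr.mk (toGL_chartMatrix_map f hc)⟩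

theorem BoundedMatrix.inChart_iff {R : Type*} [CommRing R] {m : ℕ} {d : Fin N → ℕ}
    (B : BoundedMatrix N m R) : (Gr.mk B.toGL).InChart m d ↔ IsChart B.lattice d := by
  constructor
  · rintro ⟨c, hc, h⟩
    rw [lattice_eq_of_mk_toGL_eq h, lattice_chartMatrix]
    exact isChart_chartLattice hc
  · intro h
    obtain ⟨c, hc, h'⟩ := h.exists_chart B.X_pow_smul_mem
    exact ⟨c, hc, mk_toGL_eq (by rw [lattice_chartMatrix, h'])⟩

theorem Gr.Bounded.exists_inChart {R : Type*} [CommRing R] [IsLocalRing R] {m : ℕ} {q : Gr N R}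
    (h : q.Bounded m) : ∃ d : Fin N → ℕ, (∀ i, d i ≤ 2 * m) ∧ q.InChart m d := by
  obtain ⟨B, rfl⟩ := h
  obtain ⟨d, hd, h⟩ := B.exists_isChart
  exact ⟨d, hd, B.inChart_iff.2 h⟩

/-- Membership in a chart can be checked after a local homomorphism. -/
theorem Gr.InChart.of_map {R R' : Type*} [CommRing R] [CommRing R'] [IsLocalRing R]
    [IsLocalRing R'] {m : ℕ} {d : Fin N → ℕ} {q : Gr N R} (hq : q.Bounded m) (f : R →+* R')
    [IsLocalHom f] (h : (Gr.map f q).InChart m d) : q.InChart m d := by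
  obtain ⟨B, rfl⟩ := hq
  rw [Gr.map_mk, ← BoundedMatrix.toGL_map, BoundedMatrix.inChart_iff] at h
  exact B.inChart_iff.2 (isChart_of_isChart_map f B h)

namespace FiberLattice

/-- Chart coordinates at a point extend to a neighbourhood. -/
theorem IsLocal.exists_chart_near {ξ : FiberLattice N T} (hξ : ξ.IsLocal) {m : ℕ} {d : Fin N → ℕ}
    {x : T} (h : (ξ x).InChart m d) : ∃ (W : T.Opens) (_ : x ∈ W) (c : Fin N → MonoIdx d → Γ(T, W))
      (hc : ChartValid d c (2 * m)), ∀ y (hy : y ∈ W),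
        ξ y = Gr.mk (glMap (T.presheaf.germ W y hy).hom (chartMatrix hc).toGL) := by
  obtain ⟨V, hxV, g, hg⟩ := hξ x
  obtain ⟨c, hc, hcx⟩ := h
  -- The finitely many coordinates are germs of functions on a neighbourhood `W`.
  have h1 (p : Fin N × MonoIdx d) : ∃ (W : T.Opens), x ∈ W ∧ ∃ s : Γ(T, W), ∀ hx : x ∈ W,
      T.presheaf.germ W x hx s = c p.1 p.2 := by
    obtain ⟨W, hW, s, hs⟩ := TopCat.Presheaf.exists_germ_eq T.presheaf (c p.1 p.2)
    exact ⟨W, hW, s, fun _ => hs⟩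
  obtain ⟨W, hxW, hW⟩ := exists_open_forall (x := x) _ (fun p {W W'} hW ⟨s, hs⟩ =>
    ⟨T.presheaf.map (homOfLE hW).op s, fun hx => by
      rw [← hs (hW hx)]; exact TopCat.Presheaf.germ_res_apply T.presheaf (homOfLE hW) x hx s⟩) h1
  choose s hs using hW
  -- The equations of the chart hold at `x`, hence near `x`.
  have h2 := (chartValid_iff_map (c := fun i j => s (i, j)) (T.presheaf.germ W x hxW).hom
    (e := 2 * m)).1 (by
      have : (fun i j => (T.presheaf.germ W x hxW).hom (s (i, j))) = c :=
        funext fun i => funext fun j => hs (i, j) hxW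
      rwa [this])
  obtain ⟨W₁, hxW₁, hW₁⟩ := exists_open_forall (x := x) (fun (p : Fin N × MonoIdx d) W' => ∀ y ∈ W',
      ∀ hy : y ∈ W, T.presheaf.germ W y hy ((chartShift d (fun i j => s (i, j)) ^ (2 * m))
        (chartBasis d (fun i j => s (i, j)) p.1 0) p.2) = 0)
    (fun n W W' hW H y hy => H y (hW hy)) (fun p => exists_germ_eq_zero _ hxW (h2 p.1 p.2))
  let W₂ := W ⊓ W₁ ⊓ V
  have hx₂ : x ∈ W₂ := ⟨⟨hxW, hxW₁⟩, hxV⟩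
  have hW₂ : W₂ ≤ W := inf_le_left.trans inf_le_left
  have hc₂ : ChartValid d (fun i j => T.presheaf.map (homOfLE hW₂).op (s (i, j))) (2 * m) := by
    refine chartValid_of_germ fun y hy => ?_
    have h3 := (chartValid_iff_map (c := fun i j => s (i, j))
      (T.presheaf.germ W y (hW₂ hy)).hom (e := 2 * m)).2 (fun i j => hW₁ (i, j) y hy.1.2 hy.1.1)
    convert h3 using 3
    exact TopCat.Presheaf.germ_res_apply T.presheaf (homOfLE hW₂) y hy _
  -- The lattice with these coordinates agrees with `ξ` at `x`, hence near `x`.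
  have h4 : Gr.mk (glMap (T.presheaf.germ W₂ x hx₂).hom (chartMatrix hc₂).toGL) =
      Gr.mk (glMap (T.presheaf.germ W₂ x hx₂).hom (glMap (T.presheaf.map
        (homOfLE (inf_le_right : W₂ ≤ V)).op).hom g)) := by
    rw [glMap_germ_res, ← hg, hcx, toGL_chartMatrix_map]
    congr 3
    refine funext fun i => funext fun j => ?_
    refine (TopCat.Presheaf.germ_res_apply T.presheaf (homOfLE hW₂) x hx₂ _).trans ?_
    exact hs (i, j) hxW
  obtain ⟨W₃, hx₃, h₃⟩ := exists_mk_germ_eq _ _ hx₂ h4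
  refine ⟨W₂ ⊓ W₃, ⟨hx₂, hx₃⟩, _, hc₂.map (T.presheaf.map (homOfLE inf_le_left).op).hom,
    fun y hy => ?_⟩
  rw [← toGL_chartMatrix_map _ hc₂, glMap_germ_res, h₃ y hy.2 hy.1, glMap_germ_res, ← hg]

/-- The open set where a family of lattices lies in the chart `d`. -/
def chartLocus {ξ : FiberLattice N T} (hξ : ξ.IsLocal) (m : ℕ) (d : Fin N → ℕ) : T.Opens where
  carrier := {x | (ξ x).InChart m d}
  is_open' := by
    rw [isOpen_iff_forall_mem_open]
    intro x hx
    obtain ⟨W, hxW, c, hc, hW⟩ := hξ.exists_chart_near hx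
    refine ⟨W, fun y hy => ?_, W.2, hxW⟩
    exact ⟨_, hc.map (T.presheaf.germ W y hy).hom, by
      rw [hW y hy, toGL_chartMatrix_map]⟩

/-- The family of lattices with chart coordinates `c`. -/
def ofChart {m : ℕ} {d : Fin N → ℕ} {c : Fin N → MonoIdx d → Γ(T, ⊤)}
    (hc : ChartValid d c (2 * m)) : FiberLattice N T :=
  fun x => Gr.mk (glMap (T.presheaf.germ ⊤ x (Opens.mem_top x)).hom (chartMatrix hc).toGL)

section OfChart

variable {m : ℕ} {d : Fin N → ℕ} {c : Fin N → MonoIdx d → Γ(T, ⊤)} (hc : ChartValid d c (2 * m))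

theorem isLocal_ofChart : (ofChart hc).IsLocal :=
  fun x => ⟨⊤, Opens.mem_top x, (chartMatrix hc).toGL, fun _ _ => rfl⟩

theorem bounded_ofChart (x : T) : (ofChart hc x).Bounded m :=
  ⟨_, congrArg Gr.mk (BoundedMatrix.toGL_map _ _)⟩

theorem pull_ofChart (f : T' ⟶ T) : (ofChart hc).pull f = ofChart (hc.map f.appTop.hom) := by
  funext y
  refine (map_germ_stalkMap f (chartMatrix hc).toGL y (Opens.mem_top _)).trans ?_
  rw [toGL_chartMatrix_map]
  rfl

theorem ofChart_inChart (x : T) : (ofChart hc x).InChart m d :=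
  ⟨_, hc.map (T.presheaf.germ ⊤ x (Opens.mem_top x)).hom, by
    rw [ofChart, toGL_chartMatrix_map]⟩

theorem ofChart_injective {c' : Fin N → MonoIdx d → Γ(T, ⊤)} (hc' : ChartValid d c' (2 * m))
    (h : ofChart hc = ofChart hc') : c = c' := by
  refine funext fun i => funext fun j => TopCat.Presheaf.section_ext T.sheaf ⊤ _ _ fun y hy => ?_
  have h1 := congrFun h y
  rw [ofChart, ofChart, toGL_chartMatrix_map, toGL_chartMatrix_map] at h1
  exact congrFun (congrFun (chart_toGL_injective _ _ h1) i) j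

end OfChart

/-- A family of lattices lying in one chart is given by global chart coordinates. -/
theorem IsLocal.exists_ofChart {ξ : FiberLattice N T} (hξ : ξ.IsLocal) {m : ℕ} {d : Fin N → ℕ}
    (h : ∀ x, (ξ x).InChart m d) :
    ∃ (c : Fin N → MonoIdx d → Γ(T, ⊤)) (hc : ChartValid d c (2 * m)), ξ = ofChart hc := by
  choose c hc hcx using h
  -- The coordinates are unique, so those found locally are compatible.
  have h1 (i : Fin N) (j : MonoIdx d) := exists_section (T := T) ⊤ (fun x _ => c x i j)
      (fun x _ => by
    obtain ⟨W, hxW, c', hc', hW⟩ := hξ.exists_chart_near ⟨c x, hc x, hcx x⟩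
    refine ⟨W, hxW, le_top, c' i j, fun y hy _ => ?_⟩
    have h2 := hW y hy
    rw [hcx y, toGL_chartMatrix_map] at h2
    exact (congrFun (congrFun (chart_toGL_injective _ _ h2) i) j).symm)
  choose s hs using h1
  have hs' (y : T) : (fun i j => T.presheaf.germ ⊤ y (Opens.mem_top y) (s i j)) = c y :=
    funext fun i => funext fun j => hs i j y (Opens.mem_top y)
  have hv : ChartValid d s (2 * m) := chartValid_of_germ fun y hy => by
    rw [hs']
    exact hc y
  refine ⟨s, hv, funext fun y => ?_⟩
  rw [hcx, ofChart, toGL_chartMatrix_map]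
  congr 3
  exact (hs' y).symm

end FiberLattice

end SpreadingOut

/-! ### The scheme of bounded lattices -/

section Representability

open Limits

variable {T T' : Scheme.{u}} (N m : ℕ) (d : Fin N → ℕ)

/-- Indeterminates for the chart coordinates. -/
abbrev ChartVars : Type u := ULift.{u} (Fin N × MonoIdx d)

/-- The generic chart coordinates, before imposing the equations. -/
def genericChart (i : Fin N) (j : MonoIdx d) : MvPolynomial (ChartVars.{u} N d) ℤ :=
  MvPolynomial.X ⟨(i, j)⟩

/-- The equations of the chart. -/
def chartIdeal : Ideal (MvPolynomial (ChartVars.{u} N d) ℤ) :=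
  Ideal.span (Set.range fun p : Fin N × MonoIdx d =>
    (chartShift d (genericChart N d) ^ (2 * m)) (chartBasis d (genericChart N d) p.1 0) p.2)

/-- The coordinate ring of the chart `d`. -/
abbrev ChartRing : Type u := MvPolynomial (ChartVars.{u} N d) ℤ ⧸ chartIdeal.{u} N m d

theorem chartValid_universal : ChartValid d
    (fun i j => Ideal.Quotient.mk (chartIdeal.{u} N m d) (genericChart N d i j)) (2 * m) :=
  (chartValid_iff_map (Ideal.Quotient.mk (chartIdeal N m d))).2 fun i j =>
    Ideal.Quotient.eq_zero_iff_mem.2 (Ideal.subset_span ⟨(i, j), rfl⟩)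

variable {N m d}

theorem exists_chartRing_hom {R : Type*} [CommRing R] {c : Fin N → MonoIdx d → R}
    (hc : ChartValid d c (2 * m)) : ∃ f : ChartRing.{u} N m d →+* R,
      ∀ i j, f (Ideal.Quotient.mk _ (genericChart N d i j)) = c i j := by
  let f₀ : MvPolynomial (ChartVars.{u} N d) ℤ →+* R :=
    MvPolynomial.eval₂Hom (Int.castRingHom R) fun p => c p.down.1 p.down.2
  have hf (i : Fin N) (j : MonoIdx d) : f₀ (genericChart N d i j) = c i j :=
    MvPolynomial.eval₂Hom_X' _ _ _
  have hv := (chartValid_iff_map (c := genericChart N d) f₀ (e := 2 * m)).1 (by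
    simpa only [hf] using hc)
  refine ⟨Ideal.Quotient.lift _ f₀ fun a ha => ?_, fun i j => ?_⟩
  · refine (Ideal.span_le.2 ?_ : chartIdeal N m d ≤ RingHom.ker f₀) ha
    rintro _ ⟨p, rfl⟩
    exact hv p.1 p.2
  · exact (Ideal.Quotient.lift_mk _ _ _).trans (hf i j)

theorem chartRing_hom_ext {R : Type*} [CommRing R] {f g : ChartRing.{u} N m d →+* R}
    (h : ∀ i j, f (Ideal.Quotient.mk _ (genericChart N d i j)) =
      g (Ideal.Quotient.mk _ (genericChart N d i j))) : f = g := by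
  refine Ideal.Quotient.ringHom_ext (MvPolynomial.ringHom_ext' (RingHom.ext_int _ _) ?_)
  rintro ⟨i, j⟩
  exact h i j

variable (N m d)

/-- The chart `d`, an affine scheme. -/
abbrev Chart : Scheme.{u} := Spec (CommRingCat.of (ChartRing.{u} N m d))

/-- The coordinate functions on the chart. -/
def chartFn (i : Fin N) (j : MonoIdx d) : Γ(Chart.{u} N m d, ⊤) :=
  (Scheme.ΓSpecIso (CommRingCat.of (ChartRing.{u} N m d))).inv.hom
    (Ideal.Quotient.mk _ (genericChart N d i j))

theorem chartValid_chartFn : ChartValid d (chartFn.{u} N m d) (2 * m) :=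
  (chartValid_universal N m d).map
    (Scheme.ΓSpecIso (CommRingCat.of (ChartRing.{u} N m d))).inv.hom

variable {N m d}

theorem exists_hom_chart {c : Fin N → MonoIdx d → Γ(T, ⊤)} (hc : ChartValid d c (2 * m)) :
    ∃ f : T ⟶ Chart.{u} N m d, ∀ i j, f.appTop (chartFn N m d i j) = c i j := by
  obtain ⟨φ, hφ⟩ := exists_chartRing_hom.{u} hc
  refine ⟨T.toSpecΓ ≫ Spec.map (CommRingCat.ofHom φ), fun i j => ?_⟩
  have h : (Scheme.ΓSpecIso (CommRingCat.of (ChartRing.{u} N m d))).inv ≫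
      (T.toSpecΓ ≫ Spec.map (CommRingCat.ofHom φ)).appTop = CommRingCat.ofHom φ := by
    rw [Iso.inv_comp_eq, Scheme.Hom.comp_appTop, Scheme.toSpecΓ_appTop,
      Scheme.ΓSpecIso_naturality]
  exact (ConcreteCategory.congr_hom h _).trans (hφ i j)

theorem hom_chart_ext {f g : T ⟶ Chart.{u} N m d}
    (h : ∀ i j, f.appTop (chartFn N m d i j) = g.appTop (chartFn N m d i j)) : f = g := by
  apply ext_of_isAffine
  rw [← cancel_epi (Scheme.ΓSpecIso (CommRingCat.of (ChartRing.{u} N m d))).inv]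
  exact CommRingCat.hom_ext (chartRing_hom_ext (f := ((Scheme.ΓSpecIso (CommRingCat.of
    (ChartRing.{u} N m d))).inv ≫ f.appTop).hom) (g := ((Scheme.ΓSpecIso (CommRingCat.of
    (ChartRing.{u} N m d))).inv ≫ g.appTop).hom) h)

variable (N m d)

/-- The family of lattices over the chart. -/
def chartPoint : (boundedFunctor.{u} N m).obj (op (Chart.{u} N m d)) :=
  ⟨FiberLattice.ofChart (chartValid_chartFn N m d), FiberLattice.isLocal_ofChart _,
    FiberLattice.bounded_ofChart _⟩

/-- The chart, as a subfunctor of the functor of bounded lattices. -/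
def chartMap : yoneda.obj (Chart.{u} N m d) ⟶ boundedFunctor.{u} N m :=
  yonedaEquiv.symm (chartPoint N m d)

variable {N m d}

theorem chartMap_app (f : T ⟶ Chart.{u} N m d) : ((chartMap N m d).app (op T) f).1 =
    (FiberLattice.ofChart (chartValid_chartFn N m d)).pull f := rfl

theorem chartMap_injective {f g : T ⟶ Chart.{u} N m d}
    (h : (chartMap N m d).app (op T) f = (chartMap N m d).app (op T) g) : f = g := by
  have h1 := congrArg Subtype.val h
  rw [chartMap_app, chartMap_app, FiberLattice.pull_ofChart, FiberLattice.pull_ofChart] at h1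
  exact hom_chart_ext fun i j =>
    congrFun (congrFun (FiberLattice.ofChart_injective _ _ h1) i) j

theorem chartMap_inChart (f : T ⟶ Chart.{u} N m d) (x : T) :
    (((chartMap N m d).app (op T) f).1 x).InChart m d := by
  rw [chartMap_app, FiberLattice.pull_ofChart]
  exact FiberLattice.ofChart_inChart _ x

theorem exists_chartMap_eq (ξ : (boundedFunctor.{u} N m).obj (op T))
    (h : ∀ x, (ξ.1 x).InChart m d) : ∃ f : T ⟶ Chart.{u} N m d,
      (chartMap N m d).app (op T) f = ξ := by
  obtain ⟨c, hc, hξ⟩ := ξ.2.1.exists_ofChart h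
  obtain ⟨f, hf⟩ := exists_hom_chart.{u} hc
  refine ⟨f, Subtype.ext ?_⟩
  rw [chartMap_app, FiberLattice.pull_ofChart, hξ]
  congr 1
  exact funext fun i => funext fun j => hf i j

/-- A criterion for a monomorphism `X ⟶ F` to be an open subfunctor: every section `ξ` of `F` over
`T` has a largest open subset `V` over which it comes from `X`, and a morphism along which the
pullback of `ξ` comes from `X` has image in `V`. -/
theorem isOpenImmersion_presheaf {F : Scheme.{u}ᵒᵖ ⥤ Type u} {X : Scheme.{u}}
    (f : yoneda.obj X ⟶ F)
    (hinj : ∀ {T : Scheme.{u}} {a b : T ⟶ X}, f.app (op T) a = f.app (op T) b → a = b)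
    (h : ∀ {T : Scheme.{u}} (ξ : F.obj (op T)), ∃ V : T.Opens,
      (∃ q : V.toScheme ⟶ X, f.app (op V.toScheme) q = F.map V.ι.op ξ) ∧
      ∀ {T' : Scheme.{u}} (a : T' ⟶ X) (b : T' ⟶ T), f.app (op T') a = F.map b.op ξ →
        Set.range b ⊆ V) : IsOpenImmersion.presheaf f := by
  refine MorphismProperty.relative.of_exists fun T g => ?_
  have hg {T' : Scheme.{u}} (b : T' ⟶ T) : g.app (op T') b = F.map b.op (yonedaEquiv g) :=
    (map_yonedaEquiv g b).symm
  have hf {T' T'' : Scheme.{u}} (a : T'' ⟶ T') (q : T' ⟶ X) :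
      f.app (op T'') (a ≫ q) = F.map a.op (f.app (op T') q) :=
    ConcreteCategory.congr_hom (f.naturality a.op) q
  obtain ⟨V, ⟨q, hq⟩, hV⟩ := h (yonedaEquiv g)
  refine ⟨V, yoneda.map q, V.ι, IsPullback.of_forall_isPullback_app fun ⟨T'⟩ =>
    (Types.isPullback_iff _ _ _ _).2 ⟨?_, ?_, ?_⟩, inferInstance⟩
  · ext a
    change f.app (op T') (a ≫ q) = g.app (op T') (a ≫ V.ι)
    rw [hg, hf, hq, op_comp, Functor.map_comp_apply]
  · rintro a b ⟨-, h⟩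
    exact (cancel_mono V.ι).1 h
  · intro (a : T' ⟶ X) (b : T' ⟶ T) h
    replace h : f.app (op T') a = g.app (op T') b := h
    rw [hg] at h
    have hb : Set.range b ⊆ Set.range V.ι := by
      rw [Scheme.Opens.range_ι]
      exact hV a b h
    have hl : IsOpenImmersion.lift V.ι b hb ≫ V.ι = b := IsOpenImmersion.lift_fac _ _ _
    refine ⟨IsOpenImmersion.lift V.ι b hb, hinj ?_, hl⟩
    change f.app (op T') (IsOpenImmersion.lift V.ι b hb ≫ q) = _
    rw [h, hf, hq, ← Functor.map_comp_apply, ← op_comp, hl]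

theorem chartMap_isOpenImmersion : IsOpenImmersion.presheaf (chartMap.{u} N m d) := by
  refine isOpenImmersion_presheaf _ chartMap_injective fun {T} ξ =>
    ⟨FiberLattice.chartLocus ξ.2.1 m d, exists_chartMap_eq _ fun x => x.2.map _, ?_⟩
  rintro T' a b h _ ⟨y, rfl⟩
  refine Gr.InChart.of_map (ξ.2.2 (b y)) (b.stalkMap y).hom ?_
  have h1 := chartMap_inChart a y
  rw [h] at h1
  exact h1

variable (N m) in
/-- The index set of the charts that cover the functor of bounded lattices. -/
abbrev ChartIndex : Type u := ULift.{u} (Fin N → Fin (2 * m + 1))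

/-- The exponents of the monomial basis of a chart. -/
def ChartIndex.exponents (a : ChartIndex.{u} N m) : Fin N → ℕ := fun i => (a.down i : ℕ)

variable (N m) in
/-- The charts covering the functor of bounded lattices. -/
def charts (a : ChartIndex.{u} N m) : yoneda.obj (Chart.{u} N m a.exponents) ⟶
    (⟨boundedFunctor N m, (gluesOpens_boundedFunctor N m).isSheaf⟩ :
      Sheaf Scheme.zariskiTopology.{u} (Type u)).1 := chartMap N m a.exponents

theorem charts_isOpenImmersion (a : ChartIndex.{u} N m) :
    IsOpenImmersion.presheaf (charts N m a) := chartMap_isOpenImmersion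

/-- The charts with `d i ≤ 2 * m` cover the functor, as every bounded lattice over a local ring lies
in one of them. -/
instance : Presheaf.IsLocallySurjective Scheme.zariskiTopology.{u}
    (Sigma.desc (charts.{u} N m)) where
  imageSieve_mem {T} (ξ : (boundedFunctor.{u} N m).obj (op T)) := by
    have h (x : T) : ∃ a : ChartIndex.{u} N m, x ∈ FiberLattice.chartLocus ξ.2.1 m a.exponents := by
      obtain ⟨d, hd, h⟩ := (ξ.2.2 x).exists_inChart
      exact ⟨⟨fun i => ⟨d i, by have := hd i; omega⟩⟩, h⟩
    rw [Scheme.mem_grothendieckTopology_iff]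
    refine ⟨Scheme.openCoverOfIsOpenCover T
      (fun a : ChartIndex.{u} N m => FiberLattice.chartLocus ξ.2.1 m a.exponents) ?_, ?_⟩
    · exact Opens.ext (Set.eq_univ_of_forall fun x => Opens.mem_iSup.2 (h x))
    · rintro _ _ ⟨a⟩
      obtain ⟨f, hf⟩ := exists_chartMap_eq (d := ChartIndex.exponents a) ((boundedFunctor N m).map
        (FiberLattice.chartLocus ξ.2.1 m (ChartIndex.exponents a)).ι.op ξ) (fun x => x.2.map _)
      refine ⟨(Sigma.ι (fun a : ChartIndex.{u} N m => yoneda.obj (Chart.{u} N m a.exponents)) a).app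
        _ f, ?_⟩
      refine Eq.trans ?_ hf
      exact ConcreteCategory.congr_hom
        (congrArg (fun k => NatTrans.app k _) (Sigma.ι_desc (charts.{u} N m) a)) f

variable (N m) in
/-- The scheme over `ℤ` representing the functor of `m`-bounded lattices, glued from the charts.
-/
def BoundedGr : Scheme.{u} :=
  (Scheme.LocalRepresentability.glueData (charts_isOpenImmersion.{u} (N := N) (m := m))).glued

variable (N m) in
/-- The scheme `BoundedGr N m` represents the functor of `m`-bounded lattices. -/
def boundedGrRep : (boundedFunctor.{u} N m).RepresentableBy (BoundedGr.{u} N m) :=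
  Scheme.LocalRepresentability.representableBy (charts_isOpenImmersion.{u} (N := N) (m := m))

end Representability

/-! ### Properness of the scheme of bounded lattices -/

section Properness

open Limits

variable {N m : ℕ}

namespace FiberLattice

/-- The family of lattices over an affine scheme with chart coordinates `c`. -/
def ofChartSpec (A : CommRingCat.{u}) {d : Fin N → ℕ} {c : Fin N → MonoIdx d → A}
    (hc : ChartValid d c (2 * m)) : FiberLattice N (Spec A) :=
  ofChart (hc.map (Scheme.ΓSpecIso A).inv.hom)

theorem pull_ofChartSpec {A B : CommRingCat.{u}} (φ : A ⟶ B) {d : Fin N → ℕ}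
    {c : Fin N → MonoIdx d → A} (hc : ChartValid d c (2 * m)) :
    (ofChartSpec A hc).pull (Spec.map φ) = ofChartSpec B (hc.map φ.hom) := by
  refine (pull_ofChart _ _).trans ?_
  rw [ofChartSpec]
  congr 1
  refine funext fun i => funext fun j => ?_
  exact ConcreteCategory.congr_hom (Scheme.ΓSpecIso_inv_naturality φ).symm (c i j)

theorem ofChartSpec_eq {A : CommRingCat.{u}} {d d' : Fin N → ℕ}
    {c : Fin N → MonoIdx d → A} {c' : Fin N → MonoIdx d' → A} (hc : ChartValid d c (2 * m))
    (hc' : ChartValid d' c' (2 * m))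
    (h : Gr.mk (chartMatrix hc).toGL = Gr.mk (chartMatrix hc').toGL) :
    ofChartSpec A hc = ofChartSpec A hc' := by
  funext x
  rw [ofChartSpec, ofChartSpec, ofChart, ofChart, ← toGL_chartMatrix_map _ hc,
    ← toGL_chartMatrix_map _ hc', ← Gr.map_mk, ← Gr.map_mk, ← Gr.map_mk, ← Gr.map_mk, h]

/-- A bounded family over the spectrum of a local ring lies in one of the charts, as the only open
set containing the closed point is the whole spectrum. -/
theorem exists_ofChartSpec {A : CommRingCat.{u}} [IsLocalRing A] {ξ : FiberLattice N (Spec A)}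
    (hξ : ξ.IsLocal) (hm : ∀ x, (ξ x).Bounded m) : ∃ (d : Fin N → ℕ) (c : Fin N → MonoIdx d → A)
      (hc : ChartValid d c (2 * m)), ξ = ofChartSpec A hc := by
  let x : Spec A := IsLocalRing.closedPoint A
  obtain ⟨d, -, hd⟩ := (hm x).exists_inChart
  have htop : (chartLocus hξ m d : (Spec A).Opens) = ⊤ :=
    (IsLocalRing.closedPoint_mem_iff (R := A) (U := chartLocus hξ m d)).1 hd
  obtain ⟨c, hc, rfl⟩ := hξ.exists_ofChart (fun x => htop.ge (Opens.mem_top x))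
  refine ⟨d, _, hc.map (Scheme.ΓSpecIso A).hom.hom, ?_⟩
  rw [ofChartSpec]
  congr 1
  refine funext fun i => funext fun j => ?_
  exact (ConcreteCategory.congr_hom (Scheme.ΓSpecIso A).hom_inv_id (c i j)).symm

/-- Over a field, the family of lattices determines the lattice. -/
theorem mk_eq_of_ofChartSpec_eq {K : Type u} [Field K] {d d' : Fin N → ℕ}
    {c : Fin N → MonoIdx d → K} {c' : Fin N → MonoIdx d' → K} (hc : ChartValid d c (2 * m))
    (hc' : ChartValid d' c' (2 * m))
    (h : ofChartSpec (CommRingCat.of K) hc = ofChartSpec (CommRingCat.of K) hc') :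
    Gr.mk (chartMatrix hc).toGL = Gr.mk (chartMatrix hc').toGL := by
  let x : Spec (CommRingCat.of K) := IsLocalRing.closedPoint K
  let f := (Scheme.ΓSpecIso (CommRingCat.of K)).inv ≫
    (Spec (CommRingCat.of K)).presheaf.germ ⊤ x (Opens.mem_top x)
  have hf : Function.Injective f.hom := f.hom.injective
  apply Gr.map_injective hf
  have h1 := congrFun h x
  rw [ofChartSpec, ofChartSpec, ofChart, ofChart, ← toGL_chartMatrix_map _ hc,
    ← toGL_chartMatrix_map _ hc', glMap_glMap, glMap_glMap] at h1
  exact h1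

end FiberLattice

/-- The spectrum of `ℤ`, in an arbitrary universe. -/
abbrev SpecInt : Scheme.{u} := Spec (CommRingCat.of (ULift.{u} ℤ))

variable (N m) in
/-- The structure morphism of the scheme of bounded lattices. -/
def boundedGrHom : BoundedGr.{u} N m ⟶ SpecInt.{u} := specULiftZIsTerminal.from _

variable (N m) in
/-- The covering by charts. -/
def chartCover : (BoundedGr.{u} N m).OpenCover :=
  (Scheme.LocalRepresentability.glueData (charts_isOpenImmersion.{u} (N := N) (m := m))).openCover

instance : Finite (chartCover.{u} N m).I₀ := inferInstanceAs (Finite (ChartIndex.{u} N m))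

theorem finiteType_chartRing (d : Fin N → ℕ) :
    (Int.castRingHom (ChartRing.{u} N m d)).FiniteType := by
  rw [RingHom.ext_int (Int.castRingHom (ChartRing.{u} N m d)) ((Ideal.Quotient.mk _).comp
    (algebraMap ℤ (MvPolynomial (ChartVars.{u} N d) ℤ)))]
  exact RingHom.FiniteType.comp (RingHom.FiniteType.of_surjective _ Ideal.Quotient.mk_surjective)
    (RingHom.finiteType_algebraMap.2 inferInstance)

theorem locallyOfFiniteType_chart (d : Fin N → ℕ) (f : Chart.{u} N m d ⟶ SpecInt.{u}) :
    LocallyOfFiniteType f := by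
  have h : f = Spec.map (CommRingCat.ofHom
      ((Int.castRingHom (ChartRing.{u} N m d)).comp (ULift.ringEquiv (R := ℤ)).toRingHom)) :=
    specULiftZIsTerminal.hom_ext _ _
  rw [h, HasRingHomProperty.Spec_iff (P := @LocallyOfFiniteType)]
  refine RingHom.FiniteType.comp ?_ (RingHom.FiniteType.of_surjective _ ULift.ringEquiv.surjective)
  exact finiteType_chartRing d

instance : LocallyOfFiniteType (boundedGrHom.{u} N m) := by
  have : IsZariskiLocalAtSource @LocallyOfFiniteType.{u} :=
    HasRingHomProperty.instIsZariskiLocalAtSource (Q := @RingHom.FiniteType.{u, u})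
  rw [IsZariskiLocalAtSource.iff_of_openCover (P := @LocallyOfFiniteType) (chartCover.{u} N m)]
  exact fun i => locallyOfFiniteType_chart _ _

instance : CompactSpace (BoundedGr.{u} N m) :=
  have (i : (chartCover.{u} N m).I₀) : CompactSpace ((chartCover.{u} N m).X i) :=
    inferInstanceAs (CompactSpace (Chart.{u} N m _))
  (chartCover.{u} N m).compactSpace

instance : IsNoetherianRing (ULift.{u} ℤ) :=
  isNoetherianRing_of_ringEquiv ℤ ULift.ringEquiv.symm

instance : IsLocallyNoetherian (BoundedGr.{u} N m) :=
  have : IsLocallyNoetherian SpecInt.{u} := isLocallyNoetherian_Spec.2 inferInstance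
  LocallyOfFiniteType.isLocallyNoetherian (boundedGrHom.{u} N m)

/-- The family of lattices corresponding to a morphism to the scheme of bounded lattices. -/
def boundedPoint {T : Scheme.{u}} (f : T ⟶ BoundedGr.{u} N m) : FiberLattice N T :=
  ((boundedGrRep N m).homEquiv f).1

theorem isLocal_boundedPoint {T : Scheme.{u}} (f : T ⟶ BoundedGr.{u} N m) :
    (boundedPoint f).IsLocal := ((boundedGrRep N m).homEquiv f).2.1

theorem bounded_boundedPoint {T : Scheme.{u}} (f : T ⟶ BoundedGr.{u} N m) (x : T) :
    (boundedPoint f x).Bounded m := ((boundedGrRep N m).homEquiv f).2.2 x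

theorem exists_boundedPoint_eq {T : Scheme.{u}} {ξ : FiberLattice N T} (hξ : ξ.IsLocal)
    (hm : ∀ x, (ξ x).Bounded m) : ∃ f : T ⟶ BoundedGr.{u} N m, boundedPoint f = ξ := by
  let η : (boundedFunctor.{u} N m).obj (op T) := ⟨ξ, hξ, hm⟩
  exact ⟨(boundedGrRep N m).homEquiv.symm η,
    congrArg Subtype.val ((boundedGrRep N m).homEquiv.apply_symm_apply η)⟩

theorem boundedPoint_injective {T : Scheme.{u}} {f g : T ⟶ BoundedGr.{u} N m}
    (h : boundedPoint f = boundedPoint g) : f = g :=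
  (boundedGrRep N m).homEquiv.injective (Subtype.ext h)

theorem boundedPoint_comp {T T' : Scheme.{u}} (f : T ⟶ BoundedGr.{u} N m) (g : T' ⟶ T) :
    boundedPoint (g ≫ f) = (boundedPoint f).pull g :=
  congrArg Subtype.val ((boundedGrRep N m).homEquiv_comp g f)

/-- The scheme of bounded lattices is proper over `ℤ`. -/
theorem isProper_boundedGrHom : IsProper (boundedGrHom.{u} N m) := by
  refine IsProper.of_valuativeCriterion _ (ValuativeCriterion.iff.2 ⟨fun S => ?_, fun S => ?_⟩)
  · let := S.commRing
    let := S.field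
    let := S.algebra
    have := S.domain
    have := S.valuationRing
    have := S.isFractionRing
    -- Existence: the lattice over the field of fractions lies in one chart, and extends in a
    -- possibly different one.
    obtain ⟨d, c, hc, hξ⟩ := FiberLattice.exists_ofChartSpec
      (isLocal_boundedPoint S.i₁) (bounded_boundedPoint S.i₁)
    obtain ⟨d', -, c', hc', h⟩ :=
      (chartMatrix (R := S.K) hc).exists_chart_of_valuationRing (A := S.R)
    obtain ⟨l, hl⟩ := exists_boundedPoint_eq (ξ := FiberLattice.ofChartSpec
      (CommRingCat.of S.R) hc') (FiberLattice.isLocal_ofChart _) (FiberLattice.bounded_ofChart _)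
    refine ⟨⟨l, boundedPoint_injective ?_, specULiftZIsTerminal.hom_ext _ _⟩⟩
    rw [boundedPoint_comp, hl, FiberLattice.pull_ofChartSpec, hξ]
    refine FiberLattice.ofChartSpec_eq _ _ (BoundedMatrix.mk_toGL_eq ?_)
    rw [lattice_chartMatrix]
    exact h
  · let := S.commRing
    let := S.field
    let := S.algebra
    have := S.domain
    have := S.valuationRing
    have := S.isFractionRing
    -- Uniqueness: both lifts are given by chart coordinates over the valuation ring, and free
    -- lattices over a domain are determined by their extension to the field of fractions.
    refine ⟨fun l l' => ?_⟩
    have hll' : l.l = l'.l := by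
      obtain ⟨d, c, hc, hξ⟩ := FiberLattice.exists_ofChartSpec
        (isLocal_boundedPoint l.l) (bounded_boundedPoint l.l)
      obtain ⟨d', c', hc', hξ'⟩ := FiberLattice.exists_ofChartSpec
        (isLocal_boundedPoint l'.l) (bounded_boundedPoint l'.l)
      apply boundedPoint_injective
      have h : (boundedPoint l.l).pull (Spec.map (CommRingCat.ofHom (algebraMap S.R S.K))) =
          (boundedPoint l'.l).pull (Spec.map (CommRingCat.ofHom (algebraMap S.R S.K))) := by
        rw [← boundedPoint_comp, ← boundedPoint_comp, l.fac_left, l'.fac_left]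
      rw [hξ, hξ', FiberLattice.pull_ofChartSpec, FiberLattice.pull_ofChartSpec] at h
      rw [hξ, hξ']
      refine FiberLattice.ofChartSpec_eq _ _ (Gr.map_injective
        (IsFractionRing.injective S.R S.K) ?_)
      rw [Gr.map_mk, Gr.map_mk, toGL_chartMatrix_map, toGL_chartMatrix_map]
      exact FiberLattice.mk_eq_of_ofChartSpec_eq _ _ h
    cases l
    cases l'
    cases hll'
    rfl

end Properness

/-! ### Pullback of bases -/

section PullSec

variable {S T T' : Scheme.{u}}

/-- Pullback along the identity does not change the sections. The inverse is the morphism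
`pullDesc` given by the universal property of the pullback. -/
theorem pullSec_id_bijective (E : LaurentModule S) (U : S.Opens) :
    Function.Bijective (pullSec (𝟙 S) E U) := by
  let f : E ⟶ (push (𝟙 S)).obj E :=
    mkHom (fun U => AddMonoidHom.id (Sec E U)) (fun U a s => by
      rw [push_smul, laurentApp_id]; rfl) (fun _ _ => rfl)
  let k : E ⟶ (pull (𝟙 S)).obj E :=
    mkHom (fun U => (pullSec (𝟙 S) E U : Sec E U →+ Sec ((pull (𝟙 S)).obj E) U))
      (fun U a s => by
        refine (pullSec_smul (𝟙 S) E U a s).trans ?_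
        rw [laurentApp_id]
        rfl)
      (fun i s => pullSec_res (𝟙 S) E i s)
  have h1 (U : S.Opens) (s : Sec E U) : app (pullDesc (𝟙 S) f) U (pullSec (𝟙 S) E U s) = s :=
    pullDesc_pullSec (𝟙 S) f U s
  have h2 : pullDesc (𝟙 S) f ≫ k = 𝟙 _ := pull_hom_ext (𝟙 S) E fun U s => by
    change pullSec (𝟙 S) E U (app (pullDesc (𝟙 S) f) U (pullSec (𝟙 S) E U s)) = _
    rw [h1]
    rfl
  refine ⟨fun s s' h => ?_, fun t => ⟨app (pullDesc (𝟙 S) f) U t, ?_⟩⟩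
  · rw [← h1 U s, h, h1]
  · exact congrArg (fun q => app q U t) h2

theorem isBasisOver_pullSec_id {E : LaurentModule S} {N : ℕ} {U : S.Opens} {e : Fin N → Sec E U}
    (he : IsBasisOver e) : IsBasisOver (M := (pull (𝟙 S)).obj E) (U := U)
      fun i => pullSec (𝟙 S) E U (e i) := by
  intro V h
  have h1 : (fun a : Fin N → LaurentSec V => ∑ i, a i • res (M := (pull (𝟙 S)).obj E) h
      (pullSec (𝟙 S) E U (e i))) = pullSec (𝟙 S) E V ∘ fun a => ∑ i, a i • res h (e i) := by
    funext a
    refine Eq.trans ?_ (map_sum (pullSec (𝟙 S) E V) _ _).symm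
    refine Finset.sum_congr rfl fun i _ => ?_
    rw [pullSec_smul, laurentApp_id, pullSec_res]
    rfl
  rw [h1]
  exact (pullSec_id_bijective E V).comp (he V h)

/-- The pullback of a local basis is a local basis. -/
theorem isBasisOver_pullSec (p : T ⟶ S) {E : LaurentModule S} {N : ℕ} {U : S.Opens}
    {e : Fin N → Sec E U} (he : IsBasisOver e) : IsBasisOver fun i => pullSec p E U (e i) := by
  have h : p ≫ 𝟙 S = p := Category.comp_id p
  have h1 := isBasisOver_compare h (isBasisOver_pullSec_id he)
  have h2 : (fun i => compareSec h E U (pullSec (𝟙 S) E U (e i))) =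
      fun i => pullSec p E U (e i) :=
    funext fun i => (compareSec_pullSec h E U (e i)).trans (res_self _ _)
  exact h2 ▸ h1

end PullSec

/-! ### Bases of lattices -/

section LatticeBases

variable {S T T' : Scheme.{u}} {N : ℕ}

/-- A basis of `M` over `U` that is a basis of `F` over `𝒪[[t]]`. -/
def IsLatticeBasis {M : LaurentModule S} (F : PowerSubmodule M) {U : S.Opens}
    (e : Fin N → Sec M U) : Prop :=
  IsBasisOver e ∧ ∀ (V : S.Opens) (h : V ≤ U) (a : Fin N → LaurentSec V),
      ∑ i, a i • res h (e i) ∈ F.sec V ↔ ∀ i, a i ∈ powerSubring V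

theorem IsLatticeBasis.basis_mem {M : LaurentModule S} {F : PowerSubmodule M} {U : S.Opens}
    {e : Fin N → Sec M U} (h : IsLatticeBasis F e) (i : Fin N) : e i ∈ F.sec U := by
  have := (h.2 U le_rfl (Pi.single i 1)).2 (fun j => by
    rw [Pi.single_apply]
    split_ifs
    · exact one_mem _
    · exact zero_mem _)
  rwa [← coord_basis h.1 i, sum_coord] at this

theorem IsLatticeBasis.mem_iff {M : LaurentModule S} {F : PowerSubmodule M} {U W : S.Opens}
    {e : Fin N → Sec M U} (h : IsLatticeBasis F e) (hW : W ≤ U) (s : Sec M W) :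
    s ∈ F.sec W ↔ ∀ i, coord h.1 hW s i ∈ powerSubring W := by
  rw [← h.2 W hW, sum_coord]

/-- Coordinates with respect to a pulled back basis are the pulled back coordinates. -/
theorem coord_compare {p : T ⟶ S} {g : T' ⟶ T} {p' : T' ⟶ S} (h : g ≫ p = p')
    {E : LaurentModule S} {V : T.Opens} {e : Fin N → Sec ((pull p).obj E) V} (he : IsBasisOver e)
    {W : T.Opens} (hW : W ≤ V) (hW' : g ⁻¹ᵁ W ≤ g ⁻¹ᵁ V) (s : Sec ((pull p).obj E) W) :
    coord (isBasisOver_compare h he) hW' (compareSec h E W s) =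
      fun i => laurentApp g W (coord he hW s i) := by
  refine coord_unique _ _ _ _ ?_
  conv_rhs => rw [← sum_coord he hW s]
  rw [map_sum]
  refine Finset.sum_congr rfl fun i _ => ?_
  rw [compareSec_smul, compareSec_res]

/-- The pullback of a basis of a lattice is a basis of the pullback lattice. -/
theorem IsLatticeBasis.pullback {p : T ⟶ S} {g : T' ⟶ T} {p' : T' ⟶ S} (h : g ≫ p = p')
    {E : LaurentModule S} {F : PowerSubmodule ((pull p).obj E)} {V : T.Opens}
    {e : Fin N → Sec ((pull p).obj E) V} (he : IsLatticeBasis F e) :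
    IsLatticeBasis (F.pullback h) fun i => compareSec h E V (e i) := by
  have he' := isBasisOver_compare h he.1
  refine ⟨he', fun W hW a => ⟨fun ha i => ?_, fun ha => sum_mem fun i _ => ?_⟩⟩
  -- The submodule with the pulled back basis contains the pullbacks of the sections of `F`, so it
  -- contains the submodule they generate.
  · have hle : F.pullback h ≤ PowerSubmodule.ofBasis he' := by
      rw [PowerSubmodule.pullback_le_iff]
      intro U s hs j
      have hc := (he.mem_iff (inter_le_right V U) (res (inter_le_left V U) s)).1
        (F.res_mem _ hs) j
      have h2 : res (M := (pull p').obj E) (inter_le_left (g ⁻¹ᵁ V) (g ⁻¹ᵁ U))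
          (compareSec h E U s) = res (inter_preimage g V U)
            (compareSec h E _ (res (inter_le_left V U) s)) := by
        rw [compareSec_res]
        exact (res_res (M := (pull p').obj E) _ _ _).symm
      rw [h2, coord_res he' (fun _ hx => inter_le_right V U hx)]
      exact resRing_mem_power _ (Eq.mpr (congrArg (· ∈ powerSubring _) (congrFun (coord_compare h
        he.1 (inter_le_right V U) _ _) j)) (laurentApp_mem_power g hc))
    have h3 := hle W ha i
    rw [coord_res he' hW (inter_le_left _ W), coord_unique he' hW _ a rfl] at h3
    exact fun x => h3 ⟨x.1, le_inter hW x.2⟩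
  · exact PowerSubmodule.smul_mem _ (ha i) (PowerSubmodule.res_mem _ _
      (PowerSubmodule.compareSec_mem_pullback h (he.basis_mem i)))

end LatticeBases

/-! ### Coordinates at the points -/

section StalkCoordinates

variable {S : Scheme.{u}} {N : ℕ}

/-- The section of `𝒪_S((t))` given by a Laurent series of functions. -/
def germsSec (U : S.Opens) : LaurentSeries Γ(S, U) →+* LaurentSec U where
  toFun s := ⟨germs U s, fun x => ⟨U, x.2, le_rfl, s, fun _ => rfl⟩⟩
  map_zero' := Subtype.ext (map_zero _)
  map_one' := Subtype.ext (map_one _)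
  map_add' _ _ := Subtype.ext (map_add _ _ _)
  map_mul' _ _ := Subtype.ext (map_mul _ _ _)

theorem germs_injective (U : S.Opens) {a b : LaurentSeries Γ(S, U)}
    (h : ∀ y (hy : y ∈ U), laurentMap (S.presheaf.germ U y hy).hom a =
      laurentMap (S.presheaf.germ U y hy).hom b) : a = b :=
  HahnSeries.ext (funext fun n => TopCat.Presheaf.section_ext S.sheaf U _ _ fun y hy =>
    congrArg (fun c => c.coeff n) (h y hy))

/-- Finitely many sections of `𝒪_S((t))` are simultaneously given by Laurent series near a point. -/
theorem exists_germsSec {ι : Type*} [Finite ι] {U : S.Opens} (a : ι → LaurentSec U) {x : S}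
    (hx : x ∈ U) : ∃ (V : S.Opens) (_ : x ∈ V) (hV : V ≤ U) (s : ι → LaurentSeries Γ(S, V)),
      ∀ i y (hy : y ∈ V), (a i).1 ⟨y, hV hy⟩ = laurentMap (S.presheaf.germ V y hy).hom (s i) := by
  obtain ⟨V, hxV, H⟩ := exists_open_forall (x := x) (fun (i : ι) V => ∃ s : LaurentSeries Γ(S, V),
      ∀ y (hy : y ∈ V) (hy' : y ∈ U), (a i).1 ⟨y, hy'⟩ =
        laurentMap (S.presheaf.germ V y hy).hom s)
    (fun i {V V'} hV ⟨s, hs⟩ => ⟨laurentMap (S.presheaf.map (homOfLE hV).op).hom s,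
      fun y hy hy' => (hs y (hV hy) hy').trans (germs_res hV s ⟨y, hy⟩).symm⟩)
    (fun i => by
      obtain ⟨V, hxV, h, s, hs⟩ := (a i).2 ⟨x, hx⟩
      exact ⟨V, hxV, s, fun y hy hy' => hs ⟨y, hy⟩⟩)
  choose s hs using H
  refine ⟨V ⊓ U, ⟨hxV, hx⟩, inf_le_right,
    fun i => laurentMap (S.presheaf.map (homOfLE inf_le_left).op).hom (s i), fun i y hy => ?_⟩
  exact (hs i y hy.1 hy.2).trans (germs_res inf_le_left (s i) ⟨y, hy⟩).symm

variable {M : LaurentModule S} {V : S.Opens} {b : Fin N → Sec M V} (hb : IsBasisOver b)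

/-- The coordinates of a section at a point. -/
def stalkCoord {W : S.Opens} (h : W ≤ V) (s : Sec M W) (y : S) (hy : y ∈ W) :
    Fin N → StalkLaurent S y := fun i => (coord hb h s i).1 ⟨y, hy⟩

theorem stalkCoord_res {W W' : S.Opens} (h : W ≤ V) (h' : W' ≤ W) (s : Sec M W) (y : S)
    (hy : y ∈ W') : stalkCoord hb (h'.trans h) (res h' s) y hy = stalkCoord hb h s y (h' hy) := by
  funext i
  rw [stalkCoord, coord_res hb h h']
  rfl

theorem stalkCoord_ext {W : S.Opens} (h : W ≤ V) {s s' : Sec M W}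
    (H : ∀ y hy, stalkCoord hb h s y hy = stalkCoord hb h s' y hy) : s = s' := by
  rw [← sum_coord hb h s, ← sum_coord hb h s']
  refine Finset.sum_congr rfl fun i _ => ?_
  congr 1
  exact Subtype.ext (funext fun y => congrFun (H y.1 y.2) i)

theorem stalkCoord_sum_smul {W : S.Opens} (h : W ≤ V) (a : Fin N → LaurentSec W)
    (s : Fin N → Sec M W) (y : S) (hy : y ∈ W) (i : Fin N) :
    stalkCoord hb h (∑ j, a j • s j) y hy i =
      ∑ j, (a j).1 ⟨y, hy⟩ * stalkCoord hb h (s j) y hy i := by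
  let φ : Sec M W →+ StalkLaurent S y :=
    AddMonoidHom.mk' (fun s => stalkCoord hb h s y hy i) fun s s' => by
      rw [stalkCoord, coord_add]
      rfl
  refine (map_sum φ _ _).trans (Finset.sum_congr rfl fun j _ => ?_)
  change (coord hb h (a j • s j) i).1 ⟨y, hy⟩ = _
  rw [coord_smul]
  rfl

/-- The section with given Laurent series as coordinates. -/
def ofCoord {W : S.Opens} (h : W ≤ V) (v : Fin N → LaurentSeries Γ(S, W)) : Sec M W :=
  ∑ i, germsSec W (v i) • res h (b i)

theorem stalkCoord_ofCoord {W : S.Opens} (h : W ≤ V) (v : Fin N → LaurentSeries Γ(S, W)) (y : S)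
    (hy : y ∈ W) : stalkCoord hb h (ofCoord (b := b) h v) y hy =
      fun i => laurentMap (S.presheaf.germ W y hy).hom (v i) := by
  funext i
  rw [stalkCoord, coord_unique hb h (ofCoord h v) _ rfl]
  rfl

end StalkCoordinates

/-! ### Frames -/

section Frames

variable {S T T' : Scheme.{u}} {N : ℕ}

/-- Membership of a vector in the lattice spanned by the columns of a matrix: its coordinates with
respect to the columns are power series. -/
def Gr.Mem {R : Type*} [CommRing R] (q : Gr N R) (v : Fin N → LaurentSeries R) : Prop :=
  ∃ g, Gr.mk g = q ∧ ∀ i, (g⁻¹.1.mulVec v) i ∈ (HahnSeries.ofPowerSeries ℤ R).range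

theorem Gr.mem_mk {R : Type*} [CommRing R] {g : GL (Fin N) (LaurentSeries R)}
    {v : Fin N → LaurentSeries R} :
    (Gr.mk g).Mem v ↔ ∀ i, (g⁻¹.1.mulVec v) i ∈ (HahnSeries.ofPowerSeries ℤ R).range := by
  refine ⟨fun ⟨h, hh, H⟩ i => ?_, fun H => ⟨g, rfl, H⟩⟩
  rw [Gr.mk_eq_iff, ← inv_mem_iff, mul_inv_rev, inv_inv, mem_powerGL] at hh
  have h1 : g⁻¹.1.mulVec v = (g⁻¹ * h).1.mulVec (h⁻¹.1.mulVec v) := by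
    rw [Matrix.mulVec_mulVec, ← Units.val_mul, mul_inv_cancel_right]
  rw [h1]
  change (∑ j, (g⁻¹ * h).1 i j * (h⁻¹.1.mulVec v) j) ∈ _
  exact sum_mem fun j _ => mul_mem (hh.1 i j) (H j)

/-- A class of invertible matrices is determined by the lattice. -/
theorem Gr.mk_eq_of_mem {R : Type*} [CommRing R] {g h : GL (Fin N) (LaurentSeries R)}
    (H : ∀ j, (Gr.mk g).Mem (h.1.col j)) (H' : ∀ j, (Gr.mk h).Mem (g.1.col j)) :
    Gr.mk g = Gr.mk h := by
  rw [Gr.mk_eq_iff, mem_powerGL]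
  refine ⟨fun i j => Gr.mem_mk.1 (H j) i, fun i j => ?_⟩
  rw [mul_inv_rev, inv_inv]
  exact Gr.mem_mk.1 (H' j) i

theorem Gr.mem_mk_mulVec {R : Type*} [CommRing R] {g : GL (Fin N) (LaurentSeries R)}
    {v : Fin N → LaurentSeries R} :
    (Gr.mk g).Mem (g.1.mulVec v) ↔ ∀ i, v i ∈ (HahnSeries.ofPowerSeries ℤ R).range := by
  rw [Gr.mem_mk, Matrix.mulVec_mulVec, ← Units.val_mul, inv_mul_cancel, Units.val_one,
    Matrix.one_mulVec]

theorem Gr.Mem.map {R R' : Type*} [CommRing R] [CommRing R'] (f : R →+* R') {q : Gr N R}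
    {v : Fin N → LaurentSeries R} (h : q.Mem v) :
    (Gr.map f q).Mem fun i => laurentMap f (v i) := by
  obtain ⟨g, rfl, h⟩ := h
  refine Gr.mem_mk.2 fun i => ?_
  rw [← map_inv]
  have h1 : ((glMap f g⁻¹).1.mulVec fun i => laurentMap f (v i)) i =
      laurentMap f ((g⁻¹.1.mulVec v) i) := by
    simp only [Matrix.mulVec, dotProduct, map_sum, map_mul]
    rfl
  rw [h1]
  exact laurentMap_mem_range f (h i)

theorem Gr.Mem.of_map {R R' : Type*} [CommRing R] [CommRing R'] {f : R →+* R'}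
    (hf : Function.Injective f) {q : Gr N R} {v : Fin N → LaurentSeries R}
    (h : (Gr.map f q).Mem fun i => laurentMap f (v i)) : q.Mem v := by
  obtain ⟨g, rfl⟩ := Gr.mk_surjective q
  refine Gr.mem_mk.2 fun i => mem_power_of_injective hf ?_
  have h2 := Gr.mem_mk.1 h i
  rw [← map_inv] at h2
  have h1 : ((glMap f g⁻¹).1.mulVec fun i => laurentMap f (v i)) i =
      laurentMap f ((g⁻¹.1.mulVec v) i) := by
    simp only [Matrix.mulVec, dotProduct, map_sum, map_mul]
    rfl
  rwa [h1] at h2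

variable {M : LaurentModule S} {V : S.Opens} {b : Fin N → Sec M V} (hb : IsBasisOver b)

/-- The columns of `g`, in coordinates with respect to `b`, span `F` over `𝒪[[t]]`. -/
def IsFrame (F : PowerSubmodule M) {W : S.Opens} (hW : W ≤ V)
    (g : GL (Fin N) (LaurentSeries Γ(S, W))) : Prop :=
  ∀ (W' : S.Opens) (h : W' ≤ W) (s : Sec M W'), s ∈ F.sec W' ↔ ∀ y (hy : y ∈ W'),
    (Gr.mk (glMap (S.presheaf.germ W y (h hy)).hom g)).Mem (stalkCoord hb (h.trans hW) s y hy)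

/-- A lattice basis whose coordinates are given by a matrix `g` of Laurent series of functions
gives a frame. -/
theorem isFrame_of_isLatticeBasis {F : PowerSubmodule M} {W : S.Opens} (hW : W ≤ V)
    {e : Fin N → Sec M W} (he : IsLatticeBasis F e) (g : GL (Fin N) (LaurentSeries Γ(S, W)))
    (h : ∀ j y (hy : y ∈ W), stalkCoord hb hW (e j) y hy =
      fun i => laurentMap (S.presheaf.germ W y hy).hom (g.1 i j)) : IsFrame hb F hW g := by
  intro W' h' s
  have h1 (y : S) (hy : y ∈ W') : stalkCoord hb (h'.trans hW) s y hy =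
      (glMap (S.presheaf.germ W y (h' hy)).hom g).1.mulVec fun j =>
        (coord he.1 h' s j).1 ⟨y, hy⟩ := by
    funext i
    conv_lhs => rw [← sum_coord he.1 h' s]
    rw [stalkCoord_sum_smul]
    refine Finset.sum_congr rfl fun j _ => ?_
    rw [stalkCoord_res hb hW h', h, mul_comm]
    rfl
  rw [he.mem_iff h']
  refine ⟨fun H y hy => ?_, fun H i y => ?_⟩
  · rw [h1, Gr.mem_mk_mulVec]
    exact fun i => H i ⟨y, hy⟩
  · have := H y.1 y.2
    rw [h1, Gr.mem_mk_mulVec] at this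
    exact this i

/-- The lattice basis given by a frame. -/
def frameBasis {W : S.Opens} (hW : W ≤ V) (g : GL (Fin N) (LaurentSeries Γ(S, W))) (j : Fin N) :
    Sec M W := ofCoord (b := b) hW fun i => g.1 i j

theorem stalkCoord_comb {W W' : S.Opens} (hW : W ≤ V) (g : GL (Fin N) (LaurentSeries Γ(S, W)))
    (h : W' ≤ W) (a : Fin N → LaurentSec W') (y : S) (hy : y ∈ W') :
    stalkCoord hb (h.trans hW) (∑ j, a j • res h (frameBasis (b := b) hW g j)) y hy =
      (glMap (S.presheaf.germ W y (h hy)).hom g).1.mulVec fun j => (a j).1 ⟨y, hy⟩ := by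
  funext i
  rw [stalkCoord_sum_smul]
  refine Finset.sum_congr rfl fun j _ => ?_
  rw [stalkCoord_res hb hW h, frameBasis, stalkCoord_ofCoord, mul_comm]
  rfl

/-- The columns of an invertible matrix form a basis of the ambient module. -/
theorem isBasisOver_frameBasis (hb : IsBasisOver b) {W : S.Opens} (hW : W ≤ V)
    (g : GL (Fin N) (LaurentSeries Γ(S, W))) :
    IsBasisOver (frameBasis (b := b) hW g) := by
  intro W' h
  refine ⟨fun a a' H => ?_, fun s => ?_⟩
  · have h1 (y : S) (hy : y ∈ W') : (fun j => (a j).1 ⟨y, hy⟩) = fun j => (a' j).1 ⟨y, hy⟩ := by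
      have h2 := congrArg (fun s => (glMap (S.presheaf.germ W y (h hy)).hom g)⁻¹.1.mulVec
        (stalkCoord hb (h.trans hW) s y hy)) H
      simp only [stalkCoord_comb] at h2
      rwa [Matrix.mulVec_mulVec, Matrix.mulVec_mulVec, ← Units.val_mul, inv_mul_cancel,
        Units.val_one, Matrix.one_mulVec, Matrix.one_mulVec] at h2
    exact funext fun j => Subtype.ext (funext fun y => congrFun (h1 y.1 y.2) j)
  · refine ⟨fun j => ∑ k, resRing h (germsSec W (g⁻¹.1 j k)) * coord hb (h.trans hW) s k,
      stalkCoord_ext hb (h.trans hW) fun y hy => ?_⟩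
    rw [stalkCoord_comb]
    have h1 : (fun j => (∑ k, resRing h (germsSec W (g⁻¹.1 j k)) *
        coord hb (h.trans hW) s k).1 ⟨y, hy⟩) =
        (glMap (S.presheaf.germ W y (h hy)).hom g⁻¹).1.mulVec
          (stalkCoord hb (h.trans hW) s y hy) := by
      funext j
      let φ : LaurentSec W' →+ StalkLaurent S y :=
        AddMonoidHom.mk' (fun a => a.1 ⟨y, hy⟩) fun _ _ => rfl
      exact map_sum φ _ _
    rw [h1, Matrix.mulVec_mulVec, map_inv, ← Units.val_mul, mul_inv_cancel, Units.val_one,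
      Matrix.one_mulVec]

theorem IsFrame.isLatticeBasis {F : PowerSubmodule M} {W : S.Opens} {hW : W ≤ V}
    {g : GL (Fin N) (LaurentSeries Γ(S, W))} (hg : IsFrame hb F hW g) :
    IsLatticeBasis F (frameBasis (b := b) hW g) := by
  refine ⟨isBasisOver_frameBasis hb hW g, fun W' h a => ?_⟩
  rw [hg W' h]
  simp only [stalkCoord_comb, Gr.mem_mk_mulVec]
  exact ⟨fun H i y => H y.1 y.2 i, fun H y hy i => H i ⟨y, hy⟩⟩

/-- A lattice has a frame near every point. The entries of the matrices of change of bases between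
a lattice basis and `b` are sections of `𝒪((t))`, and finitely many of these are Laurent series of
functions on a common neighbourhood. -/
theorem PowerSubmodule.IsLattice.exists_frame {F : PowerSubmodule M} (hF : F.IsLattice N) {x : S}
    (hx : x ∈ V) : ∃ (W : S.Opens) (_ : x ∈ W) (hW : W ≤ V)
      (g : GL (Fin N) (LaurentSeries Γ(S, W))), IsFrame hb F hW g := by
  obtain ⟨U, hxU, e, he, heF⟩ := hF x
  replace heF : IsLatticeBasis F e := ⟨he, heF⟩
  let c : (Fin N × Fin N) ⊕ (Fin N × Fin N) → LaurentSec (U ⊓ V) := Sum.elim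
    (fun p => coord hb inf_le_right (res inf_le_left (e p.2)) p.1)
    (fun p => coord he inf_le_left (res inf_le_right (b p.2)) p.1)
  obtain ⟨W, hxW, hW, s, hs⟩ := exists_germsSec c (x := x) ⟨hxU, hx⟩
  have hWU : W ≤ U := hW.trans inf_le_left
  have hWV : W ≤ V := hW.trans inf_le_right
  let A : Matrix (Fin N) (Fin N) (LaurentSeries Γ(S, W)) := fun i j => s (Sum.inl (i, j))
  let B : Matrix (Fin N) (Fin N) (LaurentSeries Γ(S, W)) := fun i j => s (Sum.inr (i, j))
  have hA (j : Fin N) (y : S) (hy : y ∈ W) : stalkCoord hb hWV (res hWU (e j)) y hy =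
      fun i => laurentMap (S.presheaf.germ W y hy).hom (A i j) := by
    funext i
    rw [← hs (Sum.inl (i, j)) y hy, ← res_res inf_le_left hW, stalkCoord_res hb inf_le_right hW]
    rfl
  have hB (j : Fin N) (y : S) (hy : y ∈ W) : stalkCoord he hWU (res hWV (b j)) y hy =
      fun i => laurentMap (S.presheaf.germ W y hy).hom (B i j) := by
    funext i
    rw [← hs (Sum.inr (i, j)) y hy, ← res_res inf_le_right hW, stalkCoord_res he inf_le_left hW]
    rfl
  -- The two matrices of change of bases are inverse to each other; the statement is symmetric in
  -- the two bases.
  have h1 {V V' : S.Opens} {b : Fin N → Sec M V} {e : Fin N → Sec M V'} (hb : IsBasisOver b)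
      (he : IsBasisOver e) (hV : W ≤ V) (hV' : W ≤ V')
      (A B : Matrix (Fin N) (Fin N) (LaurentSeries Γ(S, W)))
      (hA : ∀ j y (hy : y ∈ W), stalkCoord hb hV (res hV' (e j)) y hy =
        fun i => laurentMap (S.presheaf.germ W y hy).hom (A i j))
      (hB : ∀ j y (hy : y ∈ W), stalkCoord he hV' (res hV (b j)) y hy =
        fun i => laurentMap (S.presheaf.germ W y hy).hom (B i j)) : A * B = 1 := by
    refine Matrix.ext fun i k => germs_injective W fun y hy => ?_
    have h2 : stalkCoord hb hV (res hV (b k)) y hy i = (1 : Matrix _ _ _) i k := by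
      rw [stalkCoord_res hb le_rfl hV, stalkCoord, coord_basis, Pi.single_apply, Matrix.one_apply]
      split_ifs <;> rfl
    have h3 : stalkCoord hb hV (res hV (b k)) y hy i =
        ∑ j, laurentMap (S.presheaf.germ W y hy).hom (B j k) *
          laurentMap (S.presheaf.germ W y hy).hom (A i j) := by
      conv_lhs => rw [← sum_coord he hV' (res hV (b k))]
      rw [stalkCoord_sum_smul]
      refine Finset.sum_congr rfl fun j _ => ?_
      rw [hA]
      congr 1
      exact congrFun (hB k y hy) j
    rw [Matrix.mul_apply, map_sum]
    simp only [map_mul]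
    rw [Matrix.one_apply, apply_ite (laurentMap (S.presheaf.germ W y hy).hom), map_one, map_zero,
      ← Matrix.one_apply, ← h2, h3]
    exact Finset.sum_congr rfl fun j _ => mul_comm _ _
  refine ⟨W, hxW, hWV, ⟨A, B, h1 hb he hWV hWU A B hA hB, h1 he hb hWU hWV B A hB hA⟩, ?_⟩
  refine isFrame_of_isLatticeBasis hb hWV (e := fun j => res hWU (e j)) ⟨?_, ?_⟩ _ hA
  · intro W' h
    simpa only [res_res] using he W' (h.trans hWU)
  · intro W' h a
    simpa only [res_res] using heF.2 W' (h.trans hWU) a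

theorem isLattice_of_frames {F : PowerSubmodule M}
    (h : ∀ x : S, ∃ (V : S.Opens) (b : Fin N → Sec M V) (hb : IsBasisOver b) (W : S.Opens)
      (_ : x ∈ W) (hW : W ≤ V) (g : GL (Fin N) (LaurentSeries Γ(S, W))), IsFrame hb F hW g) :
    F.IsLattice N := fun x => by
  obtain ⟨V, b, hb, W, hxW, hW, g, hg⟩ := h x
  exact ⟨W, hxW, _, hg.isLatticeBasis⟩

/-- At a point, all frames of a lattice give the same coset. -/
theorem IsFrame.mk_eq {F : PowerSubmodule M} {W W' : S.Opens} {hW : W ≤ V} {hW' : W' ≤ V}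
    {g : GL (Fin N) (LaurentSeries Γ(S, W))} {g' : GL (Fin N) (LaurentSeries Γ(S, W'))}
    (hg : IsFrame hb F hW g) (hg' : IsFrame hb F hW' g') {y : S} (hy : y ∈ W) (hy' : y ∈ W') :
    Gr.mk (glMap (S.presheaf.germ W y hy).hom g) =
      Gr.mk (glMap (S.presheaf.germ W' y hy').hom g') := by
  have key {W W' : S.Opens} {hW : W ≤ V} {hW' : W' ≤ V} {g : GL (Fin N) (LaurentSeries Γ(S, W))}
      {g' : GL (Fin N) (LaurentSeries Γ(S, W'))} (hg : IsFrame hb F hW g)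
      (hg' : IsFrame hb F hW' g') (hy : y ∈ W) (hy' : y ∈ W') (j : Fin N) :
      (Gr.mk (glMap (S.presheaf.germ W y hy).hom g)).Mem
        ((glMap (S.presheaf.germ W' y hy').hom g').1.col j) := by
    have h1 := (hg (W ⊓ W') inf_le_left (res inf_le_right (frameBasis (b := b) hW' g' j))).1
      (F.res_mem _ (hg'.isLatticeBasis.basis_mem j)) y ⟨hy, hy'⟩
    exact Eq.mp (congrArg (Gr.Mem _) ((stalkCoord_res hb hW' inf_le_right _ y ⟨hy, hy'⟩).trans
      (stalkCoord_ofCoord hb hW' _ y hy'))) h1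
  exact Gr.mk_eq_of_mem (key hg hg' hy hy') (key hg' hg hy' hy)

theorem stalkCoord_compare {p : T ⟶ S} {q : T' ⟶ T} {p' : T' ⟶ S} (h : q ≫ p = p')
    {E : LaurentModule S} {V : T.Opens} {b : Fin N → Sec ((pull p).obj E) V} (hb : IsBasisOver b)
    {W : T.Opens} (hW : W ≤ V) (hW' : q ⁻¹ᵁ W ≤ q ⁻¹ᵁ V) (s : Sec ((pull p).obj E) W) (z : T')
    (hz : q z ∈ W) :
    stalkCoord (isBasisOver_compare h hb) hW' (compareSec h E W s) z hz =
      fun i => laurentMap (q.stalkMap z).hom (stalkCoord hb hW s (q z) hz i) := by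
  funext i
  exact congrArg (fun a : LaurentSec _ => a.1 ⟨z, hz⟩) (congrFun (coord_compare h hb hW hW' s) i)

/-- The pullback of a frame is a frame of the pullback lattice. -/
theorem IsFrame.pullback {p : T ⟶ S} {q : T' ⟶ T} {p' : T' ⟶ S} (h : q ≫ p = p')
    {E : LaurentModule S} {F : PowerSubmodule ((pull p).obj E)} {V : T.Opens}
    {b : Fin N → Sec ((pull p).obj E) V} {hb : IsBasisOver b} {W : T.Opens} {hW : W ≤ V}
    {g : GL (Fin N) (LaurentSeries Γ(T, W))} (hg : IsFrame hb F hW g)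
    (hW' : q ⁻¹ᵁ W ≤ q ⁻¹ᵁ V) :
    IsFrame (isBasisOver_compare h hb) (F.pullback h) hW' (glMap (q.app W).hom g) := by
  refine isFrame_of_isLatticeBasis _ _ (hg.isLatticeBasis.pullback h) _ fun j z hz => ?_
  refine (stalkCoord_compare h hb hW hW' _ z hz).trans ?_
  funext i
  exact (congrArg _ (congrFun (stalkCoord_ofCoord hb hW (fun i => g.1 i j) (q z) hz) i)).trans
    (stalk_germs q W (g.1 i j) z hz)

end Frames

/-! ### Lattices in a module with a basis, as families -/

section Families

variable {S T T' : Scheme.{u}} {N : ℕ}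

/-- The vectors that belong to a free lattice. -/
def Gr.vectors {R : Type*} [CommRing R] (q : Gr N R) : AddSubgroup (Fin N → LaurentSeries R) where
  carrier := {v | q.Mem v}
  zero_mem' := by
    obtain ⟨g, rfl⟩ := q.mk_surjective
    refine Gr.mem_mk.2 fun i => ?_
    rw [Matrix.mulVec_zero]
    exact zero_mem _
  add_mem' := by
    obtain ⟨g, rfl⟩ := q.mk_surjective
    intro v w hv hw
    refine Gr.mem_mk.2 fun i => ?_
    rw [Matrix.mulVec_add]
    exact add_mem (Gr.mem_mk.1 hv i) (Gr.mem_mk.1 hw i)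
  neg_mem' := by
    obtain ⟨g, rfl⟩ := q.mk_surjective
    intro v hv
    refine Gr.mem_mk.2 fun i => ?_
    rw [Matrix.mulVec_neg]
    exact neg_mem (Gr.mem_mk.1 hv i)

theorem Gr.Mem.smul {R : Type*} [CommRing R] {q : Gr N R} {v : Fin N → LaurentSeries R}
    (hv : q.Mem v) {a : LaurentSeries R} (ha : a ∈ (HahnSeries.ofPowerSeries ℤ R).range) :
    q.Mem (a • v) := by
  obtain ⟨g, rfl⟩ := q.mk_surjective
  refine Gr.mem_mk.2 fun i => ?_
  rw [Matrix.mulVec_smul]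
  exact mul_mem ha (Gr.mem_mk.1 hv i)

section

variable {M : LaurentModule T} {V : T.Opens} {b : Fin N → Sec M V} (hb : IsBasisOver b)

/-- `ξ` is the family of stalks of the lattice `F`, in coordinates with respect to the basis `b`. -/
def HasFamily (F : PowerSubmodule M) (ξ : FiberLattice N T) : Prop :=
  ∀ (W : T.Opens) (hW : W ≤ V) (g : GL (Fin N) (LaurentSeries Γ(T, W))), IsFrame hb F hW g →
    ∀ y (hy : y ∈ W), ξ y = Gr.mk (glMap (T.presheaf.germ W y hy).hom g)

theorem exists_hasFamily (hV : ⊤ ≤ V) {F : PowerSubmodule M} (hF : F.IsLattice N) :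
    ∃ ξ : FiberLattice N T, ξ.IsLocal ∧ HasFamily hb F ξ := by
  choose W hxW hW g hg using fun x : T => hF.exists_frame hb (hV (Opens.mem_top x))
  have h : HasFamily hb F fun x => Gr.mk (glMap (T.presheaf.germ (W x) x (hxW x)).hom (g x)) :=
    fun W' hW' g' hg' y hy => (hg y).mk_eq hb hg' (hxW y) hy
  exact ⟨_, fun x => ⟨W x, hxW x, g x, h _ _ _ (hg x)⟩, h⟩

theorem HasFamily.unique (hV : ⊤ ≤ V) {F : PowerSubmodule M} (hF : F.IsLattice N)
    {ξ ξ' : FiberLattice N T} (h : HasFamily hb F ξ) (h' : HasFamily hb F ξ') : ξ = ξ' := by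
  funext x
  obtain ⟨W, hxW, hW, g, hg⟩ := hF.exists_frame hb (hV (Opens.mem_top x))
  rw [h W hW g hg x hxW, h' W hW g hg x hxW]

/-- A lattice is determined by its stalks: a section belongs to it if its germs belong to the
members of the family. -/
theorem HasFamily.mem_iff (hV : ⊤ ≤ V) {F : PowerSubmodule M} (hF : F.IsLattice N)
    {ξ : FiberLattice N T} (h : HasFamily hb F ξ) {W : T.Opens} (s : Sec M W) :
    s ∈ F.sec W ↔ ∀ y (hy : y ∈ W), (ξ y).Mem (stalkCoord hb (le_top.trans hV) s y hy) := by
  constructor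
  · intro hs y hy
    obtain ⟨W', hyW', hW', g, hg⟩ := hF.exists_frame hb (hV (Opens.mem_top y))
    have h1 := (hg (W ⊓ W') inf_le_right (res inf_le_left s)).1 (F.res_mem _ hs) y ⟨hy, hyW'⟩
    rw [← h W' hW' g hg y hyW'] at h1
    exact Eq.mp (congrArg (Gr.Mem _) (stalkCoord_res hb (le_top.trans hV) inf_le_left s y
      ⟨hy, hyW'⟩)) h1
  · intro H
    refine F.mem_of_local fun x hx => ?_
    obtain ⟨W', hyW', hW', g, hg⟩ := hF.exists_frame hb (hV (Opens.mem_top x))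
    refine ⟨W ⊓ W', ⟨hx, hyW'⟩, inf_le_left, (hg _ inf_le_right _).2 fun y hy => ?_⟩
    rw [← h W' hW' g hg y hy.2]
    exact Eq.mpr (congrArg (Gr.Mem _) (stalkCoord_res hb (le_top.trans hV) inf_le_left s y hy))
      (H y hy.1)

theorem HasFamily.eq (hV : ⊤ ≤ V) {F F' : PowerSubmodule M} (hF : F.IsLattice N)
    (hF' : F'.IsLattice N) {ξ : FiberLattice N T} (h : HasFamily hb F ξ)
    (h' : HasFamily hb F' ξ) : F = F' :=
  PowerSubmodule.ext (funext fun W => AddSubgroup.ext fun s => by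
    rw [h.mem_iff hb hV hF, h'.mem_iff hb hV hF'])

/-- The sections whose germs lie in the given lattices. -/
def ofFamily (hV : ⊤ ≤ V) (ξ : FiberLattice N T) : PowerSubmodule M where
  sec W := ⨅ y : W, (ξ y.1).vectors.comap
    (AddMonoidHom.mk' (fun s => stalkCoord hb (le_top.trans hV) s y.1 y.2) fun s s' => by
      funext i
      rw [stalkCoord, coord_add]
      rfl)
  smul_mem ha s hs := by
    rw [AddSubgroup.mem_iInf] at hs ⊢
    intro y
    have h1 := (show (ξ y.1).Mem _ from hs y).smul (ha y)
    refine Eq.mp (congrArg (Gr.Mem _) (funext fun i => ?_)) h1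
    rw [AddMonoidHom.mk'_apply, stalkCoord, coord_smul]
    rfl
  res_mem h s hs := by
    rw [AddSubgroup.mem_iInf] at hs ⊢
    intro y
    exact Eq.mpr (congrArg (Gr.Mem _) (stalkCoord_res hb (le_top.trans hV) h s y.1 y.2))
      (hs ⟨y.1, h y.2⟩)
  mem_of_local {U s} H := by
    rw [AddSubgroup.mem_iInf]
    intro y
    obtain ⟨W, hyW, h, hW⟩ := H y.1 y.2
    rw [AddSubgroup.mem_iInf] at hW
    exact Eq.mp (congrArg (Gr.Mem _) (stalkCoord_res hb (le_top.trans hV) h s y.1 hyW))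
      (hW ⟨y.1, hyW⟩)

theorem mem_ofFamily (hV : ⊤ ≤ V) (ξ : FiberLattice N T) {W : T.Opens} (s : Sec M W) :
    s ∈ (ofFamily hb hV ξ).sec W ↔
      ∀ y (hy : y ∈ W), (ξ y).Mem (stalkCoord hb (le_top.trans hV) s y hy) :=
  AddSubgroup.mem_iInf.trans ⟨fun h y hy => h ⟨y, hy⟩, fun h y => h y.1 y.2⟩

theorem isFrame_ofFamily (hV : ⊤ ≤ V) {ξ : FiberLattice N T} {W : T.Opens} (hW : W ≤ V)
    (g : GL (Fin N) (LaurentSeries Γ(T, W)))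
    (h : ∀ y (hy : y ∈ W), ξ y = Gr.mk (glMap (T.presheaf.germ W y hy).hom g)) :
    IsFrame hb (ofFamily hb hV ξ) hW g := fun W' hW' s =>
  (mem_ofFamily hb hV ξ s).trans (forall₂_congr fun y hy => by rw [h y (hW' hy)])

theorem isLattice_ofFamily (hV : ⊤ ≤ V) {ξ : FiberLattice N T} (hξ : ξ.IsLocal) :
    (ofFamily hb hV ξ).IsLattice N := isLattice_of_frames fun x => by
  obtain ⟨W, hxW, g, hg⟩ := hξ x
  exact ⟨V, b, hb, W, hxW, le_top.trans hV, g, isFrame_ofFamily hb hV _ g hg⟩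

theorem hasFamily_ofFamily (hV : ⊤ ≤ V) {ξ : FiberLattice N T} (hξ : ξ.IsLocal) :
    HasFamily hb (ofFamily hb hV ξ) ξ := by
  intro W hW g hg y hy
  obtain ⟨W', hxW', g', hg'⟩ := hξ y
  rw [hg' y hxW']
  exact (isFrame_ofFamily hb hV (le_top.trans hV) g' hg').mk_eq hb hg hxW' hy

end

/-- The family of a pullback lattice is the pullback of the family. -/
theorem HasFamily.pullback {p : T ⟶ S} {q : T' ⟶ T} {p' : T' ⟶ S} (h : q ≫ p = p')
    {E : LaurentModule S} {F : PowerSubmodule ((pull p).obj E)} (hF : F.IsLattice N) {V : T.Opens}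
    {b : Fin N → Sec ((pull p).obj E) V} {hb : IsBasisOver b} (hV : ⊤ ≤ V)
    {ξ : FiberLattice N T} (hξ : HasFamily hb F ξ) :
    HasFamily (isBasisOver_compare h hb) (F.pullback h) (ξ.pull q) := by
  intro W hW g hg y hy
  obtain ⟨W', hxW', hW', g', hg'⟩ := hF.exists_frame hb (hV (Opens.mem_top (q y)))
  have h1 := (hg'.pullback h (fun _ hx => hW' hx)).mk_eq (isBasisOver_compare h hb) hg
    (y := y) hxW' hy
  rw [← h1, FiberLattice.pull, hξ W' hW' g' hg' (q y) hxW']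
  exact FiberLattice.map_germ_stalkMap q g' y hxW'

/-- Every family of lattices on a quasi-compact scheme is bounded: the pole orders of finitely
many invertible matrices and of their inverses are bounded. -/
theorem FiberLattice.IsLocal.exists_bounded [CompactSpace T] {ξ : FiberLattice N T}
    (hξ : ξ.IsLocal) : ∃ m₀ : ℕ, ∀ m ≥ m₀, ∀ x, (ξ x).Bounded m := by
  have key {R : Type u} [CommRing R] (g : GL (Fin N) (LaurentSeries R)) :
      ∃ m₀ : ℕ, ∀ m ≥ m₀, (Gr.mk g).Bounded m := by
    -- If the pole orders of the entries of `g` and of its inverse are at most `m`, then `t^m g`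
    -- and `t^m g⁻¹` are matrices of power series.
    choose k hk using fun p : (Fin N × Fin N) => exists_coeff_eq_zero (g.1 p.1 p.2)
    choose l hl using fun p : (Fin N × Fin N) => exists_coeff_eq_zero (g⁻¹.1 p.1 p.2)
    refine ⟨Finset.univ.sup k ⊔ Finset.univ.sup l, fun m hm => ?_⟩
    have h1 (a : LaurentSeries R) (k : ℕ) (hk : ∀ n : ℤ, n < -k → a.coeff n = 0) (hkm : k ≤ m) :
        HahnSeries.single (m : ℤ) (1 : R) * a ∈ (HahnSeries.ofPowerSeries ℤ R).range := by
      refine mem_power_iff.2 fun n => ?_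
      have h2 : Int.negSucc n = (Int.negSucc n - m) + m := (sub_add_cancel _ _).symm
      rw [h2, HahnSeries.coeff_single_mul_add, one_mul]
      exact hk _ (by omega)
    have hA (i j : Fin N) := h1 (g.1 i j) (k (i, j)) (hk (i, j))
      ((Finset.le_sup (f := k) (Finset.mem_univ (i, j))).trans (le_sup_left.trans hm))
    have hB (i j : Fin N) := h1 (g⁻¹.1 i j) (l (i, j)) (hl (i, j))
      ((Finset.le_sup (f := l) (Finset.mem_univ (i, j))).trans (le_sup_right.trans hm))
    choose A hA using hA
    choose B hB using hB
    have hA' : (Matrix.of A).map (HahnSeries.ofPowerSeries ℤ R) =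
        HahnSeries.single (m : ℤ) (1 : R) • g.1 := Matrix.ext fun i j => hA i j
    have hB' : (Matrix.of B).map (HahnSeries.ofPowerSeries ℤ R) =
        HahnSeries.single (m : ℤ) (1 : R) • g⁻¹.1 := Matrix.ext fun i j => hB i j
    have hinj : Function.Injective fun M : Matrix (Fin N) (Fin N) (PowerSeries R) =>
        M.map (HahnSeries.ofPowerSeries ℤ R) :=
      Matrix.map_injective HahnSeries.ofPowerSeries_injective
    have hX : ((PowerSeries.X ^ (2 * m) : PowerSeries R) •
        (1 : Matrix (Fin N) (Fin N) (PowerSeries R))).map (HahnSeries.ofPowerSeries ℤ R) =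
        (HahnSeries.single (m : ℤ) (1 : R) * HahnSeries.single (m : ℤ) (1 : R)) •
          (1 : Matrix (Fin N) (Fin N) (LaurentSeries R)) := by
      have h3 : HahnSeries.ofPowerSeries ℤ R (PowerSeries.X ^ (2 * m)) =
          HahnSeries.single (m : ℤ) (1 : R) * HahnSeries.single (m : ℤ) (1 : R) := by
        rw [HahnSeries.ofPowerSeries_X_pow, HahnSeries.single_mul_single, mul_one,
          show ((2 * m : ℕ) : ℤ) = m + m by omega]
      refine Matrix.ext fun i j => ?_
      rw [Matrix.map_apply, Matrix.smul_apply, Matrix.smul_apply, smul_eq_mul, map_mul, h3,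
        Matrix.one_apply, Matrix.one_apply]
      split_ifs <;> simp
    let C : BoundedMatrix N m R := ⟨Matrix.of A, Matrix.of B, hinj (by
        dsimp only
        rw [Matrix.map_mul, hA', hB', hX, Matrix.smul_mul, Matrix.mul_smul, smul_smul,
          ← Units.val_mul, mul_inv_cancel, Units.val_one]), hinj (by
        dsimp only
        rw [Matrix.map_mul, hA', hB', hX, Matrix.smul_mul, Matrix.mul_smul, smul_smul,
          ← Units.val_mul, inv_mul_cancel, Units.val_one])⟩
    refine ⟨C, congrArg Gr.mk (Units.ext ?_)⟩
    change HahnSeries.single (-(m : ℤ)) (1 : R) • (Matrix.of A).map _ = _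
    rw [hA', smul_smul, HahnSeries.single_mul_single, neg_add_cancel, mul_one]
    exact one_smul _ _
  have h2 (x : T) : ∃ V : Set T, IsOpen V ∧ x ∈ V ∧ ∃ m₀ : ℕ, ∀ m ≥ m₀, ∀ y ∈ V,
      (ξ y).Bounded m := by
    obtain ⟨V, hV, g, hg⟩ := hξ x
    obtain ⟨m₀, hm₀⟩ := key g
    refine ⟨V, V.2, hV, m₀, fun m hm y hy => ?_⟩
    rw [hg y hy, ← Gr.map_mk]
    exact (hm₀ m hm).map _
  choose V hVo hxV m₀ hm₀ using h2
  obtain ⟨t, ht⟩ := isCompact_univ.elim_finite_subcover V hVo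
    (fun x _ => Set.mem_iUnion.2 ⟨x, hxV x⟩)
  refine ⟨t.sup m₀, fun m hm x => ?_⟩
  obtain ⟨i, hi, hx⟩ := Set.mem_iUnion₂.1 (ht (Set.mem_univ x))
  exact hm₀ i m ((Finset.le_sup hi).trans hm) x hx

section FramedBase

variable {E : LaurentModule S} {U : S.Opens} {e : Fin N → Sec E U} (he : IsBasisOver e)

theorem exists_family_of_lattice {p : T ⟶ S} (hp : ⊤ ≤ p ⁻¹ᵁ U)
    {F : PowerSubmodule ((pull p).obj E)} (hF : F.IsLattice N) :
    ∃ ξ : FiberLattice N T, ξ.IsLocal ∧ HasFamily (isBasisOver_pullSec p he) F ξ :=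
  exists_hasFamily _ hp hF

/-- The version of `HasFamily.pullback` for the bases pulled back from a basis over an open subset
of `S`. -/
theorem HasFamily.pullback_framed {p : T ⟶ S} {q : T' ⟶ T} {p' : T' ⟶ S} (h : q ≫ p = p')
    (hp : ⊤ ≤ p ⁻¹ᵁ U) {F : PowerSubmodule ((pull p).obj E)} (hF : F.IsLattice N)
    {ξ : FiberLattice N T} (hξ : HasFamily (isBasisOver_pullSec p he) F ξ) :
    HasFamily (isBasisOver_pullSec p' he) (F.pullback h) (ξ.pull q) := by
  subst h
  have h1 := hξ.pullback (rfl : q ≫ p = q ≫ p) hF hp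
  have h2 : (fun i => compareSec (rfl : q ≫ p = q ≫ p) E (p ⁻¹ᵁ U) (pullSec p E U (e i))) =
      fun i => pullSec (q ≫ p) E U (e i) :=
    funext fun i => (compareSec_pullSec rfl E U (e i)).trans (res_self _ _)
  have h3 {b b' : Fin N → Sec ((pull (q ≫ p)).obj E) ((q ≫ p) ⁻¹ᵁ U)} (hbb : b = b')
      (hb : IsBasisOver b) (hb' : IsBasisOver b') {F ξ} (H : HasFamily hb F ξ) :
      HasFamily hb' F ξ := by
    subst hbb
    exact H
  exact h3 h2 _ _ h1

end FramedBase

end Families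

/-! ### Bounded lattices in a module with a basis -/

section FramedRepresentability

open Limits

variable {S : Scheme.{u}} {N : ℕ} {E : LaurentModule S} {U : S.Opens} {e : Fin N → Sec E U}

variable (N U) in
/-- The scheme of `m`-bounded lattices over an open subset `U` of `S`. -/
def boundedOver (m : ℕ) : Scheme.{u} :=
  pullback (specULiftZIsTerminal.from U.toScheme) (boundedGrHom.{u} N m)

variable (N U) in
/-- The projection of the scheme of bounded lattices to `U`. -/
def boundedOverHom (m : ℕ) : boundedOver N U m ⟶ U.toScheme :=
  pullback.fst _ _

instance (m : ℕ) : IsProper (boundedOverHom N U m) :=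
  have := isProper_boundedGrHom.{u} (N := N) (m := m)
  inferInstanceAs (IsProper (pullback.fst _ _))

variable (N U) in
/-- The scheme of bounded lattices over `U`, as a scheme over `S`. -/
abbrev boundedOverS (m : ℕ) : Over S := Over.mk (boundedOverHom N U m ≫ U.ι)

variable (N U) in
/-- The projection of `boundedOver N U m` to the absolute scheme of bounded lattices. -/
def boundedOverProj (m : ℕ) : boundedOver N U m ⟶ BoundedGr.{u} N m :=
  pullback.snd _ _

variable (N U) in
/-- The universal family of lattices. -/
def universalFamily (m : ℕ) : FiberLattice N (boundedOver N U m) :=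
  boundedPoint (boundedOverProj N U m)

theorem pull_universalFamily {T : Scheme.{u}} {m : ℕ} (f : T ⟶ boundedOver N U m) :
    (universalFamily N U m).pull f = boundedPoint (f ≫ boundedOverProj N U m) :=
  (boundedPoint_comp _ _).symm

theorem top_le_preimage {T : Scheme.{u}} (f : T ⟶ U.toScheme) : ⊤ ≤ (f ≫ U.ι) ⁻¹ᵁ U :=
  fun x _ => (f x).2

variable (he : IsBasisOver e)

/-- The universal bounded lattice. -/
def universalLattice (m : ℕ) : (latticeFunctor E N).obj (op (boundedOverS N U m)) :=
  ⟨ofFamily (isBasisOver_pullSec (boundedOverHom N U m ≫ U.ι) he)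
    (top_le_preimage (boundedOverHom N U m)) (universalFamily N U m),
    isLattice_ofFamily _ _ (isLocal_boundedPoint _)⟩

theorem hasFamily_universalLattice {T : Over S} (m : ℕ) (f : T ⟶ boundedOverS N U m) :
    HasFamily (isBasisOver_pullSec T.hom he)
      ((latticeFunctor E N).map f.op (universalLattice he m)).1
      ((universalFamily N U m).pull f.left) :=
  HasFamily.pullback_framed he (Over.w f) (top_le_preimage (boundedOverHom N U m))
    (universalLattice he m).2 (hasFamily_ofFamily _ (top_le_preimage (boundedOverHom N U m))
      (isLocal_boundedPoint _))

theorem top_le_of_hom {T : Over S} {m : ℕ} (f : T ⟶ boundedOverS N U m) : ⊤ ≤ T.hom ⁻¹ᵁ U := by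
  rw [← Over.w f]
  exact fun x _ => (boundedOverHom N U m (f.left x)).2

/-- The universal bounded lattice defines a subfunctor of the functor of lattices. -/
theorem universalLattice_injective {T : Over S} {m : ℕ} {f g : T ⟶ boundedOverS N U m}
    (h : (latticeFunctor E N).map f.op (universalLattice he m) =
      (latticeFunctor E N).map g.op (universalLattice he m)) : f = g := by
  have h1 := hasFamily_universalLattice he m f
  rw [h] at h1
  have h2 := h1.unique _ (top_le_of_hom f) ((latticeFunctor E N).map g.op _).2
    (hasFamily_universalLattice he m g)
  replace h2 := (pull_universalFamily _).symm.trans (h2.trans (pull_universalFamily _))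
  refine Over.OverMorphism.ext (pullback.hom_ext ?_ (boundedPoint_injective h2))
  rw [← cancel_mono U.ι]
  exact (Category.assoc _ _ _).trans ((Over.w f).trans (Over.w g).symm) |>.trans
    (Category.assoc _ _ _).symm

/-- A lattice over a quasi-compact scheme over `U` is a pullback of the universal `n`-bounded
lattice for large `n`. -/
theorem exists_map_universalLattice_eq {T : Over S} [CompactSpace T.left] (hT : ⊤ ≤ T.hom ⁻¹ᵁ U)
    (F : (latticeFunctor E N).obj (op T)) : ∃ n₀, ∀ n ≥ n₀, ∃ f : T ⟶ boundedOverS N U n,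
      (latticeFunctor E N).map f.op (universalLattice he n) = F := by
  obtain ⟨ξ, hξ, hF⟩ := exists_family_of_lattice he hT F.2
  obtain ⟨n₀, hn₀⟩ := hξ.exists_bounded
  refine ⟨n₀, fun n hn => ?_⟩
  obtain ⟨k, hk⟩ := exists_boundedPoint_eq hξ (hn₀ n hn)
  let l : T.left ⟶ U.toScheme := IsOpenImmersion.lift U.ι T.hom (by
    rintro _ ⟨x, rfl⟩
    rw [Scheme.Opens.range_ι]
    exact hT (Opens.mem_top x))
  have hl : l ≫ U.ι = T.hom := IsOpenImmersion.lift_fac _ _ _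
  let f : T ⟶ boundedOverS N U n := Over.homMk
    (pullback.lift l k (specULiftZIsTerminal.hom_ext _ _) : T.left ⟶ boundedOver N U n) (by
      change pullback.lift _ _ _ ≫ pullback.fst _ _ ≫ U.ι = _
      rw [pullback.lift_fst_assoc, hl])
  refine ⟨f, Subtype.ext ?_⟩
  have h1 := hasFamily_universalLattice he n f
  have h2 : (universalFamily N U n).pull f.left = ξ :=
    (pull_universalFamily _).trans ((congrArg boundedPoint (pullback.lift_snd _ _ _)).trans hk)
  rw [h2] at h1
  exact h1.eq _ hT ((latticeFunctor E N).map f.op _).2 F.2 hF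

end FramedRepresentability

/-! ### Gluing of lattices -/

section Gluing

variable {S T T' T'' : Scheme.{u}} {N : ℕ} {E : LaurentModule S}

/-- Along an open immersion, membership in a lattice can be tested after pullback. -/
theorem PowerSubmodule.IsLattice.mem_iff_compareSec {p : T ⟶ S} {q : T' ⟶ T} [IsOpenImmersion q]
    {p' : T' ⟶ S} (h : q ≫ p = p') {F : PowerSubmodule ((pull p).obj E)} (hF : F.IsLattice N)
    {V : T.Opens} (hV : V ≤ q.opensRange) (s : Sec ((pull p).obj E) V) :
    s ∈ F.sec V ↔ compareSec h E V s ∈ (F.pullback h).sec (q ⁻¹ᵁ V) := by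
  refine ⟨PowerSubmodule.compareSec_mem_pullback h, fun H => F.mem_of_local fun y hy => ?_⟩
  obtain ⟨W, hyW, e, he, heF⟩ := hF y
  replace heF : IsLatticeBasis F e := ⟨he, heF⟩
  refine ⟨V ⊓ W, ⟨hy, hyW⟩, inf_le_left, (heF.mem_iff inf_le_right _).2 fun i => ?_⟩
  have hi : q ⁻¹ᵁ (V ⊓ W) ≤ q ⁻¹ᵁ W := fun _ hx => hx.2
  have h1 : compareSec h E (V ⊓ W) (res inf_le_left s) ∈ (F.pullback h).sec (q ⁻¹ᵁ (V ⊓ W)) := by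
    rw [compareSec_res]
    exact PowerSubmodule.res_mem _ _ H
  have h2 := ((heF.pullback h).mem_iff hi _).1 h1 i
  have h3 := Eq.mp (congrArg (· ∈ powerSubring _) (congrFun (coord_compare h heF.1 inf_le_right hi
    (res inf_le_left s)) i)) h2
  rintro ⟨y, hy⟩
  obtain ⟨z, rfl⟩ := hV hy.1
  exact mem_power_of_injective (ConcreteCategory.bijective_of_isIso (q.stalkMap z)).1 (h3 ⟨z, hy⟩)

theorem compareSec_compareSec {p : T ⟶ S} {p' : T' ⟶ S} {p'' : T'' ⟶ S} {q : T' ⟶ T}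
    {q' : T'' ⟶ T'} {r : T'' ⟶ T} (h : q ≫ p = p') (h' : q' ≫ p' = p'') (hr : q' ≫ q = r)
    (h'' : r ≫ p = p'') {V : T.Opens} (hV : q' ⁻¹ᵁ (q ⁻¹ᵁ V) ≤ r ⁻¹ᵁ V)
    (s : Sec ((pull p).obj E) V) :
    compareSec h' E (q ⁻¹ᵁ V) (compareSec h E V s) = res hV (compareSec h'' E V s) := by
  subst hr
  exact (compareSec_comp h h' h'' E V s).trans (res_self _ _).symm

/-- If two submodules have the same pullback to the intersection of two open subschemes, then
membership of a section of the ambient module in the first implies membership in the second. -/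
theorem compareSec_mem_of_pullback_eq {T₁ T₂ : Scheme.{u}} {p : T ⟶ S} {p₁ : T₁ ⟶ S} {p₂ : T₂ ⟶ S}
    {p' : T' ⟶ S} {q₁ : T₁ ⟶ T} {q₂ : T₂ ⟶ T} {r₁ : T' ⟶ T₁} {r₂ : T' ⟶ T₂} [IsOpenImmersion r₂]
    (h₁ : q₁ ≫ p = p₁) (h₂ : q₂ ≫ p = p₂) (k₁ : r₁ ≫ p₁ = p') (k₂ : r₂ ≫ p₂ = p')
    (hr : r₁ ≫ q₁ = r₂ ≫ q₂) {F₁ : PowerSubmodule ((pull p₁).obj E)}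
    {F₂ : PowerSubmodule ((pull p₂).obj E)} (hF₂ : F₂.IsLattice N)
    (H : F₁.pullback k₁ = F₂.pullback k₂) {V : T.Opens} (hV : q₂ ⁻¹ᵁ V ≤ r₂.opensRange)
    {s : Sec ((pull p).obj E) V} (hs : compareSec h₁ E V s ∈ F₁.sec (q₁ ⁻¹ᵁ V)) :
    compareSec h₂ E V s ∈ F₂.sec (q₂ ⁻¹ᵁ V) := by
  rw [hF₂.mem_iff_compareSec k₂ hV, ← H]
  have h'' : (r₂ ≫ q₂) ≫ p = p' := by rw [Category.assoc, h₂, k₂]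
  have h1 := PowerSubmodule.compareSec_mem_pullback k₁ hs
  rw [compareSec_compareSec h₁ k₁ hr h'' (preimage_le hr V)] at h1
  rw [compareSec_compareSec h₂ k₂ rfl h'' le_rfl]
  have h2 := (F₁.pullback k₁).res_mem (preimage_ge hr V) h1
  rw [res_res] at h2
  exact h2

variable {ι : Type*} {p : T ⟶ S} {U : ι → T.Opens}
  (F : ∀ i, PowerSubmodule ((pull ((U i).ι ≫ p)).obj E))

/-- The submodule of sections that locally belong to the given submodules. -/
def glueSubmodules : PowerSubmodule ((pull p).obj E) where
  sec V := ⨅ i, ((F i).comap rfl).sec V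
  smul_mem ha s hs := by
    rw [AddSubgroup.mem_iInf] at hs ⊢
    exact fun i => ((F i).comap rfl).smul_mem ha (hs i)
  res_mem h s hs := by
    rw [AddSubgroup.mem_iInf] at hs ⊢
    exact fun i => ((F i).comap rfl).res_mem h (hs i)
  mem_of_local {V s} H := by
    rw [AddSubgroup.mem_iInf]
    refine fun i => ((F i).comap rfl).mem_of_local fun x hx => ?_
    obtain ⟨W, hxW, h, hW⟩ := H x hx
    exact ⟨W, hxW, h, AddSubgroup.mem_iInf.1 hW i⟩

theorem mem_glueSubmodules {V : T.Opens} {s : Sec ((pull p).obj E) V} :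
    s ∈ (glueSubmodules F).sec V ↔
      ∀ i, compareSec (rfl : (U i).ι ≫ p = _) E V s ∈ (F i).sec ((U i).ι ⁻¹ᵁ V) :=
  AddSubgroup.mem_iInf

/-- The given submodules agree on the pairwise intersections. -/
def AgreeOnOverlaps : Prop :=
  ∀ i j (hi : T.homOfLE (inf_le_left : U i ⊓ U j ≤ U i) ≫ (U i).ι ≫ p = (U i ⊓ U j).ι ≫ p)
    (hj : T.homOfLE (inf_le_right : U i ⊓ U j ≤ U j) ≫ (U j).ι ≫ p = (U i ⊓ U j).ι ≫ p),
    (F i).pullback hi = (F j).pullback hj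

variable {F}

/-- Over a subset of `U i`, the glued submodule is given by `F i`: membership in the other `F j`
follows by comparison over `U i ⊓ U j`. -/
theorem mem_glueSubmodules_iff (hF : ∀ i, (F i).IsLattice N) (H : AgreeOnOverlaps F)
    {V : T.Opens} {i : ι} (hV : V ≤ U i) {s : Sec ((pull p).obj E) V} :
    s ∈ (glueSubmodules F).sec V ↔
      compareSec (rfl : (U i).ι ≫ p = _) E V s ∈ (F i).sec ((U i).ι ⁻¹ᵁ V) := by
  rw [mem_glueSubmodules]
  refine ⟨fun h => h i, fun h j => ?_⟩
  refine compareSec_mem_of_pullback_eq (r₁ := T.homOfLE (inf_le_left : U i ⊓ U j ≤ U i))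
    (r₂ := T.homOfLE (inf_le_right : U i ⊓ U j ≤ U j)) (p' := (U i ⊓ U j).ι ≫ p) rfl rfl (by simp)
    (by simp) (by simp) (hF j) (H i j (by simp) (by simp)) ?_ h
  intro y hy
  have hy' : y.1 ∈ U i := hV hy
  exact ⟨⟨y.1, hy', y.2⟩, Subtype.ext (Scheme.homOfLE_apply ..)⟩

/-- A frame of `F i` on an open subset of `U i` is a frame of the glued submodule on its image in
`T`. -/
theorem exists_frame_glueSubmodules (hF : ∀ i, (F i).IsLattice N)
    (H : AgreeOnOverlaps F) (hE : IsLocallyFree E N) {i : ι} (x : (U i).toScheme) :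
    ∃ (V : T.Opens) (b : Fin N → Sec ((pull p).obj E) V) (hb : IsBasisOver b)
      (W' : (U i).toScheme.Opens) (_ : x ∈ W') (hW' : W' ≤ (U i).ι ⁻¹ᵁ V)
      (hW : (U i).ι ''ᵁ W' ≤ V) (g' : GL (Fin N) (LaurentSeries Γ((U i).toScheme, W')))
      (g : GL (Fin N) (LaurentSeries Γ(T, (U i).ι ''ᵁ W'))),
      IsFrame (isBasisOver_compare (rfl : (U i).ι ≫ p = _) hb) (F i) hW' g' ∧
      IsFrame hb (glueSubmodules F) hW g ∧
      ∀ y (hy : y ∈ W') (hy' : (U i).ι y ∈ (U i).ι ''ᵁ W'),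
        Gr.map ((U i).ι.stalkMap y).hom
          (Gr.mk (glMap (T.presheaf.germ ((U i).ι ''ᵁ W') ((U i).ι y) hy').hom g)) =
        Gr.mk (glMap ((U i).toScheme.presheaf.germ W' y hy).hom g') := by
  obtain ⟨V, hxV, e, he⟩ := hE (p x.1)
  have hb := isBasisOver_pullSec p he
  obtain ⟨W', hxW', hW', g', hg'⟩ := (hF i).exists_frame
    (isBasisOver_compare (rfl : (U i).ι ≫ p = _) hb) (x := x) hxV
  obtain ⟨g, hg⟩ := FiberLattice.exists_image_gl (U i).ι g'
  have hW : (U i).ι ''ᵁ W' ≤ p ⁻¹ᵁ V := by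
    rintro _ ⟨y, hy, rfl⟩
    exact hW' hy
  refine ⟨p ⁻¹ᵁ V, _, hb, W', hxW', hW', hW, g', g, hg', fun Y hY s => ?_, hg⟩
  have hY' : Y ≤ U i := by
    intro y hy
    obtain ⟨z, -, rfl⟩ := hY hy
    exact z.2
  have hY'' : (U i).ι ⁻¹ᵁ Y ≤ W' := by
    intro z hz
    obtain ⟨z', hz', h⟩ := hY hz
    rwa [← Subtype.ext h]
  rw [mem_glueSubmodules_iff hF H hY', hg' _ hY'']
  have key (z : (U i).toScheme) (hz : (U i).ι z ∈ Y) :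
      (Gr.mk (glMap ((U i).toScheme.presheaf.germ W' z (hY'' hz)).hom g')).Mem
        (stalkCoord (isBasisOver_compare (rfl : (U i).ι ≫ p = _) hb) (hY''.trans hW')
          (compareSec (rfl : (U i).ι ≫ p = _) E Y s) z hz) ↔
      (Gr.mk (glMap (T.presheaf.germ ((U i).ι ''ᵁ W') ((U i).ι z) (hY hz)).hom g)).Mem
        (stalkCoord hb (hY.trans hW) s ((U i).ι z) hz) := by
    have h1 := stalkCoord_compare (rfl : (U i).ι ≫ p = _) hb (hY.trans hW) (hY''.trans hW') s z hz
    have h2 := congrArg₂ Gr.Mem (hg z (hY'' hz) (hY hz)).symm h1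
    refine (iff_of_eq h2).trans ⟨Gr.Mem.of_map ?_, Gr.Mem.map _⟩
    exact (ConcreteCategory.bijective_of_isIso ((U i).ι.stalkMap z)).1
  refine ⟨fun h y hy => ?_, fun h z hz => (key z hz).2 (h _ hz)⟩
  exact (key ⟨y, hY' hy⟩ hy).1 (h ⟨y, hY' hy⟩ hy)

theorem isLattice_glueSubmodules (hF : ∀ i, (F i).IsLattice N)
    (H : AgreeOnOverlaps F) (hE : IsLocallyFree E N) (hU : iSup U = ⊤) :
    (glueSubmodules F).IsLattice N := isLattice_of_frames fun x => by
  have : x ∈ iSup U := hU ▸ Opens.mem_top x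
  obtain ⟨i, hi⟩ := Opens.mem_iSup.1 this
  obtain ⟨V, b, hb, W', hx, hW', hW, g', g, hg', hg, h⟩ :=
    exists_frame_glueSubmodules hF H hE (⟨x, hi⟩ : (U i).toScheme)
  exact ⟨V, b, hb, (U i).ι ''ᵁ W', ⟨_, hx, rfl⟩, hW, g, hg⟩

/-- The glued submodule restricts to the given ones. -/
theorem pullback_glueSubmodules (hF : ∀ i, (F i).IsLattice N)
    (H : AgreeOnOverlaps F) (hE : IsLocallyFree E N) (i : ι) :
    (glueSubmodules F).pullback (rfl : (U i).ι ≫ p = _) = F i := by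
  refine le_antisymm ((PowerSubmodule.pullback_le_iff _).2 fun V s hs =>
    mem_glueSubmodules F |>.1 hs i) fun Y s hs =>
    PowerSubmodule.mem_of_local _ fun x hx => ?_
  obtain ⟨V, b, hb, W', hxW', hW', hW, g', g, hg', hg, h⟩ :=
    exists_frame_glueSubmodules hF H hE x
  refine ⟨Y ⊓ W', ⟨hx, hxW'⟩, inf_le_left, ?_⟩
  have h1 := hg.pullback (rfl : (U i).ι ≫ p = _) (fun _ hz => hW hz)
  have h2 : Y ⊓ W' ≤ (U i).ι ⁻¹ᵁ ((U i).ι ''ᵁ W') := fun z hz => ⟨z, hz.2, rfl⟩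
  rw [h1 _ h2]
  intro z hz
  have h3 := (hg' (Y ⊓ W') inf_le_right _).1 ((F i).res_mem inf_le_left hs) z hz
  rw [← h z hz.2 (h2 hz)] at h3
  exact Eq.mp (congrArg (fun q => Gr.Mem q _) (FiberLattice.map_germ_stalkMap (U i).ι g z
    (h2 hz))) h3

end Gluing

/-! ### The functor of lattices as a Zariski sheaf -/

section Sheaf

variable {S : Scheme.{u}}

/-- An open subscheme of an `S`-scheme. -/
abbrev restr (T : Over S) (U : T.left.Opens) : Over S := Over.mk (U.ι ≫ T.hom)

/-- The inclusion of an open subscheme. -/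
abbrev restrι (T : Over S) (U : T.left.Opens) : restr T U ⟶ T := Over.homMk U.ι

/-- The inclusion between open subschemes. -/
abbrev restrLE (T : Over S) {U V : T.left.Opens} (h : U ≤ V) : restr T U ⟶ restr T V :=
  Over.homMk (T.left.homOfLE h) (by simp)

/-- A functor on `S`-schemes in which sections can be glued along open coverings. -/
def GluesOver (P : (Over S)ᵒᵖ ⥤ Type u) : Prop :=
  ∀ (T : Over S) (ι : Type u) (U : ι → T.left.Opens), iSup U = ⊤ →
    ∀ s : ∀ i, P.obj (op (restr T (U i))),
      (∀ i j, P.map (restrLE T (inf_le_left : U i ⊓ U j ≤ U i)).op (s i) =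
        P.map (restrLE T (inf_le_right : U i ⊓ U j ≤ U j)).op (s j)) →
      ∃! t : P.obj (op T), ∀ i, P.map (restrι T (U i)).op t = s i

theorem GluesOver.ext {P : (Over S)ᵒᵖ ⥤ Type u} (hP : GluesOver P) {T : Over S} {ι : Type u}
    {U : ι → T.left.Opens} (hU : iSup U = ⊤) {t t' : P.obj (op T)}
    (h : ∀ i, P.map (restrι T (U i)).op t = P.map (restrι T (U i)).op t') : t = t' := by
  refine (hP T ι U hU (fun i => P.map (restrι T (U i)).op t) fun i j => ?_).unique
    (fun _ => rfl) (fun i => (h i).symm)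
  rw [← Functor.map_comp_apply, ← Functor.map_comp_apply, ← op_comp, ← op_comp]
  have h1 : restrLE T (inf_le_left : U i ⊓ U j ≤ U i) ≫ restrι T (U i) =
      restrLE T (inf_le_right : U i ⊓ U j ≤ U j) ≫ restrι T (U j) :=
    Over.OverMorphism.ext (by simp)
  rw [h1]

/-- Lattices glue along open coverings. -/
theorem gluesOver_latticeFunctor {N : ℕ} {E : LaurentModule S} (hE : IsLocallyFree E N) :
    GluesOver (latticeFunctor E N) := by
  intro T ι U hU s hs
  have H : AgreeOnOverlaps fun i => (s i).1 := fun i j hi hj => congrArg Subtype.val (hs i j)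
  refine ⟨⟨glueSubmodules fun i => (s i).1, isLattice_glueSubmodules (fun i => (s i).2) H hE hU⟩,
    fun i => Subtype.ext (pullback_glueSubmodules (fun i => (s i).2) H hE i), fun F hF => ?_⟩
  refine Subtype.ext (PowerSubmodule.ext (funext fun V => AddSubgroup.ext fun t => ?_))
  have h1 (i : ι) : F.1.pullback (rfl : (U i).ι ≫ T.hom = _) = (s i).1 :=
    congrArg Subtype.val (hF i)
  have h2 (x) (hx : x ∈ V) : ∃ i, x ∈ U i := by
    have : x ∈ iSup U := hU ▸ Opens.mem_top x
    exact Opens.mem_iSup.1 this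
  have h3 {W : T.left.Opens} {i : ι} (hW : W ≤ U i) (t : Sec ((pull T.hom).obj E) W) :
      t ∈ F.1.sec W ↔ t ∈ (glueSubmodules fun i => (s i).1).sec W := by
    rw [mem_glueSubmodules_iff (fun i => (s i).2) H hW, ← h1 i]
    exact F.2.mem_iff_compareSec rfl (by rwa [Scheme.Opens.opensRange_ι]) t
  refine ⟨fun ht => PowerSubmodule.mem_of_local _ fun x hx => ?_,
    fun ht => PowerSubmodule.mem_of_local _ fun x hx => ?_⟩
  · obtain ⟨i, hi⟩ := h2 x hx
    exact ⟨V ⊓ U i, ⟨hx, hi⟩, inf_le_left, (h3 inf_le_right _).1 (F.1.res_mem _ ht)⟩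
  · obtain ⟨i, hi⟩ := h2 x hx
    exact ⟨V ⊓ U i, ⟨hx, hi⟩, inf_le_left, (h3 inf_le_right _).2 (PowerSubmodule.res_mem _ _ ht)⟩

/-- Gluing along open subsets implies the sheaf condition for the Zariski topology on `S`-schemes.
-/
theorem GluesOver.isSheaf {P : (Over S)ᵒᵖ ⥤ Type u} (hP : GluesOver P) :
    Presheaf.IsSheaf (Scheme.zariskiTopology.over S) P := by
  rw [isSheaf_iff_isSheaf_of_type]
  intro Y R hR x hx
  rw [GrothendieckTopology.mem_over_iff, Scheme.mem_grothendieckTopology_iff] at hR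
  obtain ⟨(𝒰 : Scheme.OpenCover.{u} Y.left), h𝒰⟩ := hR
  have hmem (i : 𝒰.I₀) : R (restrι Y (𝒰.f i).opensRange) := by
    have h1 : Sieve.overEquiv Y R (𝒰.f i) := h𝒰 _ _ (Presieve.ofArrows.mk i)
    rw [Sieve.overEquiv_iff] at h1
    have h2 := R.downward_closed h1 (Over.homMk (𝒰.f i).isoOpensRange.inv (by simp) :
      restr Y (𝒰.f i).opensRange ⟶ Over.mk (𝒰.f i ≫ Y.hom))
    convert h2
    ext1
    simp
  have hsup : (⨆ i, (𝒰.f i).opensRange) = ⊤ := 𝒰.iSup_opensRange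
  obtain ⟨t, ht, ht'⟩ := hP Y 𝒰.I₀ (fun i => (𝒰.f i).opensRange) hsup
    (fun i => x _ (hmem i)) (fun i j => hx _ _ _ _ (by ext1; simp))
  refine ⟨t, ?_, fun t' h => ht' t' fun i => h _ (hmem i)⟩
  intro Z f hf
  have hsup' : (⨆ i, f.left ⁻¹ᵁ (𝒰.f i).opensRange) = ⊤ := by
    refine Opens.ext (Set.eq_univ_of_forall fun z => ?_)
    have : f.left z ∈ ⨆ i, (𝒰.f i).opensRange := hsup ▸ Opens.mem_top _
    obtain ⟨i, hi⟩ := Opens.mem_iSup.1 this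
    exact Opens.mem_iSup.2 ⟨i, hi⟩
  refine hP.ext hsup' fun i => ?_
  let r : restr Z (f.left ⁻¹ᵁ (𝒰.f i).opensRange) ⟶ restr Y (𝒰.f i).opensRange :=
    Over.homMk (f.left ∣_ (𝒰.f i).opensRange) (by simp)
  have hr : restrι Z (f.left ⁻¹ᵁ (𝒰.f i).opensRange) ≫ f = r ≫ restrι Y (𝒰.f i).opensRange := by
    ext1
    simp [r]
  rw [← Functor.map_comp_apply, ← op_comp, hr, op_comp, Functor.map_comp_apply, ht]
  exact hx _ _ _ _ hr.symm

end Sheaf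

/-! ### Points that separate and lift -/

section Points

open Limits

variable {S : Scheme.{u}} {P : (Over S)ᵒᵖ ⥤ Type u} {T T' X Y Z W : Over S}

/-- A point `x` of `P` over `X` for which the morphism `X ⟶ P` is a monomorphism. -/
def Separates (x : P.obj (op X)) : Prop :=
  ∀ ⦃T : Over S⦄ (f g : T ⟶ X), P.map f.op x = P.map g.op x → f = g

/-- The point `t` is the pullback of the point `x` along some morphism. -/
def Lifts (t : P.obj (op T)) (x : P.obj (op X)) : Prop :=
  ∃ f : T ⟶ X, P.map f.op x = t

theorem Lifts.map (x : P.obj (op X)) (f : T ⟶ X) : Lifts (P.map f.op x) x := ⟨f, rfl⟩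

theorem Lifts.trans {t : P.obj (op T)} {x : P.obj (op X)} {y : P.obj (op Y)} (h : Lifts t x)
    (h' : Lifts x y) : Lifts t y := by
  obtain ⟨f, rfl⟩ := h
  obtain ⟨g, rfl⟩ := h'
  exact ⟨f ≫ g, by rw [op_comp, Functor.map_comp_apply]⟩

theorem Separates.map {x : P.obj (op X)} (hx : Separates x) (f : Y ⟶ X) [Mono f] :
    Separates (P.map f.op x) := fun T a b h => by
  rw [← Functor.map_comp_apply, ← Functor.map_comp_apply, ← op_comp, ← op_comp] at h
  exact (cancel_mono f).1 (hx _ _ h)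

theorem Separates.mono {x : P.obj (op X)} {y : P.obj (op Y)} (hy : Separates y) (f : Y ⟶ X)
    (h : P.map f.op x = y) : Mono f := ⟨fun a b hab => hy _ _ <| by
  rw [← h, ← Functor.map_comp_apply, ← Functor.map_comp_apply, ← op_comp, ← op_comp, hab]⟩

theorem mono_of_left (f : Y ⟶ X) [Mono f.left] : Mono f :=
  ⟨fun a b hab => Over.OverMorphism.ext ((cancel_mono f.left).1 (by
    rw [← Over.comp_left, ← Over.comp_left, hab]))⟩

instance (U : T.left.Opens) : Mono (restrι T U) := by
  have : Mono (restrι T U).left := inferInstanceAs (Mono U.ι)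
  exact mono_of_left _

theorem Separates.restrict {x : P.obj (op X)} (hx : Separates x) (U : X.left.Opens) :
    Separates (P.map (restrι X U).op x) := hx.map _

theorem restr_hom_ext {ι : Type u} {U : ι → T.left.Opens} (hU : iSup U = ⊤) {f g : T ⟶ X}
    (h : ∀ i, restrι T (U i) ≫ f = restrι T (U i) ≫ g) : f = g := by
  refine Over.OverMorphism.ext ((T.left.openCoverOfIsOpenCover U hU).hom_ext _ _ fun i => ?_)
  exact congrArg (fun k => k.left) (h i)

/-- Factoring through a subfunctor represented by a scheme is a local property. -/
theorem Separates.lifts_of_iSup_eq_top {x : P.obj (op X)} (hx : Separates x) (hP : GluesOver P)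
    {t : P.obj (op T)} {ι : Type u} {U : ι → T.left.Opens} (hU : iSup U = ⊤)
    (h : ∀ i, Lifts (P.map (restrι T (U i)).op t) x) : Lifts t x := by
  choose f hf using h
  let 𝒰 := T.left.openCoverOfIsOpenCover U hU
  have hcompat (i j : ι) : pullback.fst (U i).ι (U j).ι ≫ (f i).left =
      pullback.snd (U i).ι (U j).ι ≫ (f j).left := by
    let R : Over S := Over.mk (pullback.fst (U i).ι (U j).ι ≫ (U i).ι ≫ T.hom)
    let a : R ⟶ restr T (U i) := Over.homMk (pullback.fst (U i).ι (U j).ι)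
    let b : R ⟶ restr T (U j) := Over.homMk (pullback.snd (U i).ι (U j).ι)
      (by simp [R, pullback.condition_assoc])
    have hab : a ≫ restrι T (U i) = b ≫ restrι T (U j) :=
      Over.OverMorphism.ext pullback.condition
    have := hx (a ≫ f i) (b ≫ f j) (by
      rw [op_comp, op_comp, Functor.map_comp_apply, Functor.map_comp_apply, hf, hf,
        ← Functor.map_comp_apply, ← Functor.map_comp_apply, ← op_comp, ← op_comp, hab])
    exact congrArg (fun k => k.left) this
  have h1 (i : ι) : (U i).ι ≫ 𝒰.glueMorphisms (fun i => (f i).left) hcompat = (f i).left :=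
    𝒰.ι_glueMorphisms (fun i => (f i).left) hcompat i
  have h2 : 𝒰.glueMorphisms (fun i => (f i).left) hcompat ≫ X.hom = T.hom := by
    refine 𝒰.hom_ext _ _ fun i => ?_
    have h3 : (U i).ι ≫ 𝒰.glueMorphisms (fun i => (f i).left) hcompat ≫ X.hom =
        (U i).ι ≫ T.hom := by
      exact (Category.assoc _ _ _).symm.trans ((congrArg (· ≫ X.hom) (h1 i)).trans (Over.w (f i)))
    exact h3
  refine ⟨Over.homMk (𝒰.glueMorphisms (fun i => (f i).left) hcompat) h2, ?_⟩
  refine hP.ext hU fun i => ?_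
  rw [← hf i, ← Functor.map_comp_apply, ← op_comp]
  exact congrArg (fun k : restr T (U i) ⟶ X => P.map k.op x) (Over.OverMorphism.ext (h1 i))

theorem exists_restr_opensRange (j : X ⟶ Y) [IsOpenImmersion j.left] :
    ∃ (r : restr Y j.left.opensRange ⟶ X) (q : X ⟶ restr Y j.left.opensRange),
      r ≫ j = restrι Y j.left.opensRange ∧ q ≫ r = 𝟙 X ∧ q ≫ restrι Y j.left.opensRange = j :=
  ⟨Over.homMk j.left.isoOpensRange.inv (by
      rw [← Over.w j, Scheme.Hom.isoOpensRange_inv_comp_assoc]; rfl),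
    Over.homMk j.left.isoOpensRange.hom (by simp),
    Over.OverMorphism.ext (Scheme.Hom.isoOpensRange_inv_comp _),
    Over.OverMorphism.ext (Iso.hom_inv_id _),
    Over.OverMorphism.ext (Scheme.Hom.isoOpensRange_hom_ι _)⟩

theorem iSup_opensRange_eq_top {ι : Type u} {X : ι → Over S} (j : ∀ i, X i ⟶ Y)
    [∀ i, IsOpenImmersion (j i).left] (hj : ∀ y : Y.left, ∃ i, y ∈ Set.range (j i).left) :
    (⨆ i, (j i).left.opensRange) = ⊤ :=
  top_le_iff.1 fun y _ => Opens.mem_iSup.2 (hj y)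

/-- Gluing of points along a jointly surjective family of open immersions. -/
theorem GluesOver.exists_glue (hP : GluesOver P) {ι : Type u} {X : ι → Over S} (j : ∀ i, X i ⟶ Y)
    [∀ i, IsOpenImmersion (j i).left] (hj : ∀ y : Y.left, ∃ i, y ∈ Set.range (j i).left)
    (x : ∀ i, P.obj (op (X i)))
    (hx : ∀ i k (T : Over S) (f : T ⟶ X i) (g : T ⟶ X k), f ≫ j i = g ≫ j k →
      P.map f.op (x i) = P.map g.op (x k)) :
    ∃ y : P.obj (op Y), ∀ i, P.map (j i).op y = x i := by
  choose r q hr hq hq' using fun i => exists_restr_opensRange (j i)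
  obtain ⟨y, hy, -⟩ := hP Y ι _ (iSup_opensRange_eq_top j hj) (fun i => P.map (r i).op (x i))
    fun i k => by
      rw [← Functor.map_comp_apply, ← Functor.map_comp_apply, ← op_comp, ← op_comp]
      refine hx _ _ _ _ _ ?_
      rw [Category.assoc, Category.assoc, hr, hr]
      exact Over.OverMorphism.ext (by simp)
  refine ⟨y, fun i => ?_⟩
  rw [← hq', op_comp, Functor.map_comp_apply, hy i, ← Functor.map_comp_apply, ← op_comp, hq, op_id,
    Functor.map_id_apply]

theorem Separates.lifts_of_jointly_surjective {x : P.obj (op Z)} (hx : Separates x)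
    (hP : GluesOver P) {y : P.obj (op Y)} {ι : Type u} {X : ι → Over S} (j : ∀ i, X i ⟶ Y)
    [∀ i, IsOpenImmersion (j i).left] (hj : ∀ y : Y.left, ∃ i, y ∈ Set.range (j i).left)
    (h : ∀ i, Lifts (P.map (j i).op y) x) : Lifts y x := by
  refine hx.lifts_of_iSup_eq_top hP (iSup_opensRange_eq_top j hj) fun i => ?_
  obtain ⟨r, q, hr, -⟩ := exists_restr_opensRange (j i)
  rw [← hr, op_comp, Functor.map_comp_apply]
  exact (Lifts.map _ r).trans (h i)

/-- The restriction of an `S`-scheme to an open subset of `S`. -/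
abbrev restrBase (X : Over S) (U : S.Opens) : Over S := restr X (X.hom ⁻¹ᵁ U)

theorem top_le_restrBase (X : Over S) (U : S.Opens) : ⊤ ≤ (restrBase X U).hom ⁻¹ᵁ U :=
  fun x _ => x.2

theorem exists_comp_restrι (f : T ⟶ X) {U : X.left.Opens} (hf : ∀ t, f.left t ∈ U) :
    ∃ g : T ⟶ restr X U, g ≫ restrι X U = f := by
  have hr : Set.range f.left ⊆ Set.range U.ι := by
    rintro _ ⟨t, rfl⟩
    exact U.range_ι ▸ hf t
  exact ⟨Over.homMk (IsOpenImmersion.lift U.ι f.left hr) (by simp),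
    Over.OverMorphism.ext (IsOpenImmersion.lift_fac _ _ _)⟩

theorem Lifts.restrBase {t : P.obj (op T)} {x : P.obj (op X)} (h : Lifts t x) {U : S.Opens}
    (hU : ⊤ ≤ T.hom ⁻¹ᵁ U) : Lifts t (P.map (restrι X (X.hom ⁻¹ᵁ U)).op x) := by
  obtain ⟨f, rfl⟩ := h
  obtain ⟨g, hg⟩ := exists_comp_restrι f (U := X.hom ⁻¹ᵁ U) fun t => by
    have := hU (Opens.mem_top t)
    rwa [← Over.w f] at this
  exact ⟨g, by rw [← Functor.map_comp_apply, ← op_comp, hg]⟩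

/-- An `S`-scheme that is a proper scheme over the open subscheme `U`. -/
def IsProperOver (U : S.Opens) (X : Over S) : Prop :=
  ∃ f : X.left ⟶ U.toScheme, f ≫ U.ι = X.hom ∧ IsProper f

theorem isProperOver_restrBase (X : Over S) [IsProper X.hom] (U : S.Opens) :
    IsProperOver U (restrBase X U) :=
  ⟨X.hom ∣_ U, by simp, inferInstance⟩

theorem IsProperOver.restrBase {U V : S.Opens} (h : V ≤ U) (hX : IsProperOver U X) :
    IsProperOver V (restrBase X V) := by
  obtain ⟨f, hf, hp⟩ := hX
  have h1 : X.hom ⁻¹ᵁ V = f ⁻¹ᵁ (U.ι ⁻¹ᵁ V) := by rw [← hf]; rfl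
  unfold TwistedGrassmannian.restrBase
  generalize X.hom ⁻¹ᵁ V = O at h1
  subst h1
  have h2 : Set.range ((U.ι ⁻¹ᵁ V).ι ≫ U.ι) = Set.range V.ι := by
    rw [Scheme.Hom.comp_base, TopCat.coe_comp, Set.range_comp, Scheme.Opens.range_ι,
      Scheme.Opens.range_ι]
    exact Set.image_preimage_eq_of_subset (by rw [Scheme.Opens.range_ι]; exact h)
  refine ⟨(f ∣_ (U.ι ⁻¹ᵁ V)) ≫ (IsOpenImmersion.isoOfRangeEq _ _ h2).hom, ?_, inferInstance⟩
  rw [Category.assoc, IsOpenImmersion.isoOfRangeEq_hom_fac, morphismRestrict_ι_assoc, hf]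
  rfl

theorem IsProperOver.top_le {U : S.Opens} (h : IsProperOver U X) : ⊤ ≤ X.hom ⁻¹ᵁ U := by
  obtain ⟨f, hf, hp⟩ := h
  rw [← hf]
  exact fun x _ => (f x).2

theorem IsProperOver.compactSpace {U : S.Opens} (hU : IsAffineOpen U) (h : IsProperOver U X) :
    CompactSpace X.left := by
  obtain ⟨f, hf, hp⟩ := h
  have : CompactSpace U.toScheme := isCompact_iff_compactSpace.1 hU.isCompact
  exact QuasiCompact.compactSpace_of_compactSpace f

theorem IsProperOver.quasiSeparatedSpace {U : S.Opens} (hU : IsAffineOpen U)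
    (h : IsProperOver U X) : QuasiSeparatedSpace X.left := by
  obtain ⟨f, hf, hp⟩ := h
  have : IsAffine U.toScheme := hU
  exact quasiSeparatedSpace_of_quasiSeparated f

/-- A quasi-compact morphism is scheme-theoretically dominant onto its scheme-theoretic image. -/
theorem isSchemeTheoreticallyDominant_toImage {X Y : Scheme.{u}} (f : X ⟶ Y) [QuasiCompact f] :
    IsSchemeTheoreticallyDominant f.toImage := by
  refine ⟨Scheme.IdealSheafData.ext_of_iSup_eq_top
    (fun U : Y.affineOpens => ⟨f.imageι ⁻¹ᵁ U.1, U.2.preimage _⟩) ?_ fun U => ?_⟩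
  · rw [← Scheme.Hom.preimage_iSup, iSup_affineOpens_eq_top, Scheme.Hom.preimage_top]
  · rw [Scheme.Hom.ker_apply, Scheme.IdealSheafData.ideal_bot]
    exact (RingHom.injective_iff_ker_eq_bot _).1 (f.toImage_app_injective U)

variable (P) in
/-- Over the open set `U`, the functor `P` is exhausted by a sequence of subfunctors represented
by proper schemes over `U`. -/
def IsExhaustedOver (U : S.Opens) : Prop :=
  ∃ (X : ℕ → Over S) (x : ∀ n, P.obj (op (X n))), (∀ n, IsProperOver U (X n)) ∧
    (∀ n, Separates (x n)) ∧ ∀ (T : Over S), CompactSpace T.left → ⊤ ≤ T.hom ⁻¹ᵁ U →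
      ∀ t : P.obj (op T), ∃ n₀, ∀ n ≥ n₀, Lifts t (x n)

/-- The point `z` is a monomorphism onto the scheme-theoretic closure of the image of `w`. -/
def IsClosureOf (w : P.obj (op W)) (z : P.obj (op Z)) : Prop :=
  Separates z ∧ ∃ d : W ⟶ Z, P.map d.op z = w ∧ IsSchemeTheoreticallyDominant d.left ∧
    QuasiCompact d.left

theorem IsClosureOf.restrBase {w : P.obj (op W)} {z : P.obj (op Z)} (h : IsClosureOf w z)
    (V : S.Opens) : IsClosureOf (P.map (restrι W (W.hom ⁻¹ᵁ V)).op w)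
      (P.map (restrι Z (Z.hom ⁻¹ᵁ V)).op z) := by
  obtain ⟨hz, d, hd, h1, h2⟩ := h
  refine ⟨hz.map _, ?_⟩
  have h3 : W.hom ⁻¹ᵁ V = d.left ⁻¹ᵁ (Z.hom ⁻¹ᵁ V) := by rw [← Over.w d]; rfl
  generalize W.hom ⁻¹ᵁ V = O at h3
  subst h3
  refine ⟨Over.homMk (d.left ∣_ (Z.hom ⁻¹ᵁ V)) (by simp), ?_, ?_, ?_⟩
  · rw [← hd, ← Functor.map_comp_apply, ← Functor.map_comp_apply, ← op_comp, ← op_comp]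
    exact congrArg (fun k => P.map (Quiver.Hom.op k) z)
      (Over.OverMorphism.ext (morphismRestrict_ι _ _))
  · exact IsSchemeTheoreticallyDominant.of_isPullback (isPullback_morphismRestrict d.left _).flip
  · exact inferInstanceAs (QuasiCompact (d.left ∣_ (Z.hom ⁻¹ᵁ V)))

/-- Over `U`, a point factors through one of the exhausting proper schemes. Its scheme-theoretic
image there is a closure. -/
theorem IsExhaustedOver.exists_isClosureOf {U : S.Opens} (hP : IsExhaustedOver P U)
    (hU : IsAffineOpen U) [CompactSpace W.left] (hW : ⊤ ≤ W.hom ⁻¹ᵁ U) (w : P.obj (op W)) :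
    ∃ (Z : Over S) (z : P.obj (op Z)), IsProperOver U Z ∧ IsClosureOf w z := by
  obtain ⟨X, x, hX, hx, hlift⟩ := hP
  obtain ⟨n, hn⟩ := hlift W ‹_› hW w
  obtain ⟨f, hf⟩ := hn n le_rfl
  have := (hX n).quasiSeparatedSpace hU
  have hqc : QuasiCompact f.left := inferInstance
  let i : Over.mk (f.left.imageι ≫ (X n).hom) ⟶ X n := Over.homMk f.left.imageι
  have : Mono i := by
    have : Mono i.left := inferInstanceAs (Mono f.left.imageι)
    exact mono_of_left _
  refine ⟨_, P.map i.op (x n), ?_, (hx n).map i,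
    Over.homMk f.left.toImage (by simp), ?_, ?_, ?_⟩
  · obtain ⟨g, hg, hp⟩ := hX n
    exact ⟨f.left.imageι ≫ g, by rw [Category.assoc, hg]; rfl, inferInstance⟩
  · rw [← hf, ← Functor.map_comp_apply, ← op_comp]
    exact congrArg (fun k => P.map (Quiver.Hom.op k) (x n))
      (Over.OverMorphism.ext (Scheme.Hom.toImage_imageι _))
  · exact isSchemeTheoreticallyDominant_toImage f.left
  · exact inferInstanceAs (QuasiCompact f.left.toImage)

/-- Over `U`, the closure is the smallest proper subfunctor through which the point factors. Both
it and a competitor `Y` embed into one of the exhausting proper schemes, where `Y` is closed. -/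
theorem IsClosureOf.lifts {U : S.Opens} (hP : IsExhaustedOver P U) (hU : IsAffineOpen U)
    {w : P.obj (op W)} {z : P.obj (op Z)} (h : IsClosureOf w z) (hZ : IsProperOver U Z)
    {z' : P.obj (op Y)} (hY : IsProperOver U Y) (hz' : Separates z') (hw : Lifts w z') :
    Lifts z z' := by
  obtain ⟨X, x, hX, hx, hlift⟩ := hP
  obtain ⟨n, hn⟩ := hlift Z (hZ.compactSpace hU) hZ.top_le z
  obtain ⟨n', hn'⟩ := hlift Y (hY.compactSpace hU) hY.top_le z'
  obtain ⟨i, hi⟩ := hn _ (le_max_left n n')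
  obtain ⟨i', hi'⟩ := hn' _ (le_max_right n n')
  obtain ⟨hz, d, hd, hdom, hqc⟩ := h
  obtain ⟨d', hd'⟩ := hw
  have : Mono i' := hz'.mono i' hi'
  have : Mono i'.left := inferInstance
  have : IsProper i'.left := by
    obtain ⟨f, hf, hp⟩ := hX (max n n')
    obtain ⟨f', hf', hp'⟩ := hY
    have h1 : i'.left ≫ f = f' := by
      rw [← cancel_mono U.ι, Category.assoc, hf, hf', Over.w]
    have : IsProper (i'.left ≫ f) := h1 ▸ hp'
    exact IsProper.of_comp i'.left f
  have : IsClosedImmersion i'.left := (IsClosedImmersion.iff_isProper_and_mono _).2 ⟨‹_›, ‹_›⟩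
  have hcomp : d ≫ i = d' ≫ i' := hx _ _ _ <| by
    rw [op_comp, op_comp, Functor.map_comp_apply, Functor.map_comp_apply, hi, hi', hd, hd']
  have hker : i'.left.ker ≤ i.left.ker := by
    have h1 : (d.left ≫ i.left).ker = i.left.ker := by
      rw [Scheme.Hom.ker_comp, hdom.ker_eq_bot, Scheme.IdealSheafData.map_bot]
    rw [← h1, ← Over.comp_left, hcomp, Over.comp_left]
    exact Scheme.Hom.le_ker_comp _ _
  have hfac := IsClosedImmersion.lift_fac i'.left i.left hker
  refine ⟨Over.homMk (IsClosedImmersion.lift i'.left i.left hker) ?_, ?_⟩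
  · rw [← Over.w i', ← Category.assoc, hfac, Over.w i]
  · rw [← hi', ← hi, ← Functor.map_comp_apply, ← op_comp]
    exact congrArg (fun k => P.map (Quiver.Hom.op k) (x _)) (Over.OverMorphism.ext hfac)

end Points

/-! ### Schematic closures and gluing of proper schemes -/

section Closure

open Limits

variable {S : Scheme.{u}} {P : (Over S)ᵒᵖ ⥤ Type u} {W : Over S}

variable (P) in
/-- The affine open subsets of `S` over which `P` is exhausted by proper schemes. -/
abbrev ExhaustedOpens : Type u := {U : S.Opens // IsAffineOpen U ∧ IsExhaustedOver P U}

variable (P) in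
/-- The affine open subsets over which `P` is exhausted by proper schemes form a basis. -/
def HasExhaustedBasis : Prop :=
  Opens.IsBasis {U : S.Opens | IsAffineOpen U ∧ IsExhaustedOver P U}

theorem HasExhaustedBasis.exists_mem (hB : HasExhaustedBasis P) {U : S.Opens} {x : S}
    (hx : x ∈ U) : ∃ b : ExhaustedOpens P, x ∈ b.1 ∧ b.1 ≤ U := by
  obtain ⟨V, hV, hxV, hVU⟩ := Opens.isBasis_iff_nbhd.1 hB hx
  exact ⟨⟨V, hV⟩, hxV, hVU⟩

theorem HasExhaustedBasis.iSup_preimage (hB : HasExhaustedBasis P) (T : Over S) :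
    (⨆ b : ExhaustedOpens P, T.hom ⁻¹ᵁ b.1) = ⊤ := by
  refine top_le_iff.1 fun t _ => Opens.mem_iSup.2 ?_
  obtain ⟨b, hb, -⟩ := hB.exists_mem (Opens.mem_top (T.hom t))
  exact ⟨b, hb⟩

/-- The covering of `S` by the open subsets over which `P` is exhausted by proper schemes. -/
def exhaustedCover (hB : HasExhaustedBasis P) : S.OpenCover where
  I₀ := ExhaustedOpens P
  X U := U.1
  f U := U.1.ι
  mem₀ := by
    rw [Scheme.presieve₀_mem_precoverage_iff]
    refine ⟨fun x => ?_, inferInstance⟩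
    obtain ⟨b, hb, -⟩ := hB.exists_mem (Opens.mem_top x)
    exact ⟨b, by simpa using hb⟩

instance (hB : HasExhaustedBasis P) : Preorder (exhaustedCover hB).I₀ :=
  inferInstanceAs (Preorder (ExhaustedOpens P))

instance (hB : HasExhaustedBasis P) : (exhaustedCover hB).LocallyDirected :=
  .ofIsBasisOpensRange (by
    intro i j
    change i.1 ≤ j.1 ↔ i.1.ι.opensRange ≤ j.1.ι.opensRange
    rw [Scheme.Opens.opensRange_ι, Scheme.Opens.opensRange_ι]) (by
    have h : (Set.range fun i : ExhaustedOpens P => i.1.ι.opensRange) =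
        {U : S.Opens | IsAffineOpen U ∧ IsExhaustedOver P U} := by
      ext U
      refine ⟨?_, fun hU => ⟨⟨U, hU⟩, U.opensRange_ι⟩⟩
      rintro ⟨i, rfl⟩
      have h := Scheme.Opens.opensRange_ι i.1
      exact (congrArg (fun U => IsAffineOpen U ∧ IsExhaustedOver P U) h).mpr i.2
    exact (congrArg Opens.IsBasis h).mpr hB)

/-- Relative gluing, with the properties of the glued scheme collected. -/
theorem exists_glued_of_relativeGluingData {𝒰 : S.OpenCover} [Category 𝒰.I₀] [𝒰.LocallyDirected]
    [Small.{u} 𝒰.I₀] [Quiver.IsThin 𝒰.I₀] (G : 𝒰.RelativeGluingData) :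
    ∃ (Y : Scheme.{u}) (q : Y ⟶ S) (j : ∀ b, G.functor.obj b ⟶ Y), (∀ b, IsOpenImmersion (j b)) ∧
      (∀ y, ∃ b, y ∈ Set.range (j b)) ∧ (∀ {b c} (f : b ⟶ c), G.functor.map f ≫ j c = j b) ∧
      ∀ b, IsPullback (G.natTrans.app b) (j b) (𝒰.f b) q :=
  ⟨G.glued, G.toBase, fun b => G.cover.f b,
    fun b => G.cover.map_prop b, fun y => G.cover.exists_eq y,
    fun f => colimit.w G.functor f, G.isPullback_natTrans_ι_toBase⟩

/-- Relative gluing over a basis of open subsets of `S`. The assumptions `hmono` and `hlift` say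
that `Z b` is the restriction of `Z c` to `b` for `b ≤ c`. The result is proper as this is a local
property on `S`, and its restriction to `b` is `Z b`. -/
theorem HasExhaustedBasis.exists_glued (hB : HasExhaustedBasis P) (Z : ExhaustedOpens P ⥤ Over S)
    (hZ : ∀ b, IsProperOver b.1 (Z.obj b))
    (hmono : ∀ {b c} (f : b ⟶ c), Mono (Z.map f))
    (hlift : ∀ {b c} (f : b ⟶ c) {T : Over S} (g : T ⟶ Z.obj c), ⊤ ≤ T.hom ⁻¹ᵁ b.1 →
      ∃ h : T ⟶ Z.obj b, h ≫ Z.map f = g) :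
    ∃ (Y : Over S) (j : ∀ b, Z.obj b ⟶ Y), IsProper Y.hom ∧
      (∀ b, IsOpenImmersion (j b).left) ∧
      (∀ y : Y.left, ∃ b, y ∈ Set.range (j b).left) ∧
      (∀ {b c} (f : b ⟶ c), Z.map f ≫ j c = j b) ∧
      ∀ (b) {T : Over S} (f : T ⟶ Y), ⊤ ≤ T.hom ⁻¹ᵁ b.1 → ∃ g : T ⟶ Z.obj b, g ≫ j b = f := by
  choose p hp hprop using hZ
  have comm {b c : ExhaustedOpens P} (f : b ⟶ c) :
      (Z.map f).left ≫ p c = p b ≫ S.homOfLE (show b.1 ≤ c.1 from f.le) := by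
    rw [← cancel_mono c.1.ι, Category.assoc, hp, Over.w, Category.assoc, Scheme.homOfLE_ι, hp]
  have pb {b c : ExhaustedOpens P} (f : b ⟶ c) :
      IsPullback (Z.map f).left (p b) (p c) (S.homOfLE (show b.1 ≤ c.1 from f.le)) := by
    have hm : Mono (Z.map f).left := by
      have := hmono f
      infer_instance
    have H (s : PullbackCone (p c) (S.homOfLE (show b.1 ≤ c.1 from f.le))) :
        ∃ l : s.pt ⟶ (Z.obj b).left, l ≫ (Z.map f).left = s.fst := by
      let T : Over S := Over.mk (s.fst ≫ (Z.obj c).hom)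
      have hT : ⊤ ≤ T.hom ⁻¹ᵁ b.1 := by
        have h1 : T.hom = s.snd ≫ b.1.ι := by
          change s.fst ≫ (Z.obj c).hom = s.snd ≫ b.1.ι
          rw [← hp c, ← Category.assoc, s.condition, Category.assoc, Scheme.homOfLE_ι]
        rw [h1]
        exact fun t _ => (s.snd t).2
      obtain ⟨h, hh⟩ := hlift f (T := T) (Over.homMk s.fst) hT
      exact ⟨h.left, congrArg (fun k => k.left) hh⟩
    choose l hl using H
    refine ⟨⟨comm f⟩, ⟨PullbackCone.IsLimit.mk _ l hl (fun s => ?_) fun s m h1 _ => ?_⟩⟩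
    · rw [← cancel_mono (S.homOfLE (show b.1 ≤ c.1 from f.le)), ← s.condition, ← hl s,
        Category.assoc, Category.assoc, comm]
    · exact (cancel_mono (Z.map f).left).1 (h1.trans (hl s).symm)
  -- These cartesian squares form relative gluing data.
  let D : (exhaustedCover hB).I₀ ⥤ Scheme.{u} := Z ⋙ Over.forget S
  let α : D ⟶ (exhaustedCover hB).functorOfLocallyDirected :=
    { app := p
      naturality := fun b c f => comm (b := b) (c := c) f }
  let G : (exhaustedCover hB).RelativeGluingData :=
    ⟨D, α, fun b c f => pb (b := b) (c := c) f⟩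
  obtain ⟨Y, q, j, hj, hcov, hcomp, hpb⟩ := exists_glued_of_relativeGluingData G
  let j' (b : ExhaustedOpens P) : (Z.obj b).left ⟶ Y := j b
  have hG (b : ExhaustedOpens P) : IsPullback (p b) (j' b) b.1.ι q := hpb b
  have hb (b : ExhaustedOpens P) : j' b ≫ q = (Z.obj b).hom := by rw [← (hG b).w, hp]
  refine ⟨Over.mk q, fun b => Over.homMk (j' b) (hb b), ?_, hj, hcov,
    fun f => Over.OverMorphism.ext (hcomp f), ?_⟩
  · refine IsZariskiLocalAtTarget.of_openCover (𝒰 := exhaustedCover hB) fun b => ?_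
    have h1 := (hG b).flip
    have h3 : IsProper (p b) := hprop b
    have h2 : IsProper (h1.isoPullback.inv ≫ p b) := inferInstance
    exact (congrArg (fun k => IsProper k) h1.isoPullback_inv_snd).mp h2
  · intro b T f hT
    have h1 : Set.range T.hom ⊆ Set.range b.1.ι := by
      rintro _ ⟨t, rfl⟩
      exact b.1.range_ι ▸ hT (Opens.mem_top t)
    have h2 : IsOpenImmersion.lift b.1.ι T.hom h1 ≫ b.1.ι = f.left ≫ q :=
      (IsOpenImmersion.lift_fac _ _ _).trans (Over.w f).symm
    have h3 := (hG b).lift_snd _ _ h2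
    refine ⟨Over.homMk ((hG b).lift _ _ h2) ?_, Over.OverMorphism.ext h3⟩
    rw [← hb b, ← Category.assoc, h3]
    exact Over.w f

/-! ### Restriction of closures to smaller open subsets -/

section Local

variable {Z : ExhaustedOpens P → Over S} {z : ∀ b, P.obj (op (Z b))}

theorem lifts_restr_of_le (W : Over S) (w : P.obj (op W)) {b c : S.Opens} (h : b ≤ c) :
    Lifts (P.map (restrι W (W.hom ⁻¹ᵁ b)).op w) (P.map (restrι W (W.hom ⁻¹ᵁ c)).op w) :=
  (Lifts.map w _).restrBase ((top_le_restrBase W b).trans fun _ hx => h hx)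

/-- The closure over a smaller open subset factors through the closure over a larger one. -/
theorem lifts_of_le {w : P.obj (op W)} (hZ : ∀ b, IsProperOver b.1 (Z b))
    (hz : ∀ b, IsClosureOf (P.map (restrι W (W.hom ⁻¹ᵁ b.1)).op w) (z b))
    {b c : ExhaustedOpens P} (h : b ≤ c) : Lifts (z b) (z c) := by
  obtain ⟨hzc, d, hd, -⟩ := hz c
  refine ((hz b).lifts b.2.2 b.2.1 (hZ b) ((hZ c).restrBase h) (hzc.restrict _) ?_).trans
    (Lifts.map (z c) _)
  exact ((lifts_restr_of_le W w h).trans ⟨d, hd⟩).restrBase (top_le_restrBase W b.1)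

/-- The restriction of a closure to a smaller open subset factors through the closure there.
Scheme-theoretic dominance is preserved by restriction, so that `IsClosureOf.lifts` applies. -/
theorem restr_lifts_of_le {w : P.obj (op W)} (hZ : ∀ b, IsProperOver b.1 (Z b))
    (hz : ∀ b, IsClosureOf (P.map (restrι W (W.hom ⁻¹ᵁ b.1)).op w) (z b))
    {b c : ExhaustedOpens P} (h : b ≤ c) :
    Lifts (P.map (restrι (Z c) ((Z c).hom ⁻¹ᵁ b.1)).op (z c)) (z b) := by
  obtain ⟨hzb, d, hd, -⟩ := hz b
  refine ((hz c).restrBase b.1).lifts b.2.2 b.2.1 ((hZ c).restrBase h) (hZ b) hzb ?_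
  refine Lifts.trans ?_ ⟨d, hd⟩
  exact ((Lifts.map _ _).trans (Lifts.map w _)).restrBase (top_le_restrBase _ b.1)

end Local

/-- Every point of `P` that is quasi-compact over `S` has a closure: a smallest subfunctor of `P`
through which it factors and which is represented by a proper scheme over `S`. -/
theorem exists_closure (hP : GluesOver P) (hB : HasExhaustedBasis P) [QuasiCompact W.hom]
    (w : P.obj (op W)) : ∃ (Y : Over S) (y : P.obj (op Y)), IsProper Y.hom ∧ Separates y ∧
      Lifts w y ∧ ∀ (Y' : Over S) (y' : P.obj (op Y')), IsProper Y'.hom → Separates y' →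
        Lifts w y' → Lifts y y' := by
  have H (b : ExhaustedOpens P) : ∃ (Z : Over S) (z : P.obj (op Z)), IsProperOver b.1 Z ∧
      IsClosureOf (P.map (restrι W (W.hom ⁻¹ᵁ b.1)).op w) z := by
    have : CompactSpace (restr W (W.hom ⁻¹ᵁ b.1)).left :=
      isCompact_iff_compactSpace.1 (W.hom.isCompact_preimage b.2.1.isCompact)
    exact b.2.2.exists_isClosureOf b.2.1 (top_le_restrBase W b.1) _
  -- The closures over the members of the basis are unique, so they form a functor.
  choose Z z hZ hz using H
  have hm (b c : ExhaustedOpens P) (f : b ⟶ c) : Lifts (z b) (z c) := lifts_of_le hZ hz f.le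
  choose m hm using hm
  let D : ExhaustedOpens P ⥤ Over S :=
    { obj := Z
      map := fun {b c} f => m b c f
      map_id := fun b => (hz b).1 _ _ (by rw [hm, op_id, Functor.map_id_apply])
      map_comp := fun {b c d} f g => (hz d).1 _ _ (by
        rw [hm, op_comp, Functor.map_comp_apply, hm, hm]) }
  have hmono {b c : ExhaustedOpens P} (f : b ⟶ c) : Mono (D.map f) := (hz b).1.mono _ (hm b c f)
  have hlift {b c : ExhaustedOpens P} (f : b ⟶ c) {T : Over S} (g : T ⟶ D.obj c)
      (hT : ⊤ ≤ T.hom ⁻¹ᵁ b.1) : ∃ h : T ⟶ D.obj b, h ≫ D.map f = g := by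
    obtain ⟨h, hh⟩ := ((Lifts.map (z c) g).restrBase hT).trans (restr_lifts_of_le hZ hz f.le)
    refine ⟨h, (hz c).1 _ _ ?_⟩
    rw [op_comp, Functor.map_comp_apply]
    exact (congrArg (P.map h.op) (hm b c f)).trans hh
  obtain ⟨Y, j, hY, hj, hcov, hcomp, hfac⟩ := hB.exists_glued D hZ hmono hlift
  have hjm (b : ExhaustedOpens P) : Mono (j b) := by
    have : Mono (j b).left := inferInstance
    exact mono_of_left _
  -- The points `z b` are compatible on the glued scheme: this can be checked over the members of
  -- the basis contained in both open subsets.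
  obtain ⟨y, hy⟩ := hP.exists_glue j hcov z fun b c T f g hfg => by
    let O (d : {d : ExhaustedOpens P // d ≤ b ∧ d ≤ c}) : T.left.Opens := T.hom ⁻¹ᵁ d.1.1
    have hO : iSup O = ⊤ := by
      refine top_le_iff.1 fun t _ => Opens.mem_iSup.2 ?_
      have h1 : T.hom t ∈ b.1 ⊓ c.1 := by
        refine ⟨?_, ?_⟩
        · have := (hZ b).top_le (Opens.mem_top (f.left t))
          rwa [← Over.w f]
        · have := (hZ c).top_le (Opens.mem_top (g.left t))
          rwa [← Over.w g]
      obtain ⟨d, hd, hd'⟩ := hB.exists_mem h1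
      exact ⟨⟨d, hd'.trans inf_le_left, hd'.trans inf_le_right⟩, hd⟩
    refine hP.ext hO fun d => ?_
    obtain ⟨f', hf'⟩ := hlift (homOfLE d.2.1) (restrι T (O d) ≫ f) (top_le_restrBase T d.1.1)
    obtain ⟨g', hg'⟩ := hlift (homOfLE d.2.2) (restrι T (O d) ≫ g) (top_le_restrBase T d.1.1)
    have h1 : f' = g' := by
      rw [← cancel_mono (j d.1), ← hcomp (homOfLE d.2.1), ← Category.assoc, hf', Category.assoc,
        hfg, hcomp, ← hcomp (homOfLE d.2.2), ← Category.assoc g', hg', Category.assoc]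
    rw [← Functor.map_comp_apply, ← Functor.map_comp_apply, ← op_comp, ← op_comp, ← hf', ← hg',
      op_comp, op_comp, Functor.map_comp_apply, Functor.map_comp_apply, h1]
    exact congrArg (P.map g'.op) ((hm _ _ _).trans (hm _ _ _).symm)
  have hyl (b : ExhaustedOpens P) : Lifts (z b) y := ⟨j b, hy b⟩
  have hyr {T : Over S} (f : T ⟶ Y) {b : ExhaustedOpens P} (hT : ⊤ ≤ T.hom ⁻¹ᵁ b.1) :
      Lifts (P.map f.op y) (z b) := by
    obtain ⟨g, rfl⟩ := hfac b f hT
    exact ⟨g, by rw [op_comp, Functor.map_comp_apply, hy]⟩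
  -- Over each member `b` of the basis, morphisms to `Y` are morphisms to `Z b`.
  have hsep : Separates y := fun T f g hfg => by
    refine restr_hom_ext (hB.iSup_preimage T) fun b => ?_
    obtain ⟨f', hf'⟩ := hfac b (restrι T (T.hom ⁻¹ᵁ b.1) ≫ f) (top_le_restrBase T b.1)
    obtain ⟨g', hg'⟩ := hfac b (restrι T (T.hom ⁻¹ᵁ b.1) ≫ g) (top_le_restrBase T b.1)
    rw [← hf', ← hg']
    refine congrArg (· ≫ j b) ((hz b).1 _ _ ?_)
    rw [← hy b, ← Functor.map_comp_apply, ← Functor.map_comp_apply, ← op_comp, ← op_comp, hf', hg',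
      op_comp, op_comp, Functor.map_comp_apply, Functor.map_comp_apply, hfg]
  refine ⟨Y, y, hY, hsep, ?_, fun Y' y' hY' hy' hw => ?_⟩
  · refine hsep.lifts_of_iSup_eq_top hP (hB.iSup_preimage W) fun b => ?_
    obtain ⟨-, d, hd, -⟩ := hz b
    exact Lifts.trans ⟨d, hd⟩ (hyl b)
  -- Minimality holds over each member of the basis, and factorizations glue.
  · refine hy'.lifts_of_iSup_eq_top hP (hB.iSup_preimage Y) fun b => ?_
    refine (hyr (restrι Y (Y.hom ⁻¹ᵁ b.1)) (top_le_restrBase Y b.1)).trans ?_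
    refine ((hz b).lifts b.2.2 b.2.1 (hZ b) (isProperOver_restrBase Y' b.1)
      (hy'.restrict _) ?_).trans (Lifts.map y' _)
    exact ((Lifts.map w _).trans hw).restrBase (top_le_restrBase W b.1)

end Closure

/-! ### Ind-schemes from exhaustions -/

section IndSchemeOfExhaustion

open Limits

variable {S : Scheme.{u}} {P : (Over S)ᵒᵖ ⥤ Type u} {W : Over S}

theorem GluesOver.eq_of_isEmpty (hP : GluesOver P) {T : Over S} (hT : IsEmpty T.left)
    (t t' : P.obj (op T)) : t = t' :=
  hP.ext (ι := PEmpty) (U := fun i => i.elim) (top_le_iff.1 fun y _ => hT.elim y) fun i => i.elim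

/-- Finitely many points of `P` over compact schemes are dominated by a single one. -/
theorem GluesOver.exists_coproduct (hP : GluesOver P) {ι : Type u} [Finite ι] {X : ι → Over S}
    (hX : ∀ i, CompactSpace (X i).left) (x : ∀ i, P.obj (op (X i))) :
    ∃ (W : Over S) (w : P.obj (op W)), CompactSpace W.left ∧ (∀ i, Lifts (x i) w) ∧
      ∀ {Y : Over S} {y : P.obj (op Y)}, Separates y → (∀ i, Lifts (x i) y) → Lifts w y := by
  let W : Over S := Over.mk (Sigma.desc fun i => (X i).hom)
  let j (i : ι) : X i ⟶ W := Over.homMk (Sigma.ι (fun i => (X i).left) i) (by simp [W])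
  have hj (i : ι) : IsOpenImmersion (j i).left :=
    inferInstanceAs (IsOpenImmersion (Sigma.ι (fun i => (X i).left) i))
  have hcov (y : W.left) : ∃ i, y ∈ Set.range (j i).left :=
    (sigmaOpenCover fun i => (X i).left).exists_eq y
  obtain ⟨w, hw⟩ := hP.exists_glue j hcov x fun i k T f g hfg => by
    -- Different members of the disjoint union do not meet, and there is only one point of `P` over
    -- the empty scheme.
    by_cases hik : i = k
    · subst hik
      have : Mono (j i) := by
        have : Mono (j i).left := inferInstance
        exact mono_of_left _
      rw [(cancel_mono (j i)).1 hfg]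
    · refine hP.eq_of_isEmpty ⟨fun t => hik ?_⟩ _ _
      have h1 : (sigmaMk fun i => (X i).left) ⟨i, f.left t⟩ =
          (sigmaMk fun i => (X i).left) ⟨k, g.left t⟩ := by
        rw [sigmaMk_mk, sigmaMk_mk]
        exact congrArg (fun q => q.left t) hfg
      exact congrArg Sigma.fst ((sigmaMk _).injective h1)
  refine ⟨W, w, ?_, fun i => ⟨j i, hw i⟩, fun hy h =>
    hy.lifts_of_jointly_surjective hP j hcov fun i => (hw i).symm ▸ h i⟩
  have : Finite (sigmaOpenCover fun i => (X i).left).I₀ := inferInstanceAs (Finite ι)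
  have (i : (sigmaOpenCover fun i => (X i).left).I₀) :
      CompactSpace ((sigmaOpenCover fun i => (X i).left).X i) := hX i
  exact (sigmaOpenCover fun i => (X i).left).compactSpace

/-- A compatible system of monomorphisms from `S`-schemes to `P`, as a morphism from the functor of
points of the ind-scheme. -/
def pointsDesc (Y : IndScheme S) (y : ∀ i, P.obj (op (Y.diagram.obj i)))
    (hy : ∀ {i k} (f : i ⟶ k), P.map (Y.diagram.map f).op (y k) = y i) : Y.points ⟶ P :=
  colimit.desc (Y.diagram ⋙ yoneda)
    { pt := P
      ι :=
        { app := fun i => yonedaEquiv.symm (y i)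
          naturality := fun i k f => by
            apply yonedaEquiv.injective
            have h1 : yonedaEquiv ((Y.diagram ⋙ yoneda).map f ≫ yonedaEquiv.symm (y k)) =
                P.map (Y.diagram.map f).op (y k) := by
              rw [Functor.comp_map, ← yonedaEquiv_naturality, Equiv.apply_symm_apply]
            refine h1.trans ((hy f).trans ?_)
            exact (yonedaEquiv.apply_symm_apply (y i)).symm } }

theorem pointsDesc_app (Y : IndScheme S) (y : ∀ i, P.obj (op (Y.diagram.obj i)))
    (hy : ∀ {i k} (f : i ⟶ k), P.map (Y.diagram.map f).op (y k) = y i) (T : Over S) (i : Y.index)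
    (f : T ⟶ Y.diagram.obj i) :
    (pointsDesc Y y hy).app (op T) ((colimit.ι (Y.diagram ⋙ yoneda) i).app (op T) f) =
      P.map f.op (y i) := by
  have h1 : colimit.ι (Y.diagram ⋙ yoneda) i ≫ pointsDesc Y y hy = yonedaEquiv.symm (y i) :=
    colimit.ι_desc _ _
  exact congrArg (fun q : yoneda.obj (Y.diagram.obj i) ⟶ P => q.app (op T) f) h1

theorem exists_eq_ι_app (Y : IndScheme S) (T : Over S) (q : Y.points.obj (op T)) :
    ∃ (i : Y.index) (f : T ⟶ Y.diagram.obj i),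
      (colimit.ι (Y.diagram ⋙ yoneda) i).app (op T) f = q :=
  Types.jointly_surjective_of_isColimit (isColimitOfPreserves ((evaluation _ _).obj (op T))
    (colimit.isColimit (Y.diagram ⋙ yoneda))) q

theorem ι_app_map (Y : IndScheme S) (T : Over S) {i k : Y.index} (h : i ⟶ k)
    (f : T ⟶ Y.diagram.obj i) :
    (colimit.ι (Y.diagram ⋙ yoneda) k).app (op T) (f ≫ Y.diagram.map h) =
      (colimit.ι (Y.diagram ⋙ yoneda) i).app (op T) f :=
  congrArg (fun q : yoneda.obj (Y.diagram.obj i) ⟶ colimit (Y.diagram ⋙ yoneda) => q.app (op T) f)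
    (colimit.w (Y.diagram ⋙ yoneda) h)

theorem pointsDesc_app_injective (Y : IndScheme S) (y : ∀ i, P.obj (op (Y.diagram.obj i)))
    (hy : ∀ {i k} (f : i ⟶ k), P.map (Y.diagram.map f).op (y k) = y i)
    (hsep : ∀ i, Separates (y i)) (T : Over S) :
    Function.Injective ((pointsDesc Y y hy).app (op T)) := by
  intro q q' h
  obtain ⟨i, f, rfl⟩ := exists_eq_ι_app Y T q
  obtain ⟨i', f', rfl⟩ := exists_eq_ι_app Y T q'
  obtain ⟨k, hk, hk'⟩ := exists_ge_ge i i'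
  rw [← ι_app_map Y T (homOfLE hk), ← ι_app_map Y T (homOfLE hk'), pointsDesc_app,
    pointsDesc_app] at h
  rw [← ι_app_map Y T (homOfLE hk), ← ι_app_map Y T (homOfLE hk'), hsep k _ _ h]

/-- A functor that satisfies gluing, and which locally on `S` is exhausted by proper subfunctors,
is represented by an ind-proper ind-scheme. It is indexed by the finite sets of members `X b n` of
the local exhaustions; to such a set one assigns the closure of their disjoint union. -/
theorem HasExhaustedBasis.exists_indScheme [QuasiSeparatedSpace S] (hB : HasExhaustedBasis P)
    (hP : GluesOver P) : ∃ Y : IndScheme S, Y.Represents P ∧ Y.IsIndProper := by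
  choose X x hX hx hlift using fun b : ExhaustedOpens P => b.2.2
  have hXc (k : ExhaustedOpens P × ℕ) : CompactSpace (X k.1 k.2).left :=
    (hX k.1 k.2).compactSpace k.1.2.1
  have H (s : Finset (ExhaustedOpens P × ℕ)) : ∃ (Y : Over S) (y : P.obj (op Y)),
      IsProper Y.hom ∧ Separates y ∧ (∀ k ∈ s, Lifts (x k.1 k.2) y) ∧
      ∀ (Y' : Over S) (y' : P.obj (op Y')), IsProper Y'.hom → Separates y' →
        (∀ k ∈ s, Lifts (x k.1 k.2) y') → Lifts y y' := by
    obtain ⟨W, w, hW, hw, hw'⟩ := hP.exists_coproduct (ι := s) (fun k => hXc k.1)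
      (fun k => x k.1.1 k.1.2)
    -- A compact scheme is quasi-compact over `S`, because `S` is quasi-separated.
    obtain ⟨Y, y, hY, hy, hwy, hmin⟩ := exists_closure hP hB w
    exact ⟨Y, y, hY, hy, fun k hk => (hw ⟨k, hk⟩).trans hwy, fun Y' y' hY' hy' h =>
      hmin Y' y' hY' hy' (hw' hy' fun k => h k.1 k.2)⟩
  choose Y y hY hy hxy hmin using H
  have hm (s s' : Finset (ExhaustedOpens P × ℕ)) (f : s ⟶ s') : Lifts (y s) (y s') :=
    hmin s _ _ (hY s') (hy s') fun k hk => hxy s' k (f.le hk)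
  choose m hm using hm
  let D : IndScheme S :=
    { index := Finset (ExhaustedOpens P × ℕ)
      directed := inferInstance
      diagram :=
        { obj := Y
          map := fun {s s'} f => m s s' f
          map_id := fun s => hy s _ _ (by rw [hm, op_id, Functor.map_id_apply])
          map_comp := fun {s s' s''} f g => hy s'' _ _ (by
            rw [hm, op_comp, Functor.map_comp_apply, hm, hm]) }
      isClosedImmersion := fun {s s'} f => by
        have h1 : Mono (m s s' f) := (hy s).mono _ (hm s s' f)
        have h2 : Mono (m s s' f).left := inferInstance
        have h3 : IsProper (Y s').hom := hY s'
        have h4 : IsProper ((m s s' f).left ≫ (Y s').hom) := (Over.w (m s s' f)).symm ▸ hY s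
        exact (IsClosedImmersion.iff_isProper_and_mono _).2 ⟨IsProper.of_comp _ (Y s').hom, h2⟩
      quasiCompact := fun s => by
        have h3 : IsProper (Y s).hom := hY s
        exact inferInstanceAs (QuasiCompact (Y s).hom) }
  refine ⟨D, ⟨hP.isSheaf, pointsDesc D y fun {s s'} f => hm s s' f, fun T hT =>
    ⟨pointsDesc_app_injective D y _ hy T, fun t => ?_⟩⟩, hY⟩
  -- A point over a quasi-compact scheme factors locally through one of the `X b n`, hence through
  -- the closure for a finite set.
  have hloc (z : T.left) : ∃ (U : T.left.Opens) (b : ExhaustedOpens P), z ∈ U ∧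
      IsCompact (U : Set T.left) ∧ U ≤ T.hom ⁻¹ᵁ b.1 := by
    obtain ⟨b, hb, -⟩ := hB.exists_mem (Opens.mem_top (T.hom z))
    obtain ⟨U, hU, hzU, hUb⟩ := Opens.isBasis_iff_nbhd.1 T.left.isBasis_affineOpens
      (show z ∈ T.hom ⁻¹ᵁ b.1 from hb)
    exact ⟨U, b, hzU, IsAffineOpen.isCompact hU, hUb⟩
  choose U b hzU hUc hUb using hloc
  have hn (z : T.left) : ∃ n, Lifts (P.map (restrι T (U z)).op t) (x (b z) n) := by
    have : CompactSpace (restr T (U z)).left := isCompact_iff_compactSpace.1 (hUc z)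
    obtain ⟨n, hn⟩ := hlift (b z) (restr T (U z)) this (fun q _ => hUb z q.2)
      (P.map (restrι T (U z)).op t)
    exact ⟨n, hn n le_rfl⟩
  choose n hn using hn
  obtain ⟨Q, hQ⟩ := isCompact_univ.elim_finite_subcover (fun z : T.left => (U z : Set T.left))
    (fun z => (U z).isOpen) (fun z _ => Set.mem_iUnion.2 ⟨z, hzU z⟩)
  classical
  let s : Finset (ExhaustedOpens P × ℕ) := Q.image fun z => (b z, n z)
  have hsup : (⨆ z : (Q : Type u), U z.1) = ⊤ := by
    refine top_le_iff.1 fun z _ => Opens.mem_iSup.2 ?_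
    obtain ⟨q, hq⟩ := Set.mem_iUnion.1 (hQ (Set.mem_univ z))
    obtain ⟨hq1, hq2⟩ := Set.mem_iUnion.1 hq
    exact ⟨⟨q, hq1⟩, hq2⟩
  obtain ⟨f, hf⟩ := (hy s).lifts_of_iSup_eq_top hP (t := t) hsup fun z =>
    (hn z.1).trans (hxy s _ (Finset.mem_image_of_mem _ z.2))
  exact ⟨(colimit.ι (D.diagram ⋙ yoneda) s).app (op T) f,
    (pointsDesc_app D y (fun {s s'} f => hm s s' f) T s f).trans hf⟩

end IndSchemeOfExhaustion

/-! ### Matrices of Laurent series and square-zero extensions -/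

section LaurentMatrices

variable {N : ℕ} {R R' : Type*} [CommRing R] [CommRing R']

variable (N R) in
/-- Square matrices of Laurent series. -/
abbrev LaurentMatrix : Type _ := Matrix (Fin N) (Fin N) (LaurentSeries R)

variable (N R) in
/-- The subring of matrices of power series. -/
def powerMatrix : Subring (LaurentMatrix N R) where
  carrier := {x | ∀ i j, x i j ∈ (HahnSeries.ofPowerSeries ℤ R).range}
  zero_mem' _ _ := zero_mem _
  one_mem' i j := by
    rw [Matrix.one_apply]
    split_ifs
    · exact one_mem _
    · exact zero_mem _
  neg_mem' h i j := neg_mem (h i j)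
  add_mem' h h' i j := add_mem (h i j) (h' i j)
  mul_mem' h h' i j := by
    rw [Matrix.mul_apply]
    exact sum_mem fun k _ => mul_mem (h i k) (h' k j)

theorem mem_powerMatrix {x : LaurentMatrix N R} :
    x ∈ powerMatrix N R ↔ ∀ i j (n : ℕ), (x i j).coeff (Int.negSucc n) = 0 :=
  forall₂_congr fun _ _ => mem_power_iff

variable (N) in
/-- The ring homomorphism applying `f` to all coefficients of a matrix of Laurent series. -/
def matrixMap (f : R →+* R') : LaurentMatrix N R →+* LaurentMatrix N R' :=
  (laurentMap f).mapMatrix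

theorem matrixMap_mem (f : R →+* R') {x : LaurentMatrix N R} (hx : x ∈ powerMatrix N R) :
    matrixMap N f x ∈ powerMatrix N R' := fun i j => laurentMap_mem_range f (hx i j)

theorem matrixMap_smul (f : R →+* R') (r : R) (x : LaurentMatrix N R) :
    matrixMap N f (r • x) = f r • matrixMap N f x := by
  ext i j n
  exact map_mul f _ _

theorem smul_mem_powerMatrix (r : R) {x : LaurentMatrix N R} (hx : x ∈ powerMatrix N R) :
    r • x ∈ powerMatrix N R := mem_powerMatrix.2 fun i j n => by
  have := mem_powerMatrix.1 hx i j n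
  exact (congrArg (r * ·) this).trans (mul_zero r)

theorem smul_eq_scalar_mul (r : R) (x : LaurentMatrix N R) :
    r • x = Matrix.scalar (Fin N) (HahnSeries.C r : LaurentSeries R) * x := by
  ext1 i j
  rw [Matrix.scalar_apply, Matrix.diagonal_mul, HahnSeries.C_mul_eq_smul]
  rfl

theorem smul_mul_eq (r : R) (x y : LaurentMatrix N R) : (r • x) * y = r • (x * y) := by
  rw [smul_eq_scalar_mul, smul_eq_scalar_mul, mul_assoc]

theorem mul_smul_eq (r : R) (x y : LaurentMatrix N R) : x * (r • y) = r • (x * y) := by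
  rw [smul_eq_scalar_mul, smul_eq_scalar_mul, ← mul_assoc, ← mul_assoc]
  exact congrArg (· * y) (Matrix.scalar_commute _ (fun _ => Commute.all _ _) x).symm

/-- The Laurent polynomial in `t⁻¹` without constant term that has the given coefficients. -/
def polar {K : ℕ} (c : Fin K → R) : LaurentSeries R :=
  ∑ k : Fin K, HahnSeries.single (Int.negSucc k) (c k)

theorem coeff_polar {K : ℕ} (c : Fin K → R) (n : ℕ) :
    (polar c).coeff (Int.negSucc n) = if h : n < K then c ⟨n, h⟩ else 0 := by
  rw [polar, HahnSeries.coeff_sum]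
  simp only [HahnSeries.coeff_single, Int.negSucc.injEq]
  split_ifs with h
  · rw [Finset.sum_eq_single ⟨n, h⟩ (fun k _ hk => if_neg fun h' => hk (Fin.ext h'.symm))
      (fun h' => absurd (Finset.mem_univ _) h')]
    exact if_pos rfl
  · exact Finset.sum_eq_zero fun k _ => if_neg fun (h' : n = k) => h (h' ▸ k.2)

theorem laurentMap_polar (f : R →+* R') {K : ℕ} (c : Fin K → R) :
    laurentMap f (polar c) = polar fun k => f (c k) := by
  rw [polar, map_sum]
  exact Finset.sum_congr rfl fun k _ => laurentMap_single f _ _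

/-- The negative parts of the entries of a matrix are uniformly bounded. -/
theorem exists_bound (x : LaurentMatrix N R) :
    ∃ K : ℕ, ∀ i j (n : ℕ), K ≤ n → (x i j).coeff (Int.negSucc n) = 0 := by
  choose k hk using fun p : Fin N × Fin N => exists_coeff_eq_zero (x p.1 p.2)
  refine ⟨Finset.univ.sup k, fun i j n hn => hk (i, j) _ ?_⟩
  have := Finset.le_sup (f := k) (Finset.mem_univ (i, j))
  omega

/-- A ring homomorphism whose kernel has square zero. -/
def SquareZero (f : R →+* R') : Prop := ∀ ⦃r s : R⦄, f r = 0 → f s = 0 → r * s = 0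

theorem SquareZero.laurentMap {f : R →+* R'} (hf : SquareZero f) :
    SquareZero (TwistedGrassmannian.laurentMap f) :=
  fun a b ha hb => by
    ext n
    rw [HahnSeries.coeff_mul, HahnSeries.coeff_zero]
    exact Finset.sum_eq_zero fun p _ => hf (congrArg (fun c => c.coeff p.1) ha)
      (congrArg (fun c => c.coeff p.2) hb)

theorem SquareZero.mul_eq_zero {f : R →+* R'} (hf : SquareZero f) {x y : LaurentMatrix N R}
    (hx : matrixMap N f x = 0) (hy : matrixMap N f y = 0) :
    x * y = 0 := by
  ext1 i j
  rw [Matrix.mul_apply]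
  exact Finset.sum_eq_zero fun k _ => hf.laurentMap (congrFun (congrFun hx i) k)
    (congrFun (congrFun hy k) j)

/-- The matrix of the first `K` negative coefficients of the entries of `x`. -/
def polarMatrix (K : ℕ) (x : LaurentMatrix N R) : LaurentMatrix N R :=
  Matrix.of fun i j => polar fun k : Fin K => (x i j).coeff (Int.negSucc k)

theorem coeff_polarMatrix (K : ℕ) (x : LaurentMatrix N R) (i j : Fin N) (n : ℕ) :
    (polarMatrix K x i j).coeff (Int.negSucc n) =
      if n < K then (x i j).coeff (Int.negSucc n) else 0 :=
  coeff_polar _ n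

/-- A matrix that reduces to a matrix of power series differs from a matrix of power series by its
polar part, which reduces to zero. -/
theorem exists_polar_part {f : R →+* R'} {x : LaurentMatrix N R}
    (hx : matrixMap N f x ∈ powerMatrix N R') :
    ∃ n : LaurentMatrix N R, matrixMap N f n = 0 ∧ x - n ∈ powerMatrix N R := by
  obtain ⟨K, hK⟩ := exists_bound x
  refine ⟨polarMatrix K x, ?_, mem_powerMatrix.2 fun i j n => ?_⟩
  · ext1 i j
    refine (laurentMap_polar f _).trans (Finset.sum_eq_zero fun k _ => ?_)
    have h1 : f ((x i j).coeff (Int.negSucc k)) = 0 := mem_powerMatrix.1 hx i j k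
    exact (congrArg _ h1).trans (map_zero _)
  · rw [Matrix.sub_apply, HahnSeries.coeff_sub, coeff_polarMatrix]
    split_ifs with h
    · exact sub_self _
    · rw [hK i j n (not_lt.1 h), sub_zero]

/-- Laurent series lift along surjections, coefficient by coefficient. -/
theorem laurentMap_surjective {f : R →+* R'} (hf : Function.Surjective f) :
    Function.Surjective (laurentMap f) := by
  classical
  intro b
  choose σ hσ using hf
  -- The coefficient zero is lifted to zero, so that the support does not grow.
  refine ⟨⟨fun n => if b.coeff n = 0 then 0 else σ (b.coeff n), ?_⟩, ?_⟩
  · refine b.isPWO_support.mono fun n hn hb => hn ?_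
    exact if_pos hb
  · ext n
    rw [laurentMap_coeff]
    change f (if b.coeff n = 0 then 0 else σ (b.coeff n)) = b.coeff n
    split_ifs with h
    · rw [map_zero, h]
    · exact hσ _

/-- Invertible matrices lift along surjections with kernel of square zero. -/
theorem SquareZero.exists_glMap_eq {f : R →+* R'} (hf : SquareZero f)
    (hs : Function.Surjective f) (g : GL (Fin N) (LaurentSeries R')) :
    ∃ g' : GL (Fin N) (LaurentSeries R), glMap f g' = g := by
  choose σ hσ using laurentMap_surjective hs
  let x : LaurentMatrix N R := fun i j => σ (g.1 i j)
  let y : LaurentMatrix N R := fun i j => σ (g⁻¹.1 i j)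
  have hx : matrixMap N f x = g.1 := by
    ext1 i j
    exact hσ _
  have hy : matrixMap N f y = g⁻¹.1 := by
    ext1 i j
    exact hσ _
  have hn : matrixMap N f (x * y - 1) = 0 := by
    rw [map_sub, map_mul, hx, hy, ← Units.val_mul, mul_inv_cancel, Units.val_one, map_one, sub_self]
  -- The error `x * y - 1` has square zero, which gives an inverse of `x * y`.
  have h1 : x * (y * (1 - (x * y - 1))) = 1 := by
    have h2 := hf.mul_eq_zero hn hn
    have h3 : x * (y * (1 - (x * y - 1))) = 1 - (x * y - 1) * (x * y - 1) := by noncomm_ring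
    rw [h3, h2, sub_zero]
  exact ⟨⟨x, _, h1, mul_eq_one_comm.1 h1⟩, Units.ext hx⟩

end LaurentMatrices

/-! ### Splitting of the obstruction cocycle -/

section Deformation

variable {Λ Λ' : Type*} [Ring Λ] [Ring Λ'] {ρ : Λ →+* Λ'}
  {Pw : Subring Λ}

/-- The matrices `c n_{il} u_{li}` split the cocycle `c n_{ik}` of obstructions, up to matrices of
power series. Here `u` is a cocycle of transition matrices and `n_{ik}` reduces to zero and
differs from `u_{ik}` by an element of `Pw`; the map `c` is multiplication with a scalar. -/
theorem split_mem (hρ : ∀ x y, ρ x = 0 → ρ y = 0 → x * y = 0) (c : Λ →+ Λ)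
    (hc : ∀ x ∈ Pw, c x ∈ Pw) (hc₁ : ∀ x y, c (x * y) = c x * y) (hc₂ : ∀ x y, c (x * y) = x * c y)
    (hc₃ : ∀ x, ρ x = 0 → ρ (c x) = 0) {uik ukl uil ulk uli nik nkl nil nlk Xi Xk : Λ}
    (hik : uik - nik ∈ Pw) (hkl : ukl - nkl ∈ Pw) (hil : uil - nil ∈ Pw) (hlk : ulk - nlk ∈ Pw)
    (nik0 : ρ nik = 0) (nkl0 : ρ nkl = 0) (nil0 : ρ nil = 0) (nlk0 : ρ nlk = 0)
    (h₁ : uik * ukl = uil) (h₂ : ukl * ulk = 1) (h₃ : uli * uik = ulk)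
    (Xi0 : ρ Xi = 0) (Xk0 : ρ Xk = 0)
    (hXi : Xi - c (nil * uli) ∈ Pw) (hXk : Xk - c (nkl * ulk) ∈ Pw) :
    Xi * uik - uik * Xk - c nik ∈ Pw := by
  have hs (x y : Λ) (hx : ρ x = 0) : ρ (x * y) = 0 := by rw [map_mul, hx, zero_mul]
  have hs' (x y : Λ) (hy : ρ y = 0) : ρ (x * y) = 0 := by rw [map_mul, hy, mul_zero]
  -- The errors `Xi - c n_{il} u_{li}` and `Xk - c n_{kl} u_{lk}` reduce to zero.
  have e1 : (Xi - c (nil * uli)) * nik = 0 :=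
    hρ _ _ (by rw [map_sub, Xi0, hc₃ _ (hs _ _ nil0), sub_zero]) nik0
  have e2 : nik * (Xk - c (nkl * ulk)) = 0 :=
    hρ _ _ nik0 (by rw [map_sub, Xk0, hc₃ _ (hs _ _ nkl0), sub_zero])
  have e3 : nik * nkl = 0 := hρ _ _ nik0 nkl0
  have e4 : ((uik - nik) * (ukl - nkl) - (uil - nil)) * nlk = 0 := by
    refine hρ _ _ ?_ nlk0
    rw [← h₁]
    simp only [map_sub, map_mul, nik0, nkl0, nil0, sub_zero, sub_self]
  have e5 : nik * nkl * ulk = 0 := by rw [e3, zero_mul]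
  have m1 := Pw.mul_mem hXi hik
  have m2 := Pw.mul_mem hik hXk
  have m3 := hc _ (Pw.mul_mem (Pw.sub_mem (Pw.mul_mem hik hkl) hil) hlk)
  have e6 : Xi * uik - uik * Xk - c nik =
      (Xi - c (nil * uli)) * (uik - nik) - (uik - nik) * (Xk - c (nkl * ulk)) +
        c (((uik - nik) * (ukl - nkl) - (uil - nil)) * (ulk - nlk)) := by
    have f1 : (Xi - c (nil * uli)) * (uik - nik) = Xi * uik - c (nil * ulk) := by
      rw [mul_sub, e1, sub_zero, sub_mul, ← hc₁, mul_assoc, h₃]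
    have f2 : (uik - nik) * (Xk - c (nkl * ulk)) = uik * Xk - c (uik * nkl * ulk) := by
      rw [sub_mul, e2, sub_zero, mul_sub, ← hc₂, mul_assoc]
    have f3 : ((uik - nik) * (ukl - nkl) - (uil - nil)) * (ulk - nlk) =
        nil * ulk - uik * nkl * ulk - nik := by
      rw [mul_sub, e4, sub_zero]
      have : ((uik - nik) * (ukl - nkl) - (uil - nil)) * ulk =
          (uik * ukl - uil) * ulk + nil * ulk - uik * nkl * ulk - nik * (ukl * ulk) +
            nik * nkl * ulk := by noncomm_ring
      rw [this, h₁, h₂, e5, sub_self, zero_mul, zero_add, mul_one, add_zero]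
    rw [f1, f2, f3, map_sub, map_sub]
    abel
  rw [e6]
  exact Pw.add_mem (Pw.sub_mem m1 m2) m3

/-- A splitting of the obstruction cocycle corrects the transition matrices. -/
theorem conj_mem (hρ : ∀ x y, ρ x = 0 → ρ y = 0 → x * y = 0) {v n X Y : Λ} (hv : v - n ∈ Pw)
    (X0 : ρ X = 0) (Y0 : ρ Y = 0) (h : X * v - v * Y - n ∈ Pw) :
    (1 - X) * v * (1 + Y) ∈ Pw := by
  have h0 : X * v * Y = 0 := hρ _ _ (by rw [map_mul, X0, zero_mul]) Y0
  have : (1 - X) * v * (1 + Y) = (v - n) - (X * v - v * Y - n) - X * v * Y := by noncomm_ring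
  rw [this, h0, sub_zero]
  exact Pw.sub_mem hv h

end Deformation

/-! ### Extension of matrices from basic open sets -/

section Extension

variable {T T₀ : Scheme.{u}} {N : ℕ}

/-- Restriction of matrices of Laurent series of functions. -/
def resMatrix {U V : T.Opens} (h : V ≤ U) :
    LaurentMatrix N Γ(T, U) →+* LaurentMatrix N Γ(T, V) :=
  matrixMap N (T.presheaf.map (homOfLE h).op).hom

theorem resMatrix_resMatrix {U V W : T.Opens} (h : V ≤ U) (h' : W ≤ V)
    (x : LaurentMatrix N Γ(T, U)) :
    resMatrix h' (resMatrix h x) = resMatrix (h'.trans h) x := by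
  ext i j n
  change (T.presheaf.map (homOfLE h').op).hom ((T.presheaf.map (homOfLE h).op).hom _) = _
  rw [← CommRingCat.comp_apply, ← Functor.map_comp]
  rfl

theorem resMatrix_mem {U V : T.Opens} (h : V ≤ U) {x : LaurentMatrix N Γ(T, U)}
    (hx : x ∈ powerMatrix N Γ(T, U)) : resMatrix h x ∈ powerMatrix N Γ(T, V) := matrixMap_mem _ hx

/-- Pullback of matrices of Laurent series of functions. -/
def pullMatrix (q : T₀ ⟶ T) (U : T.Opens) :
    LaurentMatrix N Γ(T, U) →+* LaurentMatrix N Γ(T₀, q ⁻¹ᵁ U) := matrixMap N (q.app U).hom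

theorem app_res_apply (q : T₀ ⟶ T) {U V : T.Opens} (h : V ≤ U) (r : Γ(T, U)) :
    (q.app V).hom ((T.presheaf.map (homOfLE h).op).hom r) =
      (T₀.presheaf.map (homOfLE (fun _ hx => h hx : q ⁻¹ᵁ V ≤ q ⁻¹ᵁ U)).op).hom
        ((q.app U).hom r) :=
  ConcreteCategory.congr_hom (q.naturality (homOfLE h).op) r

theorem pullMatrix_resMatrix (q : T₀ ⟶ T) {U V : T.Opens} (h : V ≤ U)
    (x : LaurentMatrix N Γ(T, U)) : pullMatrix q V (resMatrix h x) =
      resMatrix (fun _ hx => h hx : q ⁻¹ᵁ V ≤ q ⁻¹ᵁ U) (pullMatrix q U x) := by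
  ext i j n
  exact app_res_apply q h _

theorem pullMatrix_resMatrix_eq_zero (q : T₀ ⟶ T) {U V : T.Opens} (h : V ≤ U)
    {x : LaurentMatrix N Γ(T, U)} (hx : pullMatrix q U x = 0) :
    pullMatrix q V (resMatrix h x) = 0 := by
  rw [pullMatrix_resMatrix, hx, map_zero]

variable {V W : T.Opens} {f : Γ(T, V)}

/-- Functions in the kernel of `q` extend from a basic open set to functions in the kernel, after
multiplication with a power of the equation. -/
theorem exists_extension (q : T₀ ⟶ T) (hV : IsCompact (V : Set T))
    (hV' : IsQuasiSeparated (V : Set T)) (hqV : IsCompact ((q ⁻¹ᵁ V : T₀.Opens) : Set T₀))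
    (h : W ≤ V) (hW : W = T.basicOpen f) {c : Γ(T, W)} (hc : (q.app W).hom c = 0) :
    ∃ n₀ : ℕ, ∀ n ≥ n₀, ∃ y : Γ(T, V), (q.app V).hom y = 0 ∧
      (T.presheaf.map (homOfLE h).op).hom y = (T.presheaf.map (homOfLE h).op).hom f ^ n * c := by
  subst hW
  obtain ⟨m, y, hy⟩ := exists_eq_pow_mul_of_isCompact_of_isQuasiSeparated T V hV hV' f c
  replace hy : (T.presheaf.map (homOfLE h).op).hom y =
    (T.presheaf.map (homOfLE h).op).hom f ^ m * c := hy
  have h1 : ∃ k, (q.app V).hom f ^ k * (q.app V).hom y = 0 := by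
    refine exists_pow_mul_eq_zero_of_res_basicOpen_eq_zero_of_isCompact T₀ hqV _ _ ?_
    have h2 := congrArg (q.app (T.basicOpen f)).hom hy
    rw [map_mul, hc, mul_zero, app_res_apply] at h2
    have h3 : T₀.basicOpen ((q.app V).hom f) ≤ q ⁻¹ᵁ T.basicOpen f :=
      (Scheme.preimage_basicOpen q f).ge
    have h4 := congrArg (T₀.presheaf.map (homOfLE h3).op).hom h2
    rw [map_zero, ← CommRingCat.comp_apply, ← Functor.map_comp] at h4
    exact h4
  obtain ⟨k, hk⟩ := h1
  refine ⟨m + k, fun n hn => ⟨f ^ (n - m) * y, ?_, ?_⟩⟩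
  · have h5 : n - m = n - m - k + k := by omega
    rw [map_mul, map_pow, h5, pow_add, mul_assoc, hk, mul_zero]
  · rw [map_mul, map_pow, hy, ← mul_assoc, ← pow_add]
    congr 2
    omega

/-- A function that vanishes on a basic open subset is killed by a power of the equation. -/
theorem exists_kill (hV : IsCompact (V : Set T)) (h : W ≤ V) (hW : W = T.basicOpen f)
    {c : Γ(T, V)} (hc : (T.presheaf.map (homOfLE h).op).hom c = 0) :
    ∃ n₀ : ℕ, ∀ n ≥ n₀, f ^ n * c = 0 := by
  subst hW
  obtain ⟨k, hk⟩ := exists_pow_mul_eq_zero_of_res_basicOpen_eq_zero_of_isCompact T hV c f hc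
  refine ⟨k, fun n hn => ?_⟩
  have h5 : n = n - k + k := by omega
  rw [h5, pow_add, mul_assoc, hk, mul_zero]

/-- Matrices that reduce to zero extend from a basic open subset, up to matrices of power series
and a power of the equation: it suffices to extend the finitely many polar coefficients. -/
theorem exists_matrix_extension (q : T₀ ⟶ T) (hV : IsCompact (V : Set T))
    (hV' : IsQuasiSeparated (V : Set T)) (hqV : IsCompact ((q ⁻¹ᵁ V : T₀.Opens) : Set T₀))
    (h : W ≤ V) (hW : W = T.basicOpen f) {x : LaurentMatrix N Γ(T, W)}
    (hx : pullMatrix q W x = 0) :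
    ∃ n₀ : ℕ, ∀ n ≥ n₀, ∃ y : LaurentMatrix N Γ(T, V), pullMatrix q V y = 0 ∧
      resMatrix h y - (T.presheaf.map (homOfLE h).op).hom f ^ n • x ∈ powerMatrix N Γ(T, W) := by
  obtain ⟨K, hK⟩ := exists_bound x
  choose n₀ hn₀ using fun p : Fin N × Fin N × Fin K => exists_extension q hV hV' hqV h hW
    (c := (x p.1 p.2.1).coeff (Int.negSucc p.2.2))
    (congrArg (fun z : LaurentMatrix N _ => (z p.1 p.2.1).coeff (Int.negSucc p.2.2)) hx)
  refine ⟨Finset.univ.sup n₀, fun n hn => ?_⟩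
  choose y hy0 hy using fun p : Fin N × Fin N × Fin K =>
    hn₀ p n ((Finset.le_sup (Finset.mem_univ p)).trans hn)
  refine ⟨Matrix.of fun i j => polar fun k : Fin K => y (i, j, k), ?_,
    mem_powerMatrix.2 fun i j m => ?_⟩
  · ext1 i j
    refine (laurentMap_polar _ _).trans (Finset.sum_eq_zero fun k _ => ?_)
    exact (congrArg _ (hy0 (i, j, k))).trans (map_zero _)
  · rw [Matrix.sub_apply, HahnSeries.coeff_sub]
    change (T.presheaf.map (homOfLE h).op).hom ((polar _).coeff _) -
      (T.presheaf.map (homOfLE h).op).hom f ^ n * (x i j).coeff _ = 0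
    rw [coeff_polar]
    split_ifs with hm
    · rw [hy (i, j, ⟨m, hm⟩), sub_self]
    · rw [hK i j m (not_lt.1 hm), map_zero, mul_zero, sub_self]

/-- A matrix that becomes a matrix of power series on a basic open subset does so after
multiplication with a power of the equation. -/
theorem exists_matrix_kill (hV : IsCompact (V : Set T)) (h : W ≤ V) (hW : W = T.basicOpen f)
    {x : LaurentMatrix N Γ(T, V)} (hx : resMatrix h x ∈ powerMatrix N Γ(T, W)) :
    ∃ n₀ : ℕ, ∀ n ≥ n₀, f ^ n • x ∈ powerMatrix N Γ(T, V) := by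
  obtain ⟨K, hK⟩ := exists_bound x
  choose n₀ hn₀ using fun p : Fin N × Fin N × Fin K => exists_kill hV h hW
    (c := (x p.1 p.2.1).coeff (Int.negSucc p.2.2)) (mem_powerMatrix.1 hx _ _ _)
  refine ⟨Finset.univ.sup n₀, fun n hn => mem_powerMatrix.2 fun i j m => ?_⟩
  change f ^ n * (x i j).coeff _ = 0
  by_cases hm : m < K
  · exact hn₀ (i, j, ⟨m, hm⟩) n ((Finset.le_sup (Finset.mem_univ _)).trans hn)
  · rw [hK i j m (not_lt.1 hm), mul_zero]

end Extension

/-! ### Correction of transition matrices -/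

section Coboundary

variable {T T₀ : Scheme.{u}} {N : ℕ}

theorem map_homOfLE_map {U V W : T.Opens} (h : V ≤ U) (h' : W ≤ V) (r : Γ(T, U)) :
    (T.presheaf.map (homOfLE h').op).hom ((T.presheaf.map (homOfLE h).op).hom r) =
      (T.presheaf.map (homOfLE (h'.trans h)).op).hom r := by
  rw [← CommRingCat.comp_apply, ← Functor.map_comp]
  rfl

theorem resMatrix_smul {U V : T.Opens} (h : V ≤ U) (r : Γ(T, U)) (x : LaurentMatrix N Γ(T, U)) :
    resMatrix h (r • x) = (T.presheaf.map (homOfLE h).op).hom r • resMatrix h x :=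
  matrixMap_smul _ r x

theorem pullMatrix_smul (q : T₀ ⟶ T) {U : T.Opens} (r : Γ(T, U)) (x : LaurentMatrix N Γ(T, U)) :
    pullMatrix q U (r • x) = (q.app U).hom r • pullMatrix q U x :=
  matrixMap_smul _ r x

variable {ι : Type*} (a : ι → Γ(T, ⊤))

/-- Matrices over the intersections of basic open sets that satisfy the identities of transition
matrices. -/
structure IsCocycle (v : ∀ i k, LaurentMatrix N Γ(T, T.basicOpen (a i) ⊓ T.basicOpen (a k))) :
    Prop where
  mul_eq (W : T.Opens) (i k l) (hi : W ≤ T.basicOpen (a i)) (hk : W ≤ T.basicOpen (a k))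
    (hl : W ≤ T.basicOpen (a l)) : resMatrix (le_inf hi hk) (v i k) *
      resMatrix (le_inf hk hl) (v k l) = resMatrix (le_inf hi hl) (v i l)
  self_eq (W : T.Opens) (i) (hi : W ≤ T.basicOpen (a i)) : resMatrix (le_inf hi hi) (v i i) = 1

variable {a}

theorem IsCocycle.mul_inv_eq
    {v : ∀ i k, LaurentMatrix N Γ(T, T.basicOpen (a i) ⊓ T.basicOpen (a k))} (hv : IsCocycle a v)
    (W : T.Opens) (i k) (hi : W ≤ T.basicOpen (a i)) (hk : W ≤ T.basicOpen (a k)) :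
    resMatrix (le_inf hi hk) (v i k) * resMatrix (le_inf hk hi) (v k i) = 1 := by
  rw [hv.mul_eq W i k i hi hk hi, hv.self_eq W i hi]

variable {q : T₀ ⟶ T} [IsAffine T] [IsAffineHom q] [Finite ι]

/-- The obstruction cocycle splits after multiplication with a power of the equation of one of the
open sets. On `D(a i) ⊓ D(a l)` it is split by the matrices `n_{il} v_{li}`, which are then
extended to `D(a i)`. -/
theorem IsCocycle.exists_split
    {v : ∀ i k, LaurentMatrix N Γ(T, T.basicOpen (a i) ⊓ T.basicOpen (a k))} (hv : IsCocycle a v)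
    (hq : ∀ U, SquareZero (q.app U).hom)
    {n : ∀ i k, LaurentMatrix N Γ(T, T.basicOpen (a i) ⊓ T.basicOpen (a k))}
    (n0 : ∀ i k, pullMatrix q _ (n i k) = 0) (hn : ∀ i k, v i k - n i k ∈ powerMatrix N _) (l : ι) :
    ∃ (m : ℕ) (X : ∀ i, LaurentMatrix N Γ(T, T.basicOpen (a i))), (∀ i, pullMatrix q _ (X i) = 0) ∧
      ∀ i k, resMatrix inf_le_left (X i) * v i k - v i k * resMatrix inf_le_right (X k) -
        (T.presheaf.map (homOfLE
          (le_top : T.basicOpen (a i) ⊓ T.basicOpen (a k) ≤ ⊤)).op).hom (a l) ^ m • n i k ∈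
            powerMatrix N _ := by
  have := Fintype.ofFinite ι
  have hD (i : ι) : IsAffineOpen (T.basicOpen (a i)) := (isAffineOpen_top T).basicOpen (a i)
  have hDD (i k : ι) : IsAffineOpen (T.basicOpen (a i) ⊓ T.basicOpen (a k)) := by
    rw [← Scheme.basicOpen_mul]
    exact (isAffineOpen_top T).basicOpen _
  have hW (V : T.Opens) : V ⊓ T.basicOpen (a l) =
      T.basicOpen ((T.presheaf.map (homOfLE le_top : V ⟶ ⊤).op).hom (a l)) :=
    (Scheme.basicOpen_res T (a l) (homOfLE le_top : V ⟶ ⊤).op).symm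
  have hs (i : ι) : pullMatrix q _ (n i l * resMatrix
      (le_inf inf_le_right inf_le_left) (v l i)) = 0 := by
    rw [map_mul, n0, zero_mul]
  -- Extend `a_l^m n_{il} v_{li}` to a matrix `Y i` over `D(a i)`, with the same `m` for all `i`.
  choose d hd using fun i => exists_matrix_extension q (hD i).isCompact (hD i).isQuasiSeparated
    ((hD i).preimage q).isCompact inf_le_left (hW (T.basicOpen (a i))) (hs i)
  choose Y Y0 hY using fun i => hd i (Finset.univ.sup d) (Finset.le_sup (Finset.mem_univ i))
  set m := Finset.univ.sup d
  -- On `D(a i) ⊓ D(a k) ⊓ D(a l)` the `Y i` split `a_l^m n_{ik}`.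
  have hz (i k : ι) : resMatrix (inf_le_left :
      T.basicOpen (a i) ⊓ T.basicOpen (a k) ⊓ T.basicOpen (a l) ≤ _)
        (resMatrix inf_le_left (Y i) * v i k - v i k * resMatrix inf_le_right (Y k) -
          (T.presheaf.map (homOfLE
            (le_top : T.basicOpen (a i) ⊓ T.basicOpen (a k) ≤ ⊤)).op).hom (a l) ^ m • n i k) ∈
              powerMatrix N _ := by
    set W := T.basicOpen (a i) ⊓ T.basicOpen (a k) ⊓ T.basicOpen (a l)
    have hi : W ≤ T.basicOpen (a i) := inf_le_left.trans inf_le_left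
    have hk : W ≤ T.basicOpen (a k) := inf_le_left.trans inf_le_right
    have hl : W ≤ T.basicOpen (a l) := inf_le_right
    let c := (T.presheaf.map (homOfLE (le_top : W ≤ ⊤)).op).hom (a l)
    have hsub {j j' : ι} (hj : W ≤ T.basicOpen (a j)) (hj' : W ≤ T.basicOpen (a j')) :
        resMatrix (le_inf hj hj') (v j j') - resMatrix (le_inf hj hj') (n j j') ∈
          powerMatrix N Γ(T, W) := by
      rw [← map_sub]
      exact resMatrix_mem _ (hn j j')
    have hYW {j : ι} (hj : W ≤ T.basicOpen (a j)) : resMatrix hj (Y j) - c ^ m •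
        (resMatrix (le_inf hj hl) (n j l) * resMatrix (le_inf hl hj) (v l j)) ∈
          powerMatrix N Γ(T, W) := by
      have h1 := resMatrix_mem (le_inf hj hl) (hY j)
      rw [map_sub, resMatrix_smul, map_pow, map_homOfLE_map, map_homOfLE_map, map_mul,
        resMatrix_resMatrix, resMatrix_resMatrix] at h1
      exact h1
    have key := split_mem (ρ := pullMatrix q W) (Pw := powerMatrix N Γ(T, W))
      (fun x y hx hy => (hq W).mul_eq_zero hx hy)
      (AddMonoidHom.mk' (fun x => c ^ m • x) fun x y => smul_add _ x y)
      (fun x hx => smul_mem_powerMatrix _ hx) (fun x y => (smul_mul_eq _ x y).symm)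
      (fun x y => (mul_smul_eq _ x y).symm)
      (fun x hx => by
        change pullMatrix q W (c ^ m • x) = 0
        rw [pullMatrix_smul, hx, smul_zero]) (hsub hi hk) (hsub hk hl) (hsub hi hl) (hsub hl hk)
      (pullMatrix_resMatrix_eq_zero q _ (n0 _ _)) (pullMatrix_resMatrix_eq_zero q _ (n0 _ _))
      (pullMatrix_resMatrix_eq_zero q _ (n0 _ _)) (pullMatrix_resMatrix_eq_zero q _ (n0 _ _))
      (hv.mul_eq W i k l hi hk hl) (hv.mul_inv_eq W k l hk hl) (hv.mul_eq W l i k hl hi hk)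
      (pullMatrix_resMatrix_eq_zero q hi (Y0 i)) (pullMatrix_resMatrix_eq_zero q hk (Y0 k))
      (hYW hi) (hYW hk)
    rw [map_sub, map_sub, map_mul, map_mul, resMatrix_smul, map_pow, map_homOfLE_map,
      resMatrix_resMatrix, resMatrix_resMatrix]
    exact key
  -- After multiplication with a further power of `a_l`, this holds on `D(a i) ⊓ D(a k)`.
  choose d' hd' using fun p : ι × ι => exists_matrix_kill (hDD p.1 p.2).isCompact inf_le_left
    (hW (T.basicOpen (a p.1) ⊓ T.basicOpen (a p.2))) (hz p.1 p.2)
  refine ⟨Finset.univ.sup d' + m, fun i => (T.presheaf.map (homOfLE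
    (le_top : T.basicOpen (a i) ≤ ⊤)).op).hom (a l) ^ Finset.univ.sup d' • Y i,
    fun i => ?_, fun i k => ?_⟩
  · rw [pullMatrix_smul, Y0, smul_zero]
  · have h1 := hd' (i, k) _ (Finset.le_sup (Finset.mem_univ _))
    rw [smul_sub, smul_sub, smul_smul, ← pow_add, ← smul_mul_eq, ← mul_smul_eq] at h1
    rw [resMatrix_smul, resMatrix_smul, map_pow, map_pow, map_homOfLE_map, map_homOfLE_map]
    exact h1

theorem span_pow_eq_top {R ι : Type*} [CommRing R] [Finite ι] {a : ι → R}
    (ha : Ideal.span (Set.range a) = ⊤) (m : ι → ℕ) :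
    Ideal.span (Set.range fun l => a l ^ m l) = ⊤ := by
  have := Fintype.ofFinite ι
  refine top_unique ((Ideal.span_pow_eq_top _ ha (Finset.univ.sup m)).ge.trans ?_)
  rw [Ideal.span_le]
  rintro _ ⟨_, ⟨l, rfl⟩, rfl⟩
  have h1 : Finset.univ.sup m = Finset.univ.sup m - m l + m l :=
    (Nat.sub_add_cancel (Finset.le_sup (Finset.mem_univ l))).symm
  change a l ^ Finset.univ.sup m ∈ _
  rw [h1, pow_add]
  exact Ideal.mul_mem_left _ _ (Ideal.subset_span ⟨l, rfl⟩)

theorem sum_smul_mul_sub {R ι : Type*} [CommRing R] [Fintype ι] (c : ι → R)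
    (x y z : ι → LaurentMatrix N R) (v n : LaurentMatrix N R) (hn : ∑ l, c l • z l = n) :
    (∑ l, c l • x l) * v - v * (∑ l, c l • y l) - n =
      ∑ l, c l • (x l * v - v * y l - z l) := by
  rw [← hn, Finset.sum_mul, Finset.mul_sum, ← Finset.sum_sub_distrib, ← Finset.sum_sub_distrib]
  refine Finset.sum_congr rfl fun l _ => ?_
  rw [smul_sub, smul_sub, smul_mul_eq, mul_smul_eq]

/-- Transition matrices that reduce to matrices of power series can be corrected, by matrices that
reduce to the identity, to be matrices of power series. This is the vanishing of the first
cohomology of a quasi-coherent sheaf on an affine scheme. -/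
theorem IsCocycle.exists_correction
    {v : ∀ i k, LaurentMatrix N Γ(T, T.basicOpen (a i) ⊓ T.basicOpen (a k))} (hv : IsCocycle a v)
    (hq : ∀ U, SquareZero (q.app U).hom) (ha : Ideal.span (Set.range a) = ⊤)
    (hp : ∀ i k, pullMatrix q _ (v i k) ∈ powerMatrix N _) :
    ∃ X : ∀ i, LaurentMatrix N Γ(T, T.basicOpen (a i)), (∀ i, pullMatrix q _ (X i) = 0) ∧
      ∀ i k, (1 - resMatrix inf_le_left (X i)) * v i k * (1 + resMatrix inf_le_right (X k)) ∈
        powerMatrix N _ := by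
  have := Fintype.ofFinite ι
  choose n n0 hn using fun i k => exists_polar_part (hp i k)
  choose m Y Y0 hY using hv.exists_split hq n0 hn
  -- A partition of unity `∑ c_l a_l^(m l) = 1` combines the splittings for the various `l`.
  have h1 : Ideal.span (Set.range fun l => a l ^ m l) = ⊤ := span_pow_eq_top ha m
  obtain ⟨c, hc⟩ := (Ideal.mem_span_range_iff_exists_fun).1
    (h1 ▸ Submodule.mem_top : (1 : Γ(T, ⊤)) ∈ Ideal.span (Set.range fun l => a l ^ m l))
  let X (i : ι) : LaurentMatrix N Γ(T, T.basicOpen (a i)) :=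
    ∑ l, (T.presheaf.map (homOfLE (le_top : T.basicOpen (a i) ≤ ⊤)).op).hom (c l) • Y l i
  have X0 (i : ι) : pullMatrix q _ (X i) = 0 := by
    rw [map_sum]
    exact Finset.sum_eq_zero fun l _ => by rw [pullMatrix_smul, Y0, smul_zero]
  refine ⟨X, X0, fun i k => ?_⟩
  refine conj_mem (ρ := pullMatrix q _) (fun x y hx hy => (hq _).mul_eq_zero hx hy) (hn i k)
    (pullMatrix_resMatrix_eq_zero q _ (X0 i)) (pullMatrix_resMatrix_eq_zero q _ (X0 k)) ?_
  let W := T.basicOpen (a i) ⊓ T.basicOpen (a k)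
  have h2 : n i k = ∑ l, (T.presheaf.map (homOfLE (le_top : W ≤ ⊤)).op).hom (c l) •
      (T.presheaf.map (homOfLE (le_top : W ≤ ⊤)).op).hom (a l) ^ m l • n i k := by
    simp only [smul_smul, ← map_pow, ← map_mul]
    rw [← Finset.sum_smul, ← map_sum, hc, map_one, one_smul]
  have h3 : resMatrix inf_le_left (X i) = ∑ l, (T.presheaf.map (homOfLE
      (le_top : W ≤ ⊤)).op).hom (c l) • resMatrix (inf_le_left : W ≤ _) (Y l i) := by
    simp only [X, map_sum, resMatrix_smul, map_homOfLE_map]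
  have h4 : resMatrix inf_le_right (X k) = ∑ l, (T.presheaf.map (homOfLE
      (le_top : W ≤ ⊤)).op).hom (c l) • resMatrix (inf_le_right : W ≤ _) (Y l k) := by
    simp only [X, map_sum, resMatrix_smul, map_homOfLE_map]
  rw [h3, h4, sum_smul_mul_sub _ _ _ _ _ _ h2.symm]
  exact sum_mem fun l _ => smul_mem_powerMatrix _ (hY l i k)

end Coboundary

/-! ### Laurent series over quasi-compact open sets -/

section Series

variable {S T : Scheme.{u}}

theorem germsSec_injective (U : S.Opens) : Function.Injective (germsSec U) := fun _ _ h =>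
  germs_injective U fun y hy => congrArg (fun s : LaurentSec U => s.1 ⟨y, hy⟩) h

theorem resRing_germsSec {U V : S.Opens} (h : V ≤ U) (s : LaurentSeries Γ(S, U)) :
    resRing h (germsSec U s) =
      germsSec V (laurentMap (S.presheaf.map (homOfLE h).op).hom s) :=
  Subtype.ext (funext fun y => (germs_res h s y).symm)

theorem laurentApp_germsSec (q : T ⟶ S) (U : S.Opens) (s : LaurentSeries Γ(S, U)) :
    laurentApp q U (germsSec U s) = germsSec (q ⁻¹ᵁ U) (laurentMap (q.app U).hom s) :=
  Subtype.ext (funext fun y => stalk_germs q U s y.1 y.2)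

theorem germsSec_mem_power {U : S.Opens} {s : LaurentSeries Γ(S, U)} :
    germsSec U s ∈ powerSubring U ↔ s ∈ (HahnSeries.ofPowerSeries ℤ Γ(S, U)).range := by
  refine ⟨fun h => mem_power_iff.2 fun n => section_eq_zero fun y hy => ?_,
    fun h x => laurentMap_mem_range _ h⟩
  exact mem_power_iff.1 (h ⟨y, hy⟩) n

/-- On a quasi-compact open set, the pole orders are bounded, so every section of `𝒪_S((t))` is a
Laurent series of functions. -/
theorem germsSec_surjective {U : S.Opens} (hU : IsCompact (U : Set S)) :
    Function.Surjective (germsSec U) := by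
  intro a
  have hk : ∃ k : ℕ, ∀ x ∈ (U : Set S), ∀ hx : x ∈ U, ∀ n < -(k : ℤ),
      (a.1 ⟨x, hx⟩).coeff n = 0 := by
    refine hU.induction_on (p := fun s => ∃ k : ℕ, ∀ x ∈ s, ∀ hx : x ∈ U, ∀ n < -(k : ℤ),
      (a.1 ⟨x, hx⟩).coeff n = 0) ⟨0, by simp⟩ (fun s t hst ⟨k, hk⟩ =>
        ⟨k, fun x hx => hk x (hst hx)⟩) (fun s t ⟨k, hk⟩ ⟨l, hl⟩ => ⟨max k l, ?_⟩) fun x hx => ?_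
    · rintro x (hx | hx) hxU n hn
      · exact hk x hx hxU n (by omega)
      · exact hl x hx hxU n (by omega)
    · obtain ⟨V, hxV, h, s, hs⟩ := a.2 ⟨x, hx⟩
      obtain ⟨k, hk⟩ := exists_coeff_eq_zero s
      refine ⟨V, mem_nhdsWithin_of_mem_nhds (V.2.mem_nhds hxV), k, fun y hy hyU n hn => ?_⟩
      exact (congrArg (fun c => c.coeff n) (hs ⟨y, hy⟩)).trans
        ((congrArg _ (hk n hn)).trans (map_zero _))
  obtain ⟨k, hk⟩ := hk
  -- The coefficients are sections of `𝒪_S`.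
  choose c hc using fun n : ℤ => exists_section U (fun x hx => (a.1 ⟨x, hx⟩).coeff n)
    fun x hx => by
      obtain ⟨V, hxV, h, s, hs⟩ := a.2 ⟨x, hx⟩
      exact ⟨V, hxV, h, s.coeff n, fun y hy hyU => congrArg (fun c => c.coeff n) (hs ⟨y, hy⟩).symm⟩
  have hb : BddBelow (Function.support c) := by
    refine ⟨-(k : ℤ), fun n hn => not_lt.1 fun h => hn (section_eq_zero fun x hx => ?_)⟩
    exact (hc n x hx).trans (hk x hx hx n h)
  refine ⟨HahnSeries.ofSuppBddBelow c hb, Subtype.ext (funext fun x => HahnSeries.ext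
    (funext fun n => ?_))⟩
  exact hc n x.1 x.2

end Series

/-! ### Bases and their transition matrices -/

section Combinations

variable {S : Scheme.{u}} {N : ℕ} {M : LaurentModule S}

/-- The linear combinations of sections with the columns of `v` as coefficients. -/
def combine {W : S.Opens} (v : LaurentMatrix N Γ(S, W)) (e : Fin N → Sec M W) (c : Fin N) :
    Sec M W := ∑ r, germsSec W (v r c) • e r

theorem combine_one {W : S.Opens} (e : Fin N → Sec M W) : combine 1 e = e := by
  funext c
  rw [combine, Finset.sum_eq_single c (fun r _ hr => by
    rw [Matrix.one_apply_ne hr, map_zero, zero_smul]) (fun h => absurd (Finset.mem_univ c) h),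
    Matrix.one_apply_eq, map_one, one_smul]

theorem combine_mul {W : S.Opens} (v v' : LaurentMatrix N Γ(S, W)) (e : Fin N → Sec M W) :
    combine (v * v') e = combine v' (combine v e) := by
  funext c
  simp only [combine, Matrix.mul_apply, map_sum, map_mul, Finset.sum_smul, Finset.smul_sum,
    smul_smul]
  rw [Finset.sum_comm]
  exact Finset.sum_congr rfl fun _ _ => Finset.sum_congr rfl fun _ _ => by rw [mul_comm]

theorem res_combine {U W : S.Opens} (h : W ≤ U) (v : LaurentMatrix N Γ(S, U))
    (e : Fin N → Sec M U) : (fun c => res h (combine v e c)) =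
      combine (resMatrix h v) fun r => res h (e r) := by
  funext c
  refine (res_sum h _ _).trans (Finset.sum_congr rfl fun r _ => ?_)
  rw [resRing_germsSec]
  rfl

theorem compareSec_combine {T T₀ : Scheme.{u}} {p : T ⟶ S} {q : T₀ ⟶ T} {p' : T₀ ⟶ S}
    (h : q ≫ p = p') (E : LaurentModule S) {W : T.Opens} (v : LaurentMatrix N Γ(T, W))
    (e : Fin N → Sec ((pull p).obj E) W) : (fun c => compareSec h E W (combine v e c)) =
      combine (pullMatrix q W v) fun r => compareSec h E W (e r) := by
  funext c
  refine (map_sum _ _ _).trans (Finset.sum_congr rfl fun r _ => ?_)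
  rw [compareSec_smul, laurentApp_germsSec]
  rfl

theorem combine_injective {U W : S.Opens} {e : Fin N → Sec M U} (he : IsBasisOver e) (h : W ≤ U)
    {v v' : LaurentMatrix N Γ(S, W)}
    (H : combine v (fun r => res h (e r)) = combine v' fun r => res h (e r)) : v = v' := by
  ext1 r c
  exact germsSec_injective W (congrFun ((he W h).1 (congrFun H c)) r)

/-- Over a quasi-compact open set, sections are combinations of a basis with Laurent series of
functions as coefficients. -/
theorem exists_combine {U W : S.Opens} {e : Fin N → Sec M U} (he : IsBasisOver e) (h : W ≤ U)
    (hW : IsCompact (W : Set S)) (e' : Fin N → Sec M W) :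
    ∃ v : LaurentMatrix N Γ(S, W), e' = combine v fun r => res h (e r) := by
  choose σ hσ using germsSec_surjective hW
  refine ⟨Matrix.of fun r c => σ (coord he h (e' c) r), funext fun c => ?_⟩
  refine (sum_coord he h (e' c)).symm.trans (Finset.sum_congr rfl fun r _ => ?_)
  exact congrArg (· • _) (hσ _).symm

/-- The combinations with the columns of an invertible matrix form a basis. -/
theorem isBasisOver_combine {U : S.Opens} {e : Fin N → Sec M U} (he : IsBasisOver e)
    {v v' : LaurentMatrix N Γ(S, U)} (h : v * v' = 1) : IsBasisOver (combine v e) := by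
  have h1 := isBasisOver_frameBasis he le_rfl (⟨v, v', h, mul_eq_one_comm.1 h⟩ : GL (Fin N) _)
  have h2 : frameBasis (b := e) le_rfl (⟨v, v', h, mul_eq_one_comm.1 h⟩ : GL (Fin N) _) =
      combine v e := by
    funext c
    simp only [frameBasis, ofCoord, res_self]
    rfl
  rwa [h2] at h1

/-- The transition matrix between two bases of a lattice consists of power series. -/
theorem mem_powerMatrix_of_isLatticeBasis {F : PowerSubmodule M} {U U' W : S.Opens}
    {e : Fin N → Sec M U} {e' : Fin N → Sec M U'} (he : IsLatticeBasis F e)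
    (he' : IsLatticeBasis F e') (h : W ≤ U) (h' : W ≤ U') {v : LaurentMatrix N Γ(S, W)}
    (hv : (fun c => res h' (e' c)) = combine v fun r => res h (e r)) :
    v ∈ powerMatrix N Γ(S, W) := fun r c => by
  rw [← germsSec_mem_power]
  have h1 : combine v (fun r => res h (e r)) c ∈ F.sec W :=
    congrFun hv c ▸ F.res_mem h' (he'.basis_mem c)
  exact (he.2 W h fun r => germsSec W (v r c)).1 h1 r

theorem isLatticeBasis_ofBasis {U : S.Opens} {e : Fin N → Sec M U} (he : IsBasisOver e) :
    IsLatticeBasis (PowerSubmodule.ofBasis he) e := by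
  refine ⟨he, fun V h a => ?_⟩
  have h1 : coord he (inter_le_right U V) (res (inter_le_left U V) (∑ i, a i • res h (e i))) =
      fun i => resRing (inter_le_left U V) (a i) := by
    rw [coord_res he h (inter_le_left U V), coord_unique he h _ a rfl]
  refine (forall_congr' fun i => iff_of_eq (congrArg (· ∈ powerSubring _)
    (congrFun h1 i))).trans (forall_congr' fun i => ⟨fun H x => ?_, resRing_mem_power _⟩)
  exact H ⟨x.1, le_inter h x.2⟩

theorem mem_ofBasis {U W : S.Opens} {e : Fin N → Sec M U} (he : IsBasisOver e) {s : Sec M W} :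
    s ∈ (PowerSubmodule.ofBasis he).sec W ↔
      res (inter_le_left U W) s ∈ (PowerSubmodule.ofBasis he).sec ((interFunctor U).obj W) :=
  ((isLatticeBasis_ofBasis he).mem_iff (inter_le_right U W) _).symm

theorem PowerSubmodule.eq_of_isLatticeBasis {F F' : PowerSubmodule M}
    (H : ∀ x : S, ∃ (U : S.Opens) (_ : x ∈ U) (e : Fin N → Sec M U),
      IsLatticeBasis F e ∧ IsLatticeBasis F' e) : F = F' := by
  have key {F F' : PowerSubmodule M} (H : ∀ x : S, ∃ (U : S.Opens) (_ : x ∈ U)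
      (e : Fin N → Sec M U), IsLatticeBasis F e ∧ IsLatticeBasis F' e) : F ≤ F' := by
    intro W s hs
    refine F'.mem_of_local fun x hx => ?_
    obtain ⟨U, hxU, e, he, he'⟩ := H x
    refine ⟨W ⊓ U, ⟨hx, hxU⟩, inf_le_left, ?_⟩
    exact (he'.mem_iff inf_le_right _).2 ((he.mem_iff inf_le_right _).1 (F.res_mem _ hs))
  exact le_antisymm (key H) (key fun x => by
    obtain ⟨U, hxU, e, he, he'⟩ := H x
    exact ⟨U, hxU, e, he', he⟩)

variable {ι : Type*} {D : ι → S.Opens} {e : ∀ i, Fin N → Sec M (D i)}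

/-- The submodule of sections whose coordinates in each of the given bases are power series. -/
def ofBases (he : ∀ i, IsBasisOver (e i)) : PowerSubmodule M where
  sec V := ⨅ i, (PowerSubmodule.ofBasis (he i)).sec V
  smul_mem ha s hs := by
    rw [AddSubgroup.mem_iInf] at hs ⊢
    exact fun i => PowerSubmodule.smul_mem _ ha (hs i)
  res_mem h s hs := by
    rw [AddSubgroup.mem_iInf] at hs ⊢
    exact fun i => PowerSubmodule.res_mem _ h (hs i)
  mem_of_local {V s} H := by
    rw [AddSubgroup.mem_iInf]
    refine fun i => PowerSubmodule.mem_of_local _ fun x hx => ?_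
    obtain ⟨W, hxW, h, hW⟩ := H x hx
    exact ⟨W, hxW, h, AddSubgroup.mem_iInf.1 hW i⟩

/-- Bases whose transition matrices consist of power series span a lattice. -/
theorem isLatticeBasis_ofBases (he : ∀ i, IsBasisOver (e i))
    (H : ∀ i k, ∃ v ∈ powerMatrix N Γ(S, D i ⊓ D k), (fun c => res inf_le_right (e k c)) =
      combine v fun r => res inf_le_left (e i r)) (k : ι) :
    IsLatticeBasis (ofBases he) (e k) := by
  refine ⟨he k, fun V h a => ⟨fun hs => ?_, fun ha => ?_⟩⟩
  · exact ((isLatticeBasis_ofBasis (he k)).2 V h a).1 (AddSubgroup.mem_iInf.1 hs k)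
  · refine AddSubgroup.mem_iInf.2 fun i => sum_mem fun j _ => PowerSubmodule.smul_mem _ (ha j) ?_
    rw [mem_ofBasis, res_res]
    obtain ⟨v, hv, hev⟩ := H i k
    have h1 : res (inf_le_right : D i ⊓ D k ≤ _) (e k j) ∈
        (PowerSubmodule.ofBasis (he i)).sec (D i ⊓ D k) := by
      refine (congrFun hev j).symm ▸ ((isLatticeBasis_ofBasis (he i)).2 _ _ _).2 fun r => ?_
      exact germsSec_mem_power.2 (hv r j)
    have h2 := PowerSubmodule.res_mem _
      (le_inf (inter_le_right (D i) V) ((inter_le_left (D i) V).trans h)) h1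
    rwa [res_res] at h2

end Combinations

/-! ### Lifts along square-zero extensions -/

section SquareZeroLifts

variable {S T T₀ : Scheme.{u}} {N : ℕ}

theorem IsBasisOver.res {M : LaurentModule S} {U W : S.Opens} {e : Fin N → Sec M U}
    (he : IsBasisOver e) (h : W ≤ U) :
    IsBasisOver fun c => TwistedGrassmannian.res h (e c) := fun V hV => by
  simp only [res_res]
  exact he V (hV.trans h)

theorem IsLatticeBasis.res {M : LaurentModule S} {F : PowerSubmodule M} {U W : S.Opens}
    {e : Fin N → Sec M U} (he : IsLatticeBasis F e) (h : W ≤ U) :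
    IsLatticeBasis F fun c => TwistedGrassmannian.res h (e c) :=
  ⟨he.1.res h, fun V hV => by
    simp only [res_res]
    exact he.2 V (hV.trans h)⟩

/-- A closed immersion whose ideal has square zero is surjective: on the complement of its image,
the function `1 = 1 * 1` would vanish. -/
theorem mem_range_of_squareZero {q : T₀ ⟶ T} [IsClosedImmersion q]
    (hq : ∀ U, SquareZero (q.app U).hom) (x : T) : ∃ y, q y = x := by
  by_contra hx
  let U : T.Opens := ⟨(Set.range q)ᶜ, q.isClosedEmbedding.isClosed_range.isOpen_compl⟩
  have hU : q ⁻¹ᵁ U = ⊥ := by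
    ext y
    exact ⟨fun h => h ⟨y, rfl⟩, fun h => h.elim⟩
  have h1 : (q.app U).hom 1 = 0 := by
    have : Subsingleton Γ(T₀, q ⁻¹ᵁ U) := by
      rw [hU]
      infer_instance
    exact Subsingleton.elim _ _
  have h2 := hq U h1 h1
  have h3 := congrArg (T.presheaf.germ U x hx).hom h2
  rw [map_mul, map_one, map_zero, mul_one] at h3
  exact one_ne_zero h3

variable {p : T ⟶ S} {q : T₀ ⟶ T} {p₀ : T₀ ⟶ S} (h : q ≫ p = p₀) {E : LaurentModule S}
  {F₀ : PowerSubmodule ((pull p₀).obj E)}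

/-- Locally, a lattice lifts together with a basis: an invertible matrix expressing a basis of the
lattice in terms of a basis of `𝓔` lifts. -/
theorem exists_local_lift [IsAffine T] [IsClosedImmersion q] (hq : ∀ U, SquareZero (q.app U).hom)
    (hE : IsLocallyFree E N) (hF : F₀.IsLattice N) (x : T) :
    ∃ (a : Γ(T, ⊤)) (_ : x ∈ T.basicOpen a) (e : Fin N → Sec ((pull p).obj E) (T.basicOpen a)),
      IsBasisOver e ∧ IsLatticeBasis F₀ fun c => compareSec h E _ (e c) := by
  obtain ⟨y, rfl⟩ := mem_range_of_squareZero hq x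
  obtain ⟨V, hV, b, hb⟩ := hE (p (q y))
  replace hb := isBasisOver_pullSec p hb
  obtain ⟨W₀, hyW, hW₀, g₀, hg₀⟩ := hF.exists_frame (isBasisOver_compare h hb) (x := y) hV
  -- The frame is defined on an open subset `W₀` of `T₀`, which is the preimage of an open subset
  -- of `T`; shrink the latter to a basic open subset.
  obtain ⟨W₁, hW₁, hW⟩ := q.isClosedEmbedding.isInducing.isOpen_iff.1 W₀.2
  obtain ⟨a, ha, hya⟩ := (isAffineOpen_top T).exists_basicOpen_le
    (V := (⟨W₁, hW₁⟩ : T.Opens) ⊓ p ⁻¹ᵁ V) ⟨q y, (hW.symm ▸ hyW : y ∈ q ⁻¹' W₁), hV⟩ trivial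
  have ha₀ : q ⁻¹ᵁ T.basicOpen a ≤ W₀ := fun z hz => by
    have h1 : z ∈ q ⁻¹' W₁ := (ha hz).1
    rwa [hW] at h1
  have haV : T.basicOpen a ≤ p ⁻¹ᵁ V := fun z hz => (ha hz).2
  obtain ⟨g, hg⟩ := (hq (T.basicOpen a)).exists_glMap_eq
    (q.app_surjective _ ((isAffineOpen_top T).basicOpen a))
    (glMap (T₀.presheaf.map (homOfLE ha₀).op).hom g₀)
  refine ⟨a, hya, combine g.1 fun r => res haV (pullSec p E V (b r)),
    isBasisOver_combine (hb.res haV) (v' := g⁻¹.1) (Units.mul_inv g), ?_⟩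
  rw [compareSec_combine]
  have h1 : pullMatrix q _ g.1 = resMatrix ha₀ g₀.1 := congrArg Units.val hg
  rw [h1]
  have h2 := hg₀.isLatticeBasis.res ha₀
  have h3 := res_combine ha₀ g₀.1 fun r => res hW₀ (compareSec h E _ (pullSec p E V (b r)))
  have h4 : (fun r => res ha₀ (res hW₀ (compareSec h E _ (pullSec p E V (b r))))) =
      fun r => compareSec h E _ (res haV (pullSec p E V (b r))) := by
    funext r
    rw [compareSec_res, res_res]
  rw [← h4, ← h3]
  exact h2

/-- Lattices lift along closed immersions of affine schemes whose ideal has square zero. -/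
theorem exists_lift_of_squareZero [IsAffine T] [IsClosedImmersion q]
    (hq : ∀ U, SquareZero (q.app U).hom) (hE : IsLocallyFree E N) (hF : F₀.IsLattice N) :
    ∃ F : PowerSubmodule ((pull p).obj E), F.IsLattice N ∧ F.pullback h = F₀ := by
  choose a hxa e he he₀ using exists_local_lift h hq hE hF
  obtain ⟨t, ht⟩ := CompactSpace.elim_nhds_subcover (fun x => (T.basicOpen (a x) : Set T))
    fun x => (T.basicOpen (a x)).2.mem_nhds (hxa x)
  have hcov (x : T) : ∃ i : t, x ∈ T.basicOpen (a i) := by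
    have : x ∈ ⋃ y ∈ t, (T.basicOpen (a y) : Set T) := ht ▸ trivial
    obtain ⟨y, hy, hx⟩ := Set.mem_iUnion₂.1 this
    exact ⟨⟨y, hy⟩, hx⟩
  have hspan : Ideal.span (Set.range fun i : t => a i) = ⊤ := by
    rw [← (isAffineOpen_top T).iSup_basicOpen_eq_self_iff]
    refine top_unique fun x _ => ?_
    obtain ⟨i, hi⟩ := hcov x
    exact Opens.mem_iSup.2 ⟨⟨a i, i, rfl⟩, hi⟩
  have hc (i k : t) : IsCompact ((T.basicOpen (a i) ⊓ T.basicOpen (a k) : T.Opens) : Set T) := by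
    rw [← Scheme.basicOpen_mul]
    exact ((isAffineOpen_top T).basicOpen _).isCompact
  -- The transition matrices of the lifted bases; over `T₀` they are matrices of power series.
  choose v hv using fun i k : t => exists_combine (he i) inf_le_left (hc i k)
    fun c => res inf_le_right (e k c)
  have hvW (W : T.Opens) (i k : t) (hi : W ≤ T.basicOpen (a i)) (hk : W ≤ T.basicOpen (a k)) :
      (fun c => res hk (e k c)) = combine (resMatrix (le_inf hi hk) (v i k))
        fun r => res hi (e i r) := by
    have h1 := congrArg (fun s c => res (le_inf hi hk) (s c)) (hv i k)
    have h2 := h1.trans (res_combine (le_inf hi hk) (v i k) _)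
    simpa only [res_res] using h2
  have hcoc : IsCocycle (fun i : t => a i) v :=
    ⟨fun W i k l hi hk hl => combine_injective (he i) hi (by
      rw [combine_mul, ← hvW W i k hi hk, ← hvW W k l hk hl, ← hvW W i l hi hl]),
    fun W i hi => combine_injective (he i) hi (by
      rw [← hvW W i i hi hi, combine_one])⟩
  obtain ⟨X, X0, hX⟩ := hcoc.exists_correction hq hspan fun i k => by
    refine mem_powerMatrix_of_isLatticeBasis (he₀ i) (he₀ k)
      (W := q ⁻¹ᵁ (T.basicOpen (a i) ⊓ T.basicOpen (a k))) (fun _ hx => And.left hx)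
      (fun _ hx => And.right hx) ?_
    have h1 := congrArg (fun s c => compareSec h E _ (s c)) (hv i k)
    have h2 := h1.trans (compareSec_combine h E (v i k) _)
    simpa only [compareSec_res] using h2
  -- Replace the basis `e i` by `e i (1 + X i)`. The new transition matrices are
  -- `(1 - X i) v i k (1 + X k)`, and the bases over `T₀` are unchanged.
  have hXX (i : t) : (1 + X i) * (1 - X i) = 1 := by
    have h1 : X i * X i = 0 := (hq _).mul_eq_zero (X0 i) (X0 i)
    have h2 : (1 + X i) * (1 - X i) = 1 - X i * X i := by noncomm_ring
    rw [h2, h1, sub_zero]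
  have he' (i : t) := isBasisOver_combine (he i) (hXX i)
  have hlat := isLatticeBasis_ofBases he' fun i k => ⟨_, hX i k, by
    have h1 : (fun r => res inf_le_left (e i r)) = combine (1 - resMatrix inf_le_left (X i))
        fun r => res (inf_le_left : T.basicOpen (a i) ⊓ T.basicOpen (a k) ≤ _)
          (combine (1 + X i) (e i) r) := by
      rw [res_combine, ← combine_mul, map_add, map_one]
      have h2 := congrArg (resMatrix (inf_le_left :
        T.basicOpen (a i) ⊓ T.basicOpen (a k) ≤ _)) (hXX i)
      rw [map_mul, map_add, map_sub, map_one] at h2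
      rw [h2, combine_one]
    rw [combine_mul, combine_mul, ← h1, ← hv, res_combine, map_add, map_one]⟩
  refine ⟨ofBases he', fun x => ?_, PowerSubmodule.eq_of_isLatticeBasis (N := N) fun y => ?_⟩
  · obtain ⟨i, hi⟩ := hcov x
    exact ⟨_, hi, _, hlat i⟩
  · obtain ⟨i, hi⟩ := hcov (q y)
    refine ⟨_, hi, _, (hlat i).pullback h, ?_⟩
    rw [compareSec_combine, map_add, map_one, X0, add_zero, combine_one]
    exact he₀ i

end SquareZeroLifts

/-! ### Formal smoothness -/

section FormalSmoothness

variable {S T T₀ : Scheme.{u}} {N : ℕ}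

/-- If the ideal of global functions vanishing on `T₀` has square zero, then this holds on every
open subset: near a point, functions in the kernel are quotients of global ones. -/
theorem squareZero_app [IsAffine T] [IsAffine T₀] {q : T₀ ⟶ T}
    (hq : SquareZero (q.app ⊤).hom) (U : T.Opens) : SquareZero (q.app U).hom := by
  intro r s hr hs
  refine section_eq_zero fun x hx => ?_
  obtain ⟨a, ha, hxa⟩ := (isAffineOpen_top T).exists_basicOpen_le (V := U) ⟨x, hx⟩ trivial
  have hext (c : Γ(T, U)) (hc : (q.app U).hom c = 0) := exists_extension q
    (isAffineOpen_top T).isCompact (isAffineOpen_top T).isQuasiSeparated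
    (isAffineOpen_top T₀).isCompact le_top rfl
    (c := (T.presheaf.map (homOfLE ha).op).hom c) (by rw [app_res_apply, hc, map_zero])
  obtain ⟨m, hm⟩ := hext r hr
  obtain ⟨n, hn⟩ := hext s hs
  obtain ⟨y, hy0, hy⟩ := hm m le_rfl
  obtain ⟨z, hz0, hz⟩ := hn n le_rfl
  have hunit : IsUnit ((T.presheaf.map (homOfLE (le_top : T.basicOpen a ≤ ⊤)).op).hom a) :=
    RingedSpace.isUnit_res_basicOpen _ a
  have h1 := congrArg (T.presheaf.map (homOfLE (le_top : T.basicOpen a ≤ ⊤)).op).hom (hq hy0 hz0)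
  rw [map_mul, hy, hz, map_zero, mul_mul_mul_comm, ← pow_add, ← map_mul] at h1
  have h2 := (hunit.pow (m + n)).mul_right_eq_zero.1 h1
  have h3 := TopCat.Presheaf.germ_res_apply T.presheaf (homOfLE ha) x hxa (r * s)
  exact h3.symm.trans ((congrArg _ h2).trans (map_zero _))

/-- The condition `SquareZero` on sections follows from the one on rings. -/
theorem squareZero_specMap {A B : CommRingCat.{u}} {φ : A ⟶ B} (h : RingHom.ker φ.hom ^ 2 = ⊥)
    (U : (Spec A).Opens) : SquareZero ((Spec.map φ).app U).hom := by
  refine squareZero_app (fun r s hr hs => ?_) U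
  have hker (r : Γ(Spec A, ⊤)) (hr : ((Spec.map φ).app ⊤).hom r = 0) :
      (Scheme.ΓSpecIso A).hom.hom r ∈ RingHom.ker φ.hom := by
    have h1 := ConcreteCategory.congr_hom (Scheme.ΓSpecIso_naturality φ) r
    exact h1.symm.trans ((congrArg (Scheme.ΓSpecIso B).hom.hom hr).trans (map_zero _))
  have h2 := Ideal.mul_mem_mul (hker r hr) (hker s hs)
  rw [← pow_two, h, Ideal.mem_bot, ← map_mul] at h2
  exact (ConcreteCategory.bijective_of_isIso (Scheme.ΓSpecIso A).hom).1 (h2.trans (map_zero _).symm)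

/-- Lattices lift along nilpotent thickenings of affine schemes. -/
theorem exists_lift_of_isNilpotent {E : LaurentModule S} (hE : IsLocallyFree E N)
    {A : Type u} [CommRing A] (I : Ideal A) (hI : IsNilpotent I) :
    ∀ (B : Type u) [CommRing B] (φ : A →+* B), Function.Surjective φ → RingHom.ker φ = I →
      ∀ (p : Spec (.of A) ⟶ S) (p₀ : Spec (.of B) ⟶ S)
        (h : Spec.map (CommRingCat.ofHom φ) ≫ p = p₀) (F₀ : PowerSubmodule ((pull p₀).obj E)),
        F₀.IsLattice N → ∃ F : PowerSubmodule ((pull p).obj E), F.IsLattice N ∧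
          F.pullback h = F₀ := by
  refine Ideal.IsNilpotent.induction_on (S := A) I hI (P := fun A _ I =>
    ∀ (B : Type u) [CommRing B] (φ : A →+* B), Function.Surjective φ → RingHom.ker φ = I →
      ∀ (p : Spec (.of A) ⟶ S) (p₀ : Spec (.of B) ⟶ S)
        (h : Spec.map (CommRingCat.ofHom φ) ≫ p = p₀) (F₀ : PowerSubmodule ((pull p₀).obj E)),
        F₀.IsLattice N → ∃ F : PowerSubmodule ((pull p).obj E), F.IsLattice N ∧
          F.pullback h = F₀) (fun A _ I hI B _ φ hφ hker p p₀ h F₀ hF => ?_)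
    (fun A _ I J hIJ hI hJ B _ φ hφ hker p p₀ h F₀ hF => ?_)
  · have : IsClosedImmersion (Spec.map (CommRingCat.ofHom φ)) :=
      IsClosedImmersion.spec_of_surjective _ hφ
    exact exists_lift_of_squareZero h
      (squareZero_specMap (φ := CommRingCat.ofHom φ) (hker.symm ▸ hI)) hE hF
  -- The thickening is a composition `Spec B ⟶ Spec (A ⧸ I) ⟶ Spec A`.
  · let ψ : A ⧸ I →+* B := Ideal.Quotient.lift I φ fun a ha => (hker ▸ hIJ) ha
    have hψ : ψ.comp (Ideal.Quotient.mk I) = φ := rfl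
    have h0 : Spec.map (CommRingCat.ofHom ψ) ≫ Spec.map (CommRingCat.ofHom (Ideal.Quotient.mk I)) =
        Spec.map (CommRingCat.ofHom φ) := by
      rw [← Spec.map_comp, ← CommRingCat.ofHom_comp, hψ]
    have h1 : Spec.map (CommRingCat.ofHom ψ) ≫
        Spec.map (CommRingCat.ofHom (Ideal.Quotient.mk I)) ≫ p = p₀ := by
      rw [← h, ← h0, Category.assoc]
    obtain ⟨F₁, hF₁, rfl⟩ := hJ B ψ (Ideal.Quotient.lift_surjective_of_surjective I _ hφ)
      (by rw [Ideal.ker_quotient_lift _ (hker ▸ hIJ), hker]) _ p₀ h1 F₀ hF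
    obtain ⟨F, hF', rfl⟩ := hI (A ⧸ I) (Ideal.Quotient.mk I) Ideal.Quotient.mk_surjective
      Ideal.mk_ker p _ rfl F₁ hF₁
    refine ⟨F, hF', ?_⟩
    have h2 := PowerSubmodule.pullback_comp (p := p) rfl h1 (by rw [h0, h]) F
    rw [← h2]
    simp only [h0]

theorem isFormallySmooth_latticeFunctor {E : LaurentModule S} (hE : IsLocallyFree E N) :
    IsFormallySmooth (latticeFunctor E N) := fun A I hI p F₀ => by
  obtain ⟨F, hF, h⟩ := exists_lift_of_isNilpotent hE I hI (A ⧸ I) (Ideal.Quotient.mk I)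
    Ideal.Quotient.mk_surjective Ideal.mk_ker p _ rfl F₀.1 F₀.2
  exact ⟨⟨F, hF⟩, Subtype.ext h⟩

/-- Formal smoothness only depends on the points with values in affine schemes. -/
theorem IndScheme.Represents.isFormallySmooth {Y : IndScheme S} {P : (Over S)ᵒᵖ ⥤ Type u}
    (h : Y.Represents P) (hP : IsFormallySmooth P) : IsFormallySmooth Y.points := by
  obtain ⟨-, α, hα⟩ := h
  intro A I hI p y₀
  obtain ⟨x, hx⟩ := hP A I hI p (α.app _ y₀)
  obtain ⟨y, rfl⟩ := (hα (Over.mk p) (inferInstanceAs (CompactSpace (Spec A)))).2 x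
  refine ⟨y, (hα _ (inferInstanceAs (CompactSpace (Spec _)))).1 (Eq.trans ?_ hx)⟩
  exact ConcreteCategory.congr_hom (α.naturality _) y

end FormalSmoothness

/-! ### Exhaustion of the functor of lattices -/

section Exhaustion

variable {S : Scheme.{u}} {N : ℕ} {E : LaurentModule S}

/-- Over an open subset with a basis of `E`, the functor of lattices is exhausted by the schemes
of bounded lattices. -/
theorem isExhaustedOver_latticeFunctor {U : S.Opens} {e : Fin N → Sec E U} (he : IsBasisOver e) :
    IsExhaustedOver (latticeFunctor E N) U :=
  ⟨boundedOverS N U, universalLattice he, fun m => ⟨boundedOverHom N U m, rfl, inferInstance⟩,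
    fun _ _ _ _ h => universalLattice_injective he h,
    fun _ _ hT F => exists_map_universalLattice_eq he hT F⟩

/-- The small affine open subsets of `S`, over which `E` has a basis, form a basis of the
topology. -/
theorem hasExhaustedBasis_latticeFunctor (hE : IsLocallyFree E N) :
    HasExhaustedBasis (latticeFunctor E N) := by
  refine Opens.isBasis_iff_nbhd.2 fun {U x} hx => ?_
  obtain ⟨V, hxV, e, he⟩ := hE x
  obtain ⟨W, hW, hxW, hWU⟩ := Opens.isBasis_iff_nbhd.1 S.isBasis_affineOpens
    (show x ∈ U ⊓ V from ⟨hx, hxV⟩)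
  exact ⟨W, ⟨hW, isExhaustedOver_latticeFunctor (he.res (hWU.trans inf_le_right))⟩, hxW,
    hWU.trans inf_le_left⟩

end Exhaustion

end TwistedGrassmannian

end

theorem proposition3p2p1 {S : Scheme.{u}} [QuasiSeparatedSpace S] (N : ℕ)
    (E : TwistedGrassmannian.LaurentModule S) (hE : TwistedGrassmannian.IsLocallyFree E N) :
    ∃ Gr : TwistedGrassmannian.IndScheme S,
      Gr.Represents (TwistedGrassmannian.latticeFunctor E N) ∧ Gr.IsIndProper ∧
        TwistedGrassmannian.IsFormallySmooth Gr.points := by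
  obtain ⟨Y, hY, hY'⟩ := (TwistedGrassmannian.hasExhaustedBasis_latticeFunctor hE).exists_indScheme
    (TwistedGrassmannian.gluesOver_latticeFunctor hE)
  exact ⟨Y, hY, hY', hY.isFormallySmooth (TwistedGrassmannian.isFormallySmooth_latticeFunctor hE)⟩
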